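/- \textbf{Conventions.} A (finitary) polynomial endofunctor on $\mathbf{Set}/I$ is one represented by a diagram of sets $I \leftarrow E \to B \to I$ in which $E\to B$ has finite fibres; $\mathbf{Poly}(I)$ is the category of these with cartesian natural transformations, monoidal under composition, and a \emph{polynomial monad} is a monoid in it; $\mathbf{PolyMon}(I)$ is the category of polynomial monads. $B$ is the set of operations and $I$ the set of types. \textbf{The explicit construction.} Let $P$ be a polynomial monad represented by $I\leftarrow E\to B\to I$. A $P$-tree is a finite rooted tree with edges decorated by elements of $I$, nodes decorated by elements of $B$, and for each node decorated by $b$ a bijection of its input edges with the fibre $E_b$, compatible with the types; $\mathrm{tr}(P)$ is the set of isomorphism classes of $P$-trees, i.e. the least fixpoint of $X\mapsto I+P(X)$. The polynomial monad $P^+$ on $\mathbf{Set}/B$ is represented by $B\leftarrow \mathrm{tr}^\bullet(P)\to \mathrm{tr}(P)\xrightarrow{t} B$, where $\mathrm{tr}^\bullet(P)$ is the set of $P$-trees with a marked node, the left map returns the operation at the marked node, and $t$ contracts a tree to one operation by means of the monad structure of $P$; its unit sends $b$ to the one-node tree on $b$, and its multiplication substitutes trees into nodes. \textbf{Leinster's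 construction.} For a cartesian monad $T$ on a category $\mathcal E$ with finite limits, the tensor product of $A\to T1$ and $A'\to T1$ is $A\times_{T1}TA' \to TA'\to TT1\to T1$, with unit $\eta_1:1\to T1$; a $T$-operad is a monoid in $\mathcal E/T1$ for this tensor product. If $T$-operads have a free functor, Leinster's $T^+$ is the monad on $\mathcal E/T1$ of the free--forgetful adjunction. \textbf{Theorem.} (1) Let $P$ be a polynomial monad represented by $I\leftarrow E\to B\to I$. (a) The functor $\mathbf{Poly}(I)/P\to\mathbf{Set}/B$, $[Q\Rightarrow P]\mapsto[Q1\to P1=B]$, is an equivalence, the forgetful functor $\mathbf{PolyMon}(I)/P\to\mathbf{Poly}(I)/P$ has a left adjoint, and the monad of this adjunction (the free-monad-over-$P$ monad), transported along the equivalence, is isomorphic to the monad $P^+$. (b) The forgetful functor from $P$-operads to $(\mathbf{Set}/I)/P1\simeq \mathbf{Set}/B$ has a left adjoint, and the monad of this adjunction (the free-$P$-operad monad, i.e. Leinster's construction), transported along the canonical equivalence $(\mathbf{Set}/I)/P1\simeq\mathbf{Set}/B$, is isomorphic to the monad $P^+$. (2) Let $P^0$ be the identity monad on $\mathbf{Set}$,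 $P^{k+1}=(P^k)^+$, and let $Z^k$ be the set of types of $P^k$. Let $T_0$ be the identity monad on $\mathbf{Set}$, $T_{k+1}=T_k^+$ in Leinster's sense (regarded as a monad on a slice of $\mathbf{Set}$), and let $L^k$ be the set of types of $T_k$, i.e. the set of Leinster's $k$-opetopes. For every $k$ the forgetful functor from $T_k$-operads to collections has a left adjoint, so that the sequence is well defined. There are bijections $\varphi_k:Z^k\cong L^k$ and isomorphisms $\psi_k$ between $P^k$, transported along $\varphi_k$, and $T_k$, such that $\varphi_{k+1}$ is the bijection of operations induced by $\psi_k$ at the terminal object. (3) \emph{Constellations and zoom complexes.} A tree is a finite rooted tree with boundary; a leaf is an edge which is not the output edge of a node (in the unit tree the root edge is also a leaf), a null-dot is a node without input edges, and a unit tree has one edge and no nodes. A constellation $T\to N$ between trees consists of a subdivision $T'$ of $T$ (each edge is replaced by a linear tree; the new nodes are called white), a bijection $\sigma_\bullet$ from the nodes of $T$ to the leaves of $N$, and a bijection $\sigma_\circ$ from the white nodes to the null-dots of $N$, such that for each node $x$ of $N$ the set of nodes $t$ of $T'$ with $\sigma(t)$ equal to $x$ or a descendant of $x$ spans a non-empty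 connected full subgraph of $T'$. A zoom complex of degree $n$ is a sequence of trees and constellations $T_0\to T_1\to\dots\to T_{n+1}$. An $n$-opetope in the sense of zoom complexes is an isomorphism class of zoom complexes of degree $n$ in which $T_0,T_1$, and (if $n\ge1$) $T_2$ are linear with exactly one node and, if $n\ge2$, $T_3$ is linear. Its target (if $n\geq 1$) is obtained by omitting $T_{n+1}$; the tree $T_{n+1}$ is called its composition tree. Let $O^k$ be the set of $k$-opetopes in this sense. There are bijections $\Omega_k: O^k\cong Z^k$ for all $k\ge0$, hence $O^k\cong Z^k\cong L^k$: the three notions of opetope coincide. The $\Omega_k$ can be chosen such that (i) $\Omega_k(\text{target of }X)=t(\Omega_{k+1}(X))$, where $t$ is the output-type map of $P^k$ (whose operations are the elements of $Z^{k+1}$); (ii) for each zoom complex $X$ of degree $k+2$ representing an opetope there is an isomorphism $\tau_X$ from its composition tree to the underlying tree of the $P^k$-tree $\Omega_{k+2}(X)\in\mathrm{tr}(P^k)=Z^{k+2}$; and these can be chosen such that (iii) for $X$ of degree $k+3$, with target $Y$ represented by the truncated complex, and for each node $d$ of the composition tree of $Y$, the leaf $\tau_X(\sigma_\bullet(d))$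 of the $P^{k+1}$-tree $\Omega_{k+3}(X)$ is the one which contraction matches with the node $\tau_Y(d)$ of the $P^k$-tree $t(\Omega_{k+3}(X))=\Omega_{k+2}(Y)$. -/

import Mathlib

open CategoryTheory

universe u

/-- A finitary polynomial endofunctor on the slice of sets over `I`, represented by a diagram
`I ← E → B → I`. The map `E → B` is given through its fibres `E b`, which are required to be
finite; `s` and `t` are the two outer maps. -/
structure PolyEndo (I : Type u) where
  B : Type u
  E : B → Type u
  finite : ∀ b, Finite (E b)
  s : (b : B) → E b → I
  t : B → I

namespace PolyEndo
variable {I : Type u}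

/-- A cartesian natural transformation between polynomial endofunctors: maps `P.B → Q.B` and
`P.E → Q.E` making the middle square a pullback and commuting with the outer maps. The pullback
condition says that the fibre over `onB b` is identified with the fibre over `b`, and the bijection
of fibres is recorded in the direction `Q.E (onB b) → P.E b`. -/
structure Hom (P Q : PolyEndo I) where
  onB : P.B → Q.B
  onE : (b : P.B) → Q.E (onB b) → P.E b
  bij : ∀ b, Function.Bijective (onE b)
  t_onB : ∀ b, Q.t (onB b) = P.t b
  s_onE : ∀ b e, P.s b (onE b e) = Q.s (onB b) e

theorem Hom.ext_of {P Q : PolyEndo I} (f g : Hom P Q)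
    (h : ∀ b, ∃ hb : f.onB b = g.onB b, ∀ e, f.onE b e = g.onE b (hb ▸ e)) : f = g := by
  obtain ⟨fB, fE, _, _, _⟩ := f
  obtain ⟨gB, gE, _, _, _⟩ := g
  have hB : fB = gB := funext fun b => (h b).1
  subst hB
  have hE : fE = gE := by
    funext b e
    exact (h b).2 e
  subst hE
  rfl

instance : Category (PolyEndo I) where
  Hom := Hom
  id P := ⟨id, fun _ => id, fun _ => Function.bijective_id, fun _ => rfl, fun _ _ => rfl⟩
  comp f g := ⟨g.onB ∘ f.onB, fun b => f.onE b ∘ g.onE (f.onB b),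
    fun b => (f.bij b).comp (g.bij _), fun b => (g.t_onB _).trans (f.t_onB b),
    fun b e => (f.s_onE b _).trans (g.s_onE _ e)⟩

theorem hom_ext {P Q : PolyEndo I} (f g : P ⟶ Q)
    (h : ∀ b, ∃ hb : f.onB b = g.onB b, ∀ e, f.onE b e = g.onE b (hb ▸ e)) : f = g :=
  Hom.ext_of f g h

/-- An operation of the composite `P ∘ Q`: an operation of `P` each of whose inputs is decorated by
an operation of `Q` with matching output type. -/
structure CompOp (P Q : PolyEndo I) where
  op : P.B
  args : P.E op → Q.B
  compat : ∀ e, Q.t (args e) = P.s op e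

/-- The composite `P ∘ Q` of polynomial endofunctors. -/
def comp (P Q : PolyEndo I) : PolyEndo I where
  B := CompOp P Q
  E z := Σ e : P.E z.op, Q.E (z.args e)
  finite z := by
    have := P.finite z.op
    have := fun e => Q.finite (z.args e)
    infer_instance
  s z p := Q.s (z.args p.1) p.2
  t z := P.t z.op

/-- The identity functor, represented by `I ← I → I → I`. -/
def unit (I : Type u) : PolyEndo I where
  B := I
  E _ := PUnit
  finite _ := inferInstance
  s i _ := i
  t i := i

theorem sigma_map_bij {α α' : Type*} {β : α → Type*} {β' : α' → Type*} (f : α → α')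
    (g : ∀ a, β a → β' (f a)) (hf : Function.Bijective f) (hg : ∀ a, Function.Bijective (g a)) :
    Function.Bijective (fun p : Sigma β => (⟨f p.1, g p.1 p.2⟩ : Sigma β')) :=
  ⟨hf.1.sigma_map (fun a => (hg a).1), hf.2.sigma_map (fun a => (hg a).2)⟩

def compMap {P P' Q Q' : PolyEndo I} (f : P ⟶ P') (g : Q ⟶ Q') : comp P Q ⟶ comp P' Q' where
  onB z := ⟨f.onB z.op, fun e => g.onB (z.args (f.onE z.op e)), fun e => by
    rw [g.t_onB, z.compat, f.s_onE]⟩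
  onE z p := ⟨f.onE z.op p.1, g.onE _ p.2⟩
  bij z := sigma_map_bij (β' := fun e => Q.E (z.args e)) (f.onE z.op)
    (fun e => g.onE (z.args (f.onE z.op e))) (f.bij _) (fun _ => g.bij _)
  t_onB z := f.t_onB z.op
  s_onE z p := g.s_onE _ p.2

def assocHom (P Q R : PolyEndo I) : comp (comp P Q) R ⟶ comp P (comp Q R) where
  onB z := ⟨z.op.op, fun e => ⟨z.op.args e, fun f => z.args ⟨e, f⟩, fun f => z.compat ⟨e, f⟩⟩,
    fun e => z.op.compat e⟩
  onE z p := ⟨⟨p.1, p.2.1⟩, p.2.2⟩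
  bij z := ⟨by rintro ⟨a, b, c⟩ ⟨a', b', c'⟩ h; cases h; rfl,
    by rintro ⟨⟨a, b⟩, c⟩; exact ⟨⟨a, b, c⟩, rfl⟩⟩
  t_onB _ := rfl
  s_onE _ _ := rfl

def assocInv (P Q R : PolyEndo I) : comp P (comp Q R) ⟶ comp (comp P Q) R where
  onB z := ⟨⟨z.op, fun e => (z.args e).op, z.compat⟩, fun p => (z.args p.1).args p.2,
    fun p => (z.args p.1).compat p.2⟩
  onE z p := ⟨p.1.1, ⟨p.1.2, p.2⟩⟩
  bij z := ⟨by rintro ⟨⟨a, b⟩, c⟩ ⟨⟨a', b'⟩, c'⟩ h; cases h; rfl,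
    by rintro ⟨a, b, c⟩; exact ⟨⟨⟨a, b⟩, c⟩, rfl⟩⟩
  t_onB _ := rfl
  s_onE _ _ := rfl

def leftHom (P : PolyEndo I) : comp (unit I) P ⟶ P where
  onB z := z.args ⟨⟩
  onE z e := ⟨⟨⟩, e⟩
  bij z := ⟨by intro a b h; cases h; rfl, by rintro ⟨⟨⟩, e⟩; exact ⟨e, rfl⟩⟩
  t_onB z := z.compat ⟨⟩
  s_onE _ _ := rfl

def leftInv (P : PolyEndo I) : P ⟶ comp (unit I) P where
  onB b := ⟨P.t b, fun _ => b, fun _ => rfl⟩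
  onE b p := p.2
  bij b := ⟨by rintro ⟨⟨⟩, e⟩ ⟨⟨⟩, e'⟩ h; cases h; rfl, fun e => ⟨⟨⟨⟩, e⟩, rfl⟩⟩
  t_onB _ := rfl
  s_onE _ _ := rfl

def rightHom (P : PolyEndo I) : comp P (unit I) ⟶ P where
  onB z := z.op
  onE z e := ⟨e, ⟨⟩⟩
  bij z := ⟨by intro a b h; cases h; rfl, by rintro ⟨e, ⟨⟩⟩; exact ⟨e, rfl⟩⟩
  t_onB _ := rfl
  s_onE z e := z.compat e

def rightInv (P : PolyEndo I) : P ⟶ comp P (unit I) where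
  onB b := ⟨b, P.s b, fun _ => rfl⟩
  onE b p := p.1
  bij b := ⟨by rintro ⟨e, ⟨⟩⟩ ⟨e', ⟨⟩⟩ h; cases h; rfl, fun e => ⟨⟨e, ⟨⟩⟩, rfl⟩⟩
  t_onB _ := rfl
  s_onE _ _ := rfl

/-- `PolyEndo I` is monoidal under composition of endofunctors. A polynomial monad is a monoid in
this category, i.e. an object of `Mon (PolyEndo I)`. -/
instance : MonoidalCategoryStruct (PolyEndo I) where
  tensorObj := comp
  tensorUnit := unit I
  tensorHom := compMap
  whiskerLeft P _ _ g := compMap (𝟙 P) g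
  whiskerRight f Q := compMap f (𝟙 Q)
  associator P Q R := ⟨assocHom P Q R, assocInv P Q R, rfl, rfl⟩
  leftUnitor P := ⟨leftHom P, leftInv P, by
    refine hom_ext _ _ fun z => ?_
    obtain ⟨i, c, h⟩ := z
    change I at i
    change PUnit → P.B at c
    obtain rfl : P.t (c ⟨⟩) = i := h ⟨⟩
    exact ⟨rfl, fun e => rfl⟩, rfl⟩
  rightUnitor P := ⟨rightHom P, rightInv P, by
    refine hom_ext _ _ fun z => ?_
    obtain ⟨b, c, h⟩ := z
    obtain rfl : c = P.s b := funext h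
    exact ⟨rfl, fun e => rfl⟩, rfl⟩

instance : MonoidalCategory (PolyEndo I) where
  tensorHom_def _ _ := rfl
  id_tensorHom_id _ _ := rfl
  tensorHom_comp_tensorHom _ _ _ _ := rfl
  whiskerLeft_id _ _ := rfl
  id_whiskerRight _ _ := rfl
  associator_naturality _ _ _ := rfl
  leftUnitor_naturality _ := rfl
  rightUnitor_naturality _ := rfl
  pentagon _ _ _ _ := rfl
  triangle _ _ := hom_ext _ _ fun _ => ⟨rfl, fun _ => rfl⟩

end PolyEndo

namespace PolyEndo
variable {I : Type u}

/-- An element of the value of `P` on `X → I`: an operation whose inputs are decorated by elements of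
`X` of the correct type. -/
structure Ext (P : PolyEndo I) (X : Over I) where
  op : P.B
  args : P.E op → X.left
  compat : ∀ e, X.hom (args e) = P.s op e

/-- The endofunctor of `Over I` represented by `P`. -/
def functor (P : PolyEndo I) : Over I ⥤ Over I where
  obj X := Over.mk (↾ fun z : Ext P X => P.t z.op)
  map {X Y} f := Over.homMk (↾ fun z : Ext P X => (⟨z.op, fun e => f.left (z.args e), fun e =>
    (types_congr_hom (Over.w f) (z.args e)).trans (z.compat e)⟩ : Ext P Y))

def extMap {P Q : PolyEndo I} (f : P ⟶ Q) : P.functor ⟶ Q.functor where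
  app X := Over.homMk (↾ fun z : Ext P X => (⟨f.onB z.op, fun e => z.args (f.onE z.op e),
      fun e => (z.compat _).trans (f.s_onE _ e)⟩ : Ext Q X)) (by
    ext z
    exact f.t_onB z.op)

def extComp (P Q : PolyEndo I) : Q.functor ⋙ P.functor ⟶ (comp P Q).functor where
  app X := Over.homMk (↾ fun z : Ext P (Q.functor.obj X) =>
    (⟨⟨z.op, fun e => (z.args e).op, z.compat⟩, fun p => (z.args p.1).args p.2,
      fun p => (z.args p.1).compat p.2⟩ : Ext (comp P Q) X))

theorem ext_congr (Y : Over I) (y : Y.left) (i j : I) (hi : ∀ _ : PUnit.{u + 1}, Y.hom y = i)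
    (hj : ∀ _ : PUnit.{u + 1}, Y.hom y = j) (h : i = j) :
    (⟨i, fun _ => y, hi⟩ : Ext (unit I) Y) = ⟨j, fun _ => y, hj⟩ := by
  subst h
  rfl

def extUnit (I : Type u) : 𝟭 (Over I) ⟶ (unit I).functor where
  app X := Over.homMk (↾ fun x : X.left => (⟨X.hom x, fun _ => x, fun _ => rfl⟩ : Ext (unit I) X))
  naturality X Y f := by
    ext x
    have := types_congr_hom (Over.w f) x
    change Y.hom (f.left x) = X.hom x at this
    exact ext_congr Y (f.left x) _ _ (fun _ => rfl) (fun _ => this) this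

/-- The monad on `Over I` underlying a polynomial monad. -/
def monad (P : Mon (PolyEndo I)) : Monad (Over I) where
  toFunctor := P.X.functor
  η := extUnit I ≫ extMap MonObj.one
  μ := extComp P.X P.X ≫ extMap MonObj.mul
  assoc X := by
    ext z
    have h := congrArg (fun f => (extMap f).app X) (MonObj.mul_assoc P.X)
    have h2 := types_congr_hom (congrArg (fun f => f.left) h) (((extComp (comp P.X P.X) P.X).app X).left (((extComp P.X P.X).app (P.X.functor.obj X)).left z))
    exact h2.symm
  left_unit X := by
    ext z
    have h := congrArg (fun f => (extMap f).app X) (MonObj.one_mul P.X)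
    exact types_congr_hom (congrArg (fun f => f.left) h)
      (⟨⟨P.X.t z.op, fun _ => z.op, fun _ => rfl⟩, fun p => z.args p.2,
        fun p => z.compat p.2⟩ : Ext (comp (unit I) P.X) X)
  right_unit X := by
    ext z
    have h := congrArg (fun f => (extMap f).app X) (MonObj.mul_one P.X)
    exact types_congr_hom (congrArg (fun f => f.left) h)
      (⟨⟨z.op, fun e => X.hom (z.args e), z.compat⟩, fun p => z.args p.1,
        fun p => rfl⟩ : Ext (comp P.X (unit I)) X)
end PolyEndo

/-- Trees whose nodes are decorated by operations of `P`, with the inputs of each node indexed by the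
fibre of its operation, and whose leaves are decorated by elements of `X`. The matching of types is
the separate predicate `PTree.Valid`. -/
inductive PTree {I : Type u} (P : PolyEndo I) (X : Type u) : Type u
  | leaf (x : X) : PTree P X
  | node (b : P.B) (c : P.E b → PTree P X) : PTree P X

namespace PTree
open PolyEndo
variable {I : Type u} {P Q R : PolyEndo I} {X Y Z : Type u}

/-- The type of the root edge, where `τ` gives the types of the leaf decorations. -/
def root (τ : X → I) : PTree P X → I
  | leaf x => τ x
  | node b _ => P.t b

/-- The types of the edges match. The trees `T : PTree P I` which are valid for the identity are the
(isomorphism classes of) `P`-trees, that is, the least fixpoint of `X ↦ I + P X`. -/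
def Valid (τ : X → I) : PTree P X → Prop
  | leaf _ => True
  | node b c => ∀ e, (c e).root τ = P.s b e ∧ (c e).Valid τ

/-- The leaves of a tree. -/
def Leaves : PTree P X → Type u
  | leaf _ => PUnit
  | node _ c => Σ e, (c e).Leaves

def leafLabel : (T : PTree P X) → T.Leaves → X
  | leaf x, _ => x
  | node _ c, l => (c l.1).leafLabel l.2

/-- The nodes (dots) of a tree. -/
def Nodes : PTree P X → Type u
  | leaf _ => PEmpty
  | node b c => Option (Σ e : P.E b, (c e).Nodes)

/-- The operation decorating a node. -/
def nodeOp : (T : PTree P X) → T.Nodes → P.B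
  | node b _, none => b
  | node _ c, some n => (c n.1).nodeOp n.2

/-- Grafting of trees onto the leaves. -/
def bind : PTree P X → (X → PTree P Y) → PTree P Y
  | leaf x, f => f x
  | node b c, f => node b fun e => (c e).bind f

def map (f : X → Y) (T : PTree P X) : PTree P Y := T.bind fun x => leaf (f x)

/-- Substitution of a tree into each node: a node decorated by `a` is replaced by the tree `F a`,
whose leaves are named by the inputs of the node. -/
def sub (F : (a : Q.B) → PTree P (Q.E a)) : PTree Q X → PTree P X
  | leaf x => leaf x
  | node a c => (F a).bind fun e => (c e).sub F

end PTree

namespace PolyEndo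
variable {I : Type u}
/-- The polynomial endofunctor with operations `C` obtained by pulling back along `C → B`. -/
def pull (P : PolyEndo I) {C : Type u} (f : C → P.B) : PolyEndo I where
  B := C
  E c := P.E (f c)
  finite c := P.finite (f c)
  s c := P.s (f c)
  t c := P.t (f c)
end PolyEndo

namespace PTree
open PolyEndo
variable {I : Type u} {P Q R : PolyEndo I} {X Y Z : Type u} {C D : Type u}

/-- Renaming of the node decorations along a map over `B`. -/
def relabel {f : D → P.B} {f' : C → P.B} (g : C → D) (h : ∀ c, f (g c) = f' c)
    (T : PTree (P.pull f') X) : PTree (P.pull f) X :=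
  T.sub (P := P.pull f) (Q := P.pull f') fun c =>
    node (P := P.pull f) (g c) fun e => leaf (cast (congrArg P.E (h c)) e)

/-- Replace the decorations in `C` by their images in `B`. -/
def erase {f : C → P.B} (T : PTree (P.pull f) X) : PTree P X :=
  T.sub (fun a => node (f a) leaf)

/-- The tree `T` with every node and every leaf decorated by its own name. -/
def self : (T : PTree P X) → PTree (P.pull T.nodeOp) T.Leaves
  | leaf _ => leaf PUnit.unit
  | node b c => node (P := P.pull (node b c).nodeOp) none fun e =>
      ((c e).self.relabel (f := (node b c).nodeOp) (fun n => some ⟨e, n⟩) fun _ => rfl).map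
        (Sigma.mk e)

/-- The tree `T` with every node decorated by its own name. -/
def nodeSelf (T : PTree P X) : PTree (P.pull T.nodeOp) X := T.self.map T.leafLabel

/-- The decoration in `C` of a node of the underlying tree. -/
def label {f : C → P.B} : (T : PTree (P.pull f) X) → T.erase.Nodes → C
  | node a _, none => a
  | node _ c, some n => (c n.1).label n.2

theorem nodeOp_erase {f : C → P.B} : (T : PTree (P.pull f) X) → (n : T.erase.Nodes) →
    f (T.label n) = T.erase.nodeOp n
  | node _ _, none => rfl
  | node _ c, some n => nodeOp_erase (c n.1) n.2

theorem bind_bind (T : PTree P X) (f : X → PTree P Y) (g : Y → PTree P Z) :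
    (T.bind f).bind g = T.bind fun x => (f x).bind g := by
  induction T with
  | leaf x => rfl
  | node b c ih => exact congrArg (node b) (funext fun e => ih e)

theorem bind_leaf (T : PTree P X) : T.bind leaf = T := by
  induction T with
  | leaf x => rfl
  | node b c ih => exact congrArg (node b) (funext fun e => ih e)

theorem sub_bind (F : (a : Q.B) → PTree P (Q.E a)) (T : PTree Q X) (f : X → PTree Q Y) :
    (T.bind f).sub F = (T.sub F).bind fun x => (f x).sub F := by
  induction T with
  | leaf x => rfl
  | node b c ih =>
    simp only [bind, sub, bind_bind]
    exact congrArg _ (funext fun e => ih e)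

theorem sub_sub (F : (a : Q.B) → PTree P (Q.E a)) (G : (a : P.B) → PTree R (P.E a))
    (T : PTree Q X) : (T.sub F).sub G = T.sub fun a => (F a).sub G := by
  induction T with
  | leaf x => rfl
  | node b c ih =>
    simp only [sub, sub_bind]
    exact congrArg _ (funext fun e => ih e)

theorem sub_node (T : PTree P X) : T.sub (fun a => node a leaf) = T := by
  induction T with
  | leaf x => rfl
  | node b c ih => exact congrArg (node b) (funext fun e => ih e)

theorem map_map (T : PTree P X) (f : X → Y) (g : Y → Z) :
    (T.map f).map g = T.map fun x => g (f x) := bind_bind _ _ _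

theorem map_id (T : PTree P X) : T.map (fun x => x) = T := bind_leaf T

theorem sub_map (F : (a : Q.B) → PTree P (Q.E a)) (T : PTree Q X) (f : X → Y) :
    (T.map f).sub F = (T.sub F).map f := sub_bind _ _ _

theorem erase_relabel {f : D → P.B} {f' : C → P.B} (g : C → D) (h : ∀ c, f (g c) = f' c)
    (T : PTree (P.pull f') X) : (T.relabel g h).erase = T.erase := by
  refine (sub_sub _ _ _).trans ?_
  refine congrArg (fun F => T.sub (P := P) F) (funext fun c => ?_)
  have key : ∀ (b : P.B) (hb : f (g c) = b), node (P := P) (f (g c)) (fun e =>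
      leaf (cast (congrArg P.E hb) e)) = node b leaf := by
    rintro b rfl
    rfl
  exact key _ (h c)

theorem erase_self_map (T : PTree P X) : T.self.erase.map T.leafLabel = T := by
  induction T with
  | leaf x => rfl
  | node b c ih =>
    refine congrArg (node b) (funext fun e => ?_)
    refine Eq.trans ?_ (ih e)
    refine (congrArg (fun S => PTree.bind S _) (sub_map _ _ _)).trans ?_
    refine (bind_bind _ _ _).trans ?_
    exact congrArg (fun S : PTree P (c e).Leaves => S.map (c e).leafLabel)
      (erase_relabel (f := (node b c).nodeOp) (fun n => some ⟨e, n⟩) (fun _ => rfl) (c e).self)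

theorem erase_nodeSelf (T : PTree P X) : T.nodeSelf.erase = T :=
  (sub_map _ _ _).trans (erase_self_map T)

theorem relabel_self {f : C → P.B} (τ : X → Y) (T : PTree (P.pull f) X) :
    ∃ w : (T.map τ).erase.Leaves → X,
      ((T.map τ).erase.self.map w).relabel (T.map τ).label (nodeOp_erase _) = T ∧
      ∀ l, τ (w l) = (T.map τ).erase.leafLabel l := by
  induction T with
  | leaf x => exact ⟨fun _ => x, rfl, fun _ => rfl⟩
  | node b c ih =>
    choose w hw hw' using ih
    refine ⟨fun l => w l.1 l.2, ?_, fun l => hw' l.1 l.2⟩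
    refine congrArg (node (P := P.pull f) b) (funext fun e => ?_)
    refine Eq.trans ?_ (hw e)
    refine (congrArg (fun S => PTree.sub _ S) (bind_bind _ _ _)).trans ?_
    refine (sub_map _ _ _).trans ?_
    refine Eq.trans ?_ (sub_map _ _ _).symm
    exact congrArg (fun S : PTree (P.pull f) _ => S.map (w e)) (sub_sub _ _ _)

theorem relabel_nodeSelf {f : C → P.B} (T : PTree (P.pull f) X) :
    T.erase.nodeSelf.relabel T.label (nodeOp_erase T) = T := by
  induction T with
  | leaf x => rfl
  | node b c ih =>
    refine congrArg (node (P := P.pull f) b) (funext fun e => ?_)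
    refine Eq.trans ?_ (ih e)
    refine (congrArg (fun S => PTree.sub _ S) (bind_bind _ _ _)).trans ?_
    refine (sub_map _ _ _).trans ?_
    refine Eq.trans ?_ (sub_map _ _ _).symm
    exact congrArg (fun S : PTree (P.pull f) _ => S.map _) (sub_sub _ _ _)

theorem relabel_relabel {E : Type u} {f : D → P.B} {f' : C → P.B} {f'' : E → P.B} (g : C → D)
    (h : ∀ c, f (g c) = f' c) (k : E → C) (h' : ∀ c, f' (k c) = f'' c)
    (T : PTree (P.pull f'') X) :
    (T.relabel k h').relabel g h = T.relabel (fun c => g (k c)) fun c => (h _).trans (h' c) := by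
  refine (sub_sub _ _ _).trans ?_
  refine congrArg (fun F => T.sub (P := P.pull f) F) (funext fun c => ?_)
  refine congrArg (node (P := P.pull f) (g (k c))) (funext fun e => ?_)
  exact congrArg leaf (cast_cast _ _ _)

theorem root_bind {τ : X → I} {τ' : Y → I} (T : PTree P X) (f : X → PTree P Y)
   (h : ∀ x, (f x).root τ' = τ x) : (T.bind f).root τ' = T.root τ := by
  cases T with
  | leaf x => exact h x
  | node b c => rfl

theorem valid_bind {τ : X → I} {τ' : Y → I} (T : PTree P X) (f : X → PTree P Y)
   (h : ∀ x, (f x).root τ' = τ x) (hf : ∀ x, (f x).Valid τ') (hT : T.Valid τ) :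
   (T.bind f).Valid τ' := by
  induction T with
  | leaf x => exact hf x
  | node b c ih => exact fun e => ⟨(root_bind _ _ h).trans (hT e).1, ih e (hT e).2⟩

theorem root_sub {τ : X → I} (F : (a : Q.B) → PTree P (Q.E a))
    (hr : ∀ a, (F a).root (Q.s a) = Q.t a) (T : PTree Q X) (hT : T.Valid τ) :
    (T.sub F).root τ = T.root τ := by
  induction T with
  | leaf x => rfl
  | node a c ih => exact (root_bind _ _ (fun e => (ih e (hT e).2).trans (hT e).1)).trans (hr a)

theorem valid_sub {τ : X → I} (F : (a : Q.B) → PTree P (Q.E a))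
    (hr : ∀ a, (F a).root (Q.s a) = Q.t a) (hv : ∀ a, (F a).Valid (Q.s a))
    (T : PTree Q X) (hT : T.Valid τ) : (T.sub F).Valid τ := by
  induction T with
  | leaf x => trivial
  | node a c ih =>
    exact valid_bind _ _ (fun e => (root_sub F hr _ (hT e).2).trans (hT e).1)
      (fun e => ih e (hT e).2) (hv a)

end PTree

namespace PTree
open PolyEndo
variable {I : Type u} {P Q R : PolyEndo I} {X Y Z : Type u} {C D : Type u}

theorem root_map {τ : X → I} {τ' : Y → I} (T : PTree P X) (g : X → Y)
    (h : ∀ x, τ' (g x) = τ x) : (T.map g).root τ' = T.root τ := root_bind T _ h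

theorem valid_map {τ : X → I} {τ' : Y → I} (T : PTree P X) (g : X → Y)
    (h : ∀ x, τ' (g x) = τ x) (hT : T.Valid τ) : (T.map g).Valid τ' :=
  valid_bind T _ h (fun _ => trivial) hT

theorem root_relabel {f : D → P.B} {f' : C → P.B} (g : C → D) (h : ∀ c, f (g c) = f' c)
    (τ : X → I) (T : PTree (P.pull f') X) (hT : T.Valid τ) : (T.relabel g h).root τ = T.root τ :=
  root_sub (Q := P.pull f') (P := P.pull f) (fun c =>
    node (P := P.pull f) (g c) fun e => leaf (cast (congrArg P.E (h c)) e))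
    (fun c => congrArg P.t (h c)) T hT

theorem valid_relabel {f : D → P.B} {f' : C → P.B} (g : C → D) (h : ∀ c, f (g c) = f' c)
    (τ : X → I) (T : PTree (P.pull f') X) (hT : T.Valid τ) : (T.relabel g h).Valid τ := by
  refine valid_sub (Q := P.pull f') (P := P.pull f) (fun c =>
    node (P := P.pull f) (g c) fun e => leaf (cast (congrArg P.E (h c)) e))
    (fun c => congrArg P.t (h c)) (fun c e => ⟨?_, trivial⟩) T hT
  have key : ∀ (b : P.B) (hb : f (g c) = b), P.s b (cast (congrArg P.E hb) e) = P.s (f (g c)) e := by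
    rintro b rfl
    rfl
  exact key _ (h c)

theorem root_erase {f : C → P.B} (τ : X → I) (T : PTree (P.pull f) X) (hT : T.Valid τ) :
    T.erase.root τ = T.root τ :=
  root_sub (Q := P.pull f) (P := P) (fun a => node (f a) leaf) (fun _ => rfl) T hT

theorem valid_erase {f : C → P.B} (τ : X → I) (T : PTree (P.pull f) X) (hT : T.Valid τ) :
    T.erase.Valid τ :=
  valid_sub (Q := P.pull f) (P := P) (fun a => node (f a) leaf) (fun _ => rfl) (fun _ _ => ⟨rfl, trivial⟩) T hT

theorem self_valid (τ : X → I) (T : PTree P X) (hT : T.Valid τ) :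
    T.self.Valid (fun l => τ (T.leafLabel l)) ∧ T.self.root (fun l => τ (T.leafLabel l)) = T.root τ := by
  induction T with
  | leaf x => exact ⟨trivial, rfl⟩
  | node b c ih =>
    refine ⟨fun e => ⟨?_, ?_⟩, rfl⟩
    · refine Eq.trans ?_ ((ih e (hT e).2).2.trans (hT e).1)
      refine (root_map _ _ fun _ => rfl).trans ?_
      exact root_relabel _ _ _ _ (ih e (hT e).2).1
    · refine valid_map (τ := fun l => τ ((c e).leafLabel l)) _ _ (fun _ => rfl) ?_
      exact valid_relabel _ _ _ _ (ih e (hT e).2).1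

theorem nodeSelf_valid (τ : X → I) (T : PTree P X) (hT : T.Valid τ) : T.nodeSelf.Valid τ :=
  valid_map _ _ (fun _ => rfl) (self_valid τ T hT).1

theorem nodeSelf_root (τ : X → I) (T : PTree P X) (hT : T.Valid τ) :
    T.nodeSelf.root τ = T.root τ :=
  (root_map (τ := fun l => τ (T.leafLabel l)) _ _ (fun _ => rfl)).trans (self_valid τ T hT).2

/-- An operation with the same output type as `T`, and a type preserving bijection between its inputs
and the leaves of `T`. -/
structure Contraction (τ : X → I) (T : PTree P X) where
  op : P.B
  leafOf : P.E op → T.Leaves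
  bij : Function.Bijective leafOf
  t_op : P.t op = T.root τ
  s_op : ∀ e, P.s op e = τ (T.leafLabel (leafOf e))

/-- Contraction of all inner edges of a tree by means of the monad structure of `P`; a unit tree is
sent to the unit operation on its edge. -/
def contract (P : Mon (PolyEndo I)) (τ : X → I) :
    (T : PTree P.X X) → T.Valid τ → Contraction τ T
  | leaf x, _ =>
    { op := (MonObj.one (X := P.X)).onB (τ x)
      leafOf := (MonObj.one (X := P.X)).onE (τ x)
      bij := (MonObj.one (X := P.X)).bij (τ x)
      t_op := (MonObj.one (X := P.X)).t_onB (τ x)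
      s_op := fun e => ((MonObj.one (X := P.X)).s_onE (τ x) e).symm }
  | node b c, h =>
    let k : ∀ e, Contraction τ (c e) := fun e => contract P τ (c e) (h e).2
    let z : CompOp P.X P.X := ⟨b, fun e => (k e).op, fun e => (k e).t_op.trans (h e).1⟩
    { op := (MonObj.mul (X := P.X)).onB z
      leafOf := fun e =>
        ⟨((MonObj.mul (X := P.X)).onE z e).1, (k _).leafOf ((MonObj.mul (X := P.X)).onE z e).2⟩
      bij := (sigma_map_bij (β := fun e => P.X.E (k e).op) (β' := fun e => (c e).Leaves) id
        (fun e => (k e).leafOf) Function.bijective_id fun e => (k e).bij).comp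
        ((MonObj.mul (X := P.X)).bij z)
      t_op := (MonObj.mul (X := P.X)).t_onB z
      s_op := fun e => ((MonObj.mul (X := P.X)).s_onE z e).symm.trans ((k _).s_op _) }

end PTree

namespace PTree
open PolyEndo
variable {I : Type u} (P : Mon (PolyEndo I)) {Q R : PolyEndo I} {X Y Z : Type u} {C D : Type u}

/-- The contraction of `T`, with its inputs decorated by the leaf decorations of `T`. -/
def ev (τ : X → I) (T : PTree P.X X) (hT : T.Valid τ) : Ext P.X (Over.mk (↾τ)) :=
  ⟨(contract P τ T hT).op, fun e => T.leafLabel ((contract P τ T hT).leafOf e),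
    fun e => ((contract P τ T hT).s_op e).symm⟩

theorem ev_t (τ : X → I) (T : PTree P.X X) (hT : T.Valid τ) :
    P.X.t (ev P τ T hT).op = T.root τ := (contract P τ T hT).t_op

/-- Multiplication of the monad, on elements. -/
def muE (X : Over I) (b : P.X.B) (z : P.X.E b → Ext P.X X)
    (h : ∀ e, P.X.t (z e).op = P.X.s b e) : Ext P.X X :=
  ((monad P).μ.app X).left (⟨b, z, h⟩ : Ext P.X (P.X.functor.obj X))

theorem muE_muE (X : Over I) (b : P.X.B) (d : P.X.E b → P.X.B) (h : ∀ e, P.X.t (d e) = P.X.s b e)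
    (z : ∀ e, P.X.E (d e) → Ext P.X X) (h' : ∀ e f, P.X.t (z e f).op = P.X.s (d e) f) (h₁ h₂) :
    muE P X b (fun e => muE P X (d e) (z e) (h' e)) h₁ =
      muE P X (muE P (P.X.functor.obj X) b (fun e => ⟨d e, z e, h' e⟩) h).op
        (muE P (P.X.functor.obj X) b (fun e => ⟨d e, z e, h' e⟩) h).args h₂ :=
  types_congr_hom (congrArg (fun f => f.left) ((monad P).assoc X))
    (⟨b, fun e => ⟨d e, z e, h' e⟩, h⟩ : Ext P.X (P.X.functor.obj (P.X.functor.obj X)))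

theorem muE_one (X : Over I) (i : I) (z : Ext P.X X) (hz : P.X.t z.op = i) (h) :
    muE P X ((MonObj.one (X := P.X)).onB i) (fun _ => z) h = z := by
  subst hz
  exact types_congr_hom (congrArg (fun f => f.left) ((monad P).left_unit X)) z

theorem muE_leaf (X : Over I) (b : P.X.B) (g : P.X.E b → X.left)
    (hg : ∀ e, X.hom (g e) = P.X.s b e)
    (h' : ∀ (e : P.X.E b) (_ : P.X.E ((MonObj.one (X := P.X)).onB (X.hom (g e)))),
      X.hom (g e) = P.X.s _ ‹_›) (h) :
    muE P X b (fun e => ⟨(MonObj.one (X := P.X)).onB (X.hom (g e)), fun _ => g e, h' e⟩) h =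
      ⟨b, g, hg⟩ :=
  types_congr_hom (congrArg (fun f => f.left) ((monad P).right_unit X)) (⟨b, g, hg⟩ : Ext P.X X)

theorem ev_node (τ : X → I) (b : P.X.B) (c : P.X.E b → PTree P.X X) (h : (node b c).Valid τ) :
    ev P τ (node b c) h = muE P _ b (fun e => ev P τ (c e) (h e).2) fun e =>
      (ev_t P _ _ _).trans (h e).1 := rfl

theorem muE_congr (X : Over I) (b : P.X.B) (z z' : P.X.E b → Ext P.X X) (hz : ∀ e, z e = z' e)
    (h h') : muE P X b z h = muE P X b z' h' := by
  obtain rfl : z = z' := funext hz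
  rfl

theorem ev_corolla (τ : X → I) (b : P.X.B) (g : P.X.E b → X) (hg : ∀ e, τ (g e) = P.X.s b e) (h) :
    ev P τ (node b fun e => leaf (g e)) h = ⟨b, g, hg⟩ :=
  muE_leaf P (Over.mk (↾τ)) b g hg (fun e x => ((MonObj.one (X := P.X)).s_onE (τ (g e)) x))
    fun e => ((MonObj.one (X := P.X)).t_onB _).trans (hg e)

theorem ev_bind (τ : X → I) (τ' : Y → I) (T : PTree P.X X) (hT : T.Valid τ)
    (f : X → PTree P.X Y) (hf : ∀ x, (f x).Valid τ') (hr : ∀ x, (f x).root τ' = τ x) (h h') :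
    ev P τ' (T.bind f) h = muE P _ (ev P τ T hT).op
      (fun e => ev P τ' (f ((ev P τ T hT).args e)) (hf _)) h' := by
  induction T with
  | leaf x => exact (muE_one P _ _ _ ((ev_t P _ _ _).trans (hr x)) _).symm
  | node b c ih =>
    have h1 := ev_node P τ' b (fun e => (c e).bind f) h
    refine h1.trans ?_
    refine (muE_congr P _ _ _ _ (fun e => ih e (hT e).2 _ fun x =>
      (ev_t P _ _ _).trans ((hr _).trans ((ev P τ (c e) (hT e).2).compat x))) _ ?_).trans ?_
    · intro e
      exact ((congrArg (fun z => P.X.t z.op) (ih e (hT e).2 (h e).2 fun x =>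
      (ev_t P _ _ _).trans ((hr _).trans ((ev P τ (c e) (hT e).2).compat x)))).symm.trans
        (ev_t P _ _ _)).trans (h e).1
    · exact muE_muE P _ b (fun e => (ev P τ (c e) (hT e).2).op) (fun e => (ev_t P _ _ _).trans (hT e).1)
        (fun e x => ev P τ' (f ((ev P τ (c e) (hT e).2).args x)) (hf _))
        (fun e x => (ev_t P _ _ _).trans ((hr _).trans ((ev P τ (c e) (hT e).2).compat x))) _ _

theorem ev_map (τ : X → I) (τ' : Y → I) (T : PTree P.X X) (hT : T.Valid τ)
    (g : X → Y) (hr : ∀ x, τ' (g x) = τ x) (h) :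
    ev P τ' (T.map g) h = ⟨(ev P τ T hT).op, fun e => g ((ev P τ T hT).args e),
      fun e => (hr _).trans ((ev P τ T hT).compat e)⟩ := by
  refine (ev_bind P τ τ' T hT (fun x => leaf (g x)) (fun _ => trivial) hr h ?_).trans ?_
  · exact fun e => (ev_t P _ _ _).trans ((hr _).trans ((ev P τ T hT).compat e))
  · exact muE_leaf P (Over.mk (↾τ')) _ (fun e => g ((ev P τ T hT).args e)) _
      (fun e x => ((MonObj.one (X := P.X)).s_onE _ x)) _

theorem ev_congr (τ : X → I) {T T' : PTree P.X X} (h : T = T') (hT hT') :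
    ev P τ T hT = ev P τ T' hT' := by
  subst h
  rfl

theorem ev_sub {f : C → P.X.B} (F : ∀ c : C, PTree P.X (P.X.E (f c)))
    (hF : ∀ c, (F c).Valid (P.X.s (f c)))
    (hF' : ∀ c, ev P (P.X.s (f c)) (F c) (hF c) = ⟨f c, fun e => e, fun _ => rfl⟩)
    (τ : X → I) (T : PTree (P.X.pull f) X) (hT : T.Valid τ) (h h') :
    ev P τ (T.sub (Q := P.X.pull f) F) h = ev P τ T.erase h' := by
  induction T with
  | leaf x => rfl
  | node c k ih =>
    have hr : ∀ a : (P.X.pull f).B, (F a).root ((P.X.pull f).s a) = (P.X.pull f).t a := fun a =>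
      (ev_t P _ _ (hF a)).symm.trans (congrArg (fun z => P.X.t z.op) (hF' a))
    have hv : ∀ e, ((k e).sub (Q := P.X.pull f) F).Valid τ := fun e =>
      valid_sub (Q := P.X.pull f) F hr hF _ (hT e).2
    have hrr : ∀ e, ((k e).sub (Q := P.X.pull f) F).root τ = P.X.s (f c) e := fun e =>
      (root_sub (Q := P.X.pull f) F hr _ (hT e).2).trans (hT e).1
    refine (ev_bind P (P.X.s (f c)) τ (F c) (hF c)
      (fun e => (k e).sub (Q := P.X.pull f) F) hv hrr h ?_).trans ?_
    · exact fun e => (ev_t P _ _ _).trans ((hrr _).trans ((ev P _ (F c) (hF c)).compat e))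
    · have : ∀ (z : Ext P.X (Over.mk (↾(P.X.s (f c))))) (hz : z = ⟨f c, fun e => e, fun _ => rfl⟩) (h1 h2),
        muE P (Over.mk (↾τ)) z.op (fun e => ev P τ ((k (z.args e)).sub (Q := P.X.pull f) F) (hv _)) h1
        = muE P _ (f c) (fun e => ev P τ ((k e).erase) (valid_erase τ _ (hT e).2)) h2 := by
        rintro z rfl h1 h2
        exact muE_congr P _ _ _ _ (fun e => ih e (hT e).2 _ _) _ _
      exact this _ (hF' c) _
        fun e => (ev_t P _ _ _).trans ((root_erase τ _ (hT e).2).trans (hT e).1)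

end PTree

namespace PTree
open PolyEndo
variable {I : Type u} {P Q R : PolyEndo I} {X Y Z : Type u} {C D : Type u}

/-- Two families of labels agree up to a bijection of the index sets. -/
def Same {A A' C : Type*} (l : A → C) (l' : A' → C) : Prop := ∃ φ : A ≃ A', ∀ a, l a = l' (φ a)

theorem Same.bij {A A' C : Type*} {l : A → C} {l' : A' → C} (h : Same l l')
    (h' : Function.Bijective l') : Function.Bijective l := by
  obtain ⟨φ, h⟩ := h
  obtain rfl : l = l' ∘ φ := funext h
  exact h'.comp φ.bijective

theorem leaves_bind (T : PTree P X) (f : X → PTree P Y) :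
    Same (T.bind f).leafLabel
      (fun p : Σ l : T.Leaves, (f (T.leafLabel l)).Leaves => (f _).leafLabel p.2) := by
  induction T with
  | leaf x => exact ⟨(Equiv.uniqueSigma (fun _ : PUnit => (f x).Leaves)).symm, fun _ => rfl⟩
  | node b c ih =>
    choose φ h using ih
    exact ⟨(Equiv.sigmaCongrRight φ).trans (Equiv.sigmaAssoc
      (fun e l => (f ((c e).leafLabel l)).Leaves)).symm, fun l => h l.1 l.2⟩

theorem leaves_map (T : PTree P X) (g : X → Y) :
    Same (T.map g).leafLabel (fun l => g (T.leafLabel l)) := by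
  induction T with
  | leaf x => exact ⟨Equiv.refl _, fun _ => rfl⟩
  | node b c ih =>
    choose φ h using ih
    exact ⟨Equiv.sigmaCongrRight φ, fun l => h l.1 l.2⟩

theorem leaves_sub (F : (a : Q.B) → PTree P (Q.E a))
    (hF : ∀ a, Function.Bijective (F a).leafLabel) (T : PTree Q X) :
    Same (T.sub F).leafLabel T.leafLabel := by
  induction T with
  | leaf x => exact ⟨Equiv.refl _, fun _ => rfl⟩
  | node b c ih =>
    choose φ h using ih
    obtain ⟨ψ, h'⟩ := leaves_bind (F b) (fun e => (c e).sub F)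
    exact ⟨ψ.trans (Equiv.sigmaCongr (Equiv.ofBijective _ (hF b)) fun l => φ _), fun l =>
      (h' l).trans (h _ _)⟩

theorem leaves_relabel {f : D → P.B} {f' : C → P.B} (g : C → D) (h : ∀ c, f (g c) = f' c)
    (T : PTree (P.pull f') X) : Same (T.relabel g h).leafLabel T.leafLabel :=
  leaves_sub (Q := P.pull f') (P := P.pull f) _ (fun c => by
    have key : ∀ (b : P.B) (hb : f (g c) = b), Function.Bijective
      (node (P := P.pull f) (g c) fun e => leaf (cast (congrArg P.E hb) e)).leafLabel := by
      rintro b rfl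
      exact (Equiv.sigmaPUnit (P.E (f (g c)))).bijective
    exact key _ (h c)) T

theorem self_leafLabel_bij (T : PTree P X) : Function.Bijective T.self.leafLabel := by
  induction T with
  | leaf x => exact Function.bijective_id
  | node b c ih =>
    choose φ h using fun e => leaves_map ((c e).self.relabel (f := (node b c).nodeOp)
      (fun n => some ⟨e, n⟩) fun _ => rfl) (Sigma.mk (β := fun e => (c e).Leaves) e)
    choose ψ h' using fun e => leaves_relabel (f := (node b c).nodeOp)
      (fun n => some ⟨e, n⟩) (fun _ => rfl) (c e).self
    refine Same.bij (l' := fun p : Σ e, (c e).self.Leaves =>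
      (⟨p.1, (c p.1).self.leafLabel p.2⟩ : Σ e, (c e).Leaves)) ?_
      (sigma_map_bij (β' := fun e => (c e).Leaves) id (fun e => (c e).self.leafLabel)
        Function.bijective_id ih)
    exact ⟨Equiv.sigmaCongrRight fun e => (φ e).trans (ψ e), fun l => (h l.1 l.2).trans
      (congrArg (Sigma.mk l.1) (h' _ _))⟩

def optionSum (A B : Type*) : Option (A ⊕ B) ≃ Option A ⊕ B where
  toFun
    | none => Sum.inl none
    | some (Sum.inl a) => Sum.inl (some a)
    | some (Sum.inr b) => Sum.inr b
  invFun
    | Sum.inl none => none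
    | Sum.inl (some a) => some (Sum.inl a)
    | Sum.inr b => some (Sum.inr b)
  left_inv := by rintro (_ | _ | _) <;> rfl
  right_inv := by rintro ((_ | _) | _) <;> rfl

theorem nodes_bind (T : PTree P X) (f : X → PTree P Y) :
    Same (T.bind f).nodeOp (Sum.elim T.nodeOp
      (fun p : Σ l : T.Leaves, (f (T.leafLabel l)).Nodes => (f _).nodeOp p.2)) := by
  induction T with
  | leaf x =>
    exact ⟨(Equiv.uniqueSigma (fun _ : PUnit => (f x).Nodes)).symm.trans
      (Equiv.emptySum PEmpty _).symm, fun _ => rfl⟩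
  | node b c ih =>
    choose φ h using ih
    let e1 : (Σ e, ((c e).Nodes ⊕ Σ l : (c e).Leaves, (f ((c e).leafLabel l)).Nodes)) ≃
        (Σ e, (c e).Nodes) ⊕ Σ l : (Σ e, (c e).Leaves), (f ((c l.1).leafLabel l.2)).Nodes :=
      (Equiv.sigmaSumDistrib _ _).trans (Equiv.sumCongr (Equiv.refl _)
        (Equiv.sigmaAssoc (fun e l => (f ((c e).leafLabel l)).Nodes)).symm)
    refine ⟨(Equiv.optionCongr ((Equiv.sigmaCongrRight φ).trans e1)).trans (optionSum _ _), ?_⟩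
    rintro (_ | ⟨e, n⟩)
    · rfl
    · refine (h e n).trans ?_
      obtain ⟨x, rfl⟩ := (φ e).symm.surjective n
      change _ = Sum.elim _ _ (optionSum _ _ (some (e1 ⟨e, φ e ((φ e).symm x)⟩)))
      rw [Equiv.apply_symm_apply]
      rcases x with x | x <;> rfl

theorem nodes_map (T : PTree P X) (g : X → Y) : Same (T.map g).nodeOp T.nodeOp := by
  induction T with
  | leaf x => exact ⟨Equiv.refl PEmpty, fun n => PEmpty.elim n⟩
  | node b c ih =>
    choose φ h using ih
    refine ⟨Equiv.optionCongr (Equiv.sigmaCongrRight φ), ?_⟩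
    rintro (_ | ⟨e, n⟩)
    · rfl
    · exact h e n

theorem nodes_sub (F : (a : Q.B) → PTree P (Q.E a))
    (hF : ∀ a, Function.Bijective (F a).leafLabel) (T : PTree Q X) :
    Same (T.sub F).nodeOp
      (fun p : Σ n : T.Nodes, (F (T.nodeOp n)).Nodes => (F _).nodeOp p.2) := by
  induction T with
  | leaf x => exact ⟨Equiv.equivOfIsEmpty PEmpty (Σ n : PEmpty, _), fun n => PEmpty.elim n⟩
  | node b c ih =>
    choose φ h using ih
    obtain ⟨ψ, h'⟩ := nodes_bind (F b) (fun e => (c e).sub F)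
    let e0 : (Σ l : (F b).Leaves, ((c ((F b).leafLabel l)).sub F).Nodes) ≃
        Σ p : (Σ e, (c e).Nodes), (F ((c p.1).nodeOp p.2)).Nodes :=
      (Equiv.sigmaCongr (Equiv.ofBijective _ (hF b)) fun l => φ _).trans
        (Equiv.sigmaAssoc (fun e n => (F ((c e).nodeOp n)).Nodes)).symm
    let e1 : ((F b).Nodes ⊕ Σ p : (Σ e, (c e).Nodes), (F ((c p.1).nodeOp p.2)).Nodes) ≃
        Σ n : (node b c).Nodes, (F ((node b c).nodeOp n)).Nodes :=
      { toFun := Sum.elim (fun n => ⟨none, n⟩) (fun p => ⟨some p.1, p.2⟩)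
        invFun := fun p => match p with
          | ⟨none, n⟩ => Sum.inl n
          | ⟨some q, n⟩ => Sum.inr ⟨q, n⟩
        left_inv := by rintro (_ | _) <;> rfl
        right_inv := by rintro ⟨_ | _, _⟩ <;> rfl }
    refine ⟨(ψ.trans (Equiv.sumCongr (Equiv.refl _) e0)).trans e1, fun n => ?_⟩
    refine (h' n).trans ?_
    obtain ⟨x, rfl⟩ := ψ.symm.surjective n
    change _ = (F _).nodeOp (e1 (Equiv.sumCongr (Equiv.refl _) e0 (ψ (ψ.symm x)))).2
    rw [Equiv.apply_symm_apply]
    rcases x with x | x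
    · rfl
    · exact h _ _

theorem nodes_relabel {f : D → P.B} {f' : C → P.B} (g : C → D) (h : ∀ c, f (g c) = f' c)
    (T : PTree (P.pull f') X) : Same (T.relabel g h).nodeOp (fun n => g (T.nodeOp n)) := by
  induction T with
  | leaf x => exact ⟨Equiv.refl _, fun n => PEmpty.elim n⟩
  | node b c ih =>
    choose φ h' using ih
    have key : ∀ (b' : P.B) (hb : f (g b) = b') (k : P.E b' → PTree (P.pull f) X)
      (N : P.E b' → Type u) (o : ∀ e, N e → D) (φ : ∀ e, (k e).Nodes ≃ N e)
      (_ : ∀ e n, (k e).nodeOp n = o e (φ e n)),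
      Same (node (P := P.pull f) (g b) fun e => k (cast (congrArg P.E hb) e)).nodeOp
        (fun n : Option (Σ e, N e) => n.elim (g b) fun p => o p.1 p.2) := by
      rintro _ rfl k N o φ h
      refine ⟨Equiv.optionCongr (Equiv.sigmaCongrRight φ), ?_⟩
      rintro (_ | ⟨e, n⟩)
      · rfl
      · exact h e n
    obtain ⟨ψ, hψ⟩ := key _ (h b) (fun e => (c e).relabel g h) _
      (fun e n => g ((c e).nodeOp n)) φ h'
    refine ⟨ψ, fun n => (hψ n).trans ?_⟩
    rcases ψ n with _ | _ <;> rfl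

theorem self_nodeOp_bij (T : PTree P X) : Function.Bijective T.self.nodeOp := by
  induction T with
  | leaf x => exact ⟨fun n => PEmpty.elim n, fun n => PEmpty.elim n⟩
  | node b c ih =>
    choose φ h using fun e => nodes_map ((c e).self.relabel (f := (node b c).nodeOp)
      (fun n => some ⟨e, n⟩) fun _ => rfl) (Sigma.mk (β := fun e => (c e).Leaves) e)
    choose ψ h' using fun e => nodes_relabel (f := (node b c).nodeOp)
      (fun n => some ⟨e, n⟩) (fun _ => rfl) (c e).self
    refine Same.bij (l' := Option.map fun p : Σ e, (c e).self.Nodes =>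
      (⟨p.1, (c p.1).self.nodeOp p.2⟩ : Σ e, (c e).Nodes)) ?_
      ((Equiv.optionCongr (Equiv.ofBijective _
        (sigma_map_bij (β' := fun e => (c e).Nodes) id (fun e => (c e).self.nodeOp)
          Function.bijective_id ih))).bijective)
    refine ⟨Equiv.optionCongr (Equiv.sigmaCongrRight fun e => (φ e).trans (ψ e)), ?_⟩
    rintro (_ | ⟨e, n⟩)
    · rfl
    · exact (h e n).trans (h' _ _)

theorem nodeSelf_nodeOp_bij (T : PTree P X) : Function.Bijective T.nodeSelf.nodeOp :=
  (nodes_map _ _).bij (self_nodeOp_bij T)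

theorem same_label {f : C → P.B} (T : PTree (P.pull f) X) : Same T.label T.nodeOp := by
  induction T with
  | leaf x => exact ⟨Equiv.refl _, fun n => PEmpty.elim n⟩
  | node b c ih =>
    choose φ h using ih
    refine ⟨Equiv.optionCongr (Equiv.sigmaCongrRight φ), ?_⟩
    rintro (_ | ⟨e, n⟩)
    · rfl
    · exact h e n

theorem finite_nodes (T : PTree P X) : Finite T.Nodes := by
  induction T with
  | leaf x => exact inferInstanceAs (Finite PEmpty)
  | node b c ih =>
    have := P.finite b
    exact inferInstanceAs (Finite (Option (Σ e, (c e).Nodes)))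

end PTree

namespace PTree
open PolyEndo
variable {I : Type u} {P Q R : PolyEndo I} {X Y Z : Type u} {C D : Type u}

theorem relabel_map {f : D → P.B} {f' : C → P.B} (g : C → D) (h : ∀ c, f (g c) = f' c)
    (T : PTree (P.pull f') X) (k : X → Y) :
    (T.map k).relabel g h = (T.relabel g h).map k := sub_map _ _ _

theorem sub_relabel {f : D → P.B} {f' : C → P.B} (g : C → D) (h : ∀ c, f (g c) = f' c)
    (G : (d : D) → PTree R (P.E (f d))) (T : PTree (P.pull f') X) :
    PTree.sub (Q := P.pull f) G (T.relabel g h) =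
      T.sub (Q := P.pull f') fun c => (G (g c)).map (cast (congrArg P.E (h c))) :=
  sub_sub _ _ _

theorem relabel_sub {f : D → P.B} {f' : C → P.B} (g : C → D) (h : ∀ c, f (g c) = f' c)
    (G : (a : Q.B) → PTree (P.pull f') (Q.E a)) (T : PTree Q X) :
    (T.sub G).relabel g h = T.sub fun a => (G a).relabel g h :=
  sub_sub _ _ _

theorem erase_sub {f : C → P.B} (G : (a : Q.B) → PTree (P.pull f) (Q.E a)) (T : PTree Q X) :
    (T.sub G).erase = T.sub fun a => (G a).erase :=
  sub_sub _ _ _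

theorem node_ext {f : C → P.B} (a a' : C) (b : P.B) (h : f a = b) (h' : f a' = b)
    (k k' : P.E b → PTree (P.pull f) X)
    (e : node (P := P.pull f) a (fun e => k (cast (congrArg P.E h) e)) =
      node (P := P.pull f) a' (fun e => k' (cast (congrArg P.E h') e))) : a = a' ∧ k = k' := by
  obtain ⟨h1, h2⟩ := node.inj e
  subst h1
  subst h
  exact ⟨rfl, eq_of_heq h2⟩

theorem nodeSelf_relabel_inj {f : C → P.B} (T : PTree P X) (l l' : T.Nodes → C)
    (h : ∀ n, f (l n) = T.nodeOp n) (h' : ∀ n, f (l' n) = T.nodeOp n)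
    (e : T.nodeSelf.relabel l h = T.nodeSelf.relabel l' h') : l = l' := by
  induction T with
  | leaf x => exact funext fun n => PEmpty.elim n
  | node b c ih =>
    have key : ∀ (l : (node b c).Nodes → C) (h : ∀ n, f (l n) = (node b c).nodeOp n) (e : P.E b),
        (c e).nodeSelf.relabel (f := f) (fun n => l (some ⟨e, n⟩)) (fun n => h (some ⟨e, n⟩)) =
          PTree.relabel (f := f) l h (((c e).self.relabel (f := (node b c).nodeOp)
            (fun n => some ⟨e, n⟩) (fun _ => rfl)).map (Sigma.mk (β := fun e => (c e).Leaves) e) |>.map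
              (node b c).leafLabel) := by
      intro l h e
      refine (relabel_map _ _ _ _).trans ?_
      refine Eq.trans ?_ (congrArg (PTree.relabel (f := f) l h) (map_map _ _ _)).symm
      refine Eq.trans ?_ (relabel_map _ _ _ _).symm
      exact congrArg (fun S : PTree (P.pull f) _ => S.map _) (relabel_relabel _ _ _ _ _).symm
    obtain ⟨h1, h2⟩ := node_ext (f := f) (l none) (l' none) b (h none) (h' none)
      (fun e => (c e).nodeSelf.relabel (f := f) (fun n => l (some ⟨e, n⟩)) (fun n => h (some ⟨e, n⟩)))
      (fun e => (c e).nodeSelf.relabel (f := f) (fun n => l' (some ⟨e, n⟩)) (fun n => h' (some ⟨e, n⟩)))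
      (((congrArg (node (P := P.pull f) (l none)) (funext fun x => key l h _)).trans e).trans
        (congrArg (node (P := P.pull f) (l' none)) (funext fun x => key l' h' _)).symm)
    funext n
    rcases n with _ | ⟨x, n⟩
    · exact h1
    · exact congrFun (ih x _ _ _ _ (congrFun h2 x)) n

end PTree

namespace PolyEndo
open PTree
variable {I : Type u} (P : Mon (PolyEndo I))

/-- The polynomial functor `B ← tr•(P) → tr(P) → B`. Its operations are the `P`-trees, the inputs of
a `P`-tree are its nodes, the type of an input is the operation at that node, and the output type
is the contraction of the tree. -/
def plusPoly : PolyEndo P.X.B where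
  B := {T : PTree P.X I // T.Valid fun i => i}
  E T := T.1.Nodes
  finite T := finite_nodes T.1
  s T := T.1.nodeOp
  t T := (contract P (fun i => i) T.1 T.2).op

variable {P}

/-- A `P`-tree with contraction `b`, its leaves renamed by the inputs of `b`. -/
noncomputable def lift (T : (plusPoly P).B) (b : P.X.B) (h : (plusPoly P).t T = b) :
    PTree (P.X.pull T.1.nodeOp) (P.X.E b) :=
  T.1.self.map fun l => cast (congrArg P.X.E h)
    ((Equiv.ofBijective _ (contract P (fun i => i) T.1 T.2).bij).symm l)

variable (T : (plusPoly P).B) (b : P.X.B) (h : (plusPoly P).t T = b)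

theorem lift_aux (l : T.1.Leaves) : P.X.s b (cast (congrArg P.X.E h)
    ((Equiv.ofBijective _ (contract P (fun i => i) T.1 T.2).bij).symm l)) = T.1.leafLabel l := by
  subst h
  refine ((contract P (fun i => i) T.1 T.2).s_op _).trans ?_
  exact congrArg _ ((Equiv.ofBijective _ (contract P (fun i => i) T.1 T.2).bij).apply_symm_apply l)

theorem lift_valid : (lift T b h).Valid (P.X.s b) :=
  valid_map (τ := T.1.leafLabel) _ _ (lift_aux T b h) (self_valid _ T.1 T.2).1

theorem lift_root : (lift T b h).root (P.X.s b) = P.X.t b := by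
  refine (root_map (τ := T.1.leafLabel) _ _ (lift_aux T b h)).trans ?_
  refine (self_valid _ T.1 T.2).2.trans ?_
  subst h
  exact (contract P (fun i => i) T.1 T.2).t_op.symm

theorem lift_map : (lift T b h).map (P.X.s b) = T.1.nodeSelf :=
  (map_map _ _ _).trans (congrArg T.1.self.map (funext (lift_aux T b h)))

theorem lift_cast (b' : P.X.B) (h' : b = b') :
    lift T b' (h.trans h') = (lift T b h).map (cast (congrArg P.X.E h')) := by
  subst h'
  exact (map_id _).symm

theorem lift_leafLabel_bij : Function.Bijective (lift T b h).leafLabel := by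
  refine (leaves_map _ _).bij (Function.Bijective.comp (g := fun l => cast (congrArg P.X.E h)
    ((Equiv.ofBijective _ (contract P (fun i => i) T.1 T.2).bij).symm l)) ?_
    (self_leafLabel_bij T.1))
  exact (cast_bijective _).comp (Equiv.bijective _)

theorem lift_nodeOp_bij : Function.Bijective (lift T b h).nodeOp :=
  (nodes_map _ _).bij (self_nodeOp_bij _)

theorem ev_self {X : Type u} (τ : X → I) (T : PTree P.X X) (hT : T.Valid τ) (h) :
    ev P (fun l => τ (T.leafLabel l)) T.self.erase h =
      ⟨(contract P τ T hT).op, (contract P τ T hT).leafOf,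
        fun e => ((contract P τ T hT).s_op e).symm⟩ := by
  induction T with
  | leaf x => rfl
  | node b c ih =>
    have hv : ∀ e, (c e).self.erase.Valid fun l => τ ((c e).leafLabel l) := fun e =>
      valid_erase _ _ (self_valid τ (c e) (hT e).2).1
    have h1 : ∀ e, (((c e).self.relabel (f := (node b c).nodeOp)
            (fun n => some ⟨e, n⟩) (fun _ => rfl)).map (Sigma.mk (β := fun e => (c e).Leaves) e)).erase
        = (c e).self.erase.map (Sigma.mk (β := fun e => (c e).Leaves) e) := fun e =>
      (sub_map _ _ _).trans (congrArg (fun S : PTree P.X (c e).Leaves => S.map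
        (Sigma.mk (β := fun e => (c e).Leaves) e)) (erase_relabel (f := (node b c).nodeOp)
          (fun n => some ⟨e, n⟩) (fun _ => rfl) (c e).self))
    have hm : ∀ e, ((c e).self.erase.map (Sigma.mk (β := fun e => (c e).Leaves) e)).Valid
        fun l => τ ((node b c).leafLabel l) := fun e =>
      valid_map (τ := fun l => τ ((c e).leafLabel l)) _ _ (fun _ => rfl) (hv e)
    have h2 := ev_node P (fun l => τ ((node b c).leafLabel l)) b _ h
    refine h2.trans ?_
    refine (muE_congr P _ _ _ (fun e => ⟨(contract P τ (c e) (hT e).2).op, fun x =>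
      Sigma.mk (β := fun e => (c e).Leaves) e ((contract P τ (c e) (hT e).2).leafOf x),
        fun x => ((contract P τ (c e) (hT e).2).s_op x).symm⟩) (fun e => ?_) _
          fun e => (contract P τ (c e) (hT e).2).t_op.trans (hT e).1).trans rfl
    refine (ev_congr P _ (h1 e) _ (hm e)).trans ?_
    refine (ev_map P (fun l => τ ((c e).leafLabel l)) (fun l => τ ((node b c).leafLabel l)) _ (hv e)
      (Sigma.mk (β := fun e => (c e).Leaves) e) (fun _ => rfl) _).trans ?_
    rw [ih e (hT e).2]

theorem ev_lift (h') : ev P (P.X.s b) (lift T b h).erase h' = ⟨b, fun e => e, fun _ => rfl⟩ := by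
  have hv := valid_erase _ _ (self_valid (fun i => i) T.1 T.2).1
  refine (ev_congr P _ (sub_map _ _ _) _ (valid_map (τ := T.1.leafLabel) _ _ (lift_aux T b h) hv)).trans ?_
  refine (ev_map P _ _ _ hv _ (lift_aux T b h) _).trans ?_
  subst h
  rw [ev_self (fun i => i) T.1 T.2]
  congr 1
  funext e
  exact (Equiv.ofBijective _ (contract P (fun i => i) T.1 T.2).bij).symm_apply_apply e

theorem symm_eq_of {P : PolyEndo I} {X : Type u} {τ : X → I} {S : PTree P X} (c : Contraction τ S)
    (b : P.B) (h : c.op = b) (w : S.Leaves → P.E b) (h1) (hc)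
    (e : (⟨b, fun e => e, h1⟩ : Ext P (Over.mk (↾(P.s b)))) = ⟨c.op, fun e => w (c.leafOf e), hc⟩) :
    (fun l => cast (congrArg P.E h) ((Equiv.ofBijective _ c.bij).symm l)) = w := by
  subst h
  injection e with _ e
  funext l
  obtain ⟨x, rfl⟩ := c.bij.2 l
  refine ((Equiv.ofBijective _ c.bij).symm_apply_apply x).trans ?_
  exact congrFun e x

theorem lift_unique {C : Type u} {f : C → P.X.B} (W : PTree (P.X.pull f) (P.X.E b))
    (hW : W.Valid (P.X.s b))
    (hW' : ev P (P.X.s b) W.erase (valid_erase _ _ hW) = ⟨b, fun e => e, fun _ => rfl⟩)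
    (hT : (W.map (P.X.s b)).erase.Valid fun i => i) (h) :
    (lift ⟨(W.map (P.X.s b)).erase, hT⟩ b h).relabel (W.map (P.X.s b)).label (nodeOp_erase _)
      = W := by
  obtain ⟨w, hw, hw'⟩ := relabel_self (P.X.s b) W
  refine Eq.trans ?_ hw
  refine congrArg (fun k => PTree.relabel (f := f) _ _ (PTree.map k _)) ?_
  have hv := valid_erase _ _ (self_valid (fun i => i) _ hT).1
  have e1 : W.erase = (W.map (P.X.s b)).erase.self.erase.map w := by
    conv_lhs => rw [← hw]
    exact (erase_relabel _ _ _).trans (sub_map _ _ _)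
  have e2 := hW'.symm.trans ((ev_congr P _ e1 _ (e1 ▸ valid_erase _ _ hW)).trans
    (ev_map P (W.map (P.X.s b)).erase.leafLabel _ _ hv w hw' _))
  rw [ev_self (fun i => i) _ hT] at e2
  exact symm_eq_of _ _ h w (fun _ => rfl) _ e2

end PolyEndo

namespace PolyEndo
open PTree
variable {I : Type u} {P : Mon (PolyEndo I)}

/-- The `P`-tree `f.onB r`, with its nodes decorated by the corresponding inputs of `r`. -/
def hat {R : PolyEndo P.X.B} (f : R ⟶ plusPoly P) (r : R.B) : PTree (P.X.pull (R.s r)) I :=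
  (f.onB r).1.nodeSelf.relabel (f.onE r) (f.s_onE r)

theorem hat_inj {R : PolyEndo P.X.B} (f g : R ⟶ plusPoly P) (h : ∀ r, hat f r = hat g r) :
    f = g := by
  refine hom_ext _ _ fun r => ?_
  have h1 : (f.onB r).1 = (g.onB r).1 := by
    have := congrArg PTree.erase (h r)
    refine Eq.trans ?_ (this.trans ?_)
    · exact ((erase_relabel _ _ _).trans (erase_nodeSelf _)).symm
    · exact (erase_relabel _ _ _).trans (erase_nodeSelf _)
  have key : ∀ (x y : (plusPoly P).B) (_ : x.1 = y.1) (l : (plusPoly P).E x → R.E r)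
      (l' : (plusPoly P).E y → R.E r) (hl : ∀ n, R.s r (l n) = x.1.nodeOp n)
      (hl' : ∀ n, R.s r (l' n) = y.1.nodeOp n)
      (_ : x.1.nodeSelf.relabel l hl = y.1.nodeSelf.relabel l' hl'),
      ∃ hb : x = y, ∀ n, l n = l' (hb ▸ n) := by
    rintro ⟨x, hx⟩ ⟨y, hy⟩ rfl l l' hl hl' e
    exact ⟨rfl, congrFun (nodeSelf_relabel_inj x l l' hl hl' e)⟩
  exact key _ _ h1 _ _ _ _ (h r)

theorem hat_comp {R R' : PolyEndo P.X.B} (f : R ⟶ R') (g : R' ⟶ plusPoly P) (r : R.B) :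
    hat (f ≫ g) r = (hat g (f.onB r)).relabel (f.onE r) (f.s_onE r) :=
  (relabel_relabel (f := R.s r) (f' := R'.s (f.onB r)) (f.onE r) (f.s_onE r) (g.onE _)
    (g.s_onE _) (g.onB (f.onB r)).1.nodeSelf).symm

/-- A map into `plusPoly P` given by trees whose nodes are bijectively decorated by the inputs. -/
def mkHom {R : PolyEndo P.X.B} (W : ∀ r, PTree (P.X.pull (R.s r)) I)
    (hW : ∀ r, (W r).Valid fun i => i) (hb : ∀ r, Function.Bijective (W r).nodeOp)
    (ht : ∀ r h, (ev P (fun i => i) (W r).erase h).op = R.t r) : R ⟶ plusPoly P where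
  onB r := ⟨(W r).erase, valid_erase _ _ (hW r)⟩
  onE r := (W r).label
  bij r := (same_label (W r)).bij (hb r)
  t_onB r := ht r _
  s_onE r n := nodeOp_erase (W r) n

theorem hat_mkHom {R : PolyEndo P.X.B} (W : ∀ r, PTree (P.X.pull (R.s r)) I) (hW hb ht) (r : R.B) :
    hat (mkHom W hW hb ht) r = W r := relabel_nodeSelf (W r)

/-- The unit of the Baez-Dolan construction: an operation is sent to the tree with one node. -/
def plusOne (P : Mon (PolyEndo I)) : unit P.X.B ⟶ plusPoly P :=
  mkHom (fun b => node (P := P.X.pull fun _ => b) PUnit.unit fun e => leaf (P.X.s b e))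
    (fun _ _ => ⟨rfl, trivial⟩)
    (fun b => ⟨by rintro (_ | ⟨_, ⟨⟩⟩) (_ | ⟨_, ⟨⟩⟩) _; rfl, fun _ => ⟨none, rfl⟩⟩)
    (fun b h => congrArg Ext.op (ev_corolla P (fun i => i) b (P.X.s b) (fun _ => rfl) h))

/-- Given a `P`-tree with nodes decorated by `P`-trees whose contractions match, substitute each
decorating tree into its node. The nodes are named by pairs of an outer and an inner node. -/
noncomputable def subst (z : CompOp (plusPoly P) (plusPoly P)) :
    PTree (P.X.pull ((comp (plusPoly P) (plusPoly P)).s z)) I :=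
  z.op.1.nodeSelf.sub (Q := P.X.pull z.op.1.nodeOp)
    (P := P.X.pull ((comp (plusPoly P) (plusPoly P)).s z))
    fun n => (lift (z.args n) (z.op.1.nodeOp n) (z.compat n)).relabel
      (f := (comp (plusPoly P) (plusPoly P)).s z) (fun m => ⟨n, m⟩) fun _ => rfl

theorem subst_valid (z : CompOp (plusPoly P) (plusPoly P)) : (subst z).Valid fun i => i :=
  valid_sub (Q := P.X.pull z.op.1.nodeOp) _
    (fun _ => (root_relabel _ _ _ _ (lift_valid _ _ _)).trans (lift_root _ _ _))
    (fun _ => valid_relabel _ _ _ _ (lift_valid _ _ _)) _ (nodeSelf_valid _ _ z.op.2)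

theorem subst_bij (z : CompOp (plusPoly P) (plusPoly P)) :
    Function.Bijective (subst z).nodeOp := by
  refine (nodes_sub (Q := P.X.pull z.op.1.nodeOp) _
    (fun n => (leaves_relabel _ _ _).bij (lift_leafLabel_bij _ _ _)) _).bij ?_
  choose φ h using fun n => nodes_relabel (f := (comp (plusPoly P) (plusPoly P)).s z)
    (fun m => ⟨n, m⟩) (fun _ => rfl) (lift (z.args n) (z.op.1.nodeOp n) (z.compat n))
  refine Same.bij (l' := fun p : Σ n : z.op.1.nodeSelf.Nodes,
    (lift (z.args (z.op.1.nodeSelf.nodeOp n)) _ (z.compat _)).Nodes =>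
      (⟨z.op.1.nodeSelf.nodeOp p.1, (lift (z.args (z.op.1.nodeSelf.nodeOp p.1)) _ _).nodeOp p.2⟩ :
        Σ n, (z.args n).1.Nodes)) ?_ (sigma_map_bij (β' := fun n => (z.args n).1.Nodes) _ _
          (nodeSelf_nodeOp_bij _) fun n => lift_nodeOp_bij _ _ _)
  exact ⟨Equiv.sigmaCongrRight fun n => φ _, fun p => h _ _⟩

theorem erase_subst (z : CompOp (plusPoly P) (plusPoly P)) : (subst z).erase =
    z.op.1.nodeSelf.sub (Q := P.X.pull z.op.1.nodeOp) fun n =>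
      (lift (z.args n) (z.op.1.nodeOp n) (z.compat n)).erase :=
  (erase_sub (Q := P.X.pull z.op.1.nodeOp) _ _).trans (congrArg
    (fun F => PTree.sub (Q := P.X.pull z.op.1.nodeOp) F z.op.1.nodeSelf)
      (funext fun _ => erase_relabel _ _ _))

theorem subst_t (z : CompOp (plusPoly P) (plusPoly P)) (h) :
    (ev P (fun i => i) (subst z).erase h).op = (comp (plusPoly P) (plusPoly P)).t z := by
  have hv := nodeSelf_valid _ _ z.op.2
  refine congrArg Ext.op (?_ : _ = ev P (fun i => i) z.op.1 z.op.2)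
  refine (ev_congr P _ (erase_subst z) _ ((erase_subst z) ▸ h)).trans ?_
  refine (ev_sub P _ (fun n => valid_erase _ _ (lift_valid _ _ _))
    (fun n => ev_lift _ _ _ _) _ _ hv _ (valid_erase _ _ hv)).trans ?_
  exact ev_congr P _ (erase_nodeSelf _) _ _

/-- The multiplication of the Baez-Dolan construction: substitution of trees into nodes. -/
noncomputable def plusMul (P : Mon (PolyEndo I)) :
    comp (plusPoly P) (plusPoly P) ⟶ plusPoly P :=
  mkHom subst subst_valid subst_bij subst_t

theorem hat_plusOne (b : P.X.B) : hat (plusOne P) b =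
    node (P := P.X.pull fun _ => b) PUnit.unit fun e => leaf (P.X.s b e) := hat_mkHom _ _ _ _ _

theorem hat_plusMul (z : CompOp (plusPoly P) (plusPoly P)) : hat (plusMul P) z = subst z :=
  hat_mkHom _ _ _ _ _

theorem subst_one_left (b : P.X.B) (T : (plusPoly P).B) (h : (plusPoly P).t T = b)
    (hb : ∀ n : (plusPoly P).E ((plusOne P).onB b),
      (plusPoly P).t T = (plusPoly P).s ((plusOne P).onB b) n) :
    subst ⟨(plusOne P).onB b, fun _ => T, hb⟩ =
      T.1.nodeSelf.relabel (f := (comp (plusPoly P) (plusPoly P)).s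
        ⟨(plusOne P).onB b, fun _ => T, hb⟩) (fun m => ⟨none, m⟩) fun _ => rfl := by
  refine Eq.trans ?_ (congrArg (PTree.relabel _ _) (lift_map T b h))
  exact (relabel_map _ _ _ _).symm

theorem plus_one_mul : compMap (plusOne P) (𝟙 _) ≫ plusMul P = leftHom (plusPoly P) := by
  refine hat_inj _ _ fun z => ?_
  refine (hat_comp _ _ _).trans ?_
  refine (congrArg (PTree.relabel _ _) (hat_plusMul _)).trans ?_
  obtain ⟨b, T, h⟩ := z
  refine (congrArg (PTree.relabel _ _) (subst_one_left b (T PUnit.unit) (h PUnit.unit) _)).trans ?_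
  exact relabel_relabel _ _ _ _ _

theorem lift_one (b b' : P.X.B) (h) (h' : b = b') : lift ((plusOne P).onB b) b' h =
    node (P := P.X.pull ((plusOne P).onB b).1.nodeOp) none
      fun e => leaf (cast (congrArg P.X.E h') e) := by
  subst h'
  have e1 := ev_lift ((plusOne P).onB b) b h (valid_erase _ _ (lift_valid _ _ _))
  obtain ⟨g, hg⟩ : ∃ g : P.X.E b → P.X.E b, lift ((plusOne P).onB b) b h =
    node (P := P.X.pull ((plusOne P).onB b).1.nodeOp) none fun e => leaf (g e) := ⟨_, rfl⟩
  have hv := lift_valid _ _ h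
  rw [hg] at hv
  have e2 := e1.symm.trans ((ev_congr P _ (congrArg PTree.erase hg) _ (valid_erase _ _ hv)).trans
    (ev_corolla P (P.X.s b) b g (fun e => (hv e).1) _))
  refine hg.trans ?_
  injection e2 with _ e2
  rw [← e2]
  rfl

theorem plus_mul_one : compMap (𝟙 _) (plusOne P) ≫ plusMul P = rightHom (plusPoly P) := by
  refine hat_inj _ _ fun z => ?_
  refine (hat_comp _ _ _).trans ?_
  refine (congrArg (PTree.relabel _ _) (hat_plusMul _)).trans ?_
  obtain ⟨T, b, h⟩ := z
  refine (relabel_sub (Q := P.X.pull T.1.nodeOp) _ _ _ _).trans ?_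
  refine congrArg (fun F => PTree.sub (Q := P.X.pull T.1.nodeOp) F T.1.nodeSelf) (funext fun n => ?_)
  refine (relabel_relabel _ _ _ _ _).trans ?_
  exact congrArg (PTree.relabel _ _) (lift_one (b n) _ _ (h n))

theorem lift_subst (z : CompOp (plusPoly P) (plusPoly P)) (b : P.X.B) (h) :
    (lift ((plusMul P).onB z) b h).relabel (f := (comp (plusPoly P) (plusPoly P)).s z)
      ((plusMul P).onE z) ((plusMul P).s_onE z) =
    (lift z.op b (((plusMul P).t_onB z).symm.trans h)).sub (Q := P.X.pull z.op.1.nodeOp)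
      (P := P.X.pull ((comp (plusPoly P) (plusPoly P)).s z))
      fun n => (lift (z.args n) (z.op.1.nodeOp n) (z.compat n)).relabel
        (f := (comp (plusPoly P) (plusPoly P)).s z) (fun m => ⟨n, m⟩) fun _ => rfl := by
  set W := (lift z.op b (((plusMul P).t_onB z).symm.trans h)).sub (Q := P.X.pull z.op.1.nodeOp)
      (P := P.X.pull ((comp (plusPoly P) (plusPoly P)).s z))
      fun n => (lift (z.args n) (z.op.1.nodeOp n) (z.compat n)).relabel
        (f := (comp (plusPoly P) (plusPoly P)).s z) (fun m => ⟨n, m⟩) fun _ => rfl with hW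
  have e1 : W.map (P.X.s b) = subst z := by
    refine (sub_map _ _ _).symm.trans ?_
    exact congrArg (PTree.sub (Q := P.X.pull z.op.1.nodeOp) _) (lift_map _ _ _)
  have hv : W.Valid (P.X.s b) := valid_sub (Q := P.X.pull z.op.1.nodeOp) _
    (fun _ => (root_relabel _ _ _ _ (lift_valid _ _ _)).trans (lift_root _ _ _))
    (fun _ => valid_relabel _ _ _ _ (lift_valid _ _ _)) _ (lift_valid _ _ _)
  have e2 : W.erase = (lift z.op b (((plusMul P).t_onB z).symm.trans h)).sub
      (Q := P.X.pull z.op.1.nodeOp) fun n =>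
        (lift (z.args n) (z.op.1.nodeOp n) (z.compat n)).erase :=
    (erase_sub (Q := P.X.pull z.op.1.nodeOp) _ _).trans (congrArg
      (fun F => PTree.sub (Q := P.X.pull z.op.1.nodeOp) F _)
        (funext fun _ => erase_relabel _ _ _))
  have e3 : ev P (P.X.s b) W.erase (valid_erase _ _ hv) = ⟨b, fun e => e, fun _ => rfl⟩ := by
    refine (ev_congr P _ e2 _ (e2 ▸ valid_erase _ _ hv)).trans ?_
    refine (ev_sub P _ (fun n => valid_erase _ _ (lift_valid _ _ _))
      (fun n => ev_lift _ _ _ _) _ _ (lift_valid _ _ _) _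
        (valid_erase _ _ (lift_valid _ _ _))).trans ?_
    exact ev_lift _ _ _ _
  refine Eq.trans ?_ (lift_unique b W hv e3 (e1 ▸ valid_erase _ _ (subst_valid z))
    (Eq.trans (congrArg (plusPoly P).t (Subtype.ext (congrArg PTree.erase e1))) h))
  have key : ∀ (S : PTree (P.X.pull ((comp (plusPoly P) (plusPoly P)).s z)) I) (hS : S = subst z)
      (h1 h2), (lift ((plusMul P).onB z) b h).relabel (f := (comp (plusPoly P) (plusPoly P)).s z)
      ((plusMul P).onE z) ((plusMul P).s_onE z) = (lift ⟨S.erase, h1⟩ b h2).relabel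
        (f := (comp (plusPoly P) (plusPoly P)).s z) S.label (nodeOp_erase S) := by
    rintro S rfl h1 h2
    rfl
  exact key _ e1 _ _

theorem plus_mul_assoc : compMap (plusMul P) (𝟙 _) ≫ plusMul P =
    assocHom _ _ _ ≫ compMap (𝟙 _) (plusMul P) ≫ plusMul P := by
  refine hat_inj _ _ fun z => ?_
  obtain ⟨⟨M, A, hA⟩, C, hC⟩ := z
  let z0 : CompOp (plusPoly P) (plusPoly P) := ⟨M, A, hA⟩
  let z : CompOp (comp (plusPoly P) (plusPoly P)) (plusPoly P) := ⟨z0, C, hC⟩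
  let f := (comp (comp (plusPoly P) (plusPoly P)) (plusPoly P)).s z
  let f0 := (comp (plusPoly P) (plusPoly P)).s z0
  let G : ∀ c : ((comp (plusPoly P) (plusPoly P)).E z0), PTree (P.X.pull f) (P.X.E (f0 c)) :=
    fun c => (lift (C c) (f0 c) (hC c)).relabel (f := f) (fun p => ⟨c, p⟩) (fun _ => rfl)
  have hL : hat (compMap (plusMul P) (𝟙 _) ≫ plusMul P) z =
      M.1.nodeSelf.sub (Q := P.X.pull M.1.nodeOp) (P := P.X.pull f) fun n =>
        (lift (A n) (M.1.nodeOp n) (hA n)).sub (Q := P.X.pull (A n).1.nodeOp) (P := P.X.pull f)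
          fun m => G ⟨n, m⟩ := by
    have h1 : (subst z0).sub (Q := P.X.pull f0) G =
        M.1.nodeSelf.sub (Q := P.X.pull M.1.nodeOp) (P := P.X.pull f) fun n =>
        (lift (A n) (M.1.nodeOp n) (hA n)).sub (Q := P.X.pull (A n).1.nodeOp) (P := P.X.pull f)
          fun m => G ⟨n, m⟩ := by
      refine (sub_sub _ _ _).trans ?_
      refine congrArg (fun F => PTree.sub (Q := P.X.pull M.1.nodeOp) F _) (funext fun n => ?_)
      refine (sub_relabel (f := f0) _ _ _ _).trans ?_
      refine congrArg (fun F => PTree.sub (Q := P.X.pull (A n).1.nodeOp) F _) (funext fun m => ?_)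
      exact map_id _
    refine Eq.trans ?_ h1
    refine Eq.trans ?_ (congrArg (PTree.sub (Q := P.X.pull f0) G) (hat_plusMul z0))
    refine Eq.trans ?_ (sub_relabel (f := f0) _ _ G _).symm
    refine (hat_comp _ _ _).trans ?_
    refine (congrArg (PTree.relabel _ _) (hat_plusMul _)).trans ?_
    refine (relabel_sub (Q := P.X.pull _) _ _ _ _).trans ?_
    refine congrArg (fun F => PTree.sub (Q := P.X.pull _) F _) (funext fun x => ?_)
    refine (relabel_relabel _ _ _ _ _).trans ?_
    refine Eq.trans ?_ (relabel_map _ _ _ _)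
    refine congrArg (PTree.relabel _ _) ?_
    exact lift_cast _ _ (hC _) _ ((plusMul P).s_onE z0 x)
  have hR : hat (assocHom _ _ _ ≫ compMap (𝟙 _) (plusMul P) ≫ plusMul P) z =
      M.1.nodeSelf.sub (Q := P.X.pull M.1.nodeOp) (P := P.X.pull f) fun n =>
        (lift (A n) (M.1.nodeOp n) (hA n)).sub (Q := P.X.pull (A n).1.nodeOp) (P := P.X.pull f)
          fun m => G ⟨n, m⟩ := by
    refine (hat_comp _ _ _).trans ?_
    refine (congrArg (PTree.relabel _ _) (hat_comp _ _ _)).trans ?_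
    refine (congrArg (PTree.relabel _ _) (congrArg (PTree.relabel _ _) (hat_plusMul _))).trans ?_
    refine (relabel_relabel _ _ _ _ _).trans ?_
    refine (relabel_sub (Q := P.X.pull M.1.nodeOp) _ _ _ _).trans ?_
    refine congrArg (fun F => PTree.sub (Q := P.X.pull M.1.nodeOp) F _) (funext fun n => ?_)
    refine (relabel_relabel _ _ _ _ _).trans ?_
    let zn : CompOp (plusPoly P) (plusPoly P) :=
      ⟨A n, fun m => C ⟨n, m⟩, fun m => hC ⟨n, m⟩⟩
    have h1 := lift_subst zn (M.1.nodeOp n) (((plusMul P).t_onB _).trans (hA n))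
    have h2 := congrArg (PTree.relabel (f := f)
      (fun p : Σ m, (plusPoly P).E (C ⟨n, m⟩) => ⟨⟨n, p.1⟩, p.2⟩) (fun _ => rfl)) h1
    refine (Eq.trans ?_ h2).trans ?_
    · exact (relabel_relabel (f := f) (f' := (comp (plusPoly P) (plusPoly P)).s zn)
        (fun p : Σ m, (plusPoly P).E (C ⟨n, m⟩) => ⟨⟨n, p.1⟩, p.2⟩) (fun _ => rfl)
        ((plusMul P).onE zn) ((plusMul P).s_onE zn) _).symm
    refine (relabel_sub (Q := P.X.pull (A n).1.nodeOp) _ _ _ _).trans ?_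
    refine congrArg (fun F => PTree.sub (Q := P.X.pull (A n).1.nodeOp) F _) (funext fun m => ?_)
    exact relabel_relabel _ _ _ _ _
  exact hL.trans hR.symm

/-- The explicit Baez-Dolan construction on a polynomial monad. -/
noncomputable def plus (P : Mon (PolyEndo I)) : Mon (PolyEndo P.X.B) where
  X := plusPoly P
  mon :=
    { one := plusOne P
      mul := plusMul P
      one_mul := plus_one_mul
      mul_one := plus_mul_one
      mul_assoc := plus_mul_assoc }

end PolyEndo

/-- Transport of a monad along an equivalence: the monad of the composite adjunction
`D ⇄ C ⇄ T-algebras`, with underlying functor `e.inverse ⋙ T ⋙ e.functor`. -/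
noncomputable def transportMonad {C : Type*} [Category C] {D : Type*} [Category D] (e : C ≌ D) (T : Monad C) :
    Monad D :=
  (e.symm.toAdjunction.comp T.adj).toMonad

namespace PolyEndo
variable {I : Type u}

/-- The set of operations `B`, which is the value of the functor at the terminal object. -/
def ops (I : Type u) : PolyEndo I ⥤ Type u where
  obj Q := Q.B
  map f := ↾f.onB

/-- The functor from polynomial endofunctors over `P` to sets over `B` sending `Q ⟶ P` to the map on
sets of operations. -/
def base (P : Mon (PolyEndo I)) : Over P.X ⥤ Over P.X.B := Over.post (ops I)

/-- The forgetful functor from polynomial monads over `P` to polynomial endofunctors over `P`. -/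
def forgetOver (P : Mon (PolyEndo I)) : Over P ⥤ Over P.X := Over.post (Mon.forget (PolyEndo I))

end PolyEndo

namespace Collection
open Limits
variable {C : Type*} [Category C] [HasTerminal C] (T : Monad C)

/-- The image under `T` of the map to the terminal object. -/
noncomputable abbrev proj (X : C) : T.obj X ⟶ T.obj (⊤_ C) := T.map (terminal.from X)

theorem map_proj {X Y : C} (f : X ⟶ Y) : T.map f ≫ proj T Y = proj T X := by
  rw [← T.map_comp]
  congr 1
  exact Subsingleton.elim _ _

variable [HasPullbacks C]

/-- The unit collection. For a monad `T`, a collection is an object of the slice over `T 1`. -/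
noncomputable def one : Over (T.obj (⊤_ C)) := Over.mk (T.η.app (⊤_ C))

/-- The tensor product of collections: the pullback of `A → T 1 ← T A'`, mapped to `T 1` by
`T A' → T T 1 → T 1`. -/
noncomputable def tensor (A A' : Over (T.obj (⊤_ C))) : Over (T.obj (⊤_ C)) :=
  Over.mk (pullback.snd A.hom (proj T A'.left) ≫ T.map A'.hom ≫ T.μ.app (⊤_ C))

variable {T}

/-- First projection. -/
noncomputable def fst (A A' : Over (T.obj (⊤_ C))) : (tensor T A A').left ⟶ A.left :=
  pullback.fst _ _

/-- Second projection. -/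
noncomputable def snd (A A' : Over (T.obj (⊤_ C))) : (tensor T A A').left ⟶ T.obj A'.left :=
  pullback.snd _ _

theorem condition (A A' : Over (T.obj (⊤_ C))) :
    fst A A' ≫ A.hom = snd A A' ≫ proj T A'.left := pullback.condition

/-- The map into a tensor product given by the universal property. -/
noncomputable def toTensor {A A' : Over (T.obj (⊤_ C))} {Z : Over (T.obj (⊤_ C))} (a : Z.left ⟶ A.left)
    (x : Z.left ⟶ T.obj A'.left) (h : a ≫ A.hom = x ≫ proj T A'.left)
    (h' : x ≫ T.map A'.hom ≫ T.μ.app (⊤_ C) = Z.hom) : Z ⟶ tensor T A A' :=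
  Over.homMk (pullback.lift a x h) (by
    refine Eq.trans ?_ h'
    exact pullback.lift_snd_assoc _ _ _ _)

/-- Functoriality of the tensor product. -/
noncomputable def tensorMap {A B A' B' : Over (T.obj (⊤_ C))} (f : A ⟶ B) (f' : A' ⟶ B') :
    tensor T A A' ⟶ tensor T B B' :=
  toTensor (fst A A' ≫ f.left) (snd A A' ≫ T.map f'.left)
    (by rw [Category.assoc, Over.w f, condition, Category.assoc, map_proj])
    (by
      rw [Category.assoc, ← T.map_comp_assoc, Over.w f']
      rfl)

/-- The left unit comparison map, invertible when `T` is cartesian. -/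
noncomputable def leftUnit (A : Over (T.obj (⊤_ C))) : A ⟶ tensor T (one T) A :=
  toTensor (terminal.from A.left) (T.η.app A.left) (T.η.naturality _) (by
    rw [← T.unit_naturality_assoc, T.left_unit]
    exact Category.comp_id _)

/-- The right unit comparison map, invertible when `T` is cartesian. -/
noncomputable def rightUnit (A : Over (T.obj (⊤_ C))) : A ⟶ tensor T A (one T) :=
  toTensor (𝟙 A.left) A.hom (by
    rw [Category.id_comp]
    have : terminal.from (one T).left = 𝟙 _ := Subsingleton.elim _ _
    refine Eq.trans ?_ (congrArg (fun f => A.hom ≫ T.map f) this.symm)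
    refine Eq.trans ?_ (congrArg (A.hom ≫ ·) (T.map_id _).symm)
    exact (Category.comp_id _).symm) (by
    change A.hom ≫ T.map (T.η.app _) ≫ T.μ.app _ = _
    rw [T.right_unit]
    exact Category.comp_id _)

/-- The associativity comparison map, invertible when `T` is cartesian. -/
noncomputable def assoc (A A' A'' : Over (T.obj (⊤_ C))) :
    tensor T A (tensor T A' A'') ⟶ tensor T (tensor T A A') A'' :=
  toTensor
    (toTensor (Z := Over.mk (snd A (tensor T A' A'') ≫ T.map (fst A' A'') ≫ T.map A'.hom ≫
        T.μ.app (⊤_ C)))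
      (fst A (tensor T A' A'')) (snd A (tensor T A' A'') ≫ T.map (fst A' A''))
      (by rw [Category.assoc, map_proj]; exact condition _ _) (by simp)).left
    (snd A (tensor T A' A'') ≫ T.map (snd A' A'') ≫ T.μ.app _)
    (by
      rw [Over.w]
      simp only [Over.mk_hom, ← T.map_comp_assoc, condition]
      simp only [Category.assoc, T.map_comp, proj]
      congr 2
      exact T.μ.naturality _)
    (by
      simp only [Category.assoc, Over.mk_hom, tensor, snd]
      simp only [Over.mk_left, T.map_comp, Category.assoc]
      have h1 := T.μ.naturality A''.hom
      have h2 := T.assoc (⊤_ C)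
      dsimp at h1 h2
      rw [← reassoc_of% h1, ← h2])

end Collection

section Operads
open Limits Collection
variable {C : Type*} [Category C] [HasTerminal C] [HasPullbacks C]

/-- A `T`-operad: a monoid in the category of `T`-collections with its tensor product.
The axioms are written with the comparison maps in the direction in which they exist for every `T`;
for cartesian `T` these maps are invertible and are the coherence isomorphisms. -/
structure TOperad (T : Monad C) where
  carrier : Over (T.obj (⊤_ C))
  one : Collection.one T ⟶ carrier
  mul : tensor T carrier carrier ⟶ carrier
  one_mul : leftUnit carrier ≫ tensorMap one (𝟙 carrier) ≫ mul = 𝟙 carrier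
  mul_one : rightUnit carrier ≫ tensorMap (𝟙 carrier) one ≫ mul = 𝟙 carrier
  mul_assoc : tensorMap (𝟙 carrier) mul ≫ mul =
    assoc carrier carrier carrier ≫ tensorMap mul (𝟙 carrier) ≫ mul

namespace TOperad
variable {T : Monad C}

/-- A morphism of operads is a morphism of monoids. -/
@[ext]
structure Hom (A B : TOperad T) where
  hom : A.carrier ⟶ B.carrier
  one_hom : A.one ≫ hom = B.one
  mul_hom : A.mul ≫ hom = tensorMap hom hom ≫ B.mul

theorem tensor_ext {A A' Z : Over (T.obj (⊤_ C))} (f g : Z ⟶ tensor T A A')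
    (h : f.left ≫ fst A A' = g.left ≫ fst A A') (h' : f.left ≫ snd A A' = g.left ≫ snd A A') :
    f = g :=
  Over.OverMorphism.ext (pullback.hom_ext h h')

theorem tensorMap_fst {A A' B B' : Over (T.obj (⊤_ C))} (f : A ⟶ B) (f' : A' ⟶ B') :
    (tensorMap f f').left ≫ fst B B' = fst A A' ≫ f.left :=
  pullback.lift_fst _ _ _

theorem tensorMap_snd {A A' B B' : Over (T.obj (⊤_ C))} (f : A ⟶ B) (f' : A' ⟶ B') :
    (tensorMap f f').left ≫ snd B B' = snd A A' ≫ T.map f'.left :=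
  pullback.lift_snd _ _ _

theorem tensorMap_id (A A' : Over (T.obj (⊤_ C))) :
    tensorMap (𝟙 A) (𝟙 A') = 𝟙 (tensor T A A') :=
  tensor_ext _ _ ((tensorMap_fst _ _).trans (by simp)) ((tensorMap_snd _ _).trans (by simp))

theorem tensorMap_comp {A A' B B' D D' : Over (T.obj (⊤_ C))} (f : A ⟶ B) (g : B ⟶ D)
    (f' : A' ⟶ B') (g' : B' ⟶ D') :
    tensorMap (f ≫ g) (f' ≫ g') = tensorMap f f' ≫ tensorMap g g' := by
  refine tensor_ext _ _ ?_ ?_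
  · rw [tensorMap_fst, Over.comp_left, Over.comp_left, Category.assoc, tensorMap_fst,
      ← Category.assoc (tensorMap f f').left, tensorMap_fst, Category.assoc]
  · rw [tensorMap_snd, Over.comp_left, Over.comp_left, Category.assoc, tensorMap_snd,
      ← Category.assoc (tensorMap f f').left, tensorMap_snd, Category.assoc, T.map_comp]

noncomputable instance : Category (TOperad T) where
  Hom := Hom
  id A := ⟨𝟙 _, Category.comp_id _, by rw [tensorMap_id, Category.id_comp, Category.comp_id]⟩
  comp f g := ⟨f.hom ≫ g.hom, by rw [← Category.assoc, f.one_hom, g.one_hom], by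
    rw [← Category.assoc, f.mul_hom, Category.assoc, g.mul_hom, ← Category.assoc, tensorMap_comp]⟩
  id_comp f := Hom.ext (Category.id_comp f.hom)
  comp_id f := Hom.ext (Category.comp_id f.hom)
  assoc f g h := Hom.ext (Category.assoc f.hom g.hom h.hom)

/-- The functor from operads to collections. -/
noncomputable def forget (T : Monad C) : TOperad T ⥤ Over (T.obj (⊤_ C)) where
  obj A := A.carrier
  map f := f.hom

end TOperad
end Operads

section Towers
open Limits
variable {I : Type u}

/-- The comparison between collections for the monad of `P` and sets over `B`: forget the structure
map to `I` and use the canonical bijection between `P 1` and `B`. -/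
noncomputable def leinsterBase (P : Mon (PolyEndo I)) :
    Over ((PolyEndo.monad P).obj (⊤_ (Over I))) ⥤ Over P.X.B :=
  Over.iteratedSliceForward _ ⋙ Over.map (↾ fun z : PolyEndo.Ext P.X (⊤_ (Over I)) => z.op)

open Classical in
/-- Leinster's version of the construction: the monad of the free operad adjunction, on the category
of `T`-collections, regarded as a slice of sets. (The second case is the conventional value
when there are no free `T`-operads.) -/
noncomputable def leinsterPlus (T : Monad (Over I)) : Monad (Over (T.obj (⊤_ (Over I))).left) :=
  if _h : (TOperad.forget T).IsRightAdjoint then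
    transportMonad (Over.iteratedSliceEquiv _) (Adjunction.ofIsRightAdjoint (TOperad.forget T)).toMonad
  else Monad.id _

/-- The iterated Baez-Dolan construction, starting with the identity functor on sets. The set
`(opetopicMonad k).1` is the set of types of the `k`-th polynomial monad. -/
noncomputable def opetopicMonad : ℕ → Σ I : Type u, Mon (PolyEndo I)
  | 0 => ⟨PUnit, Mon.trivial _⟩
  | k + 1 => ⟨(opetopicMonad k).2.X.B, PolyEndo.plus (opetopicMonad k).2⟩

/-- Leinster's sequence of monads, starting with the identity monad on sets. The set of `k`-opetopes
in the sense of Leinster is the set `(leinsterMonad k).1` of types of the `k`-th monad. -/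
noncomputable def leinsterMonad : ℕ → Σ I : Type u, Monad (Over I)
  | 0 => ⟨PUnit, Monad.id _⟩
  | k + 1 => ⟨((leinsterMonad k).2.obj (⊤_ (Over (leinsterMonad k).1))).left, leinsterPlus (leinsterMonad k).2⟩

end Towers

/-- A finite rooted tree with boundary. Each node has one output edge `out n`, and every edge except the
root edge is an input edge of exactly one node `into a`. Following the edges downwards leads to the
root edge. There is a unit tree with one edge and no nodes. -/
structure FTree where
  Edge : Type
  Node : Type
  finite_edge : Finite Edge
  finite_node : Finite Node
  out : Node → Edge
  into : Edge → Option Node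
  root : Edge
  out_injective : Function.Injective out
  into_eq_none : ∀ a, into a = none ↔ a = root
  reaches_root : ∀ a, Relation.ReflTransGen (fun a b => ∃ n, into a = some n ∧ out n = b) a root

namespace FTree

/-- The order on the edges: `a ≤ b` if the path from `a` to the root passes through `b`. -/
def Le (T : FTree) : T.Edge → T.Edge → Prop :=
  Relation.ReflTransGen fun a b => ∃ n, T.into a = some n ∧ T.out n = b

/-- The leaves (input edges) of the tree. -/
def Leaf (T : FTree) : Type := {a : T.Edge // ∀ n, T.out n ≠ a}

/-- The nodes without input edges. -/
def NullDot (T : FTree) : Type := {n : T.Node // ∀ a, T.into a ≠ some n}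

/-- Every node has exactly one input edge. -/
def IsLinear (T : FTree) : Prop := ∀ n, ∃! a, T.into a = some n

/-- The graph of nodes and inner edges. -/
def graph (T : FTree) : SimpleGraph T.Node :=
  SimpleGraph.fromRel fun n m => T.into (T.out n) = some m

/-- A set of nodes is a kernel if it spans a nonempty connected full subgraph. -/
def IsKernel (T : FTree) (K : Set T.Node) : Prop := (T.graph.induce K).Connected

/-- Isomorphism of trees. -/
structure Iso (S T : FTree) where
  edge : S.Edge ≃ T.Edge
  node : S.Node ≃ T.Node
  out_node : ∀ n, T.out (node n) = edge (S.out n)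
  into_edge : ∀ a, T.into (edge a) = (S.into a).map node

/-- In the subdivision with `w a` white dots on the edge `a`, the node of which a segment is an input. -/
def subdivInto (T : FTree) (w : T.Edge → ℕ) (p : Σ a, Fin (w a + 1)) :
    Option (T.Node ⊕ Σ a, Fin (w a)) :=
  Fin.lastCases (motive := fun _ => Option (T.Node ⊕ Σ a, Fin (w a)))
    ((T.into p.1).map Sum.inl) (fun i => some (Sum.inr ⟨p.1, i⟩)) p.2

theorem subdiv_down (T : FTree) (w : T.Edge → ℕ) (a : T.Edge) (j : Fin (w a + 1)) :
    Relation.ReflTransGen (fun p q => ∃ n, T.subdivInto w p = some n ∧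
      (Sum.elim (fun n => ⟨T.out n, 0⟩) (fun q => ⟨q.1, q.2.succ⟩) n :
        Σ a, Fin (w a + 1)) = q) ⟨a, j⟩ ⟨a, Fin.last _⟩ := by
  induction j using Fin.reverseInduction with
  | last => exact .refl
  | cast i ih =>
    refine .head ⟨Sum.inr ⟨a, i⟩, ?_, rfl⟩ ih
    simp [subdivInto]

/-- The subdivision of a tree in which each edge `a` is replaced by a linear tree with `w a` new
(white) dots. The segments and the white dots of `a` are numbered from top to bottom. -/
def subdivide (T : FTree) (w : T.Edge → ℕ) : FTree where
  Edge := Σ a, Fin (w a + 1)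
  Node := T.Node ⊕ Σ a, Fin (w a)
  finite_edge := by
    have := T.finite_edge
    infer_instance
  finite_node := by
    have := T.finite_edge
    have := T.finite_node
    infer_instance
  out := Sum.elim (fun n => ⟨T.out n, 0⟩) (fun p => ⟨p.1, p.2.succ⟩)
  into := T.subdivInto w
  root := ⟨T.root, Fin.last _⟩
  out_injective := by
    rintro (n | ⟨a, i⟩) (m | ⟨b, j⟩) h
    · exact congrArg Sum.inl (T.out_injective (congrArg Sigma.fst h))
    · obtain ⟨h1, h2⟩ := Sigma.mk.inj h
      subst h1
      exact absurd (eq_of_heq h2).symm (Fin.succ_ne_zero _)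
    · obtain ⟨h1, h2⟩ := Sigma.mk.inj h
      subst h1
      exact absurd (eq_of_heq h2) (Fin.succ_ne_zero _)
    · obtain ⟨h1, h2⟩ := Sigma.mk.inj h
      change a = b at h1
      subst h1
      exact congrArg (fun i => Sum.inr (Sigma.mk a i)) (Fin.succ_injective _ (eq_of_heq h2))
  into_eq_none := by
    rintro ⟨a, j⟩
    induction j using Fin.lastCases with
    | last =>
      simp only [subdivInto, Fin.lastCases_last, Option.map_eq_none_iff, T.into_eq_none]
      constructor
      · rintro rfl
        rfl
      · exact fun h => congrArg Sigma.fst h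
    | cast i =>
      simp only [subdivInto, Fin.lastCases_castSucc]
      refine ⟨fun h => by simp at h, fun h => ?_⟩
      obtain ⟨h1, h2⟩ := Sigma.mk.inj h
      subst h1
      exact absurd (eq_of_heq h2) (Fin.castSucc_lt_last i).ne
  reaches_root := by
    rintro ⟨a, j⟩
    have h := T.reaches_root a
    induction h using Relation.ReflTransGen.head_induction_on with
    | refl => exact T.subdiv_down w T.root j
    | head h _ ih =>
      obtain ⟨n, h1, rfl⟩ := h
      refine (T.subdiv_down w _ j).trans (.head ⟨Sum.inl n, ?_, rfl⟩ (ih 0))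
      simp [subdivInto, h1]

end FTree

/-- A constellation: a subdivision of `T`, a bijection between the (black) dots of `T` and the leaves
of `N`, and a bijection between the white dots and the null-dots of `N`, subject to the kernel
rule. A leaf or null-dot lies below a node `x` in the tree order of `N` iff its edge, or output
edge, is `≤` the output edge of `x`. -/
structure Constellation (T N : FTree) where
  white : T.Edge → ℕ
  black : T.Node ≃ N.Leaf
  null : (Σ a, Fin (white a)) ≃ N.NullDot
  kernel : ∀ x : N.Node, (T.subdivide white).IsKernel
    {d | N.Le (Sum.elim (fun n => (black n).1) (fun p => N.out (null p).1) d) (N.out x)}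

/-- The pair of tree isomorphisms `f`, `g` is an isomorphism of constellations. (An isomorphism of
subdivided trees extending `f` exists iff the numbers of white dots agree, and then it preserves the
numbering of the white dots.) -/
def Constellation.Compatible {T N T' N' : FTree} (C : Constellation T N)
    (C' : Constellation T' N') (f : T.Iso T') (g : N.Iso N') : Prop :=
  (∀ a, C'.white (f.edge a) = C.white a) ∧
  (∀ n, g.edge (C.black n).1 = (C'.black (f.node n)).1) ∧
  ∀ a (i : Fin (C.white a)) (i' : Fin (C'.white (f.edge a))), (i : ℕ) = i' → g.node (C.null ⟨a, i⟩).1 = (C'.null ⟨f.edge a, i'⟩).1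

/-- A zoom complex of degree `n`: constellations `X₀, …, Xₙ`, where the tree of nested spheres of each
one is the underlying tree of the next one. -/
structure ZoomComplex (n : ℕ) where
  tree : Fin (n + 2) → FTree
  const : ∀ i : Fin (n + 1), Constellation (tree i.castSucc) (tree i.succ)

namespace ZoomComplex

/-- Omit the top constellation. -/
def truncate {n : ℕ} (X : ZoomComplex (n + 1)) : ZoomComplex n where
  tree i := X.tree i.castSucc
  const i := X.const i.castSucc

/-- The initial condition of opetopes: `X₀` and `X₁` are a line with one dot and one sphere around it, and
`X₂` is a line with one dot and a finite number of linearly nested spheres around the dot. -/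
def IsOpetopic {n : ℕ} (X : ZoomComplex n) : Prop :=
  (∀ i : Fin (n + 2), (i : ℕ) ≤ 2 → (X.tree i).IsLinear ∧ Nat.card (X.tree i).Node = 1) ∧
  ∀ i : Fin (n + 2), (i : ℕ) = 3 → (X.tree i).IsLinear

/-- Isomorphism of zoom complexes. -/
def Isomorphic {n : ℕ} (X Y : ZoomComplex n) : Prop :=
  ∃ f : ∀ i, (X.tree i).Iso (Y.tree i),
    ∀ i, (X.const i).Compatible (Y.const i) (f i.castSucc) (f i.succ)

/-- The composition tree: the tree of nested spheres of the top constellation. -/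
def composition {n : ℕ} (X : ZoomComplex n) : FTree := X.tree (Fin.last _)

/-- In a complex of degree `n + 1`, the dots of the top constellation are the leaves of the composition
tree. -/
def spheres {n : ℕ} (X : ZoomComplex (n + 1)) :
    X.truncate.composition.Node ≃ X.composition.Leaf :=
  (X.const (Fin.last _)).black
end ZoomComplex

/-- Zoom complexes with the initial condition. -/
def OpetopicComplex (n : ℕ) : Type 1 := {X : ZoomComplex n // X.IsOpetopic}

/-- Omit the top constellation. -/
def OpetopicComplex.truncate {n : ℕ} (X : OpetopicComplex (n + 1)) : OpetopicComplex n :=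
  ⟨X.1.truncate, fun i => X.2.1 i.castSucc, fun i => X.2.2 i.castSucc⟩

/-- An opetope of dimension `n`: an isomorphism class of zoom complexes of degree `n` satisfying the
initial condition. -/
def Opetope (n : ℕ) : Type 1 := Quot fun X Y : OpetopicComplex n => X.1.Isomorphic Y.1

/-- The opetope represented by a zoom complex. -/
def Opetope.mk {n : ℕ} (X : OpetopicComplex n) : Opetope n := Quot.mk _ X

/-- The target of an opetope is obtained by omitting the top constellation. -/
def Opetope.target {n : ℕ} : Opetope (n + 1) → Opetope n :=
  Quot.map OpetopicComplex.truncate fun _ _ ⟨f, hf⟩ =>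
    ⟨fun i => f i.castSucc, fun i => hf i.castSucc⟩

namespace PTree
variable {I : Type} {P : PolyEndo I} {X : Type}

/-- The edges of a tree. -/
def Edges : PTree P X → Type
  | leaf _ => PUnit
  | node _ c => Option (Σ e, (c e).Edges)

/-- The root edge. -/
def rootEdge : (T : PTree P X) → T.Edges
  | leaf _ => PUnit.unit
  | node _ _ => none

/-- The edge belonging to a leaf. -/
def leafEdge : (T : PTree P X) → T.Leaves → T.Edges
  | leaf _, _ => PUnit.unit
  | node _ c, l => some ⟨l.1, (c l.1).leafEdge l.2⟩

/-- The output edge of a node. -/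
def out : (T : PTree P X) → T.Nodes → T.Edges
  | node _ _, none => none
  | node _ c, some n => some ⟨n.1, (c n.1).out n.2⟩

/-- The node of which an edge is an input edge. -/
def into : (T : PTree P X) → T.Edges → Option T.Nodes
  | leaf _, _ => none
  | node _ _, none => none
  | node _ c, some a => some (((c a.1).into a.2).map (Sigma.mk a.1))

theorem finite_edges (T : PTree P X) : Finite T.Edges := by
  induction T with
  | leaf x => exact inferInstanceAs (Finite PUnit)
  | node b c ih =>
    have := P.finite b
    exact inferInstanceAs (Finite (Option (Σ e, (c e).Edges)))

/-- The underlying tree of a decorated tree. -/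
def underlying (T : PTree P X) : FTree where
  Edge := T.Edges
  Node := T.Nodes
  finite_edge := finite_edges T
  finite_node := finite_nodes T
  out := T.out
  into := T.into
  root := T.rootEdge
  out_injective := by
    induction T with
    | leaf x => exact fun n => PEmpty.elim n
    | node b c ih =>
      rintro (_ | ⟨e, n⟩) (_ | ⟨e', n'⟩) h
      · rfl
      · exact absurd h (by simp [out])
      · exact absurd h (by simp [out])
      · have h := Option.some.inj h
        obtain ⟨h1, h2⟩ := Sigma.mk.inj h
        change e = e' at h1
        subst h1
        exact congrArg (fun n => some (Sigma.mk e n)) (ih e (eq_of_heq h2))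
  into_eq_none := by
    cases T with
    | leaf x => exact fun _ => ⟨fun _ => rfl, fun _ => rfl⟩
    | node b c =>
      rintro (_ | ⟨e, a⟩)
      · exact ⟨fun _ => rfl, fun _ => rfl⟩
      · exact ⟨fun h => absurd h (by simp [into]), fun h => absurd h (by simp [rootEdge])⟩
  reaches_root := by
    induction T with
    | leaf x => exact fun _ => .refl
    | node b c ih =>
      rintro (_ | ⟨e, a⟩)
      · exact .refl
      · have h := (ih e a).lift (p := fun a b' => ∃ n, (node b c).into a = some n ∧
          (node b c).out n = b') (fun a => some ⟨e, a⟩) (by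
            rintro a _ ⟨n, h, rfl⟩
            exact ⟨some ⟨e, n⟩, by simp [into, h], rfl⟩)
        refine h.tail ⟨none, ?_, rfl⟩
        have : (c e).into (c e).rootEdge = none := by
          cases c e <;> rfl
        simp [into, this]

end PTree

/-! Parts (1) and (2) rest on one elementary notion. An operad over `P` in terms of elements,
`SetOperad P`, is a set over the operations of `P` with units and a substitution lying over those of
`P`. Polynomial monads over `P` are equivalent to such operads (`SetOperad.ofOver`), because a
cartesian map `Q ⟶ P` is determined on fibres by its effect on operations. `T`-operads are
equivalent to them as well (`Rep.comparison`), as soon as the elements of the values of `T` are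
described by `P` (`Rep`): the pullback defining the tensor product then consists of an element
together with a decoration of the inputs of its operation. Both equivalences respect the forgetful
functors.

The free operad on a set `X` over the operations is built by hand. Its elements are the `P`-trees
with nodes decorated by `X`, their leaves being named by the inputs of the contraction (`Tr`);
multiplication is grafting, and maps out of it are evaluations of trees (`desc`). A tree with
decorated nodes is exactly an element of `P⁺ X`. Under this identification the unit of the
adjunction is the one-node tree and the counit is substitution into nodes, so the monad is `P⁺`
(`freeAdj_monad`). Adjunctions over the same category whose right adjoints correspond under an
equivalence have isomorphic monads (`toMonad_iso`); this proves (1). For (2) one carries along the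
tower an isomorphism between `P^k` and `T_k`. It describes `T_k` by `P^k`, so the free `T_k`-operads
exist and their monad is described by `P^{k+1}` (`Rep.leinsterPlus_iso`).

Part (3) rests on the fact that a `P⁺`-tree `S` is the same as a constellation from its contraction
`T`, a `P`-tree, to the underlying tree of `S`. Given `S`, substitute recursively all the `P`-trees
decorating its nodes, but wherever a node is decorated by a unit tree leave a unit operation behind
(`full`). The result is `T` with unit operations inserted in its edges, that is, a subdivision of
`T`. Its original nodes correspond to the leaves of `S`, its inserted ones to the null-dots of `S`,
since a node of `S` without inputs is decorated by a `P`-tree without nodes. What lies above a node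
of `S` is substituted as one piece, hence is connected; this is the kernel rule (`conn_full`).
Contracting the inserted units gives back `T` (`prune_full`).

Conversely, let the nodes of a subdivided `P`-tree be labelled by the edges of `N` with nothing
above them, subject to the kernel rule. The branches of `N` colour the labels, and each colour class
is connected. Contracting the classes gives the `P`-tree decorating the root node of `S`, and the
classes themselves are treated recursively (`Tr.exists_partition`, `exists_full`). Nothing is lost:
neighbouring classes have different colours, so the partition can be read off from the whole tree
(`ChunkTree.flatten_injective`, `full_injective`). Hence every constellation out of `T` is
isomorphic to a canonical one, and an isomorphism between canonical ones which is fixed on `T` is an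
identity (`exists_compatible_canonical`, `canonical_injective`).

This rigidity makes an induction on the degree possible (`ZoomComplex.IsDecoration`). It starts in
degree 2, where the only datum is a linear tree, that is, a tree over the identity monad
(`FTree.linear_rigid`). Compatibility with targets and with the matching of spheres is built into
the canonical constellations. -/

namespace PolyEndo
-- Trees with prescribed contraction
open PTree
variable {I : Type u} {P : Mon (PolyEndo I)}

/-- The operation `b` with each input decorated by itself. -/
def idExt (P : Mon (PolyEndo I)) (b : P.X.B) : Ext P.X (Over.mk (↾(P.X.s b))) :=
  ⟨b, fun e => e, fun _ => rfl⟩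

/-- The trees with nodes decorated along `f`, contraction `b`, and leaves named by the inputs of `b`
in the way prescribed by the contraction. -/
def Tr {X : Type u} (f : X → P.X.B) (b : P.X.B) : Type u :=
  {W : PTree (P.X.pull f) (P.X.E b) // ∃ hW : W.Valid (P.X.s b),
    ev P (P.X.s b) W.erase (valid_erase _ _ hW) = idExt P b}

namespace Tr
variable {X Y X' Y' : Type u} {f : X → P.X.B} {f' : X' → P.X.B} {b b' : P.X.B}

theorem valid (x : Tr f b) : x.1.Valid (P.X.s b) := x.2.1

theorem ev_erase (x : Tr f b) (h) : ev P (P.X.s b) x.1.erase h = idExt P b := x.2.2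

theorem root_eq (x : Tr f b) : x.1.root (P.X.s b) = P.X.t b := by
  have h := ev_t P _ _ (valid_erase _ _ x.valid)
  rw [x.ev_erase, root_erase _ _ x.valid] at h
  exact h.symm

theorem valid_map (x : Tr f b) (τ : Y → I) (k : P.X.E b → Y) (hk : ∀ e, τ (k e) = P.X.s b e) :
    (x.1.map k).Valid τ :=
  PTree.valid_map _ _ hk x.valid

/-- Evaluation is natural in the leaf names, and the names used in `x` evaluate to the identity
decoration. So `k` can be read off from the renamed tree. -/
theorem ev_map (x : Tr f b) (τ : Y → I) (k : P.X.E b → Y) (hk : ∀ e, τ (k e) = P.X.s b e) (h) :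
    ev P τ (x.1.map k).erase h = ⟨b, k, hk⟩ := by
  have hv := valid_erase _ _ x.valid
  refine (ev_congr P τ (sub_map (Q := P.X.pull f) _ x.1 k) h
    (PTree.valid_map _ _ hk hv)).trans ?_
  refine (PTree.ev_map P _ τ _ hv k hk _).trans ?_
  rw [x.ev_erase]
  rfl

/-- The tree with its leaves decorated by their types. -/
def tree (x : Σ b, Tr f b) : PTree (P.X.pull f) I := x.2.1.map (P.X.s x.1)

theorem tree_valid (x : Σ b, Tr f b) : (tree x).Valid fun i => i :=
  x.2.valid_map (fun i => i) _ fun _ => rfl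

theorem tree_ev (x : Σ b, Tr f b) (h) : ev P (fun i => i) (tree x).erase h =
    ⟨x.1, P.X.s x.1, fun _ => rfl⟩ :=
  x.2.ev_map (fun i => i) _ (fun _ => rfl) h

/-- A valid tree with contraction `b`, its leaves renamed. -/
noncomputable def ofTree (V : PTree (P.X.pull f) I) (hV : V.Valid fun i => i) (b : P.X.B)
    (h : (plusPoly P).t ⟨V.erase, valid_erase _ _ hV⟩ = b) : Tr f b :=
  ⟨(lift ⟨V.erase, valid_erase _ _ hV⟩ b h).relabel V.label (nodeOp_erase V),
    valid_relabel _ _ _ _ (lift_valid _ _ _), by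
      refine (ev_congr P _ (erase_relabel _ (nodeOp_erase V) _) _
        (valid_erase _ _ (lift_valid _ _ h))).trans ?_
      exact ev_lift _ _ _ _⟩

theorem ofTree_map (V : PTree (P.X.pull f) I) (hV : V.Valid fun i => i) (b : P.X.B) (h) :
    (ofTree V hV b h).1.map (P.X.s b) = V :=
  (relabel_map _ (nodeOp_erase V) _ _).symm.trans ((congrArg (PTree.relabel _ (nodeOp_erase V)) (lift_map _ _ _)).trans (relabel_nodeSelf V))

theorem t_tree (x : Σ b, Tr f b) (h) :
    (plusPoly P).t ⟨(tree x).erase, h⟩ = x.1 :=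
  congrArg Ext.op (tree_ev x h)

theorem ofTree_tree (x : Σ b, Tr f b) (hV h) : ofTree (tree x) hV x.1 h = x.2 :=
  Subtype.ext (lift_unique x.1 x.2.1 x.2.valid (x.2.ev_erase _) (valid_erase _ _ hV) h)

/-- The names of the leaves carry no information: contraction matches inputs and leaves bijectively,
and an element of `Tr f b` has to use this matching. Formally, `ofTree` is a left inverse.
Equalities in the free operad are proved by applying this lemma. -/
theorem tree_injective : Function.Injective (tree (f := f)) := by
  intro x y h
  have hb : x.1 = y.1 := by
    have h1 := t_tree x (valid_erase _ _ (tree_valid x))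
    have h2 := t_tree y (valid_erase _ _ (tree_valid y))
    simp only [h] at h1
    exact h1.symm.trans h2
  obtain ⟨b, x⟩ := x
  obtain ⟨b', y⟩ := y
  obtain rfl : b = b' := hb
  have h1 := ofTree_tree ⟨b, x⟩ (tree_valid _) (t_tree _ _)
  have h2 := ofTree_tree ⟨b, y⟩ (tree_valid _) (t_tree _ _)
  have key : ∀ (V V' : PTree (P.X.pull f) I) (hV hV' h h'), V = V' →
      ofTree V hV b h = ofTree V' hV' b h' := by
    rintro V _ _ _ _ _ rfl
    rfl
  exact congrArg (Sigma.mk b) (h1.symm.trans ((key _ _ _ _ _ _ h).trans h2))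

/-- Together with `exists_map` this says that forming trees is itself a polynomial functor: a valid
tree with leaves in `Y` is uniquely an element of `Tr` with its inputs decorated by `Y`. Passing to
leaf types identifies the elements of `Tr`; evaluation then identifies the decorations. -/
theorem map_injective {x y : Σ b, Tr f b} {k : P.X.E x.1 → Y} {k' : P.X.E y.1 → Y} (τ : Y → I)
    (hk : ∀ e, τ (k e) = P.X.s x.1 e) (hk' : ∀ e, τ (k' e) = P.X.s y.1 e)
    (h : x.2.1.map k = y.2.1.map k') :
    (⟨x, k⟩ : Σ x : (Σ b, Tr f b), P.X.E x.1 → Y) = ⟨y, k'⟩ := by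
  obtain rfl : x = y := tree_injective <| by
    refine ((congrArg x.2.1.map (funext hk)).symm.trans ?_).trans
      (congrArg y.2.1.map (funext hk'))
    exact (map_map _ _ _).symm.trans ((congrArg (fun T => PTree.map τ T) h).trans (map_map _ _ _))
  have h1 := x.2.ev_map τ k hk (valid_erase _ _ (x.2.valid_map τ k hk))
  have h2 := x.2.ev_map τ k' hk' (valid_erase _ _ (x.2.valid_map τ k' hk'))
  have h3 := h1.symm.trans ((ev_congr P τ (congrArg PTree.erase h) _ _).trans h2)
  injection h3 with _ h3
  rw [h3]

theorem ext_map {x y : Tr f b} (h : x.1.map (P.X.s b) = y.1.map (P.X.s b)) : x = y := by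
  have := tree_injective (a₁ := ⟨b, x⟩) (a₂ := ⟨b, y⟩) h
  exact eq_of_heq (Sigma.mk.inj this).2

theorem exists_map (τ : Y → I) (V : PTree (P.X.pull f) Y) (hV : V.Valid τ) :
    ∃ (x : Σ b, Tr f b) (k : P.X.E x.1 → Y), (∀ e, τ (k e) = P.X.s x.1 e) ∧ x.2.1.map k = V := by
  obtain ⟨w, hw, hw'⟩ := relabel_self τ V
  have hV' : (V.map τ).Valid fun i => i := PTree.valid_map _ _ (fun _ => rfl) hV
  set T : (plusPoly P).B := ⟨(V.map τ).erase, valid_erase _ _ hV'⟩ with hT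
  let c := contract P (fun i => i) T.1 T.2
  -- The input `e` receives the original decoration of the leaf which contraction matches with `e`.
  refine ⟨⟨_, ofTree (V.map τ) hV' _ rfl⟩, fun e => w (c.leafOf e),
    fun e => (hw' _).trans (c.s_op e).symm, ?_⟩
  refine Eq.trans ?_ hw
  refine (relabel_map _ (nodeOp_erase (V.map τ)) _ _).symm.trans ?_
  refine congrArg (PTree.relabel _ (nodeOp_erase (V.map τ))) ((map_map _ _ _).trans ?_)
  refine congrArg (fun k => PTree.map k T.1.self) (funext fun l => ?_)
  exact congrArg w ((Equiv.ofBijective _ c.bij).apply_symm_apply l)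

theorem leafLabel_bijective (x : Tr f b) : Function.Bijective x.1.leafLabel := by
  rw [← congrArg Subtype.val (ofTree_tree ⟨b, x⟩ (tree_valid _) (t_tree _ _))]
  exact (leaves_relabel _ (nodeOp_erase _) _).bij (lift_leafLabel_bij _ _ _)

/-- Transport along an equality of contractions. -/
def cast (h : b = b') (x : Tr f b) : Tr f b' := h ▸ x

theorem cast_val (h : b = b') (x : Tr f b) :
    (x.cast h).1 = x.1.map (_root_.cast (congrArg P.X.E h)) := by
  subst h
  exact (map_id _).symm

/-- Renaming of the node decorations. -/
def relabel (g : X' → X) (h : ∀ a, f (g a) = f' a) (x : Tr f' b) : Tr f b :=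
  ⟨x.1.relabel g h, valid_relabel _ _ _ _ x.valid, by
    refine (ev_congr P _ (erase_relabel _ h _) _ (valid_erase _ _ x.valid)).trans ?_
    exact x.ev_erase _⟩

/-- The tree with one node. -/
def corolla (f : X → P.X.B) (a : X) : Tr f (f a) :=
  ⟨node (P := P.X.pull f) a fun e => leaf e, fun _ => ⟨rfl, trivial⟩,
    ev_corolla P _ (f a) (fun e => e) (fun _ => rfl) _⟩

theorem valid_sub_tree {τ : Y → I} (F : ∀ a, Tr f (f' a)) (T : PTree (P.X.pull f') Y)
    (hT : T.Valid τ) :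
    (T.sub (Q := P.X.pull f') fun a => (F a).1).Valid τ :=
  PTree.valid_sub (Q := P.X.pull f') _ (fun a => (F a).root_eq) (fun a => (F a).valid) T hT

/-- Every inserted tree contracts to the operation of the node it replaces, with the identity
matching of inputs, so contracting first inside and then outside changes nothing. -/
theorem ev_sub_tree {τ : Y → I} (F : ∀ a, Tr f (f' a)) (T : PTree (P.X.pull f') Y)
    (hT : T.Valid τ) (h h') :
    ev P τ (T.sub (Q := P.X.pull f') fun a => (F a).1).erase h = ev P τ T.erase h' := by
  refine (ev_congr P τ (erase_sub (Q := P.X.pull f') _ T) h ?_).trans ?_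
  · exact (erase_sub (Q := P.X.pull f') _ T) ▸ h
  · exact ev_sub P (fun a => (F a).1.erase) (fun a => valid_erase _ _ (F a).valid)
      (fun a => (F a).ev_erase _) τ T hT _ _

/-- Substitution of trees into the nodes of a tree. -/
def sub (x : Tr f' b) (F : ∀ a, Tr f (f' a)) : Tr f b :=
  ⟨x.1.sub (Q := P.X.pull f') fun a => (F a).1, valid_sub_tree F _ x.valid,
    (ev_sub_tree F _ x.valid _ _).trans (x.ev_erase (valid_erase _ _ x.valid))⟩

/-- The tree `T` with its nodes decorated by their names. -/
noncomputable def ofLift (T : (plusPoly P).B) (b : P.X.B) (h : (plusPoly P).t T = b) :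
    Tr T.1.nodeOp b :=
  ⟨lift T b h, lift_valid T b h, ev_lift T b h _⟩

end Tr
end PolyEndo

/-! ### Operads over a polynomial monad, in terms of elements, and free operads -/

namespace PolyEndo
open PTree
variable {I : Type u} {P : Mon (PolyEndo I)}

/-- A set over the operations, with its elements sent to their output types. -/
def typeObj {X : Type u} (f : X → P.X.B) : Over I := Over.mk (↾ fun x => P.X.t (f x))

/-- The composite operation whose inputs are the images of the inputs of `z`. -/
def Ext.compOp {X : Type u} {f : X → P.X.B} (z : Ext P.X (typeObj f)) : CompOp P.X P.X :=
  ⟨z.op, fun e => f (z.args e), z.compat⟩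

/-- An operad over the polynomial monad `P`, in terms of elements. -/
structure SetOperad (P : Mon (PolyEndo I)) where
  carrier : Type u
  op : carrier → P.X.B
  one : I → carrier
  op_one : ∀ i, op (one i) = (MonObj.one (X := P.X)).onB i
  -- The decoration `z` has its own operation, equated with `op x` by a separate argument, so that
  -- `x` can be replaced by an equal element without transporting the decorations.
  mul : (x : carrier) → (z : Ext P.X (typeObj op)) → op x = z.op → carrier
  op_mul : ∀ x z h, op (mul x z h) = (MonObj.mul (X := P.X)).onB z.compOp
  one_mul : ∀ x h, mul (one (P.X.t (op x)))
    ⟨(MonObj.one (X := P.X)).onB (P.X.t (op x)), fun _ => x, h⟩ (op_one _) = x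
  mul_one : ∀ x h, mul x ⟨op x, fun e => one (P.X.s (op x) e), h⟩ rfl = x
  mul_assoc : ∀ x (z : Ext P.X (typeObj op)) (h : op x = z.op)
    (w : P.X.E z.op → Ext P.X (typeObj op)) (hw : ∀ e, op (z.args e) = (w e).op) h₁ h₂ h₃,
    mul (mul x z h) (muE P (typeObj op) z.op w h₁) h₂ =
      mul x ⟨z.op, fun e => mul (z.args e) (w e) (hw e), h₃⟩ h

namespace SetOperad

/-- The image of an element of an extension under a map over the operations. -/
def mapExt {X Y : Type u} {f : X → P.X.B} {g : Y → P.X.B} (k : X → Y) (hk : ∀ x, g (k x) = f x)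
    (z : Ext P.X (typeObj f)) : Ext P.X (typeObj g) :=
  ⟨z.op, fun e => k (z.args e), fun e => (congrArg P.X.t (hk _)).trans (z.compat e)⟩

@[ext]
structure Hom (M N : SetOperad P) where
  toFun : M.carrier → N.carrier
  op_toFun : ∀ x, N.op (toFun x) = M.op x
  map_one : ∀ i, toFun (M.one i) = N.one i
  map_mul : ∀ x z h, toFun (M.mul x z h) =
    N.mul (toFun x) (mapExt toFun op_toFun z) ((op_toFun x).trans h)

instance : Category (SetOperad P) where
  Hom := Hom
  id M := ⟨fun x => x, fun _ => rfl, fun _ => rfl, fun _ _ _ => rfl⟩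
  comp f g := ⟨fun x => g.toFun (f.toFun x), fun x => (g.op_toFun _).trans (f.op_toFun x),
    fun i => (congrArg g.toFun (f.map_one i)).trans (g.map_one i),
    fun x z h => (congrArg g.toFun (f.map_mul x z h)).trans (g.map_mul _ _ _)⟩

theorem hom_ext {M N : SetOperad P} (f g : M ⟶ N) (h : ∀ x, f.toFun x = g.toFun x) : f = g :=
  Hom.ext (funext h)

/-- The underlying set over the operations. -/
def forget (P : Mon (PolyEndo I)) : SetOperad P ⥤ Over P.X.B where
  obj M := Over.mk (↾M.op)
  map f := Over.homMk (↾f.toFun) (by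
    ext x
    exact f.op_toFun x)

theorem mul_congr (M : SetOperad P) {x x' : M.carrier} (hx : x = x') {z z' : Ext P.X (typeObj M.op)}
    (hz : z = z') (h h') : M.mul x z h = M.mul x' z' h' := by
  subst hx hz
  rfl

/-- The unit law with a variable type `i`, for the situations in which the type of `x` is known only
up to a provable equality. -/
theorem one_mul' (M : SetOperad P) (x : M.carrier) (i : I) (hi : P.X.t (M.op x) = i) (h) :
    M.mul (M.one i) ⟨(MonObj.one (X := P.X)).onB i, fun _ => x, h⟩ (M.op_one _) = x := by
  subst hi
  exact M.one_mul x h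

theorem onB_congr {z z' : CompOp P.X P.X} (h : z = z') :
    (MonObj.mul (X := P.X)).onB z = (MonObj.mul (X := P.X)).onB z' := congrArg _ h

theorem compOp_congr (b : P.X.B) {k k' : P.X.E b → P.X.B} (h : k = k') (h₁ h₂) :
    (⟨b, k, h₁⟩ : CompOp P.X P.X) = ⟨b, k', h₂⟩ := by
  subst h
  rfl

section eval
variable (M : SetOperad P) {X Y Z : Type u} {f : X → P.X.B} (φ : X → M.carrier)
  (hφ : ∀ x, M.op (φ x) = f x)

/-- Evaluation in `M` of a tree with nodes decorated by elements of `M`. -/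
def eval (τ : Y → I) : (V : PTree (P.X.pull f) Y) → (hV : V.Valid τ) →
    {y : M.carrier // M.op y = (ev P τ V.erase (valid_erase τ V hV)).op}
  | leaf y, _ => ⟨M.one (τ y), M.op_one _⟩
  | node x c, hV =>
    let k := fun e => eval τ (c e) (hV e).2
    ⟨M.mul (φ x) ⟨f x, fun e => (k e).1, fun e =>
      (congrArg P.X.t (k e).2).trans ((ev_t P τ _ _).trans
        ((root_erase τ _ (hV e).2).trans (hV e).1))⟩ (hφ x), by
      refine (M.op_mul _ _ _).trans (onB_congr ?_)
      unfold Ext.compOp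
      congr 1
      exact funext fun e => (k e).2⟩

theorem t_eval (τ : Y → I) (V : PTree (P.X.pull f) Y) (hV : V.Valid τ) :
    P.X.t (M.op (M.eval φ hφ τ V hV).1) = V.root τ :=
  (congrArg P.X.t (M.eval φ hφ τ V hV).2).trans ((ev_t P τ _ _).trans (root_erase τ _ hV))

theorem mk_congr {W : Over I} (b : P.X.B) {g g' : P.X.E b → W.left} (h : g = g') (hg hg') :
    (⟨b, g, hg⟩ : Ext P.X W) = ⟨b, g', hg'⟩ := by
  subst h
  rfl

theorem eval_map (τ : Y → I) (τ' : Z → I) (k : Y → Z) (hk : ∀ y, τ' (k y) = τ y)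
    (V : PTree (P.X.pull f) Y) (hV : V.Valid τ) (h) :
    (M.eval φ hφ τ' (V.map k) h).1 = (M.eval φ hφ τ V hV).1 := by
  induction V with
  | leaf y => exact congrArg M.one (hk y)
  | node x c ih =>
    exact M.mul_congr rfl (mk_congr _ (funext fun e => ih e (hV e).2 _) _ _) _ _

/-- Evaluation turns grafting into multiplication. For a leaf this is the left unit law; for a node
it is associativity, applied after the induction hypothesis in the branches. -/
theorem eval_bind (τ : Y → I) (τ' : Z → I) (V : PTree (P.X.pull f) Y) (hV : V.Valid τ)
    (r : Y → PTree (P.X.pull f) Z) (hr : ∀ y, (r y).Valid τ') (hr' : ∀ y, (r y).root τ' = τ y)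
    (h h') :
    (M.eval φ hφ τ' (V.bind r) h).1 = M.mul (M.eval φ hφ τ V hV).1
      ⟨(ev P τ V.erase (valid_erase τ V hV)).op, fun e => (M.eval φ hφ τ'
        (r ((ev P τ V.erase (valid_erase τ V hV)).args e)) (hr _)).1, h'⟩
      (M.eval φ hφ τ V hV).2 := by
  induction V with
  | leaf y => exact (M.one_mul' _ _ ((M.t_eval φ hφ _ _ _).trans (hr' y)) _).symm
  | node x c ih =>
    have hc : ∀ e i, P.X.t (M.op (M.eval φ hφ τ' (r ((ev P τ (c e).erase
        (valid_erase τ _ (hV e).2)).args i)) (hr _)).1) = P.X.s (ev P τ (c e).erase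
        (valid_erase τ _ (hV e).2)).op i := fun e i =>
      (M.t_eval φ hφ _ _ _).trans ((hr' _).trans ((ev P τ (c e).erase _).compat i))
    refine (M.mul_congr rfl (mk_congr _ (funext fun e => ih e (hV e).2 _ (hc e)) _ ?_) _
      (hφ x)).trans ?_
    · exact fun e => (congrArg (fun y => P.X.t (M.op y)) (ih e (hV e).2 (h e).2 (hc e))).symm.trans
        ((M.t_eval φ hφ _ _ _).trans (h e).1)
    · refine (M.mul_assoc (φ x) ⟨f x, fun e => (M.eval φ hφ τ (c e) (hV e).2).1, _⟩ (hφ x)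
        (fun e => ⟨(ev P τ (c e).erase (valid_erase τ _ (hV e).2)).op, fun i =>
          (M.eval φ hφ τ' (r ((ev P τ (c e).erase (valid_erase τ _ (hV e).2)).args i)) (hr _)).1,
          hc e⟩) (fun e => (M.eval φ hφ τ (c e) (hV e).2).2) ?_ ?_ ?_).symm
      exact fun e => (ev_t P τ _ _).trans ((root_erase τ _ (hV e).2).trans (hV e).1)

theorem eval_bind_tr (τ' : Z → I) {b : P.X.B} (x : Tr f b)
    (r : P.X.E b → PTree (P.X.pull f) Z) (hr : ∀ y, (r y).Valid τ')
    (hr' : ∀ y, (r y).root τ' = P.X.s b y) (h h' h'') :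
    (M.eval φ hφ τ' (x.1.bind r) h).1 = M.mul (M.eval φ hφ (P.X.s b) x.1 x.valid).1
      ⟨b, fun e => (M.eval φ hφ τ' (r e) (hr _)).1, h'⟩ h'' := by
  refine (M.eval_bind φ hφ (P.X.s b) τ' x.1 x.valid r hr hr' h ?_).trans ?_
  · exact fun i => (M.t_eval φ hφ _ _ _).trans ((hr' _).trans ((ev P (P.X.s b) x.1.erase _).compat i))
  · refine M.mul_congr rfl ?_ _ _
    -- The types of the decorations depend on the evaluation, so it is generalised to a variable `E`
    -- before being replaced by `idExt P b`.
    have key : ∀ (E : Ext P.X (Over.mk (↾(P.X.s b)))) (_ : E = idExt P b) (h₁),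
        (⟨E.op, fun e => (M.eval φ hφ τ' (r (E.args e)) (hr _)).1, h₁⟩ : Ext P.X (typeObj M.op)) =
          ⟨b, fun e => (M.eval φ hφ τ' (r e) (hr _)).1, h'⟩ := by
      rintro _ rfl h₁
      rfl
    exact key _ (x.ev_erase _) _

end eval

section free
variable {X : Type u} (f : X → P.X.B)

theorem tree_root (x : Σ b, Tr f b) : (Tr.tree x).root (fun i => i) = P.X.t x.1 :=
  (root_map _ _ fun _ => rfl).trans x.2.root_eq

theorem ev_bind_tr {Z : Type u} {f : X → P.X.B} (τ' : Z → I) {b : P.X.B} (x : Tr f b)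
    (r : P.X.E b → PTree (P.X.pull f) Z) (hr : ∀ y, (r y).Valid τ')
    (hr' : ∀ y, (r y).root τ' = P.X.s b y) (h h') :
    ev P τ' (x.1.bind r).erase h = muE P _ b
      (fun e => ev P τ' (r e).erase (valid_erase _ _ (hr e))) h' := by
  have hv := valid_erase _ _ x.valid
  have hb : ∀ e, (r e).erase.root τ' = P.X.s b e := fun e => (root_erase _ _ (hr e)).trans (hr' e)
  have e1 : (x.1.bind r).erase = x.1.erase.bind fun e => (r e).erase :=
    sub_bind (Q := P.X.pull f) _ _ _
  refine (ev_congr P τ' e1 h (e1 ▸ h)).trans ?_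
  refine (ev_bind P (P.X.s b) τ' x.1.erase hv _ (fun e => valid_erase _ _ (hr e)) hb _ ?_).trans ?_
  · exact fun e => (ev_t P _ _ _).trans ((hb _).trans ((ev P _ _ hv).compat e))
  · have key : ∀ (E : Ext P.X (Over.mk (↾(P.X.s b)))) (_ : E = idExt P b) (h₁),
        muE P (Over.mk (↾τ')) E.op
          (fun e => ev P τ' (r (E.args e)).erase (valid_erase _ _ (hr _))) h₁ =
        muE P _ b (fun e => ev P τ' (r e).erase (valid_erase _ _ (hr e))) h' := by
      rintro _ rfl h₁
      rfl
    exact key _ (x.ev_erase _) _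

variable {f} in
theorem bind_valid (x : Σ b, Tr f b) (z : Ext P.X (typeObj (Sigma.fst (β := Tr f))))
    (h : x.1 = z.op) :
    (x.2.1.bind fun e => Tr.tree (z.args (_root_.cast (congrArg P.X.E h) e))).Valid fun i => i := by
  obtain ⟨b, x⟩ := x
  obtain ⟨b', z, hz⟩ := z
  change b = b' at h
  subst h
  exact valid_bind _ _ (fun e => (tree_root f _).trans (hz e)) (fun e => Tr.tree_valid _) x.valid

/-- The operation and the tree of a composite in the free operad. -/
noncomputable def graft (x : Σ b, Tr f b) (z : Ext P.X (typeObj (Sigma.fst (β := Tr f))))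
    (h : x.1 = z.op) : Σ b, Tr f b :=
  ⟨_, Tr.ofTree _ (bind_valid x z h) _ rfl⟩

variable {f} in
theorem tree_graft (x : Σ b, Tr f b) (z : Ext P.X (typeObj (Sigma.fst (β := Tr f))))
    (h : x.1 = z.op) : Tr.tree (graft f x z h) =
      x.2.1.bind fun e => Tr.tree (z.args (_root_.cast (congrArg P.X.E h) e)) :=
  Tr.ofTree_map _ (bind_valid x z h) _ rfl

/-- The operation and the tree of a unit of the free operad. -/
noncomputable def unitTr (i : I) : Σ b, Tr f b :=
  ⟨_, Tr.ofTree (leaf i) trivial _ rfl⟩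

theorem tree_unitTr (i : I) : Tr.tree (unitTr f i) = leaf i :=
  Tr.ofTree_map (leaf i) trivial _ rfl

variable {f} in
-- By `ev_bind_tr` the evaluation of a grafted tree is the product of the evaluations of its parts;
-- here only operations are compared.
theorem graft_op (x : Σ b, Tr f b) (z : Ext P.X (typeObj (Sigma.fst (β := Tr f))))
    (h : x.1 = z.op) : (graft f x z h).1 = (MonObj.mul (X := P.X)).onB z.compOp := by
  obtain ⟨b, x⟩ := x
  obtain ⟨b', z, hz⟩ := z
  change b = b' at h
  subst h
  have h1 := ev_bind_tr (fun i => i) x (fun e => Tr.tree (z e)) (fun e => Tr.tree_valid _)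
    (fun e => (tree_root f _).trans (hz e)) (valid_erase _ _ (bind_valid ⟨b, x⟩ ⟨b, z, hz⟩ rfl))
    fun e => (ev_t P _ _ _).trans ((root_erase _ _ (Tr.tree_valid _)).trans
      ((tree_root f _).trans (hz e)))
  refine (congrArg Ext.op h1).trans ?_
  exact onB_congr (compOp_congr _ (funext fun e => congrArg Ext.op (Tr.tree_ev _ _)) _ _)

variable {f} in
-- On trees this is associativity of grafting. The issue is which input of the composite operation
-- belongs to which leaf of the grafted tree. Both sides are compared with the grafted tree whose
-- leaves are named by pairs `(e, i)`: `exists_map` factors these names through the inputs of its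
-- contraction, and evaluating it shows that the factorization is the matching used by `muE`.
theorem graft_assoc (x : Σ b, Tr f b) (z : Ext P.X (typeObj (Sigma.fst (β := Tr f))))
    (h : x.1 = z.op) (w : P.X.E z.op → Ext P.X (typeObj (Sigma.fst (β := Tr f))))
    (hw : ∀ e, (z.args e).1 = (w e).op) (h₁ h₂ h₃) :
    graft f (graft f x z h) (muE P (typeObj (Sigma.fst (β := Tr f))) z.op w h₁) h₂ =
      graft f x ⟨z.op, fun e => graft f (z.args e) (w e) (hw e), h₃⟩ h := by
  obtain ⟨b, x⟩ := x
  obtain ⟨b', z, hz⟩ := z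
  change b = b' at h
  subst h
  -- The equalities `hw` are substituted, so that the decorations `w e` are indexed by the inputs of
  -- the contraction of `z e`.
  obtain ⟨g, hg, rfl⟩ : ∃ (g : ∀ e, P.X.E (z e).1 → Σ b, Tr f b) (hg : ∀ e i, P.X.t (g e i).1 =
      P.X.s (z e).1 i), w = fun e => ⟨(z e).1, g e, hg e⟩ := by
    have : ∀ e, ∃ (g : P.X.E (z e).1 → Σ b, Tr f b) (hg : ∀ i, P.X.t (g i).1 =
      P.X.s (z e).1 i), w e = ⟨(z e).1, g, hg⟩ := by
      intro e
      have := hw e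
      change (z e).1 = _ at this
      generalize w e = we at this ⊢
      obtain ⟨_, g, hg⟩ := we
      obtain rfl : (z e).1 = _ := this
      exact ⟨g, hg, rfl⟩
    choose g hg h using this
    exact ⟨g, hg, funext h⟩
  refine Tr.tree_injective ((tree_graft _ _ _).trans (Eq.trans ?_ (tree_graft _ _ _).symm))
  let τ : (Σ e, P.X.E (z e).1) → I := fun p => P.X.s (z p.1).1 p.2
  have hτ : ∀ e, ((z e).2.1.map (Sigma.mk (β := fun e => P.X.E (z e).1) e)).Valid τ := fun e =>
    (z e).2.valid_map τ _ fun _ => rfl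
  have hρ : ∀ e, ((z e).2.1.map (Sigma.mk (β := fun e => P.X.E (z e).1) e)).root τ = P.X.s b e :=
    fun e => (root_map _ _ fun _ => rfl).trans ((z e).2.root_eq.trans (hz e))
  have hV := valid_bind _ _ hρ hτ x.valid
  obtain ⟨y, k, hk, hy⟩ := Tr.exists_map τ _ hV
  have hyg : y = graft f ⟨b, x⟩ ⟨b, z, hz⟩ rfl := by
    refine Tr.tree_injective (Eq.trans ?_ (tree_graft _ _ _).symm)
    refine (congrArg y.2.1.map (funext hk)).symm.trans ((map_map _ _ _).symm.trans ?_)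
    refine (congrArg (fun T => PTree.map τ T) hy).trans ?_
    refine (bind_bind _ _ _).trans (congrArg x.1.bind (funext fun e => ?_))
    exact map_map _ _ _
  -- Both sides are evaluations of the same tree, computed once directly and once through its parts.
  -- The equality says that `k` is the map from inputs of the composite operation to pairs of
  -- inputs.
  have hE : (⟨y.1, k, hk⟩ : Ext P.X (Over.mk (↾τ))) = muE P (Over.mk (↾τ)) b
      (fun e => ⟨(z e).1, fun i => (⟨e, i⟩ : Σ e, P.X.E (z e).1), fun _ => rfl⟩) hz := by
    refine (y.2.ev_map τ k hk (valid_erase _ _ (y.2.valid_map τ k hk))).symm.trans ?_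
    refine (ev_congr P τ (congrArg PTree.erase hy) _ (valid_erase _ _ hV)).trans ?_
    refine (ev_bind_tr τ x _ hτ hρ _ ?_).trans (muE_congr P _ _ _ _ (fun e =>
      (z e).2.ev_map τ _ (fun _ => rfl) _) _ _)
    exact fun e => (ev_t P _ _ _).trans ((root_erase _ _ (hτ e)).trans (hρ e))
  have key : ∀ (y' : Σ b, Tr f b) (W : Ext P.X (typeObj (Sigma.fst (β := Tr f)))) (h : y'.1 = W.op)
      (hk'), y = y' → W = ⟨y.1, fun i => g (k i).1 (k i).2, hk'⟩ →
      (y'.2.1.bind fun e => Tr.tree (W.args (_root_.cast (congrArg P.X.E h) e))) =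
      y.2.1.bind fun i => Tr.tree (g (k i).1 (k i).2) := by
    rintro _ _ _ _ rfl rfl
    rfl
  refine (key _ _ h₂ ?_ hyg ?_).trans ?_
  · exact fun i => (hg _ _).trans (hk i)
  · have key2 : ∀ (E E' : Ext P.X (Over.mk (↾τ))) (h₁ h₂), E = E' →
      (⟨E.op, fun i => g (E.args i).1 (E.args i).2, h₁⟩ :
        Ext P.X (typeObj (Sigma.fst (β := Tr f)))) =
        ⟨E'.op, fun i => g (E'.args i).1 (E'.args i).2, h₂⟩ := by
      rintro _ _ _ _ rfl
      rfl
    exact (key2 _ _ _ _ hE).symm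
  · refine (bind_bind y.2.1 (fun i => leaf (k i)) (fun p => Tr.tree (g p.1 p.2))).symm.trans ?_
    refine (congrArg (fun T => PTree.bind T _) hy).trans ?_
    refine (bind_bind _ _ _).trans (congrArg x.1.bind (funext fun e => ?_))
    refine (bind_bind _ _ _).trans ?_
    exact (tree_graft (z e) ⟨(z e).1, g e, hg e⟩ rfl).symm

/-- The free operad on a set over the operations. -/
noncomputable def free : SetOperad P where
  carrier := Σ b, Tr f b
  op := Sigma.fst
  one := unitTr f
  op_one _ := rfl
  mul := graft f
  op_mul := graft_op
  one_mul x h := by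
    refine Tr.tree_injective ((tree_graft _ _ _).trans ?_)
    have : (unitTr f (P.X.t x.1)).2.1.bind (fun _ => Tr.tree x) =
        (Tr.tree (unitTr f (P.X.t x.1))).bind fun _ => Tr.tree x := (bind_bind _ _ _).symm
    exact this.trans (congrArg (fun T => PTree.bind T _) (tree_unitTr f _))
  mul_one x h := by
    refine Tr.tree_injective ((tree_graft _ _ _).trans ?_)
    exact congrArg x.2.1.bind (funext fun e => tree_unitTr f _)
  mul_assoc := graft_assoc

end free
end SetOperad
end PolyEndo

/-! ### The universal property of the free operad, and its monad -/

namespace PolyEndo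
open PTree
variable {I : Type u} {P : Mon (PolyEndo I)}

namespace SetOperad
section
variable {X : Type u} {f : X → P.X.B}

/-- The generators of the free operad. -/
def generator (a : X) : Σ b, Tr f b := ⟨f a, Tr.corolla f a⟩

variable (M : SetOperad P) (φ : X → M.carrier) (hφ : ∀ x, M.op (φ x) = f x)

theorem eval_congr {Y : Type u} (τ : Y → I) {V V' : PTree (P.X.pull f) Y} (h : V = V') (hV hV') :
    (M.eval φ hφ τ V hV).1 = (M.eval φ hφ τ V' hV').1 := by
  subst h
  rfl

theorem eval_tree (x : Σ b, Tr f b) :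
    (M.eval φ hφ (fun i => i) (Tr.tree x) (Tr.tree_valid x)).1 =
      (M.eval φ hφ (P.X.s x.1) x.2.1 x.2.valid).1 :=
  M.eval_map φ hφ _ _ _ (fun _ => rfl) _ _ _

/-- The extension of a map over the operations to the free operad. -/
noncomputable def desc : free f ⟶ M where
  toFun x := (M.eval φ hφ (fun i => i) (Tr.tree x) (Tr.tree_valid x)).1
  op_toFun x := (M.eval φ hφ _ _ _).2.trans (congrArg Ext.op (Tr.tree_ev x _))
  map_one i := M.eval_congr φ hφ _ (tree_unitTr f i) _ trivial
  map_mul x z h := by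
    obtain ⟨b, x⟩ := x
    obtain ⟨b', z, hz⟩ := z
    change b = b' at h
    subst h
    have hr : ∀ e, (Tr.tree (z e)).root (fun i => i) = P.X.s b e := fun e =>
      (tree_root f _).trans (hz e)
    refine (M.eval_congr φ hφ _ (tree_graft (f := f) ⟨b, x⟩ ⟨b, z, hz⟩ rfl) _ (valid_bind _ _ hr
      (fun e => Tr.tree_valid _) x.valid)).trans ?_
    refine (M.eval_bind_tr φ hφ (fun i => i) x (fun e => Tr.tree (z e)) (fun e => Tr.tree_valid _)
      hr _ ?_ ?_).trans ?_
    · exact fun e => (M.t_eval φ hφ _ _ _).trans (hr e)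
    · exact (M.eval φ hφ _ _ _).2.trans (congrArg Ext.op (x.ev_erase _))
    · exact M.mul_congr (M.eval_tree φ hφ ⟨b, x⟩).symm rfl _ _

theorem desc_generator (a : X) : (desc M φ hφ).toFun (generator a) = φ a := by
  have key : ∀ (b : P.X.B) (h : M.op (φ a) = b) (h₁ h₂), M.mul (φ a)
      ⟨b, fun e => M.one (P.X.s b e), h₁⟩ h₂ = φ a := by
    rintro _ rfl h₁ h₂
    exact M.mul_one _ _
  exact key _ (hφ a) _ _

/-- Units and generators suffice: a unit tree is a unit, and any other tree is the product of the
generator at its root node with its branches. -/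
theorem desc_unique (ρ : free f ⟶ M) (h : ∀ a, ρ.toFun (generator a) = φ a) :
    ρ = desc M φ hφ := by
  refine SetOperad.hom_ext _ _ fun x => ?_
  have key : ∀ (V : PTree (P.X.pull f) I) (hV : V.Valid fun i => i) (x : Σ b, Tr f b),
      Tr.tree x = V → ρ.toFun x = (M.eval φ hφ (fun i => i) V hV).1 := by
    intro V hV
    induction V with
    | leaf i =>
      intro x hx
      obtain rfl : x = unitTr f i := Tr.tree_injective (hx.trans (tree_unitTr f i).symm)
      exact ρ.map_one i
    | node a c ih =>
      intro x hx
      let y : ∀ e, Σ b, Tr f b := fun e => ⟨_, Tr.ofTree (c e) (hV e).2 _ rfl⟩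
      have hy : ∀ e, Tr.tree (y e) = c e := fun e => Tr.ofTree_map (c e) (hV e).2 _ rfl
      have hyt : ∀ e, P.X.t (y e).1 = P.X.s (f a) e := fun e =>
        (tree_root f _).symm.trans ((congrArg (root fun i => i) (hy e)).trans (hV e).1)
      obtain rfl : x = graft f (generator a) ⟨f a, y, hyt⟩ rfl := by
        refine Tr.tree_injective (hx.trans (Eq.trans ?_ (tree_graft _ _ _).symm))
        exact congrArg (node (P := P.X.pull f) a) (funext fun e => (hy e).symm)
      refine (ρ.map_mul (generator a) ⟨f a, y, hyt⟩ rfl).trans ?_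
      exact M.mul_congr (h a) (mk_congr _ (funext fun e => ih e (hV e).2 _ (hy e)) _ _) _ _
  exact key _ (Tr.tree_valid x) x rfl

end

/-- The adjunction between operads and sets over the operations. -/
noncomputable def freeEquiv (X : Over P.X.B) (M : SetOperad P) :
    (free (P := P) X.hom ⟶ M) ≃ (X ⟶ (forget P).obj M) where
  toFun ρ := Over.homMk (↾fun a => ρ.toFun (generator a)) (by
    ext a
    exact ρ.op_toFun _)
  invFun k := desc M k.left fun a => types_congr_hom (Over.w k) a
  left_inv ρ := (desc_unique M _ _ ρ fun _ => rfl).symm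
  right_inv k := by
    ext a
    exact desc_generator M _ _ a

/-- The free functor. -/
noncomputable def freeFunctor (P : Mon (PolyEndo I)) : Over P.X.B ⥤ SetOperad P :=
  Adjunction.leftAdjointOfEquiv (G := forget P) (F_obj := fun X => free X.hom) freeEquiv
    fun _ _ _ _ _ => rfl

noncomputable def freeAdj (P : Mon (PolyEndo I)) : freeFunctor P ⊣ forget P :=
  Adjunction.adjunctionOfEquivLeft (G := forget P) (F_obj := fun X => free X.hom) freeEquiv
    fun _ _ _ _ _ => rfl

instance : (forget P).IsRightAdjoint := ⟨_, ⟨freeAdj P⟩⟩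

/-- The tree with nodes decorated by elements of `X` belonging to an element of `P⁺ X`. -/
noncomputable def extTr {X : Over P.X.B} (z : Ext (plusPoly P) X) :
    Σ b, Tr (P := P) (fun a : X.left => X.hom a) b :=
  ⟨_, (Tr.ofLift z.op _ rfl).relabel (f := fun a : X.left => X.hom a) z.args z.compat⟩

theorem tree_extTr {X : Over P.X.B} (z : Ext (plusPoly P) X) :
    Tr.tree (extTr z) = z.op.1.nodeSelf.relabel (f := fun a : X.left => X.hom a)
      z.args z.compat :=
  (relabel_map _ z.compat _ _).symm.trans
    (congrArg (PTree.relabel (f := fun a : X.left => X.hom a) _ z.compat) (lift_map z.op _ rfl))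

/-- A `P`-tree with a decoration of its nodes is the same as a tree with decorated nodes. Erasing
the decorations recovers the `P`-tree, `nodeSelf_relabel_inj` recovers the decoration, and `label`
provides the inverse construction. -/
theorem extTr_bijective (X : Over P.X.B) : Function.Bijective (extTr (X := X)) := by
  constructor
  · intro z z' h
    have h' := (tree_extTr z).symm.trans ((congrArg Tr.tree h).trans (tree_extTr z'))
    have h1 : z.op.1 = z'.op.1 := by
      refine Eq.trans ?_ ((congrArg PTree.erase h').trans ?_)
      · exact ((erase_relabel _ z.compat _).trans (erase_nodeSelf _)).symm
      · exact (erase_relabel _ z'.compat _).trans (erase_nodeSelf _)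
    obtain ⟨T, a, ha⟩ := z
    obtain ⟨T', a', ha'⟩ := z'
    obtain rfl : T = T' := Subtype.ext h1
    obtain rfl := nodeSelf_relabel_inj (f := fun a : X.left => X.hom a) T.1 a a' ha ha' h'
    rfl
  · intro x
    refine ⟨⟨⟨(Tr.tree x).erase, valid_erase _ _ (Tr.tree_valid x)⟩, (Tr.tree x).label,
      nodeOp_erase _⟩, Tr.tree_injective ((tree_extTr _).trans ?_)⟩
    exact relabel_nodeSelf _

/-- The free functor is defined by extension along generators, so it evaluates a tree by grafting
renamed corollas. This rebuilds the tree with renamed nodes. -/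
theorem free_map {X Y : Over P.X.B} (k : X ⟶ Y) (x : Σ b, Tr (P := P) (fun a : X.left => X.hom a) b) :
    Tr.tree (((freeFunctor P).map k).toFun x) = (Tr.tree x).relabel
      (f := fun a : Y.left => Y.hom a) (f' := fun a : X.left => X.hom a) k.left
        fun a => types_congr_hom (Over.w k) a := by
  have hk : ∀ a, Y.hom (k.left a) = X.hom a := fun a => types_congr_hom (Over.w k) a
  let M := free (P := P) fun a : Y.left => Y.hom a
  have key : ∀ (Z : Type u) (τ : Z → I) (V : PTree (P.X.pull fun a : X.left => X.hom a) Z)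
      (hV : V.Valid τ), Tr.tree (M.eval (fun a => generator (k.left a)) hk τ V hV).1 =
        (V.relabel (f := fun a : Y.left => Y.hom a) k.left hk).map τ := by
    intro Z τ V hV
    induction V with
    | leaf z => exact tree_unitTr _ _
    | node a c ih =>
      refine (tree_graft _ _ (hk a)).trans ?_
      refine congrArg (node (P := P.X.pull fun a : Y.left => Y.hom a) (k.left a)) (funext fun e => ?_)
      exact ih _ (hV _).2
  exact (key I (fun i => i) (Tr.tree x) (Tr.tree_valid x)).trans (map_id _)

/-- The counit evaluates a tree of trees in the free operad. Each node contributes the tree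
decorating it, with the values of the branches grafted to its leaves; this is substitution. -/
theorem free_mul (X : Over P.X.B) (x : Σ b, Tr (P := P)
    (fun a : Σ b, Tr (P := P) (fun a : X.left => X.hom a) b => a.1) b) :
    Tr.tree (((freeAdj P).counit.app ((freeFunctor P).obj X)).toFun x) =
      (Tr.tree x).sub (Q := P.X.pull fun a : Σ b, Tr (P := P) (fun a : X.left => X.hom a) b => a.1)
        fun a => a.2.1 := by
  let M := free (P := P) fun a : X.left => X.hom a
  have key : ∀ (Z : Type u) (τ : Z → I) (V : PTree (P.X.pull M.op) Z)
      (hV : V.Valid τ), Tr.tree (M.eval (fun a => a) (fun _ => rfl) τ V hV).1 =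
        (V.sub (Q := P.X.pull M.op) fun a : M.carrier => a.2.1).map τ := by
    intro Z τ V hV
    induction V with
    | leaf z => exact tree_unitTr _ _
    | node a c ih =>
      refine (tree_graft _ _ rfl).trans ((congrArg a.2.1.bind (funext fun e => ih e (hV e).2)).trans ?_)
      exact (bind_bind _ _ _).symm
  exact (key I (fun i => i) (Tr.tree x) (Tr.tree_valid x)).trans (map_id _)

theorem extTr_unit (X : Over P.X.B) (a : X.left) :
    extTr (((monad (plus P)).η.app X).left a) = generator a := by
  refine Tr.tree_injective ((tree_extTr _).trans ?_)
  refine ((relabel_relabel (f := fun a : X.left => X.hom a) (f' := fun _ : PUnit => X.hom a)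
    (fun _ : PUnit.{u + 1} => a) (fun _ => rfl) ((plusOne P).onE (X.hom a)) ((plusOne P).s_onE _)
    ((plusOne P).onB (X.hom a)).1.nodeSelf).symm.trans ?_)
  exact congrArg (PTree.relabel (f := fun a : X.left => X.hom a) (f' := fun _ : PUnit => X.hom a)
    (fun _ => a) (fun _ => rfl)) (hat_plusOne (X.hom a))

/-- `plusMul` names the nodes of the substituted tree by pairs of an outer and an inner node.
Replacing each pair by its decoration gives the substitution which computes the counit in
`free_mul`. -/
theorem extTr_mul (X : Over P.X.B) (z : Ext (plusPoly P) ((plusPoly P).functor.obj X)) :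
    Tr.tree (extTr (((monad (plus P)).μ.app X).left z)) =
      (z.op.1.nodeSelf.relabel (f := fun a : Σ b, Tr (P := P) (fun a : X.left => X.hom a) b => a.1)
        (fun n => extTr (z.args n)) z.compat).sub
        (Q := P.X.pull fun a : Σ b, Tr (P := P) (fun a : X.left => X.hom a) b => a.1)
          fun a => a.2.1 := by
  let f : X.left → P.X.B := fun a => X.hom a
  let z' : CompOp (plusPoly P) (plusPoly P) := ⟨z.op, fun n => (z.args n).op, z.compat⟩
  let k : (Σ n, (plusPoly P).E (z'.args n)) → X.left := fun p => (z.args p.1).args p.2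
  have hk : ∀ p, f (k p) = (comp (plusPoly P) (plusPoly P)).s z' p := fun p =>
    (z.args p.1).compat p.2
  have e1 : Tr.tree (extTr (((monad (plus P)).μ.app X).left z)) =
      (subst z').relabel (f := f) k hk := by
    refine (tree_extTr _).trans ?_
    refine (relabel_relabel (f := f) k hk ((plusMul P).onE z') ((plusMul P).s_onE z') _).symm.trans ?_
    exact congrArg (PTree.relabel (f := f) k hk) (hat_plusMul z')
  refine e1.trans ?_
  refine (relabel_sub (Q := P.X.pull z.op.1.nodeOp) k hk _ _).trans ?_
  refine Eq.trans ?_ (sub_relabel (f := fun a : Σ b, Tr (P := P) f b => a.1) _ z.compat _ _).symm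
  refine congrArg (fun F => PTree.sub (Q := P.X.pull z.op.1.nodeOp) F z.op.1.nodeSelf)
    (funext fun n => ?_)
  refine (relabel_relabel _ _ _ _ _).trans ?_
  refine Eq.trans ?_ (relabel_map _ (z.args n).compat _ _)
  exact congrArg (PTree.relabel (f := f) _ (z.args n).compat) (lift_cast (z.args n).op _ rfl _ (z.compat n))

/-- The monad of free operads over `P` is the Baez-Dolan construction. -/
theorem freeAdj_monad (P : Mon (PolyEndo I)) :
    Nonempty ((freeAdj P).toMonad ≅ monad (plus P)) := by
  refine ⟨(MonadIso.mk (M := monad (plus P)) (N := (freeAdj P).toMonad) (NatIso.ofComponents (fun X => Over.isoMk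
    (Equiv.ofBijective _ (extTr_bijective X)).toIso ?_) ?_) ?_ ?_).symm⟩
  · ext z
    rfl
  · intro X Y k
    ext z
    refine Tr.tree_injective ((tree_extTr _).trans (Eq.trans ?_ (free_map k (extTr z)).symm))
    refine Eq.trans ?_ (congrArg (PTree.relabel (f := fun a : Y.left => Y.hom a) k.left
      fun a => types_congr_hom (Over.w k) a) (tree_extTr z).symm)
    exact (relabel_relabel (f := fun a : Y.left => Y.hom a) (f' := fun a : X.left => X.hom a)
      k.left (fun a => types_congr_hom (Over.w k) a) z.args z.compat z.op.1.nodeSelf).symm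
  · intro X
    ext a
    exact extTr_unit X a
  · intro X
    ext z
    refine Tr.tree_injective ((extTr_mul X z).trans (Eq.trans ?_ (free_mul X _).symm))
    refine congrArg (PTree.sub (Q := P.X.pull
      fun a : Σ b, Tr (P := P) (fun a : X.left => X.hom a) b => a.1) _) ?_
    exact (tree_extTr (X := (forget P).obj (free fun a : X.left => X.hom a))
      ⟨z.op, fun n => extTr (z.args n), z.compat⟩).symm

end SetOperad
end PolyEndo

/-! ### Monads of adjunctions and their transport -/

section
variable {A A' C D : Type*} [Category A] [Category A'] [Category C] [Category D]

theorem toMonad_iso_of_leftAdjoint {L L' : D ⥤ A} {R : A ⥤ D} (adj : L ⊣ R) (adj' : L' ⊣ R) :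
    Nonempty (adj.toMonad ≅ adj'.toMonad) := by
  refine ⟨MonadIso.mk (M := adj.toMonad) (N := adj'.toMonad)
    (Functor.isoWhiskerRight (adj.leftAdjointUniq adj') R) (fun X => ?_) (fun X => ?_)⟩
  · exact adj.unit_leftAdjointUniq_hom_app adj' X
  · have h := adj.leftAdjointUniq_hom_app_counit adj' (L'.obj X)
    have h2 := adj.counit.naturality ((adj.leftAdjointUniq adj').hom.app X)
    dsimp at h h2
    change R.map (adj.counit.app (L.obj X)) ≫ R.map ((adj.leftAdjointUniq adj').hom.app X) =
      (R.map (L.map (R.map ((adj.leftAdjointUniq adj').hom.app X))) ≫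
        R.map ((adj.leftAdjointUniq adj').hom.app (R.obj (L'.obj X)))) ≫
          R.map (adj'.counit.app (L'.obj X))
    rw [← R.map_comp, ← R.map_comp, ← R.map_comp, Category.assoc, h, h2]

theorem toMonad_iso_of_rightAdjoint {L : D ⥤ A} {R R' : A ⥤ D} (adj : L ⊣ R) (α : R ≅ R') :
    Nonempty (adj.toMonad ≅ (adj.ofNatIsoRight α).toMonad) := by
  refine ⟨MonadIso.mk (M := adj.toMonad) (N := (adj.ofNatIsoRight α).toMonad)
    (Functor.isoWhiskerLeft L α) (fun X => ?_) (fun X => ?_)⟩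
  · simp
    rfl
  · have h : (adj.ofNatIsoRight α).counit.app (L.obj X) =
      L.map (α.inv.app (L.obj X)) ≫ adj.counit.app (L.obj X) := by simp
    change R.map (adj.counit.app (L.obj X)) ≫ α.hom.app (L.obj X) =
      (R.map (L.map (α.hom.app (L.obj X))) ≫ α.hom.app (L.obj (R'.obj (L.obj X)))) ≫
        R'.map ((adj.ofNatIsoRight α).counit.app (L.obj X))
    rw [h, Category.assoc, ← α.hom.naturality, ← R.map_comp_assoc, ← L.map_comp_assoc]
    simp

/-- Replacing the category of algebraic objects by an equivalent one inserts `E` and its inverse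
between `L` and `R`; the counit of `E` removes them, and its naturality makes this a map of monads.
-/
theorem toMonad_comp_equivalence {L : D ⥤ A} {R : A ⥤ D} (adj : L ⊣ R) (E : A' ≌ A) :
    Nonempty ((adj.comp E.symm.toAdjunction).toMonad ≅ adj.toMonad) := by
  have hc : ∀ Z, (adj.comp E.symm.toAdjunction).counit.app Z =
      E.inverse.map (adj.counit.app (E.functor.obj Z)) ≫ E.unitInv.app Z := fun Z => by
    simp
  refine ⟨MonadIso.mk (M := (adj.comp E.symm.toAdjunction).toMonad) (N := adj.toMonad)
    (NatIso.ofComponents (fun X => R.mapIso (E.counitIso.app (L.obj X))) fun {X Y} f => ?_)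
    (fun X => ?_) (fun X => ?_)⟩
  · change R.map (E.functor.map (E.inverse.map (L.map f))) ≫ R.map (E.counit.app (L.obj Y)) =
      R.map (E.counit.app (L.obj X)) ≫ R.map (L.map f)
    rw [← R.map_comp, ← R.map_comp]
    exact congrArg R.map (E.counit.naturality (L.map f))
  · have h : (adj.comp E.symm.toAdjunction).unit.app X =
      adj.unit.app X ≫ R.map (E.counitInv.app (L.obj X)) := by simp
    change (adj.comp E.symm.toAdjunction).unit.app X ≫ R.map (E.counit.app (L.obj X)) =
      adj.unit.app X
    rw [h, Category.assoc, ← R.map_comp]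
    simp
  · change R.map (E.functor.map ((adj.comp E.symm.toAdjunction).counit.app
        (E.inverse.obj (L.obj X)))) ≫ R.map (E.counit.app (L.obj X)) =
      (R.map (E.functor.map (E.inverse.map (L.map (R.map (E.counit.app (L.obj X)))))) ≫
        R.map (E.counit.app (L.obj (R.obj (L.obj X))))) ≫ R.map (adj.counit.app (L.obj X))
    rw [hc, ← R.map_comp, ← R.map_comp, ← R.map_comp]
    refine congrArg R.map ?_
    have h1 := E.counit.naturality (L.map (R.map (E.counit.app (L.obj X))))
    have h2 := adj.counit.naturality (E.counit.app (L.obj X))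
    have h3 := E.counit.naturality (adj.counit.app (E.functor.obj (E.inverse.obj (L.obj X))))
    dsimp at h1 h2 h3
    rw [h1, Category.assoc, h2, E.functor.map_comp, Category.assoc]
    rw [← reassoc_of% h3]
    simp

/-- Adjunctions over the same category with equivalent right adjoints have isomorphic monads. -/
theorem toMonad_iso {L : D ⥤ A} {R : A ⥤ D} {L' : D ⥤ A'} {R' : A' ⥤ D} (adj : L ⊣ R)
    (adj' : L' ⊣ R') (Φ : A ⥤ A') [Φ.IsEquivalence] (α : Φ ⋙ R' ≅ R) :
    Nonempty (adj.toMonad ≅ adj'.toMonad) := by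
  obtain ⟨i⟩ := toMonad_comp_equivalence adj' Φ.asEquivalence
  let adj'' : L' ⋙ Φ.asEquivalence.inverse ⊣ Φ ⋙ R' := adj'.comp Φ.asEquivalence.symm.toAdjunction
  obtain ⟨j⟩ := toMonad_iso_of_rightAdjoint adj'' α
  obtain ⟨k⟩ := toMonad_iso_of_leftAdjoint adj (adj''.ofNatIsoRight α)
  exact ⟨k ≪≫ j.symm ≪≫ i⟩

/-- A transported monad is by definition the monad of an adjunction with the algebras, and
isomorphic monads have equivalent categories of algebras over `C`, so `toMonad_iso` applies. -/
theorem transportMonad_congr (e : C ≌ D) {T T' : Monad C} (i : Nonempty (T ≅ T')) :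
    Nonempty (transportMonad e T ≅ transportMonad e T') := by
  obtain ⟨i⟩ := i
  exact toMonad_iso _ _ (Monad.algebraEquivOfIsoMonads i).functor
    (NatIso.ofComponents (fun X => Iso.refl (e.functor.obj X.A)) fun {X Y} f =>
      (Category.comp_id _).trans (Category.id_comp _).symm)

/-- The transport passes through the algebras, but its functor, unit and multiplication only involve
the monad. It may therefore be computed from any adjunction inducing the monad, with identities as
components of the isomorphism. -/
theorem transportMonad_toMonad (e : C ≌ D) {L : C ⥤ A} {R : A ⥤ C} (adj : L ⊣ R) :
    Nonempty (transportMonad e adj.toMonad ≅ (e.symm.toAdjunction.comp adj).toMonad) := by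
  refine ⟨MonadIso.mk (M := transportMonad e adj.toMonad)
    (N := (e.symm.toAdjunction.comp adj).toMonad)
    (NatIso.ofComponents (fun X => Iso.refl (e.functor.obj (R.obj (L.obj (e.inverse.obj X)))))
      fun {X Y} f => (Category.comp_id _).trans (Category.id_comp _).symm)
    (fun X => ?_) (fun X => ?_)⟩
  · refine (Category.comp_id _).trans ?_
    simp [transportMonad]
    rfl
  · have h1 : (transportMonad e adj.toMonad).μ.app X = e.functor.map (R.map (L.map (e.unitInv.app
        (R.obj (L.obj (e.inverse.obj X))))) ≫ R.map (adj.counit.app (L.obj (e.inverse.obj X)))) := by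
      simp only [transportMonad, Adjunction.toMonad_μ, Functor.whiskerRight_app,
        Functor.whiskerLeft_app, Adjunction.comp_counit_app, Functor.comp_map, Functor.map_comp]
      refine congrArg₂ (fun f g => f ≫ g) ?_ (congrArg e.functor.map ?_)
      · rfl
      · change (adj.toMonad.adj.counit.app _).f = _
        simp
        rfl
    have h2 : (e.symm.toAdjunction.comp adj).toMonad.μ.app X = e.functor.map (R.map (L.map
        (e.unitInv.app (R.obj (L.obj (e.inverse.obj X))))) ≫
          R.map (adj.counit.app (L.obj (e.inverse.obj X)))) := by
      simp
      rfl
    refine (Category.comp_id _).trans ?_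
    rw [h1, h2]
    refine Eq.trans ?_ (congrArg (fun f => f ≫ _) (Category.comp_id _).symm)
    have h3 : (transportMonad e adj.toMonad).map (𝟙 (e.functor.obj (R.obj (L.obj (e.inverse.obj X)))))
      = 𝟙 _ := CategoryTheory.Functor.map_id _ _
    exact ((congrArg (fun f => f ≫ _) h3).trans (Category.id_comp _)).symm

end

/-! ### Cartesian maps between polynomial functors -/

namespace PolyEndo
variable {I : Type u}

/-- The fibre maps of `f` are bijections, so the fibre part of `h` is determined by that of `h ≫ f`.
Equations between maps to `Q` can thus be checked over `S` and on operations. -/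
theorem onE_injective_of_comp {R Q S : PolyEndo I} {h h' : R ⟶ Q} (f : Q ⟶ S)
    (e : h ≫ f = h' ≫ f) (hB : ∀ r, h.onB r = h'.onB r) : h = h' := by
  obtain ⟨hb, hE, h1, h2, h3⟩ := h
  obtain ⟨hb', hE', h1', h2', h3'⟩ := h'
  obtain rfl : hb = hb' := funext hB
  refine hom_ext _ _ fun r => ⟨rfl, fun x => ?_⟩
  obtain ⟨y, rfl⟩ := (f.bij _).2 x
  have := Hom.mk.inj e
  exact congrFun (congrFun (eq_of_heq this.2) r) y

/-- On fibres one composes those of `g` with the inverse fibre bijections of `f`. With the previous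
lemma, maps into `Q` over `S` are the same as maps of operations over those of `S`. -/
theorem exists_factorization {R Q S : PolyEndo I} (f : Q ⟶ S) (g : R ⟶ S) (k : R.B → Q.B)
    (hk : ∀ r, f.onB (k r) = g.onB r) : ∃ h : R ⟶ Q, h ≫ f = g ∧ ∀ r, h.onB r = k r := by
  have key : ∀ (b : S.B) (E : Type u) (s : E → I) (g : S.E b → E) (_ : Function.Bijective g)
      (_ : ∀ e, s (g e) = S.s b e) (q : Q.B) (hq : f.onB q = b),
      ∃ x : Q.E q → E, Function.Bijective x ∧ (∀ e, s (x e) = Q.s q e) ∧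
        ∀ e, x (f.onE q e) = g (hq ▸ e) := by
    rintro _ E s g hg hs q rfl
    refine ⟨fun e => g ((Equiv.ofBijective _ (f.bij q)).symm e), hg.comp (Equiv.bijective _),
      fun e => ?_, fun e => ?_⟩
    · obtain ⟨y, rfl⟩ := (f.bij q).2 e
      refine ((congrArg (fun z => s (g z)) ((Equiv.ofBijective _ (f.bij q)).symm_apply_apply y)).trans
        (hs y)).trans (f.s_onE q y).symm
    · exact congrArg g ((Equiv.ofBijective _ (f.bij q)).symm_apply_apply e)
  choose x hx hs hx' using fun r => key (g.onB r) (R.E r) (R.s r) (g.onE r) (g.bij r) (g.s_onE r)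
    (k r) (hk r)
  refine ⟨⟨k, x, hx, fun r => ?_, hs⟩, ?_, fun _ => rfl⟩
  · exact (f.t_onB _).symm.trans ((congrArg S.t (hk r)).trans (g.t_onB r))
  · exact hom_ext _ _ fun r => ⟨hk r, hx' r⟩

/-- The projection of a pulled back polynomial functor. -/
def pullHom (P : PolyEndo I) {X : Type u} (f : X → P.B) : P.pull f ⟶ P where
  onB := f
  onE _ e := e
  bij _ := Function.bijective_id
  t_onB _ := rfl
  s_onE _ _ := rfl

theorem base_isEquivalence (P : Mon (PolyEndo I)) : (base P).IsEquivalence where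
  faithful := ⟨fun {Q R} g g' h => by
    refine Over.OverMorphism.ext (onE_injective_of_comp R.hom ?_ fun r => ?_)
    · exact (Over.w g).trans (Over.w g').symm
    · exact types_congr_hom (congrArg (fun k => k.left) h) r⟩
  full := ⟨fun {Q R} k => by
    obtain ⟨g, hg, hg'⟩ := exists_factorization R.hom Q.hom (fun b => k.left b) fun b =>
      types_congr_hom (Over.w k) b
    refine ⟨Over.homMk g hg, Over.OverMorphism.ext ?_⟩
    ext b
    exact hg' b⟩
  essSurj := ⟨fun X => ⟨Over.mk (pullHom P.X fun x : X.left => X.hom x),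
    ⟨Over.isoMk (Iso.refl _) rfl⟩⟩⟩

/-- The image of an element of an extension under a map of polynomial functors. -/
def extHom {Q R : PolyEndo I} (f : Q ⟶ R) {X : Over I} (z : Ext Q X) : Ext R X :=
  ⟨f.onB z.op, fun e => z.args (f.onE z.op e), fun e => (z.compat _).trans (f.s_onE _ e)⟩

theorem extHom_injective {Q R : PolyEndo I} (f : Q ⟶ R) {X : Over I} (b : Q.B) (k k' : Q.E b → X.left)
    (h h') (e : extHom f ⟨b, k, h⟩ = extHom f (⟨b, k', h'⟩ : Ext Q X)) : k = k' := by
  injection e with _ e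
  funext x
  obtain ⟨y, rfl⟩ := (f.bij b).2 x
  exact congrFun e y

/-- With `extHom_injective`, this is the pullback property of the naturality squares of `f`: a
decorated operation of `R` together with a preimage of the operation lifts uniquely to `Q`. -/
theorem exists_extHom {Q R : PolyEndo I} (f : Q ⟶ R) {X : Over I} (b : Q.B) (z : Ext R X)
    (h : f.onB b = z.op) : ∃ (k : Q.E b → X.left) (hk : _), extHom f ⟨b, k, hk⟩ = z := by
  obtain ⟨b', k, hk⟩ := z
  change f.onB b = b' at h
  subst h
  refine ⟨fun e => k ((Equiv.ofBijective _ (f.bij b)).symm e), fun e => ?_, ?_⟩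
  · obtain ⟨y, rfl⟩ := (f.bij b).2 e
    refine ((congrArg (fun z => X.hom (k z))
      ((Equiv.ofBijective _ (f.bij b)).symm_apply_apply y)).trans (hk y)).trans (f.s_onE b y).symm
  · unfold extHom
    congr 1
    funext e
    exact congrArg k ((Equiv.ofBijective _ (f.bij b)).symm_apply_apply e)

theorem extHom_muE {Q P : Mon (PolyEndo I)} (f : Q ⟶ P) {X : Over I} (b : Q.X.B)
    (z : Q.X.E b → Ext Q.X X) (h h') :
    extHom f.hom (PTree.muE Q X b z h) =
      PTree.muE P X (f.hom.onB b) (fun e => extHom f.hom (z (f.hom.onE b e))) h' := by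
  have e := IsMonHom.mul_hom f.hom
  exact types_congr_hom (congrArg (fun g => ((extMap g).app X).left) e)
    (⟨⟨b, fun e => (z e).op, h⟩, fun p => (z p.1).args p.2, fun p => (z p.1).compat p.2⟩ :
      Ext (comp Q.X Q.X) X)

theorem onB_one {Q P : Mon (PolyEndo I)} (f : Q ⟶ P) (i : I) :
    f.hom.onB ((MonObj.one (X := Q.X)).onB i) = (MonObj.one (X := P.X)).onB i :=
  congrFun (congrArg Hom.onB (IsMonHom.one_hom f.hom)) i

theorem extHom_one {Q P : Mon (PolyEndo I)} (f : Q ⟶ P) {X : Over I} (x : X.left) (i : I) (h h') :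
    extHom f.hom (⟨(MonObj.one (X := Q.X)).onB i, fun _ => x, h⟩ : Ext Q.X X) =
      ⟨(MonObj.one (X := P.X)).onB i, fun _ => x, h'⟩ := by
  have key : ∀ (b b' : P.X.B) (_ : b = b') (h h'), (⟨b, fun _ => x, h⟩ : Ext P.X X) =
      ⟨b', fun _ => x, h'⟩ := by
    rintro b _ rfl _ _
    rfl
  exact key _ _ (onB_one f i) _ _

end PolyEndo

/-! ### Polynomial monads over `P` as operads -/

namespace PolyEndo
open PTree
variable {I : Type u} {P : Mon (PolyEndo I)}

namespace SetOperad

section ofHom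
variable {Q : Mon (PolyEndo I)} (f : Q ⟶ P)

/-- The unique preimage with operation `b` of an element of an extension. -/
noncomputable def preExt {X : Over I} (b : Q.X.B) (z : Ext P.X X) (h : f.hom.onB b = z.op) :
    Ext Q.X X :=
  ⟨b, (exists_extHom f.hom b z h).choose, (exists_extHom f.hom b z h).choose_spec.choose⟩

theorem extHom_preExt {X : Over I} (b : Q.X.B) (z : Ext P.X X) (h : f.hom.onB b = z.op) :
    extHom f.hom (preExt f b z h) = z :=
  (exists_extHom f.hom b z h).choose_spec.choose_spec

/-- Preimages are unique, so the chosen one can be replaced by any explicit candidate. -/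
theorem preExt_eq {X : Over I} (b : Q.X.B) (z : Ext P.X X) (h : f.hom.onB b = z.op) (k hk)
    (e : extHom f.hom (⟨b, k, hk⟩ : Ext Q.X X) = z) : preExt f b z h = ⟨b, k, hk⟩ := by
  have h1 := extHom_injective f.hom b _ k (preExt f b z h).compat hk
    ((extHom_preExt f b z h).trans e.symm)
  exact mk_congr (W := X) (P := Q) b h1 _ _

/-- An operation decorated by operations of `Q`. -/
def toComp (z : Ext Q.X (typeObj (P := P) f.hom.onB)) : CompOp Q.X Q.X :=
  ⟨z.op, z.args, fun e => (f.hom.t_onB _).symm.trans (z.compat e)⟩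

/-- The multiplication of `Q` on decorated operations. -/
def mulExt (z : Ext Q.X (typeObj (P := P) f.hom.onB)) : Q.X.B := (MonObj.mul (X := Q.X)).onB (toComp f z)

theorem onB_mulExt (z : Ext Q.X (typeObj (P := P) f.hom.onB)) :
    f.hom.onB (mulExt f z) = (MonObj.mul (X := P.X)).onB (extHom f.hom z).compOp :=
  congrFun (congrArg PolyEndo.Hom.onB (IsMonHom.mul_hom f.hom)) (toComp f z)

theorem one_mulExt (b : Q.X.B) (i : I) (hi : Q.X.t b = i) (h) :
    mulExt f ⟨(MonObj.one (X := Q.X)).onB i, fun _ => b, h⟩ = b := by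
  subst hi
  exact congrFun (congrArg PolyEndo.Hom.onB (MonObj.one_mul Q.X)) ⟨Q.X.t b, fun _ => b, fun _ => rfl⟩

theorem mulExt_one (b : Q.X.B) (h) :
    mulExt f ⟨b, fun e => (MonObj.one (X := Q.X)).onB (Q.X.s b e), h⟩ = b :=
  congrFun (congrArg PolyEndo.Hom.onB (MonObj.mul_one Q.X)) ⟨b, fun e => Q.X.s b e, fun _ => rfl⟩

theorem mulExt_assoc (b : Q.X.B) (z : Q.X.E b → Ext Q.X (typeObj (P := P) f.hom.onB))
    (h : ∀ e, Q.X.t (z e).op = Q.X.s b e) (h') :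
    mulExt f (muE Q _ b z h) = mulExt f ⟨b, fun e => mulExt f (z e), h'⟩ :=
  congrFun (congrArg PolyEndo.Hom.onB (MonObj.mul_assoc Q.X))
    ⟨⟨b, fun e => (z e).op, h⟩, fun p => (z p.1).args p.2,
      fun p => (f.hom.t_onB _).symm.trans ((z p.1).compat p.2)⟩

/-- The operad of a polynomial monad over `P`. -/
noncomputable def ofHom : SetOperad P where
  carrier := Q.X.B
  op := f.hom.onB
  one := (MonObj.one (X := Q.X)).onB
  op_one := onB_one f
  mul x z h := mulExt f (preExt f x z h)
  op_mul x z h := (onB_mulExt f _).trans (congrArg (fun z => (MonObj.mul (X := P.X)).onB z.compOp)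
    (extHom_preExt f x z h))
  one_mul x h := by
    have ht : Q.X.t x = P.X.t (f.hom.onB x) := (f.hom.t_onB x).symm
    have hk : ∀ e, (typeObj (P := P) f.hom.onB).hom x =
        Q.X.s ((MonObj.one (X := Q.X)).onB (P.X.t (f.hom.onB x))) e := fun e =>
      ((MonObj.one (X := Q.X)).s_onE (P.X.t (f.hom.onB x)) e)
    refine (congrArg (mulExt f) (preExt_eq f _ _ _ (fun _ => x) hk ?_)).trans
      (one_mulExt f x _ ht _)
    exact extHom_one f _ _ _ _
  mul_one x h := by
    have hk : ∀ e, (typeObj (P := P) f.hom.onB).hom ((MonObj.one (X := Q.X)).onB (Q.X.s x e)) =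
        Q.X.s x e := fun e => (f.hom.t_onB _).trans ((MonObj.one (X := Q.X)).t_onB _)
    refine (congrArg (mulExt f) (preExt_eq f _ _ _ (fun e =>
      (MonObj.one (X := Q.X)).onB (Q.X.s x e)) hk ?_)).trans (mulExt_one f x _)
    refine mk_congr (P := P) _ (funext fun e => ?_) _ _
    exact congrArg (MonObj.one (X := Q.X)).onB (f.hom.s_onE x e)
  mul_assoc x z h w hw h₁ h₂ h₃ := by
    -- All decorations are moved from the inputs in `P` to the inputs in `Q` along the fibre
    -- bijections; what remains is associativity of `Q`, in the form `mulExt_assoc`.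
    obtain ⟨k, hk, rfl⟩ := exists_extHom f.hom x z h
    have e0 : ∀ h', preExt f x (extHom f.hom ⟨x, k, hk⟩) h' = ⟨x, k, hk⟩ := fun h' =>
      preExt_eq f _ _ _ _ _ rfl
    obtain ⟨w, rfl⟩ : ∃ w' : Q.X.E x → Ext P.X (typeObj (P := P) f.hom.onB),
        w = fun e => w' (f.hom.onE x e) := by
      refine ⟨fun e => w ((Equiv.ofBijective _ (f.hom.bij x)).symm e), funext fun e => ?_⟩
      exact (congrArg w ((Equiv.ofBijective _ (f.hom.bij x)).symm_apply_apply e)).symm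
    have hw' : ∀ e, f.hom.onB (k e) = (w e).op := fun e => by
      obtain ⟨y, rfl⟩ := (f.hom.bij x).2 e
      exact hw y
    choose v hv hv' using fun e => exists_extHom f.hom (k e) (w e) (hw' e)
    obtain rfl : (fun e => extHom f.hom (⟨k e, v e, hv e⟩ : Ext Q.X (typeObj (P := P) f.hom.onB))) = w := funext hv'
    have hz : ∀ e, Q.X.t (⟨k e, v e, hv e⟩ : Ext Q.X (typeObj (P := P) f.hom.onB)).op = Q.X.s x e :=
      fun e => (f.hom.t_onB _).symm.trans (hk e)
    have e1 := extHom_muE f x (fun e => (⟨k e, v e, hv e⟩ : Ext Q.X (typeObj (P := P) f.hom.onB)))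
      hz h₁
    have e2 : mulExt f (preExt f x (extHom f.hom ⟨x, k, hk⟩) h) = (muE Q _ x
      (fun e => (⟨k e, v e, hv e⟩ : Ext Q.X (typeObj (P := P) f.hom.onB))) hz).op :=
      congrArg (mulExt f) (e0 h)
    have e3 : preExt f (mulExt f (preExt f x (extHom f.hom ⟨x, k, hk⟩) h)) _ h₂ = muE Q _ x
      (fun e => (⟨k e, v e, hv e⟩ : Ext Q.X (typeObj (P := P) f.hom.onB))) hz := by
      have key : ∀ (b : Q.X.B) (y : Ext Q.X (typeObj (P := P) f.hom.onB)) (_ : b = y.op) (z) (h)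
          (_ : extHom f.hom y = z), preExt f b z h = y := by
        rintro _ y rfl z h e
        exact preExt_eq f _ _ _ _ _ e
      exact key _ _ e2 _ _ e1
    have hm : ∀ e, mulExt f (preExt f (k e) (extHom f.hom ⟨k e, v e, hv e⟩) rfl) =
        mulExt f ⟨k e, v e, hv e⟩ := fun e => congrArg (mulExt f) (preExt_eq f _ _ _ _ _ rfl)
    have h4 : ∀ e, (typeObj (P := P) f.hom.onB).hom (mulExt f ⟨k e, v e, hv e⟩) = Q.X.s x e :=
      fun e => ((f.hom.t_onB _).trans ((MonObj.mul (X := Q.X)).t_onB _)).trans (hz e)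
    refine (congrArg (mulExt f) e3).trans ((mulExt_assoc f x _ hz h4).trans ?_)
    refine congrArg (mulExt f) (Eq.symm ?_)
    refine preExt_eq (X := typeObj (P := P) f.hom.onB) f x _ _
      (fun e => mulExt f ⟨k e, v e, hv e⟩) h4 ?_
    exact mk_congr (P := P) _ (funext fun e => (hm _).symm) _ _

end ofHom

theorem extHom_left {Q R : Over P} (g : Q ⟶ R) {X : Over I} (z : Ext Q.left.X X) :
    extHom R.hom.hom (extHom g.left.hom z) = extHom Q.hom.hom z :=
  congrArg (fun k : Q.left.X ⟶ P.X => extHom k z) (congrArg (fun k => k.hom) (Over.w g))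

/-- The functor from polynomial monads over `P` to operads. -/
noncomputable def ofOver (P : Mon (PolyEndo I)) : Over P ⥤ SetOperad P where
  obj Q := ofHom Q.hom
  map {Q R} g :=
    { toFun := g.left.hom.onB
      op_toFun := fun x => congrFun (congrArg (fun k => PolyEndo.Hom.onB k.hom) (Over.w g)) x
      map_one := onB_one g.left
      map_mul := fun x z h => by
        obtain ⟨k, hk, rfl⟩ := exists_extHom Q.hom.hom x z h
        have hg : ∀ x, R.hom.hom.onB (g.left.hom.onB x) = Q.hom.hom.onB x := fun x =>
          congrFun (congrArg (fun k => PolyEndo.Hom.onB k.hom) (Over.w g)) x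
        have hk' : ∀ e, (typeObj (P := P) R.hom.hom.onB).hom (g.left.hom.onB (k e)) =
            Q.left.X.s x e := fun e => (congrArg P.X.t (hg (k e))).trans (hk e)
        have e1 := preExt_eq Q.hom x _ h k hk rfl
        have e2 := preExt_eq R.hom (g.left.hom.onB x)
          (mapExt g.left.hom.onB hg (extHom Q.hom.hom ⟨x, k, hk⟩)) ((hg x).trans h) _ _
          (extHom_left g (X := typeObj (P := P) R.hom.hom.onB)
            ⟨x, fun e => g.left.hom.onB (k e), hk'⟩)
        refine (congrArg (fun y => g.left.hom.onB (mulExt Q.hom y)) e1).trans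
          (Eq.trans ?_ (congrArg (mulExt R.hom) e2).symm)
        exact congrFun (congrArg PolyEndo.Hom.onB (IsMonHom.mul_hom g.left.hom))
          (toComp Q.hom ⟨x, k, hk⟩) }

theorem exists_iso {M N : SetOperad P} (f : M ⟶ N) (g : N.carrier → M.carrier)
    (h : ∀ x, g (f.toFun x) = x) (h' : ∀ y, f.toFun (g y) = y) : IsIso f := by
  refine ⟨⟨g, fun y => (f.op_toFun _).symm.trans (congrArg N.op (h' y)), fun i => ?_,
    fun y z hy => ?_⟩, hom_ext _ _ h, hom_ext _ _ h'⟩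
  · exact (congrArg g (f.map_one i)).symm.trans (h _)
  · refine Eq.trans (congrArg g ?_) (h _)
    refine Eq.trans ?_ (f.map_mul _ _ _).symm
    exact N.mul_congr (h' y).symm (mk_congr _ (funext fun e => (h' _).symm) _ _) _ _

section ess
variable (M : SetOperad P)

/-- The polynomial endofunctor underlying an operad. -/
abbrev polyEndo : PolyEndo I := P.X.pull M.op

/-- The projection to `P`. -/
abbrev proj : M.polyEndo ⟶ P.X := pullHom P.X M.op

/-- The unit of the polynomial monad of an operad. -/
noncomputable def oneHom : unit I ⟶ M.polyEndo :=
  (exists_factorization M.proj (MonObj.one (X := P.X)) M.one M.op_one).choose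

/-- The multiplication of the polynomial monad of an operad. -/
noncomputable def mulHom : comp M.polyEndo M.polyEndo ⟶ M.polyEndo :=
  (exists_factorization M.proj (compMap M.proj M.proj ≫ MonObj.mul (X := P.X))
    (fun z : CompOp M.polyEndo M.polyEndo => M.mul z.op ⟨M.op z.op, z.args, z.compat⟩ rfl)
    (fun _ => M.op_mul _ _ _)).choose

theorem oneHom_proj : M.oneHom ≫ M.proj = MonObj.one (X := P.X) :=
  (exists_factorization M.proj (MonObj.one (X := P.X)) M.one M.op_one).choose_spec.1

theorem oneHom_onB (i : I) : M.oneHom.onB i = M.one i :=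
  (exists_factorization M.proj (MonObj.one (X := P.X)) M.one M.op_one).choose_spec.2 i

theorem mulHom_proj : M.mulHom ≫ M.proj = compMap M.proj M.proj ≫ MonObj.mul (X := P.X) :=
  (exists_factorization M.proj (compMap M.proj M.proj ≫ MonObj.mul (X := P.X))
    (fun z : CompOp M.polyEndo M.polyEndo => M.mul z.op ⟨M.op z.op, z.args, z.compat⟩ rfl)
    (fun _ => M.op_mul _ _ _)).choose_spec.1

theorem mulHom_onB (z : CompOp M.polyEndo M.polyEndo) :
    M.mulHom.onB z = M.mul z.op ⟨M.op z.op, z.args, z.compat⟩ rfl :=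
  (exists_factorization M.proj (compMap M.proj M.proj ≫ MonObj.mul (X := P.X))
    (fun z : CompOp M.polyEndo M.polyEndo => M.mul z.op ⟨M.op z.op, z.args, z.compat⟩ rfl)
    (fun _ => M.op_mul _ _ _)).choose_spec.2 z

theorem mk_const {X : Over I} (x : X.left) {b b' : P.X.B} (hb : b = b') (h h') :
    (⟨b, fun _ => x, h⟩ : Ext P.X X) = ⟨b', fun _ => x, h'⟩ := by
  subst hb
  rfl

/-- The monoid laws of `M.polyEndo` all follow by `onE_injective_of_comp`: after projection to `P`
they are the laws of `P`, and on operations they are the laws of `M`. -/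
theorem polyEndo_one_mul : compMap M.oneHom (𝟙 M.polyEndo) ≫ M.mulHom = leftHom M.polyEndo := by
  refine onE_injective_of_comp M.proj ?_ fun z => ?_
  · refine (congrArg (compMap M.oneHom (𝟙 M.polyEndo) ≫ ·) M.mulHom_proj).trans ?_
    refine (congrArg (fun k => compMap k M.proj ≫ MonObj.mul (X := P.X)) M.oneHom_proj).trans ?_
    exact congrArg (compMap (𝟙 (unit I)) M.proj ≫ ·) (MonObj.one_mul P.X)
  · refine (M.mulHom_onB _).trans ?_
    obtain ⟨i, y, hy⟩ := z
    have hy : P.X.t (M.op (y PUnit.unit)) = i := hy PUnit.unit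
    have h1 : ∀ e, (typeObj M.op).hom (y PUnit.unit) =
        P.X.s ((MonObj.one (X := P.X)).onB i) e := fun e =>
      hy.trans ((MonObj.one (X := P.X)).s_onE i e)
    refine (M.mul_congr (M.oneHom_onB i) ?_ _ _).trans (M.one_mul' (y PUnit.unit) i hy h1)
    exact mk_const (X := typeObj M.op) (y PUnit.unit)
      ((congrArg M.op (M.oneHom_onB i)).trans (M.op_one i)) _ _

theorem polyEndo_mul_one : compMap (𝟙 M.polyEndo) M.oneHom ≫ M.mulHom = rightHom M.polyEndo := by
  refine onE_injective_of_comp M.proj ?_ fun z => ?_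
  · refine (congrArg (compMap (𝟙 M.polyEndo) M.oneHom ≫ ·) M.mulHom_proj).trans ?_
    refine (congrArg (fun k => compMap M.proj k ≫ MonObj.mul (X := P.X)) M.oneHom_proj).trans ?_
    exact congrArg (compMap M.proj (𝟙 (unit I)) ≫ ·) (MonObj.mul_one P.X)
  · refine (M.mulHom_onB _).trans ?_
    obtain ⟨x, y, hy⟩ := z
    have h1 : ∀ e, (typeObj M.op).hom (M.one (P.X.s (M.op x) e)) = P.X.s (M.op x) e := fun e =>
      (congrArg P.X.t (M.op_one _)).trans ((MonObj.one (X := P.X)).t_onB _)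
    refine (M.mul_congr rfl (mk_congr _ (funext fun e => ?_) _ h1) _ rfl).trans (M.mul_one x h1)
    exact (M.oneHom_onB _).trans (congrArg M.one (hy e))

theorem polyEndo_mul_assoc : compMap M.mulHom (𝟙 M.polyEndo) ≫ M.mulHom =
    assocHom _ _ _ ≫ compMap (𝟙 M.polyEndo) M.mulHom ≫ M.mulHom := by
  have hm := M.mulHom_proj
  refine onE_injective_of_comp M.proj ?_ fun z => ?_
  · refine (congrArg (compMap M.mulHom (𝟙 M.polyEndo) ≫ ·) hm).trans ?_
    refine (congrArg (fun k => compMap k M.proj ≫ MonObj.mul (X := P.X)) hm).trans ?_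
    refine Eq.trans ?_ (congrArg (fun k => assocHom M.polyEndo M.polyEndo M.polyEndo ≫
      compMap (𝟙 M.polyEndo) M.mulHom ≫ k) hm).symm
    refine Eq.trans ?_ (congrArg (fun k => assocHom M.polyEndo M.polyEndo M.polyEndo ≫
      compMap M.proj k ≫ MonObj.mul (X := P.X)) hm).symm
    exact congrArg (compMap (compMap M.proj M.proj) M.proj ≫ ·) (MonObj.mul_assoc P.X)
  · refine (M.mulHom_onB _).trans ?_
    refine Eq.trans ?_ (M.mulHom_onB _).symm
    obtain ⟨⟨x, y, hy⟩, v, hv⟩ := z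
    have e := congrArg (fun k => extHom k (⟨⟨x, y, hy⟩, v, hv⟩ :
      Ext (comp M.polyEndo M.polyEndo) (typeObj M.op))) hm
    have h3 : ∀ e, (typeObj M.op).hom (M.mul (y e) ⟨M.op (y e), fun i => v ⟨e, i⟩,
        fun i => hv ⟨e, i⟩⟩ rfl) = P.X.s (M.op x) e := fun e =>
      ((congrArg P.X.t (M.op_mul _ _ _)).trans ((MonObj.mul (X := P.X)).t_onB _)).trans (hy e)
    refine (M.mul_congr (M.mulHom_onB _) e _ (M.op_mul _ _ _)).trans ?_
    refine (M.mul_assoc x ⟨M.op x, y, hy⟩ rfl (fun e => ⟨M.op (y e), fun i => v ⟨e, i⟩,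
      fun i => hv ⟨e, i⟩⟩) (fun e => rfl) hy _ h3).trans ?_
    exact M.mul_congr rfl (mk_congr _ (funext fun e => (M.mulHom_onB
      ⟨y e, fun i => v ⟨e, i⟩, fun i => hv ⟨e, i⟩⟩).symm) _ _) _ _

/-- The polynomial monad of an operad. -/
noncomputable def mon : Mon (PolyEndo I) where
  X := M.polyEndo
  mon :=
    { one := M.oneHom
      mul := M.mulHom
      one_mul := M.polyEndo_one_mul
      mul_one := M.polyEndo_mul_one
      mul_assoc := M.polyEndo_mul_assoc }

/-- The polynomial monad of an operad, over `P`. -/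
noncomputable def toOver : Over P :=
  Over.mk (Y := M.mon) (Mon.Hom.mk (M := M.mon) (N := P) M.proj
    (isMonHom_hom := ⟨M.oneHom_proj, M.mulHom_proj⟩))

end ess

/-- Maps over `P` are maps of operations over `P`, which yields faithfulness and fullness. An operad
`M` comes from the pullback of `P` along `M.op`, with the monad structure `M.mon`. -/
instance (P : Mon (PolyEndo I)) : (ofOver P).IsEquivalence where
  faithful := ⟨fun {Q R} g g' h => by
    refine Over.OverMorphism.ext (Mon.Hom.ext (onE_injective_of_comp R.hom.hom ?_ fun r => ?_))
    · exact congrArg (fun k => k.hom) ((Over.w g).trans (Over.w g').symm)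
    · exact congrFun (congrArg Hom.toFun h) r⟩
  full := ⟨fun {Q R} k => by
    obtain ⟨g, hg, hg'⟩ := exists_factorization R.hom.hom Q.hom.hom k.toFun k.op_toFun
    obtain ⟨kf, ko, k1, km⟩ := k
    obtain rfl : g.onB = kf := funext hg'
    have h1 : IsMonHom g := by
      constructor
      · refine onE_injective_of_comp R.hom.hom ?_ k1
        rw [Category.assoc, hg, IsMonHom.one_hom, IsMonHom.one_hom]
      · refine onE_injective_of_comp R.hom.hom ?_ fun z => ?_
        · rw [Category.assoc, hg, IsMonHom.mul_hom, Category.assoc, IsMonHom.mul_hom]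
          exact congrArg (fun k => compMap k k ≫ MonObj.mul (X := P.X)) hg.symm
        · have hz : ∀ e, (typeObj (P := P) Q.hom.hom.onB).hom (z.args e) = Q.left.X.s z.op e :=
            fun e => (Q.hom.hom.t_onB _).trans (z.compat e)
          have hz' : ∀ e, (typeObj (P := P) R.hom.hom.onB).hom (g.onB (z.args e)) =
            Q.left.X.s z.op e := fun e =>
              (R.hom.hom.t_onB _).trans ((g.t_onB _).trans (z.compat _))
          have e1 := preExt_eq (X := typeObj (P := P) Q.hom.hom.onB) Q.hom z.op
            (extHom Q.hom.hom ⟨z.op, z.args, hz⟩) rfl z.args hz rfl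
          have e2 := preExt_eq R.hom (g.onB z.op) (mapExt g.onB ko
            (extHom Q.hom.hom ⟨z.op, z.args, hz⟩)) (ko z.op) (fun e => g.onB (z.args (g.onE _ e)))
            (fun e => (hz' _).trans (g.s_onE _ _))
            (congrArg (fun k => extHom k (⟨z.op, fun e => g.onB (z.args e), hz'⟩ :
              Ext Q.left.X (typeObj (P := P) R.hom.hom.onB))) hg)
          refine (congrArg (fun y => g.onB (mulExt Q.hom y)) e1).symm.trans ?_
          exact (km z.op (extHom Q.hom.hom ⟨z.op, z.args, hz⟩) rfl).trans
            (congrArg (mulExt R.hom) e2)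
    refine ⟨Over.homMk (Mon.Hom.mk g) (Mon.Hom.ext hg), hom_ext _ _ hg'⟩⟩
  essSurj := ⟨fun M => ⟨M.toOver, by
    let f : (ofOver P).obj M.toOver ⟶ M :=
      { toFun := fun x => x
        op_toFun := fun _ => rfl
        map_one := M.oneHom_onB
        map_mul := fun x z h => by
          obtain ⟨b, v, hv⟩ := z
          change M.op x = b at h
          subst h
          refine (congrArg (mulExt M.toOver.hom) (preExt_eq M.toOver.hom x _ rfl v hv rfl)).trans ?_
          exact M.mulHom_onB _ }
    have := exists_iso f (fun x => x) (fun _ => rfl) (fun _ => rfl)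
    exact ⟨asIso f⟩⟩⟩

/-- The functor to operads commutes with the forgetful functors. -/
noncomputable def ofOverForget (P : Mon (PolyEndo I)) : ofOver P ⋙ forget P ≅ forgetOver P ⋙ base P :=
  NatIso.ofComponents (fun _ => Iso.refl _) fun _ =>
    (Category.comp_id _).trans (Category.id_comp _).symm

end SetOperad
end PolyEndo

/-! ### Elements of terminal objects and pullbacks in slices of sets -/

open Limits in
/-- Elements of an object of a slice of sets. -/
def Over.point {J : Type u} (X : Over J) (x : X.left) : Over.mk (↾ fun _ : PUnit.{u + 1} => X.hom x) ⟶ X :=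
  Over.homMk (↾ fun _ => x)

section
open Limits
variable {J : Type u}

theorem terminal_hom_bijective : Function.Bijective fun x : (⊤_ (Over J)).left => (⊤_ (Over J)).hom x := by
  let i : (⊤_ (Over J)) ≅ Over.mk (𝟙 J) := terminalIsTerminal.uniqueUpToIso Over.mkIdTerminal
  have h : ∀ x, i.hom.left x = (⊤_ (Over J)).hom x := fun x => types_congr_hom (Over.w i.hom) x
  have h1 : ∀ x, i.inv.left (i.hom.left x) = x := fun x =>
    types_congr_hom (congrArg (fun k => k.left) i.hom_inv_id) x
  have h2 : ∀ x, i.hom.left (i.inv.left x) = x := fun x =>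
    types_congr_hom (congrArg (fun k => k.left) i.inv_hom_id) x
  refine ⟨fun x y hxy => ?_, fun y => ⟨i.inv.left y, (h _).symm.trans (h2 y)⟩⟩
  have := ((h x).trans hxy).trans (h y).symm
  exact (h1 x).symm.trans ((congrArg i.inv.left this).trans (h1 y))

/-- Elements are maps from one-point objects over `J`, so the universal property of an abstract
pullback can be tested on elements. The same applies to existence in the next lemma. -/
theorem pullback_element_ext {X Y Z : Over J} (f : X ⟶ Z) (g : Y ⟶ Z) (t t' : (pullback f g).left)
    (h : (pullback.fst f g).left t = (pullback.fst f g).left t')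
    (h' : (pullback.snd f g).left t = (pullback.snd f g).left t') : t = t' := by
  have e : (pullback f g).hom t = (pullback f g).hom t' := by
    have h1 := types_congr_hom (Over.w (pullback.fst f g)) t
    have h2 := types_congr_hom (Over.w (pullback.fst f g)) t'
    exact h1.symm.trans ((congrArg X.hom h).trans h2)
  let a : Over.mk (↾ fun _ : PUnit.{u + 1} => (pullback f g).hom t) ⟶ pullback f g := Over.point _ t
  let b : Over.mk (↾ fun _ : PUnit.{u + 1} => (pullback f g).hom t) ⟶ pullback f g :=
    Over.homMk (↾ fun _ => t') (by ext; exact e.symm)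
  have : a = b := by
    refine pullback.hom_ext (Over.OverMorphism.ext ?_) (Over.OverMorphism.ext ?_)
    · ext ⟨⟩
      exact h
    · ext ⟨⟩
      exact h'
  exact types_congr_hom (congrArg (fun k => k.left) this) PUnit.unit

theorem exists_pullback_element {X Y Z : Over J} (f : X ⟶ Z) (g : Y ⟶ Z) (x : X.left) (y : Y.left)
    (h : f.left x = g.left y) : ∃ t : (pullback f g).left,
      (pullback.fst f g).left t = x ∧ (pullback.snd f g).left t = y := by
  have e : Y.hom y = X.hom x := by
    have h1 := types_congr_hom (Over.w f) x
    have h2 := types_congr_hom (Over.w g) y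
    exact h2.symm.trans ((congrArg Z.hom h).symm.trans h1)
  let a : Over.mk (↾ fun _ : PUnit.{u + 1} => X.hom x) ⟶ X := Over.point _ x
  let b : Over.mk (↾ fun _ : PUnit.{u + 1} => X.hom x) ⟶ Y := Over.homMk (↾ fun _ => y) (by ext; exact e)
  have hab : a ≫ f = b ≫ g := by
    refine Over.OverMorphism.ext ?_
    ext ⟨⟩
    exact h
  refine ⟨(pullback.lift a b hab).left PUnit.unit, ?_, ?_⟩
  · exact types_congr_hom (congrArg (fun k => k.left) (pullback.lift_fst a b hab)) PUnit.unit
  · exact types_congr_hom (congrArg (fun k => k.left) (pullback.lift_snd a b hab)) PUnit.unit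

end

/-! ### Collections for a monad described by a polynomial monad -/

namespace PolyEndo
open PTree Limits
variable {I J : Type u} {P : Mon (PolyEndo I)} {φ : I ≃ J} {T : Monad (Over J)}

/-- Pulling back along a bijection. -/
def pb (φ : I ≃ J) (A : Over J) : Over I := Over.mk (↾ fun a : A.left => φ.symm (A.hom a))

/-- A description of the elements of the values of a monad on `Over J` by those of a polynomial monad
on `Over I`, where `I ≃ J`. -/
structure Rep (P : Mon (PolyEndo I)) (φ : I ≃ J) (T : Monad (Over J)) where
  el : ∀ A : Over J, Ext P.X (pb φ A) → (T.obj A).left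
  bij : ∀ A, Function.Bijective (el A)
  hom_el : ∀ A z, (T.obj A).hom (el A z) = φ (P.X.t z.op)
  map_el : ∀ {A A'} (k : A ⟶ A') (b : P.X.B) (z : P.X.E b → A.left) (h h'),
    (T.map k).left (el A ⟨b, z, h⟩) = el A' ⟨b, fun e => k.left (z e), h'⟩
  η_el : ∀ A (a : A.left) (h),
    (T.η.app A).left a = el A ⟨(MonObj.one (X := P.X)).onB (φ.symm (A.hom a)), fun _ => a, h⟩
  μ_el : ∀ A (b : P.X.B) (z : P.X.E b → Ext P.X (pb φ A)) (h h'),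
    (T.μ.app A).left (el (T.obj A) ⟨b, fun e => el A (z e), h'⟩) = el A (muE P _ b z h)

namespace Rep

/-- The elements of the values of the monad of `P`. -/
def refl (P : Mon (PolyEndo I)) : Rep P (Equiv.refl I) (monad P) where
  el _ z := z
  bij _ := Function.bijective_id
  hom_el _ _ := rfl
  map_el _ _ _ _ _ := rfl
  η_el _ _ _ := rfl
  μ_el _ _ _ _ _ := rfl

variable (ρ : Rep P φ T)

/-- The operation of an element of `T 1`. -/
noncomputable def opTop (t : (T.obj (⊤_ (Over J))).left) : P.X.B :=
  ((Equiv.ofBijective _ (ρ.bij _)).symm t).op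

theorem opTop_el (z) : ρ.opTop (ρ.el _ z) = z.op :=
  congrArg Ext.op ((Equiv.ofBijective _ (ρ.bij _)).symm_apply_apply z)

/-- The element of the terminal object over `i`. -/
noncomputable def pt (φ : I ≃ J) (i : I) : (⊤_ (Over J)).left := (terminal_hom_bijective.2 (φ i)).choose

theorem pt_hom (i : I) : (⊤_ (Over J)).hom (pt φ i) = φ i :=
  (terminal_hom_bijective.2 (φ i)).choose_spec

theorem pb_pt (i : I) : (pb φ (⊤_ (Over J))).hom (pt φ i) = i :=
  (congrArg φ.symm (pt_hom i)).trans (φ.symm_apply_apply i)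

theorem eq_pt {x : (⊤_ (Over J)).left} {i : I} (h : (pb φ (⊤_ (Over J))).hom x = i) : x = pt φ i :=
  terminal_hom_bijective.1 <| by
    refine Eq.trans ?_ (pt_hom i).symm
    exact (φ.symm_apply_eq).1 h

/-- The element of `T 1` with a given operation. -/
noncomputable def elTop (b : P.X.B) : (T.obj (⊤_ (Over J))).left :=
  ρ.el _ ⟨b, fun e => pt φ (P.X.s b e), fun _ => pb_pt _⟩

theorem opTop_elTop (b : P.X.B) : ρ.opTop (ρ.elTop b) = b := ρ.opTop_el _

/-- Over the terminal object the decorations are forced by their types, so an element of `T 1` is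
nothing but an operation. -/
theorem elTop_opTop (t) : ρ.elTop (ρ.opTop t) = t := by
  obtain ⟨z, rfl⟩ := (ρ.bij _).2 t
  rw [opTop_el]
  refine congrArg (ρ.el _) ?_
  exact SetOperad.mk_congr (P := P) _ (funext fun e => (eq_pt (z.compat e)).symm) _ _

theorem opTop_bijective : Function.Bijective ρ.opTop :=
  ⟨fun a b h => (ρ.elTop_opTop a).symm.trans ((congrArg ρ.elTop h).trans (ρ.elTop_opTop b)),
    fun b => ⟨_, ρ.opTop_elTop b⟩⟩

theorem hom_opTop (t) : (T.obj (⊤_ (Over J))).hom t = φ (P.X.t (ρ.opTop t)) := by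
  obtain ⟨z, rfl⟩ := (ρ.bij _).2 t
  rw [opTop_el, hom_el]

variable (A A' A'' : Over (T.obj (⊤_ (Over J))))

/-- The operation of an element of a collection. -/
noncomputable def opOf (a : A.left.left) : P.X.B := ρ.opTop (A.hom.left a)

theorem hom_opOf (a : A.left.left) : (pb φ A.left).hom a = P.X.t (ρ.opOf A a) := by
  refine φ.symm_apply_eq.2 ((types_congr_hom (Over.w A.hom) a).symm.trans ?_)
  exact ρ.hom_opTop _

variable {A A' A''}

/-- The elements of `T A` for a collection `A`. -/
noncomputable def elC (z : Ext P.X (typeObj (ρ.opOf A))) : (T.obj A.left).left :=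
  ρ.el _ ⟨z.op, z.args, fun e => (ρ.hom_opOf A _).trans (z.compat e)⟩

theorem elC_bijective : Function.Bijective (ρ.elC (A := A)) := by
  refine ⟨fun z z' h => ?_, fun t => ?_⟩
  · have := (ρ.bij _).1 h
    obtain ⟨b, k, hk⟩ := z
    obtain ⟨b', k', hk'⟩ := z'
    injection this with h1 h2
    subst h1
    obtain rfl := eq_of_heq h2
    rfl
  · obtain ⟨z, rfl⟩ := (ρ.bij _).2 t
    exact ⟨⟨z.op, z.args, fun e => (ρ.hom_opOf A _).symm.trans (z.compat e)⟩, rfl⟩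

theorem proj_elC (z : Ext P.X (typeObj (ρ.opOf A))) :
    (Collection.proj T A.left).left (ρ.elC z) = ρ.elTop z.op := by
  refine (ρ.map_el _ _ _ _ ?_).trans ?_
  · exact fun e => (congrArg φ.symm (types_congr_hom (Over.w (terminal.from A.left)) (z.args e))).trans
      ((ρ.hom_opOf A _).trans (z.compat e))
  · refine congrArg (ρ.el _) (SetOperad.mk_congr (P := P) (W := pb φ (⊤_ (Over J))) _
      (funext fun e => ?_) _ _)
    refine eq_pt ?_
    exact (congrArg φ.symm (types_congr_hom (Over.w (terminal.from A.left)) (z.args e))).trans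
      ((ρ.hom_opOf A _).trans (z.compat e))

/-- The two components of the pullback must have the same image in `T 1`, that is, the same
operation. An element of the tensor product is therefore an element of `A` whose operation is
decorated by elements of `A'`. -/
theorem exists_pair (a : A.left.left) (z : Ext P.X (typeObj (ρ.opOf A'))) (h : ρ.opOf A a = z.op) :
    ∃ t : (Collection.tensor T A A').left.left,
      (Collection.fst A A').left t = a ∧ (Collection.snd A A').left t = ρ.elC z :=
  exists_pullback_element _ _ _ _ <| by
    refine Eq.trans ?_ (ρ.proj_elC z).symm
    exact (ρ.elTop_opTop _).symm.trans (congrArg ρ.elTop h)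

/-- The elements of a tensor product of collections. -/
noncomputable def pair (a : A.left.left) (z : Ext P.X (typeObj (ρ.opOf A'))) (h : ρ.opOf A a = z.op) :
    (Collection.tensor T A A').left.left := (ρ.exists_pair a z h).choose

theorem fst_pair (a : A.left.left) (z : Ext P.X (typeObj (ρ.opOf A'))) (h) :
    (Collection.fst A A').left (ρ.pair a z h) = a := (ρ.exists_pair a z h).choose_spec.1

theorem snd_pair (a : A.left.left) (z : Ext P.X (typeObj (ρ.opOf A'))) (h) :
    (Collection.snd A A').left (ρ.pair a z h) = ρ.elC z := (ρ.exists_pair a z h).choose_spec.2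

theorem eq_pair {t : (Collection.tensor T A A').left.left} {a : A.left.left}
    {z : Ext P.X (typeObj (ρ.opOf A'))} (h)
    (h1 : (Collection.fst A A').left t = a) (h2 : (Collection.snd A A').left t = ρ.elC z) :
    t = ρ.pair a z h :=
  pullback_element_ext _ _ _ _ (h1.trans (ρ.fst_pair a z h).symm) (h2.trans (ρ.snd_pair a z h).symm)

theorem exists_eq_pair (t : (Collection.tensor T A A').left.left) : ∃ a z h, t = ρ.pair a z h := by
  obtain ⟨z, hz⟩ := ρ.elC_bijective.2 ((Collection.snd A A').left t)
  have h := types_congr_hom (congrArg (fun k => k.left) (Collection.condition A A')) t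
  refine ⟨(Collection.fst A A').left t, z, ?_, ρ.eq_pair _ rfl hz.symm⟩
  refine (congrArg ρ.opTop h).trans ?_
  refine (congrArg (fun x => ρ.opTop ((Collection.proj T A'.left).left x)) hz.symm).trans ?_
  exact (congrArg ρ.opTop (ρ.proj_elC z)).trans (ρ.opTop_elTop _)

theorem opOf_hom (f : A ⟶ A') (a : A.left.left) : ρ.opOf A' (f.left.left a) = ρ.opOf A a :=
  congrArg ρ.opTop (types_congr_hom (congrArg (fun k => k.left) (Over.w f)) a)

theorem map_elC (f : A ⟶ A') (z : Ext P.X (typeObj (ρ.opOf A))) :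
    (T.map f.left).left (ρ.elC z) =
      ρ.elC (SetOperad.mapExt (fun a => f.left.left a) (ρ.opOf_hom f) z) :=
  ρ.map_el _ _ _ _ _

theorem tensorMap_pair {B B' : Over (T.obj (⊤_ (Over J)))} (f : A ⟶ B) (f' : A' ⟶ B') (a : A.left.left)
    (z : Ext P.X (typeObj (ρ.opOf A'))) (h) :
    (Collection.tensorMap f f').left.left (ρ.pair a z h) = ρ.pair (f.left.left a)
      (SetOperad.mapExt (fun a => f'.left.left a) (ρ.opOf_hom f') z) ((ρ.opOf_hom f a).trans h) := by
  refine ρ.eq_pair _ ?_ ?_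
  · refine (types_congr_hom (congrArg (fun k => k.left) (TOperad.tensorMap_fst f f')) _).trans ?_
    exact congrArg f.left.left (ρ.fst_pair a z h)
  · refine (types_congr_hom (congrArg (fun k => k.left) (TOperad.tensorMap_snd f f')) _).trans ?_
    exact (congrArg (T.map f'.left).left (ρ.snd_pair a z h)).trans (ρ.map_elC f' z)

theorem pb_hom_el (A : Over J) (z) : (pb φ (T.obj A)).hom (ρ.el A z) = P.X.t z.op :=
  φ.symm_apply_eq.2 (ρ.hom_el A z)

/-- The structure map of the tensor product replaces every decoration by its operation, regarded as
an element of `T 1`, and then applies the multiplication of `T`. -/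
theorem opOf_pair (a : A.left.left) (z : Ext P.X (typeObj (ρ.opOf A'))) (h) :
    ρ.opOf (Collection.tensor T A A') (ρ.pair a z h) = (MonObj.mul (X := P.X)).onB z.compOp := by
  let w : P.X.E z.op → Ext P.X (pb φ (⊤_ (Over J))) := fun e =>
    ⟨ρ.opOf A' (z.args e), fun i => pt φ (P.X.s _ i), fun _ => pb_pt _⟩
  have hw : ∀ e, A'.hom.left (z.args e) = ρ.el _ (w e) := fun e => (ρ.elTop_opTop _).symm
  have hw' : ∀ e, (pb φ (T.obj (⊤_ (Over J)))).hom (ρ.el _ (w e)) = P.X.s z.op e := fun e =>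
    (ρ.pb_hom_el _ _).trans (z.compat e)
  have h1 : (T.map A'.hom).left (ρ.elC z) = ρ.el _ ⟨z.op, fun e => ρ.el _ (w e), hw'⟩ := by
    refine (ρ.map_el A'.hom z.op z.args _ fun e => ?_).trans ?_
    · exact (congrArg (pb φ (T.obj (⊤_ (Over J)))).hom (hw e)).trans (hw' e)
    · exact congrArg (ρ.el _) (SetOperad.mk_congr (P := P) (W := pb φ (T.obj (⊤_ (Over J)))) _
        (funext hw) _ _)
  have h2 : (Collection.tensor T A A').hom.left (ρ.pair a z h) = ρ.el _ (muE P _ z.op w z.compat) := by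
    refine (congrArg (fun x => (T.μ.app (⊤_ (Over J))).left ((T.map A'.hom).left x))
      (ρ.snd_pair a z h)).trans ?_
    exact (congrArg (T.μ.app (⊤_ (Over J))).left h1).trans (ρ.μ_el _ _ _ _ _)
  exact (congrArg ρ.opTop h2).trans (ρ.opTop_el _)

theorem fst_toTensor {Z : Over (T.obj (⊤_ (Over J)))} (a : Z.left ⟶ A.left)
    (x : Z.left ⟶ T.obj A'.left) (h h') (z : Z.left.left) :
    (Collection.fst A A').left ((Collection.toTensor a x h h').left.left z) = a.left z :=
  types_congr_hom (congrArg (fun k => k.left) (pullback.lift_fst a x h)) z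

theorem snd_toTensor {Z : Over (T.obj (⊤_ (Over J)))} (a : Z.left ⟶ A.left)
    (x : Z.left ⟶ T.obj A'.left) (h h') (z : Z.left.left) :
    (Collection.snd A A').left ((Collection.toTensor a x h h').left.left z) = x.left z :=
  types_congr_hom (congrArg (fun k => k.left) (pullback.lift_snd a x h)) z

theorem leftUnit_eq (a : A.left.left) (h h') : (Collection.leftUnit A).left.left a =
    ρ.pair (A := Collection.one T) (pt φ (P.X.t (ρ.opOf A a)))
      ⟨(MonObj.one (X := P.X)).onB (P.X.t (ρ.opOf A a)), fun _ => a, h⟩ h' := by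
  refine ρ.eq_pair _ ?_ ?_
  · refine (fst_toTensor _ _ _ _ a).trans (eq_pt ?_)
    exact (congrArg φ.symm (types_congr_hom (Over.w (terminal.from A.left)) a)).trans
      (ρ.hom_opOf A a)
  · refine (snd_toTensor _ _ _ _ a).trans ?_
    have key : ∀ (i : I) (_ : i = P.X.t (ρ.opOf A a)) (h1 h2),
        ρ.el A.left ⟨(MonObj.one (X := P.X)).onB i, fun _ => a, h1⟩ =
        ρ.el A.left ⟨(MonObj.one (X := P.X)).onB (P.X.t (ρ.opOf A a)), fun _ => a, h2⟩ := by
      rintro _ rfl _ _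
      rfl
    have h3 : φ.symm (A.left.hom a) = P.X.t (ρ.opOf A a) := ρ.hom_opOf A a
    have h4 : ∀ e, (pb φ A.left).hom a =
        P.X.s ((MonObj.one (X := P.X)).onB (φ.symm (A.left.hom a))) e := fun e =>
      (MonObj.one (X := P.X)).s_onE (φ.symm (A.left.hom a)) e
    exact (ρ.η_el A.left a h4).trans (key _ h3 _ _)

theorem opOf_one (i : I) : ρ.opOf (Collection.one T) (pt φ i) = (MonObj.one (X := P.X)).onB i := by
  have h1 : φ.symm ((⊤_ (Over J)).hom (pt φ i)) = i := pb_pt i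
  have h4 : ∀ e, (pb φ (⊤_ (Over J))).hom (pt φ i) =
      P.X.s ((MonObj.one (X := P.X)).onB (φ.symm ((⊤_ (Over J)).hom (pt φ i)))) e := fun e =>
    (MonObj.one (X := P.X)).s_onE (φ.symm ((⊤_ (Over J)).hom (pt φ i))) e
  refine (congrArg ρ.opTop (ρ.η_el _ (pt φ i) h4)).trans ((ρ.opTop_el _).trans ?_)
  exact congrArg (MonObj.one (X := P.X)).onB h1

theorem t_opOf_one (i : I) : P.X.t (ρ.opOf (Collection.one T) (pt φ i)) = i :=
  (congrArg P.X.t (ρ.opOf_one i)).trans ((MonObj.one (X := P.X)).t_onB i)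

theorem rightUnit_eq (a : A.left.left) : (Collection.rightUnit A).left.left a =
    ρ.pair (A' := Collection.one T) a
      ⟨ρ.opOf A a, fun e => pt φ (P.X.s _ e), fun _ => ρ.t_opOf_one _⟩ rfl := by
  refine ρ.eq_pair _ ?_ ?_
  · exact fst_toTensor _ _ _ _ a
  · refine (snd_toTensor _ _ _ _ a).trans ?_
    exact (ρ.elTop_opTop _).symm

/-- With `leftUnit_eq` and `rightUnit_eq`, this makes the comparison maps explicit. The operad
axioms thereby turn into those of a `SetOperad`, with `muE` collecting the innermost decorations. -/
theorem assoc_pair (a : A.left.left) (b : P.X.B) (y : P.X.E b → A'.left.left)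
    (w : P.X.E b → Ext P.X (typeObj (ρ.opOf A''))) (hw : ∀ e, ρ.opOf A' (y e) = (w e).op)
    (hb : ρ.opOf A a = b) (hc hy hm hp) :
    (Collection.assoc A A' A'').left.left
      (ρ.pair (A' := Collection.tensor T A' A'') a ⟨b, fun e => ρ.pair (y e) (w e) (hw e), hc⟩ hb) =
      ρ.pair (A := Collection.tensor T A A') (ρ.pair a ⟨b, y, hy⟩ hb) (muE P _ b w hm) hp := by
  -- Stated for a general `k`, since it is needed for both projections of the inner tensor product.
  have hE : ∀ {B : Over J} (k : (Collection.tensor T A' A'').left ⟶ B) (v : P.X.E b → B.left)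
      (_ : ∀ e, k.left (ρ.pair (y e) (w e) (hw e)) = v e) (h'),
      (T.map k).left ((Collection.snd A (Collection.tensor T A' A'')).left
        (ρ.pair (A' := Collection.tensor T A' A'') a
          ⟨b, fun e => ρ.pair (y e) (w e) (hw e), hc⟩ hb)) = ρ.el B ⟨b, v, h'⟩ := by
    intro B k v hv h'
    refine (congrArg (T.map k).left (ρ.snd_pair _ _ _)).trans ?_
    refine (ρ.map_el k b _ _ fun e => ?_).trans ?_
    · exact (congrArg (pb φ B).hom (hv e)).trans (h' e)
    · exact congrArg (ρ.el _) (SetOperad.mk_congr (P := P) (W := pb φ B) _ (funext hv) _ _)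
  refine ρ.eq_pair _ ?_ ?_
  · refine (fst_toTensor _ _ _ _ _).trans (ρ.eq_pair _ ?_ ?_)
    · exact (fst_toTensor _ _ _ _ _).trans (ρ.fst_pair _ _ _)
    · refine (snd_toTensor _ _ _ _ _).trans ?_
      exact hE _ _ (fun e => ρ.fst_pair _ _ _) _
  · refine (snd_toTensor _ _ _ _ _).trans ?_
    have h1 : ∀ e, (pb φ (T.obj A''.left)).hom (ρ.elC (w e)) = P.X.s b e := fun e =>
      (ρ.pb_hom_el _ _).trans (hm e)
    refine (congrArg (T.μ.app A''.left).left (hE (Collection.snd A' A'') (fun e => ρ.elC (w e))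
      (fun e => ρ.snd_pair _ _ _) h1)).trans ?_
    exact ρ.μ_el _ _ _ hm _

end Rep
end PolyEndo

/-! ### `T`-operads as operads over the representing polynomial monad -/

namespace PolyEndo
open PTree Limits
variable {I J : Type u} {P : Mon (PolyEndo I)} {φ : I ≃ J} {T : Monad (Over J)}

namespace Rep
variable (ρ : Rep P φ T)

/-- The operad with elements those of a `T`-operad. -/
noncomputable def toSetOperad (A : TOperad T) : SetOperad P where
  carrier := A.carrier.left.left
  op := ρ.opOf A.carrier
  one i := A.one.left.left (pt φ i)
  op_one i := (ρ.opOf_hom A.one _).trans (ρ.opOf_one i)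
  mul x z h := A.mul.left.left (ρ.pair x z h)
  op_mul x z h := (ρ.opOf_hom A.mul _).trans (ρ.opOf_pair x z h)
  one_mul x h := by
    refine Eq.trans ?_ (types_congr_hom (congrArg (fun k => k.left.left) A.one_mul) x)
    refine congrArg A.mul.left.left ?_
    refine Eq.trans ?_ (congrArg (Collection.tensorMap A.one (𝟙 A.carrier)).left.left
      (ρ.leftUnit_eq x h (ρ.opOf_one _)).symm)
    exact (ρ.tensorMap_pair (A := Collection.one T) (A' := A.carrier) A.one (𝟙 A.carrier) (pt φ (P.X.t (ρ.opOf A.carrier x)))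
      ⟨(MonObj.one (X := P.X)).onB (P.X.t (ρ.opOf A.carrier x)), fun _ => x, h⟩
      (ρ.opOf_one _)).symm
  mul_one x h := by
    refine Eq.trans ?_ (types_congr_hom (congrArg (fun k => k.left.left) A.mul_one) x)
    refine congrArg A.mul.left.left ?_
    refine Eq.trans ?_ (congrArg (Collection.tensorMap (𝟙 A.carrier) A.one).left.left
      (ρ.rightUnit_eq x).symm)
    exact (ρ.tensorMap_pair (A := A.carrier) (A' := Collection.one T) (𝟙 A.carrier) A.one x
      ⟨ρ.opOf A.carrier x, fun e => pt φ (P.X.s _ e), fun _ => ρ.t_opOf_one _⟩ rfl).symm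
  mul_assoc x z h w hw h₁ h₂ h₃ := by
    obtain ⟨b, y, hy⟩ := z
    have hc : ∀ e, (typeObj (ρ.opOf (Collection.tensor T A.carrier A.carrier))).hom
        (ρ.pair (y e) (w e) (hw e)) = P.X.s b e := fun e =>
      (congrArg P.X.t (ρ.opOf_hom A.mul _)).symm.trans (h₃ e)
    have e := types_congr_hom (congrArg (fun k => k.left.left) A.mul_assoc)
      (ρ.pair (A' := Collection.tensor T A.carrier A.carrier) x
        ⟨b, fun e => ρ.pair (y e) (w e) (hw e), hc⟩ h)
    have e1 := ρ.tensorMap_pair (𝟙 A.carrier) A.mul x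
      ⟨b, fun e => ρ.pair (y e) (w e) (hw e), hc⟩ h
    have hp : ρ.opOf _ (ρ.pair x ⟨b, y, hy⟩ h) = (muE P _ b w h₁).op := by
      exact (ρ.opOf_hom A.mul _).symm.trans h₂
    have e2 := ρ.assoc_pair (A := A.carrier) (A' := A.carrier) (A'' := A.carrier) x b y w hw h hc hy
      h₁ hp
    have e3 := ρ.tensorMap_pair A.mul (𝟙 A.carrier) (ρ.pair x ⟨b, y, hy⟩ h) (muE P _ b w h₁) hp
    refine (congrArg A.mul.left.left e3).symm.trans ?_
    refine (congrArg (fun t => A.mul.left.left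
      ((Collection.tensorMap A.mul (𝟙 A.carrier)).left.left t)) e2).symm.trans ?_
    exact e.symm.trans (congrArg A.mul.left.left e1)

/-- The functor from `T`-operads to operads over the representing polynomial monad. -/
noncomputable def comparison : TOperad T ⥤ SetOperad P where
  obj A := ρ.toSetOperad A
  map {A B} f :=
    { toFun := fun x => f.hom.left.left x
      op_toFun := ρ.opOf_hom f.hom
      map_one := fun i => types_congr_hom (congrArg (fun k => k.left.left) f.one_hom) (pt φ i)
      map_mul := fun x z h => by
        refine (types_congr_hom (congrArg (fun k => k.left.left) f.mul_hom) (ρ.pair x z h)).trans ?_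
        exact congrArg B.mul.left.left (ρ.tensorMap_pair f.hom f.hom x z h) }

theorem collection_hom_ext {A B : Over (T.obj (⊤_ (Over J)))} (f g : A ⟶ B)
    (h : ∀ x, f.left.left x = g.left.left x) : f = g :=
  Over.OverMorphism.ext (Over.OverMorphism.ext (by ext x; exact h x))

/-- Because `opTop` is injective, preserving operations already gives compatibility with the maps to
`T 1`; compatibility with the maps to `J` follows, as types are output types of operations. -/
theorem exists_collection_hom {A B : Over (T.obj (⊤_ (Over J)))} (k : A.left.left → B.left.left)
    (hk : ∀ x, ρ.opOf B (k x) = ρ.opOf A x) : ∃ f : A ⟶ B, ∀ x, f.left.left x = k x := by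
  have h1 : ∀ x, B.hom.left (k x) = A.hom.left x := fun x => ρ.opTop_bijective.1 (hk x)
  have h2 : ∀ x, B.left.hom (k x) = A.left.hom x := fun x => φ.symm.injective <|
    (ρ.hom_opOf B (k x)).trans ((congrArg P.X.t (hk x)).trans (ρ.hom_opOf A x).symm)
  refine ⟨Over.homMk (Over.homMk (↾k) (by ext x; exact h2 x))
    (Over.OverMorphism.ext (by ext x; exact h1 x)), fun x => rfl⟩

/-- The collection given by a set over the operations. -/
noncomputable def collection {X : Type u} (f : X → P.X.B) : Over (T.obj (⊤_ (Over J))) :=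
  Over.mk (Y := Over.mk (↾ fun x => φ (P.X.t (f x)))) (Over.homMk (↾ fun x => ρ.elTop (f x)) (by
    ext x
    exact (ρ.hom_opTop _).trans (congrArg (fun b => φ (P.X.t b)) (ρ.opTop_elTop _))))

theorem opOf_collection {X : Type u} (f : X → P.X.B) (x : X) : ρ.opOf (ρ.collection f) x = f x :=
  ρ.opTop_elTop _

theorem pair_injective {A A' : Over (T.obj (⊤_ (Over J)))} {a a' : A.left.left}
    {z z' : Ext P.X (typeObj (ρ.opOf A'))} {h h'} (e : ρ.pair a z h = ρ.pair a' z' h') :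
    a = a' ∧ z = z' :=
  ⟨(ρ.fst_pair a z h).symm.trans ((congrArg (Collection.fst A A').left e).trans (ρ.fst_pair a' z' h')),
    ρ.elC_bijective.1 ((ρ.snd_pair a z h).symm.trans ((congrArg (Collection.snd A A').left e).trans
      (ρ.snd_pair a' z' h')))⟩

theorem exists_eq_pt (x : (⊤_ (Over J)).left) : ∃ i : I, x = pt φ i :=
  ⟨(pb φ (⊤_ (Over J))).hom x, eq_pt rfl⟩

variable (M : SetOperad P)

/-- The structure maps are prescribed on elements, every element of the unit collection being some
`pt φ i` and every element of a tensor product a pair. The explicit comparison maps then reduce the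
axioms to those of `M`. -/
theorem exists_toOperad : ∃ A : TOperad T, Nonempty (ρ.comparison.obj A ≅ M) := by
  have hop : ∀ x : M.carrier, ρ.opOf (ρ.collection M.op) x = M.op x := ρ.opOf_collection M.op
  let A := ρ.collection M.op
  -- The operation of an element of the collection is `M.op` only up to the equality `hop`; `conv`
  -- passes from one to the other.
  let conv : Ext P.X (typeObj (ρ.opOf A)) → Ext P.X (typeObj M.op) :=
    SetOperad.mapExt (f := ρ.opOf A) (g := M.op) (fun x => x) fun x => (hop x).symm
  choose a z h hp using ρ.exists_eq_pair (A := A) (A' := A)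
  obtain ⟨u, hu⟩ := ρ.exists_collection_hom (A := Collection.one T) (B := A)
    (fun x => M.one ((pb φ (⊤_ (Over J))).hom x)) fun x => by
      obtain ⟨i, rfl⟩ := exists_eq_pt (φ := φ) x
      refine (hop _).trans ((M.op_one _).trans (Eq.trans ?_ (ρ.opOf_one i).symm))
      exact congrArg (MonObj.one (X := P.X)).onB (pb_pt i)
  obtain ⟨m, hm⟩ := ρ.exists_collection_hom (A := Collection.tensor T A A) (B := A)
    (fun t => M.mul (a t) (conv (z t)) ((hop _).symm.trans (h t))) fun t => by
      refine (hop _).trans ((M.op_mul _ _ _).trans ?_)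
      refine Eq.trans ?_ (congrArg (ρ.opOf (Collection.tensor T A A)) (hp t)).symm
      refine Eq.trans ?_ (ρ.opOf_pair _ _ _).symm
      exact congrArg (MonObj.mul (X := P.X)).onB
        (SetOperad.compOp_congr _ (funext fun e => (hop _).symm) _ _)
  have hu' : ∀ i, u.left.left (pt φ i) = M.one i := fun i => (hu _).trans (congrArg M.one (pb_pt i))
  have hm' : ∀ x y hx, m.left.left (ρ.pair x y hx) = M.mul x (conv y) ((hop _).symm.trans hx) := by
    intro x y hx
    obtain ⟨h1, h2⟩ := ρ.pair_injective (hp (ρ.pair x y hx))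
    refine (hm _).trans (M.mul_congr h1.symm (congrArg conv h2.symm) _ _)
  have h1m : Collection.leftUnit A ≫ Collection.tensorMap u (𝟙 A) ≫ m = 𝟙 A := by
    refine collection_hom_ext _ _ fun x => ?_
    have h1 : ∀ e, (typeObj (ρ.opOf A)).hom x =
        P.X.s ((MonObj.one (X := P.X)).onB (P.X.t (ρ.opOf A x))) e := fun e =>
      (MonObj.one (X := P.X)).s_onE (P.X.t (ρ.opOf A x)) e
    refine (congrArg (fun t => m.left.left ((Collection.tensorMap u (𝟙 A)).left.left t))
      (ρ.leftUnit_eq x h1 (ρ.opOf_one _))).trans ?_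
    refine (congrArg m.left.left (ρ.tensorMap_pair (A := Collection.one T) (A' := A) u (𝟙 A)
      (pt φ (P.X.t (ρ.opOf A x))) ⟨(MonObj.one (X := P.X)).onB (P.X.t (ρ.opOf A x)), fun _ => x, h1⟩
      (ρ.opOf_one _))).trans ?_
    refine (hm' _ _ _).trans ?_
    refine (M.mul_congr (hu' _) rfl _ (M.op_one _)).trans ?_
    exact M.one_mul' x _ (congrArg P.X.t (hop x)).symm _
  have hm1 : Collection.rightUnit A ≫ Collection.tensorMap (𝟙 A) u ≫ m = 𝟙 A := by
    refine collection_hom_ext _ _ fun x => ?_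
    refine (congrArg (fun t => m.left.left ((Collection.tensorMap (𝟙 A) u).left.left t))
      (ρ.rightUnit_eq x)).trans ?_
    refine (congrArg m.left.left (ρ.tensorMap_pair (A := A) (A' := Collection.one T) (𝟙 A) u x
      ⟨ρ.opOf A x, fun e => pt φ (P.X.s _ e), fun _ => ρ.t_opOf_one _⟩ rfl)).trans ?_
    refine (hm' _ _ _).trans ?_
    have key : ∀ (b : P.X.B) (hb : M.op x = b) (k : P.X.E b → M.carrier) (h)
        (_ : ∀ e, k e = M.one (P.X.s b e)), M.mul x ⟨b, k, h⟩ hb = x := by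
      rintro _ rfl k h hk
      obtain rfl : k = _ := funext hk
      exact M.mul_one x h
    exact key _ (hop x).symm _ _ fun e => hu' _
  have hmm : Collection.tensorMap (𝟙 A) m ≫ m =
      Collection.assoc A A A ≫ Collection.tensorMap m (𝟙 A) ≫ m := by
    refine collection_hom_ext _ _ fun t => ?_
    obtain ⟨x, ⟨b, k, hk⟩, h, rfl⟩ := ρ.exists_eq_pair (A := A) (A' := Collection.tensor T A A) t
    choose y w hw hyw using fun e => ρ.exists_eq_pair (A := A) (A' := A) (k e)
    obtain rfl : k = fun e => ρ.pair (y e) (w e) (hw e) := funext hyw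
    have h₁ : ∀ e, P.X.t (w e).op = P.X.s b e := fun e => Eq.trans
      ((MonObj.mul (X := P.X)).t_onB ⟨(w e).op, fun i => ρ.opOf A ((w e).args i), (w e).compat⟩).symm ((congrArg P.X.t (ρ.opOf_pair _ _ _)).symm.trans (hk e))
    have hy : ∀ e, (typeObj (ρ.opOf A)).hom (y e) = P.X.s b e := fun e =>
      (congrArg P.X.t (hw e)).trans (h₁ e)
    have hp : ρ.opOf _ (ρ.pair (A := A) (A' := A) x ⟨b, y, hy⟩ h) = (muE P _ b w h₁).op :=
      (ρ.opOf_pair _ _ _).trans (congrArg (MonObj.mul (X := P.X)).onB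
        (SetOperad.compOp_congr _ (funext hw) _ _))
    have e1 := ρ.tensorMap_pair (A := A) (A' := Collection.tensor T A A) (𝟙 A) m x
      ⟨b, fun e => ρ.pair (y e) (w e) (hw e), hk⟩ h
    have e2 := ρ.assoc_pair (A := A) (A' := A) (A'' := A) x b y w hw h hk hy h₁ hp
    have e3 := ρ.tensorMap_pair (A := Collection.tensor T A A) (A' := A) m (𝟙 A)
      (ρ.pair (A := A) (A' := A) x ⟨b, y, hy⟩ h) (muE P _ b w h₁) hp
    refine (congrArg m.left.left e1).trans ((hm' _ _ _).trans ?_)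
    refine Eq.trans ?_ (congrArg (fun t => m.left.left
      ((Collection.tensorMap m (𝟙 A)).left.left t)) e2).symm
    refine Eq.trans ?_ (congrArg m.left.left e3).symm
    refine Eq.trans ?_ (hm' _ _ _).symm
    have h3 : ∀ e, (typeObj M.op).hom (M.mul (y e) (conv (w e)) ((hop _).symm.trans (hw e))) =
        P.X.s b e := fun e => (congrArg P.X.t (M.op_mul _ _ _)).trans
          (((MonObj.mul (X := P.X)).t_onB _).trans (h₁ e))
    have hop' : M.op (M.mul x (conv ⟨b, y, hy⟩) ((hop x).symm.trans h)) =
        (muE P (typeObj M.op) b (fun e => conv (w e)) h₁).op :=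
      (M.op_mul _ _ _).trans (congrArg (MonObj.mul (X := P.X)).onB
        (SetOperad.compOp_congr _ (funext fun e => (hop _).symm.trans (hw e)) _ _))
    refine Eq.trans ?_ ((M.mul_assoc x (conv ⟨b, y, hy⟩) ((hop x).symm.trans h)
      (fun e => conv (w e)) (fun e => (hop _).symm.trans (hw e)) h₁ hop' h3).symm.trans ?_)
    · refine M.mul_congr rfl ?_ _ _
      exact SetOperad.mk_congr (P := P) (W := typeObj M.op) b
        (funext fun e => hm' (y e) (w e) (hw e)) _ h3
    · exact M.mul_congr (hm' _ _ _).symm rfl _ _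
  let B : TOperad T := ⟨A, u, m, h1m, hm1, hmm⟩
  let f : ρ.comparison.obj B ⟶ M :=
    { toFun := fun x => x
      op_toFun := fun x => (hop x).symm
      map_one := hu'
      map_mul := hm' }
  have := SetOperad.exists_iso f (fun x => x) (fun _ => rfl) (fun _ => rfl)
  exact ⟨B, ⟨asIso f⟩⟩

instance : ρ.comparison.IsEquivalence where
  faithful := ⟨fun {A B} f g h => TOperad.Hom.ext (collection_hom_ext _ _ fun x =>
    congrFun (congrArg SetOperad.Hom.toFun h) x)⟩
  full := ⟨fun {A B} k => by
    obtain ⟨f, hf⟩ := ρ.exists_collection_hom k.toFun k.op_toFun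
    obtain ⟨kf, ko, k1, km⟩ := k
    obtain rfl : (fun x => f.left.left x) = kf := funext hf
    refine ⟨⟨f, collection_hom_ext _ _ fun x => ?_, collection_hom_ext _ _ fun t => ?_⟩, rfl⟩
    · obtain ⟨i, rfl⟩ := exists_eq_pt (φ := φ) x
      exact k1 i
    · obtain ⟨x, z, h, rfl⟩ := ρ.exists_eq_pair t
      exact (km x z h).trans (congrArg B.mul.left.left (ρ.tensorMap_pair f f x z h)).symm⟩
  essSurj := ⟨ρ.exists_toOperad⟩

end Rep
end PolyEndo

/-! ### The free operad monads and the Baez-Dolan construction -/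

namespace PolyEndo
open PTree Limits
variable {I J : Type u} {P : Mon (PolyEndo I)} {φ : I ≃ J} {T : Monad (Over J)}

namespace Rep
variable (ρ : Rep P φ T)

/-- The comparison between collections and sets over the operations. -/
noncomputable def collBase : Over (T.obj (⊤_ (Over J))) ⥤ Over P.X.B :=
  Over.iteratedSliceForward _ ⋙ Over.map (↾ρ.opTop)

instance : ρ.collBase.IsEquivalence := by
  have : IsIso (↾ρ.opTop) := (isIso_iff_bijective _).2 ρ.opTop_bijective
  have h : (Over.iteratedSliceForward (T.obj (⊤_ (Over J)))).IsEquivalence :=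
    (Over.iteratedSliceEquiv (T.obj (⊤_ (Over J)))).isEquivalence_functor
  unfold collBase
  infer_instance

/-- The comparison of operads commutes with the forgetful functors. -/
noncomputable def comparisonForget :
    ρ.comparison ⋙ SetOperad.forget P ≅ TOperad.forget T ⋙ ρ.collBase :=
  NatIso.ofComponents (fun A => Over.isoMk (Iso.refl A.carrier.left.left)) fun _ =>
    Over.OverMorphism.ext ((Category.comp_id _).trans (Category.id_comp _).symm)

/-- Up to the equivalences `ρ.comparison` and `ρ.collBase` this is the forgetful functor of
`SetOperad P`, whose left adjoint is the explicit free operad. -/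
theorem forget_isRightAdjoint (ρ : Rep P φ T) : (TOperad.forget T).IsRightAdjoint := by
  let i : (ρ.comparison ⋙ SetOperad.forget P) ⋙ ρ.collBase.inv ≅ TOperad.forget T :=
    Functor.isoWhiskerRight ρ.comparisonForget _ ≪≫
      Functor.isoWhiskerLeft (TOperad.forget T) ρ.collBase.asEquivalence.unitIso.symm ≪≫
        Functor.rightUnitor _
  have : ((ρ.comparison ⋙ SetOperad.forget P) ⋙ ρ.collBase.inv).IsRightAdjoint := inferInstance
  exact Functor.isRightAdjoint_of_iso i

/-- Both monads are compared in a third category `D`. For Leinster's tower this will be the slice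
over the set of elements of `T 1`, which is neither of the two categories of generators. -/
theorem toMonad_iso {D : Type*} [Category D] (e : Over (T.obj (⊤_ (Over J))) ≌ D)
    (e' : Over P.X.B ≌ D)
    (α : ρ.comparison ⋙ SetOperad.forget P ⋙ e'.functor ≅ TOperad.forget T ⋙ e.functor)
    {F : Over (T.obj (⊤_ (Over J))) ⥤ TOperad T} (adj : F ⊣ TOperad.forget T) :
    Nonempty (transportMonad e' (monad (plus P)) ≅ transportMonad e adj.toMonad) := by
  obtain ⟨i⟩ := transportMonad_congr e' (SetOperad.freeAdj_monad P)
  obtain ⟨j⟩ := transportMonad_toMonad e' (SetOperad.freeAdj P)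
  obtain ⟨k⟩ := transportMonad_toMonad e adj
  obtain ⟨l⟩ := _root_.toMonad_iso (e.symm.toAdjunction.comp adj)
    (e'.symm.toAdjunction.comp (SetOperad.freeAdj P)) ρ.comparison α
  exact ⟨i.symm ≪≫ j ≪≫ l.symm ≪≫ k.symm⟩

end Rep

/-- The monad of free operads over a polynomial monad. -/
theorem Rep.toMonad_iso_plus (ρ : Rep P φ T) (e : Over (T.obj (⊤_ (Over J))) ≌ Over P.X.B)
    (α : ρ.comparison ⋙ SetOperad.forget P ≅ TOperad.forget T ⋙ e.functor)
    {F : Over (T.obj (⊤_ (Over J))) ⥤ TOperad T} (adj : F ⊣ TOperad.forget T) :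
    Nonempty (transportMonad e adj.toMonad ≅ monad (plus P)) := by
  obtain ⟨i⟩ := SetOperad.freeAdj_monad P
  obtain ⟨k⟩ := transportMonad_toMonad e adj
  obtain ⟨l⟩ := _root_.toMonad_iso (e.symm.toAdjunction.comp adj) (SetOperad.freeAdj P) ρ.comparison α
  exact ⟨k ≪≫ l ≪≫ i⟩

/-- For the monad of `P` itself `el` is the identity, so `opTop` returns the operation of an element
of `P 1`. -/
theorem leinsterBase_iso (P : Mon (PolyEndo I)) :
    Nonempty (leinsterBase P ≅ (Rep.refl P).collBase) :=
  ⟨NatIso.ofComponents (fun A => Over.isoMk (Iso.refl _) (by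
    ext x
    exact (Rep.refl P).opTop_el _)) fun _ =>
      Over.OverMorphism.ext ((Category.comp_id _).trans (Category.id_comp _).symm)⟩

theorem baez_dolan (P : Mon (PolyEndo I)) :
    (base P).IsEquivalence ∧ (forgetOver P).IsRightAdjoint ∧
      (∀ (e : Over P.X ≌ Over P.X.B), e.functor = base P →
        ∀ (F : Over P.X ⥤ Over P) (adj : F ⊣ forgetOver P),
          Nonempty (transportMonad e adj.toMonad ≅ monad (plus P))) ∧
      (leinsterBase P).IsEquivalence ∧ (TOperad.forget (monad P)).IsRightAdjoint ∧
      (∀ (e : Over ((monad P).obj (⊤_ (Over I))) ≌ Over P.X.B),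
        e.functor = leinsterBase P →
        ∀ (F : Over ((monad P).obj (⊤_ (Over I))) ⥤ TOperad (monad P))
          (adj : F ⊣ TOperad.forget (monad P)),
          Nonempty (transportMonad e adj.toMonad ≅ monad (plus P))) := by
  have hb := base_isEquivalence P
  obtain ⟨j⟩ := leinsterBase_iso P
  refine ⟨hb, ?_, fun e he F adj => ?_, ?_, (Rep.refl P).forget_isRightAdjoint, fun e he F adj => ?_⟩
  · let i : (SetOperad.ofOver P ⋙ SetOperad.forget P) ⋙ (base P).inv ≅ forgetOver P :=
      Functor.isoWhiskerRight (SetOperad.ofOverForget P) _ ≪≫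
        Functor.isoWhiskerLeft (forgetOver P) (base P).asEquivalence.unitIso.symm ≪≫
          Functor.rightUnitor _
    have : ((SetOperad.ofOver P ⋙ SetOperad.forget P) ⋙ (base P).inv).IsRightAdjoint :=
      inferInstance
    exact Functor.isRightAdjoint_of_iso i
  · obtain ⟨i⟩ := SetOperad.freeAdj_monad P
    obtain ⟨k⟩ := transportMonad_toMonad e adj
    obtain ⟨l⟩ := toMonad_iso (e.symm.toAdjunction.comp adj) (SetOperad.freeAdj P)
      (SetOperad.ofOver P) (SetOperad.ofOverForget P ≪≫
        Functor.isoWhiskerLeft (forgetOver P) (eqToIso he.symm))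
    exact ⟨k ≪≫ l ≪≫ i⟩
  · exact Functor.isEquivalence_of_iso j.symm
  · exact (Rep.refl P).toMonad_iso_plus e ((Rep.refl P).comparisonForget ≪≫
      Functor.isoWhiskerLeft (TOperad.forget (monad P)) (j.symm ≪≫ eqToIso he.symm)) adj

/-! ### Comparison of the two towers -/

theorem transportMonad_η {C D : Type*} [Category C] [Category D] (e : C ≌ D) (T : Monad C) (X : D) :
    (transportMonad e T).η.app X =
      e.counitInv.app X ≫ e.functor.map (T.η.app (e.inverse.obj X)) := by
  simp [transportMonad]
  rfl

theorem transportMonad_μ {C D : Type*} [Category C] [Category D] (e : C ≌ D) (T : Monad C) (X : D) :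
    (transportMonad e T).μ.app X = e.functor.map (T.map (e.unitInv.app (T.obj (e.inverse.obj X)))) ≫
      e.functor.map (T.μ.app (e.inverse.obj X)) := by
  simp only [transportMonad, Adjunction.toMonad_μ, Functor.whiskerRight_app,
    Functor.whiskerLeft_app, Adjunction.comp_counit_app, Functor.comp_map, Functor.map_comp]
  refine congrArg₂ (fun f g => f ≫ g) rfl (congrArg e.functor.map ?_)
  change (T.adj.counit.app _).f = _
  simp
  rfl

namespace Rep

/-- The description of elements given by an isomorphism with a polynomial monad. -/
noncomputable def ofIso (ψ : transportMonad (Over.mapIso φ.toIso) (monad P) ≅ T) : Rep P φ T where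
  el A z := (ψ.hom.app A).left z
  bij A := by
    have h1 := fun z => types_congr_hom (congrArg (fun k => (k.app A).left) (congrArg (fun k => k.toNatTrans) ψ.hom_inv_id)) z
    have h2 := fun z => types_congr_hom (congrArg (fun k => (k.app A).left) (congrArg (fun k => k.toNatTrans) ψ.inv_hom_id)) z
    exact ⟨fun x y h => (h1 x).symm.trans ((congrArg (ψ.inv.app A).left h).trans (h1 y)),
      fun y => ⟨_, h2 y⟩⟩
  hom_el A z := types_congr_hom (Over.w (ψ.hom.app A)) z
  map_el k b z h h' :=
    (types_congr_hom (congrArg (fun k => k.left) (ψ.hom.naturality k)) (⟨b, z, h⟩ : Ext P.X _)).symm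
  η_el A a h := by
    have h1 := types_congr_hom (congrArg (fun k => k.left) (ψ.hom.app_η A)) a
    rw [transportMonad_η] at h1
    exact h1.symm
  μ_el A b z h h' := by
    have h1 := types_congr_hom (congrArg (fun k => k.left) (ψ.hom.app_μ A))
      (⟨b, z, fun e => (φ.symm_apply_apply _).trans (h e)⟩ : Ext P.X _)
    rw [transportMonad_μ] at h1
    exact h1.symm

theorem toIso (ρ : Rep P φ T) : Nonempty (transportMonad (Over.mapIso φ.toIso) (monad P) ≅ T) := by
  refine ⟨MonadIso.mk (M := transportMonad (Over.mapIso φ.toIso) (monad P)) (N := T)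
    (NatIso.ofComponents (fun A => Over.isoMk (Equiv.ofBijective _ (ρ.bij A)).toIso (by
      ext z
      exact ρ.hom_el A z)) fun {A B} k => ?_) (fun A => ?_) (fun A => ?_)⟩
  · refine Over.OverMorphism.ext ?_
    ext z
    exact (ρ.map_el k z.op z.args _ _).symm
  · refine Over.OverMorphism.ext ?_
    ext a
    rw [transportMonad_η]
    exact (ρ.η_el A a (fun e => (MonObj.one (X := P.X)).s_onE _ e)).symm
  · refine Over.OverMorphism.ext ?_
    ext z
    rw [transportMonad_μ]
    obtain ⟨b, z, h⟩ := z
    exact (ρ.μ_el A b z (fun e => (φ.symm_apply_apply _).symm.trans (h e)) _).symm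

/-- The bijection between the operations of `P` and the elements of `T 1`. -/
noncomputable def opsEquiv (ρ : Rep P φ T) : P.X.B ≃ (T.obj (⊤_ (Over J))).left :=
  (Equiv.ofBijective _ ρ.opTop_bijective).symm

theorem opsEquiv_op (ρ : Rep P φ T) (z) : ρ.opsEquiv (Ext.op z) = ρ.el _ z := by
  refine (Equiv.symm_apply_eq _).2 ?_
  exact (ρ.opTop_el z).symm

/-- The inductive step of the comparison. The free operads exist, so `leinsterPlus` is given by its
first case; its monad is that of `plus P`, transported along the bijection between operations and
elements of `T 1`. -/
theorem leinsterPlus_iso (ρ : Rep P φ T) :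
    Nonempty (transportMonad (Over.mapIso ρ.opsEquiv.toIso) (monad (plus P)) ≅ leinsterPlus T) := by
  unfold leinsterPlus
  rw [dif_pos ρ.forget_isRightAdjoint]
  have := ρ.forget_isRightAdjoint
  refine ρ.toMonad_iso (Over.iteratedSliceEquiv _) (Over.mapIso ρ.opsEquiv.toIso) ?_ _
  refine NatIso.ofComponents (fun A => Over.isoMk (Iso.refl A.carrier.left.left) ?_) fun _ =>
    Over.OverMorphism.ext ((Category.comp_id _).trans (Category.id_comp _).symm)
  ext x
  exact ((Equiv.ofBijective _ ρ.opTop_bijective).symm_apply_apply _).symm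

end Rep

theorem trivial_iso : Nonempty (transportMonad (Over.mapIso (Equiv.refl PUnit.{u + 1}).toIso)
    (monad (Mon.trivial (PolyEndo PUnit.{u + 1}))) ≅ Monad.id (Over PUnit.{u + 1})) := by
  let ρ : Rep (Mon.trivial (PolyEndo PUnit.{u + 1})) (Equiv.refl PUnit) (Monad.id (Over PUnit.{u + 1})) :=
    { el := fun A z => z.args PUnit.unit
      bij := fun A => ⟨fun x y h => by
        obtain ⟨_, x, _⟩ := x
        obtain ⟨_, y, _⟩ := y
        obtain rfl : x = y := funext fun _ => h
        rfl, fun a => ⟨⟨PUnit.unit, fun _ => a, fun _ => rfl⟩, rfl⟩⟩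
      hom_el := fun _ _ => rfl
      map_el := fun _ _ _ _ _ => rfl
      η_el := fun _ _ _ => rfl
      μ_el := fun _ _ _ _ _ => rfl }
  exact ρ.toIso

/-- The comparison of the two sequences in degree `k`. -/
noncomputable def comparisonData : ∀ k, Σ φ : (opetopicMonad.{u} k).1 ≃ (leinsterMonad.{u} k).1,
    transportMonad (Over.mapIso φ.toIso) (monad (opetopicMonad.{u} k).2) ≅ (leinsterMonad.{u} k).2
  | 0 => ⟨Equiv.refl _, trivial_iso.some⟩
  | k + 1 => ⟨(Rep.ofIso (comparisonData k).2).opsEquiv, (Rep.ofIso (comparisonData k).2).leinsterPlus_iso.some⟩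

theorem leinster_comparison : (∀ k, (TOperad.forget (leinsterMonad.{u} k).2).IsRightAdjoint) ∧
    (∃ (φ : ∀ k, (opetopicMonad.{u} k).1 ≃ (leinsterMonad.{u} k).1)
      (ψ : ∀ k, transportMonad (Over.mapIso (φ k).toIso)
        (PolyEndo.monad (opetopicMonad.{u} k).2) ≅ (leinsterMonad.{u} k).2),
      ∀ k (z : PolyEndo.Ext (opetopicMonad.{u} k).2.X
          ((Over.map (φ k).symm.toIso.hom).obj (⊤_ (Over (leinsterMonad.{u} k).1)))),
        ((ψ k).hom.app (⊤_ (Over (leinsterMonad.{u} k).1))).left z = φ (k + 1) z.op) :=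
  ⟨fun k => (Rep.ofIso (comparisonData k).2).forget_isRightAdjoint, fun k => (comparisonData k).1,
    fun k => (comparisonData k).2, fun k z => ((Rep.ofIso (comparisonData k).2).opsEquiv_op z).symm⟩

end PolyEndo

/-! ### Kernels and isomorphisms of finite trees -/

namespace FTree

/-- The node of which the output edge of `x` is an input edge. -/
def parent (T : FTree) (x : T.Node) : Option T.Node := T.into (T.out x)

/-- A connected set of nodes in a rooted tree has a lowest node, and the path from any other member
to it descends within the set. So it is enough to ask that every other member has its parent in the
set. All later work with the kernel rule uses this form. -/
theorem isKernel_iff (T : FTree) (K : Set T.Node) : T.IsKernel K ↔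
    ∃ r ∈ K, ∀ x ∈ K, x = r ∨ ∃ y ∈ K, T.parent x = some y := by
  constructor
  · intro h
    have hadj : ∀ x y : K, (T.graph.induce K).Adj x y →
        T.parent x.1 = some y.1 ∨ T.parent y.1 = some x.1 := by
      intro x y hxy
      exact ((SimpleGraph.fromRel_adj _ _ _).1 (SimpleGraph.induce_adj.1 hxy)).2
    -- Descending from a member of `K` for as long as one stays in `K` leads to the lowest node.
    have htop : ∀ a x, T.out x = a → x ∈ K → ∃ r ∈ K, ∀ y, T.parent r = some y → y ∉ K := by
      intro a
      induction T.reaches_root a using Relation.ReflTransGen.head_induction_on with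
      | refl =>
        intro x hx hK
        refine ⟨x, hK, fun y hy => ?_⟩
        have h0 : T.parent x = none := (T.into_eq_none _).2 hx
        exact absurd (h0.symm.trans hy) (by simp)
      | head h1 _ ih =>
        obtain ⟨n, h1, h2⟩ := h1
        intro x hx hK
        by_cases hn : n ∈ K
        · exact ih n h2 hn
        · refine ⟨x, hK, fun y hy hyK => hn ?_⟩
          have : some n = some y := h1.symm.trans ((congrArg T.into hx).symm.trans hy)
          exact Option.some.inj this ▸ hyK
    obtain ⟨⟨k, hk⟩⟩ := h.nonempty
    obtain ⟨r, hr, hr'⟩ := htop _ k rfl hk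
    refine ⟨r, hr, fun x hx => ?_⟩
    have hreach := (SimpleGraph.reachable_iff_reflTransGen _ _).1 (h.preconnected ⟨r, hr⟩ ⟨x, hx⟩)
    -- A walk starting at `r` is turned into a descending path from its end. A step upwards prolongs
    -- the path; a step downwards retraces its first step, since parents are unique and the parent
    -- of `r` is not in `K`.
    have key : Relation.ReflTransGen (fun a b : K => T.parent a.1 = some b.1) ⟨x, hx⟩ ⟨r, hr⟩ := by
      generalize (⟨x, hx⟩ : K) = z at hreach
      induction hreach with
      | refl => exact .refl
      | @tail b c _ hbc ih =>
        rcases hadj _ _ hbc with h1 | h1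
        · rcases Relation.ReflTransGen.cases_head ih with h2 | ⟨d, hd, hd'⟩
          · exact absurd c.2 (hr' _ ((congrArg (fun z : K => T.parent z.1) h2).symm.trans h1))
          · obtain rfl : d = c := Subtype.ext (Option.some.inj (hd.symm.trans h1))
            exact hd'
        · exact .head h1 ih
    rcases Relation.ReflTransGen.cases_head key with h1 | ⟨d, hd, _⟩
    · exact .inl (congrArg Subtype.val h1)
    · exact .inr ⟨d.1, d.2, hd⟩
  · rintro ⟨r, hr, h⟩
    have key : ∀ a x, T.out x = a → ∀ hx : x ∈ K, (T.graph.induce K).Reachable ⟨x, hx⟩ ⟨r, hr⟩ := by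
      intro a
      induction T.reaches_root a using Relation.ReflTransGen.head_induction_on with
      | refl =>
        intro x hx hK
        rcases h x hK with rfl | ⟨y, _, hy⟩
        · exact .refl _
        · have h0 : T.parent x = none := (T.into_eq_none _).2 hx
          exact absurd (h0.symm.trans hy) (by simp)
      | head h1 _ ih =>
        obtain ⟨n, h1, h2⟩ := h1
        intro x hx hK
        rcases h x hK with rfl | ⟨y, hyK, hy⟩
        · exact .refl _
        · have hn : n = y := Option.some.inj (h1.symm.trans ((congrArg T.into hx).symm.trans hy))
          subst hn
          by_cases hxn : x = n
          · subst hxn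
            exact ih x h2 hK
          · refine (SimpleGraph.Adj.reachable ?_).trans (ih n h2 hyK)
            exact SimpleGraph.induce_adj.2 ((SimpleGraph.fromRel_adj _ _ _).2 ⟨hxn, .inl hy⟩)
    have : Nonempty K := ⟨⟨r, hr⟩⟩
    exact ⟨fun x y => (key _ x.1 rfl x.2).trans (key _ y.1 rfl y.2).symm⟩

theorem mem_root (T : FTree) (a : T.Edge) : T.Le a T.root := T.reaches_root a

namespace Iso
variable {S T U : FTree}

/-- The identity isomorphism. -/
def refl (T : FTree) : T.Iso T := ⟨Equiv.refl _, Equiv.refl _, fun _ => rfl, fun a => by simp⟩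

/-- The inverse isomorphism. -/
def symm (f : S.Iso T) : T.Iso S where
  edge := f.edge.symm
  node := f.node.symm
  out_node n := by
    rw [Equiv.eq_symm_apply, ← f.out_node, Equiv.apply_symm_apply]
  into_edge a := by
    have := f.into_edge (f.edge.symm a)
    rw [Equiv.apply_symm_apply] at this
    rw [this, Option.map_map]
    simp

/-- The composite isomorphism. -/
def trans (f : S.Iso T) (g : T.Iso U) : S.Iso U where
  edge := f.edge.trans g.edge
  node := f.node.trans g.node
  out_node n := (g.out_node _).trans (congrArg g.edge (f.out_node n))
  into_edge a := by
    refine (g.into_edge _).trans ?_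
    rw [f.into_edge, Option.map_map]
    rfl

/-- The isomorphism given by an equality. -/
def ofEq (h : S = T) : S.Iso T := h ▸ refl S

theorem ext_edge {f g : S.Iso T} (h : ∀ a, f.edge a = g.edge a) : f = g := by
  obtain ⟨fe, fn, f1, f2⟩ := f
  obtain ⟨ge, gn, g1, g2⟩ := g
  obtain rfl : fe = ge := Equiv.ext h
  obtain rfl : fn = gn := Equiv.ext fun n => T.out_injective ((f1 n).trans (g1 n).symm)
  rfl

theorem le_edge (f : S.Iso T) {a b : S.Edge} (h : S.Le a b) : T.Le (f.edge a) (f.edge b) := by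
  refine h.lift (p := fun a b => ∃ n, T.into a = some n ∧ T.out n = b) f.edge ?_
  rintro a _ ⟨n, h1, rfl⟩
  exact ⟨f.node n, by rw [f.into_edge, h1]; rfl, f.out_node n⟩

theorem le_edge_iff (f : S.Iso T) {a b : S.Edge} : T.Le (f.edge a) (f.edge b) ↔ S.Le a b := by
  refine ⟨fun h => ?_, f.le_edge⟩
  have := f.symm.le_edge h
  simpa [symm] using this

theorem edge_root (f : S.Iso T) : f.edge S.root = T.root := by
  rw [← T.into_eq_none, f.into_edge, (S.into_eq_none _).2 rfl]
  rfl

theorem into_eq_some_iff (f : S.Iso T) (a : S.Edge) (n : S.Node) :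
    T.into (f.edge a) = some (f.node n) ↔ S.into a = some n := by
  rw [f.into_edge, Option.map_eq_some_iff]
  exact ⟨fun ⟨m, h, h'⟩ => f.node.injective h' ▸ h, fun h => ⟨n, h, rfl⟩⟩

/-- The induced bijection of leaves. -/
def leaf (f : S.Iso T) : S.Leaf ≃ T.Leaf :=
  f.edge.subtypeEquiv fun a => by
    refine ⟨fun h n hn => h (f.node.symm n) (f.edge.injective ?_), fun h n hn => h (f.node n) ?_⟩
    · rw [← f.out_node, Equiv.apply_symm_apply, hn]
    · rw [f.out_node, hn]

/-- The induced bijection of null-dots. -/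
def nullDot (f : S.Iso T) : S.NullDot ≃ T.NullDot :=
  f.node.subtypeEquiv fun n => by
    refine ⟨fun h a ha => h (f.edge.symm a) ?_, fun h a ha => h (f.edge a) ?_⟩
    · rw [← f.into_eq_some_iff, Equiv.apply_symm_apply, ha]
    · rw [f.into_eq_some_iff, ha]

/-- The induced bijection of the dots of subdivisions. -/
def subdivNode (f : S.Iso T) (w : T.Edge → ℕ) :
    (S.Node ⊕ Σ a, Fin (w (f.edge a))) ≃ (T.Node ⊕ Σ a, Fin (w a)) :=
  Equiv.sumCongr f.node (Equiv.sigmaCongrLeft (β := fun a => Fin (w a)) f.edge)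

theorem parent_subdivide (f : S.Iso T) (w : T.Edge → ℕ) (x : S.Node ⊕ Σ a, Fin (w (f.edge a))) :
    (T.subdivide w).parent (f.subdivNode w x) =
      ((S.subdivide fun a => w (f.edge a)).parent x).map (f.subdivNode w) := by
  have key : ∀ (a : S.Edge) (j : Fin (w (f.edge a) + 1)), T.subdivInto w ⟨f.edge a, j⟩ =
      (S.subdivInto (fun a => w (f.edge a)) ⟨a, j⟩).map (f.subdivNode w) := by
    intro a j
    induction j using Fin.lastCases with
    | last =>
      simp only [subdivInto, Fin.lastCases_last, f.into_edge, Option.map_map]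
      rfl
    | cast i =>
      simp only [subdivInto, Fin.lastCases_castSucc, Option.map_some]
      rfl
  rcases x with n | ⟨a, i⟩
  · refine Eq.trans ?_ (key (S.out n) 0)
    exact congrArg (fun b => T.subdivInto w ⟨b, 0⟩) (f.out_node n)
  · exact key a i.succ

end Iso
end FTree

/-! ### Isomorphisms and transport of constellations -/

namespace Constellation
open FTree
variable {T T' T'' N N' N'' : FTree}

/-- Transport of a constellation along isomorphisms. -/
def transport (C : Constellation T N) (f : T'.Iso T) (g : N.Iso N') : Constellation T' N' where
  white a := C.white (f.edge a)
  black := (f.node.trans C.black).trans g.leaf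
  null := ((Equiv.sigmaCongrLeft (β := fun a => Fin (C.white a)) f.edge).trans C.null).trans g.nullDot
  kernel x := by
    obtain ⟨r, hr, h⟩ := (isKernel_iff _ _).1 (C.kernel (g.node.symm x))
    have hmem : ∀ d : T'.Node ⊕ Σ a, Fin (C.white (f.edge a)),
        N'.Le (Sum.elim (fun n => (((f.node.trans C.black).trans g.leaf) n).1)
          (fun p => N'.out ((((Equiv.sigmaCongrLeft (β := fun a => Fin (C.white a)) f.edge).trans C.null).trans
            g.nullDot) p).1) d) (N'.out x) ↔
        N.Le (Sum.elim (fun n => (C.black n).1) (fun p => N.out (C.null p).1) (f.subdivNode C.white d))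
          (N.out (g.node.symm x)) := by
      intro d
      rw [← g.le_edge_iff, ← g.out_node, Equiv.apply_symm_apply]
      rcases d with n | p
      · rfl
      · refine iff_of_eq (congrArg (fun b => N'.Le b (N'.out x)) ?_)
        exact g.out_node _
    obtain ⟨r, rfl⟩ := (f.subdivNode C.white).surjective r
    refine (isKernel_iff _ _).2 ⟨r, (hmem r).2 hr, fun d hd => ?_⟩
    rcases h _ ((hmem d).1 hd) with h1 | ⟨y, hy, h1⟩
    · exact .inl ((f.subdivNode C.white).injective h1)
    · refine .inr ?_
      obtain ⟨y, rfl⟩ := (f.subdivNode C.white).surjective y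
      refine ⟨y, (hmem y).2 hy, ?_⟩
      replace h1 := (f.parent_subdivide C.white d).symm.trans h1
      obtain ⟨z, hz, hz'⟩ := Option.map_eq_some_iff.1 h1
      rw [← (f.subdivNode C.white).injective hz']
      exact hz

theorem null_congr (C : Constellation T N) {a : T.Edge} {i i' : Fin (C.white a)} (h : (i : ℕ) = i') :
    C.null ⟨a, i⟩ = C.null ⟨a, i'⟩ := by
  rw [Fin.ext h]

theorem compatible_transport (C : Constellation T N) (f : T'.Iso T) (g : N.Iso N') :
    (C.transport f g).Compatible C f g.symm := by
  refine ⟨fun _ => rfl, fun n => ?_, fun a i i' h => ?_⟩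
  · exact g.edge.symm_apply_apply _
  · refine (g.node.symm_apply_apply _).trans ?_
    exact congrArg Subtype.val (C.null_congr h)

theorem Compatible.symm {C : Constellation T N} {C' : Constellation T' N'} {f : T.Iso T'}
    {g : N.Iso N'} (h : C.Compatible C' f g) : C'.Compatible C f.symm g.symm := by
  obtain ⟨h1, h2, h3⟩ := h
  refine ⟨fun a => ?_, fun n => ?_, fun a i i' hi => ?_⟩
  · have := h1 (f.edge.symm a)
    rw [Equiv.apply_symm_apply] at this
    exact this.symm
  · refine g.edge.symm_apply_eq.2 ?_
    refine Eq.trans ?_ (h2 _).symm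
    exact congrArg (fun n => (C'.black n).1) (f.node.apply_symm_apply n).symm
  · obtain ⟨a, rfl⟩ := f.edge.surjective a
    refine g.node.symm_apply_eq.2 ?_
    have key : ∀ b (hb : b = a) (j : Fin (C.white b)) (_ : (j : ℕ) = i'),
        (C'.null ⟨f.edge a, i⟩).1 = g.node (C.null ⟨b, j⟩).1 := by
      rintro b rfl j hj
      exact (h3 b j i (hj.trans (hi.symm))).symm
    exact key _ (f.edge.symm_apply_apply a) i' rfl

theorem Compatible.trans {C : Constellation T N} {C' : Constellation T' N'} {C'' : Constellation T'' N''}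
    {f : T.Iso T'} {g : N.Iso N'} {f' : T'.Iso T''} {g' : N'.Iso N''}
    (h : C.Compatible C' f g) (h' : C'.Compatible C'' f' g') :
    C.Compatible C'' (f.trans f') (g.trans g') := by
  refine ⟨fun a => (h'.1 _).trans (h.1 a), fun n => ?_, fun a i i' hi => ?_⟩
  · exact (congrArg g'.edge (h.2.1 n)).trans (h'.2.1 _)
  · let j : Fin (C'.white (f.edge a)) := Fin.cast (h.1 a).symm i
    exact (congrArg g'.node (h.2.2 a i j rfl)).trans (h'.2.2 _ j i' hi)

theorem compatible_refl (C : Constellation T N) : C.Compatible C (Iso.refl T) (Iso.refl N) :=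
  ⟨fun _ => rfl, fun _ => rfl, fun _ _ _ h => congrArg Subtype.val (C.null_congr h)⟩

end Constellation

/-! ### Constellations as labellings of dots by edges -/

namespace FTree

/-- There is no edge directly above the edge `a`, that is, `a` is a leaf or the output edge of a null-dot. -/
def IsTop (T : FTree) (a : T.Edge) : Prop := ∀ x n, T.into x = some n → T.out n ≠ a

theorem subdivInto_eq (T : FTree) (w : T.Edge → ℕ) (a : T.Edge) (j : Fin (w a + 1)) :
    T.subdivInto w ⟨a, j⟩ =
      if h : (j : ℕ) < w a then some (Sum.inr ⟨a, ⟨j, h⟩⟩) else (T.into a).map Sum.inl := by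
  induction j using Fin.lastCases with
  | last => simp [subdivInto]
  | cast i => simp [subdivInto]

theorem Iso.isTop_iff {S T : FTree} (f : S.Iso T) (a : S.Edge) : T.IsTop (f.edge a) ↔ S.IsTop a := by
  constructor
  · intro h x n hx ha
    refine h (f.edge x) (f.node n) ((f.into_eq_some_iff x n).2 hx) ?_
    rw [f.out_node, ha]
  · intro h x n hx ha
    obtain ⟨x, rfl⟩ := f.edge.surjective x
    obtain ⟨n, rfl⟩ := f.node.surjective n
    refine h x n ((f.into_eq_some_iff x n).1 hx) (f.edge.injective ?_)
    rw [← f.out_node, ha]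

theorem Iso.ofEq_symm {S T : FTree} (h : S = T) : (Iso.ofEq h).symm = Iso.ofEq h.symm := by
  subst h
  exact Iso.ext_edge fun _ => rfl

end FTree

namespace Constellation
open FTree
variable {T T' N N' : FTree}

/-- The edge belonging to a dot: the leaf of a black dot, or the output edge of the null-dot of a white dot. -/
def edge (C : Constellation T N) : (T.Node ⊕ Σ a, Fin (C.white a)) → N.Edge :=
  Sum.elim (fun n => (C.black n).1) (fun p => N.out (C.null p).1)

theorem edge_injective (C : Constellation T N) : Function.Injective C.edge := by
  rintro (n | p) (m | q) h
  · exact congrArg Sum.inl (C.black.injective (Subtype.ext h))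
  · exact absurd h.symm ((C.black n).2 _)
  · exact absurd h ((C.black m).2 _)
  · exact congrArg Sum.inr (C.null.injective (Subtype.ext (N.out_injective h)))

/-- An edge with nothing above it is either a leaf or the output edge of a null-dot. Together with
`edge_injective`, the two bijections of a constellation become a single one, between the dots of the
subdivision and these edges of `N`. -/
theorem exists_edge (C : Constellation T N) (a : N.Edge) : (∃ p, C.edge p = a) ↔ N.IsTop a := by
  constructor
  · rintro ⟨n | p, rfl⟩
    · exact fun x m _ h => (C.black n).2 m h
    · intro x m h h'
      exact (C.null p).2 x (N.out_injective h' ▸ h)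
  · intro h
    by_cases ha : ∃ n, N.out n = a
    · obtain ⟨n, rfl⟩ := ha
      refine ⟨Sum.inr (C.null.symm ⟨n, fun x hx => h x n hx rfl⟩), ?_⟩
      exact congrArg (fun z => N.out z.1) (C.null.apply_symm_apply _)
    · refine ⟨Sum.inl (C.black.symm ⟨a, fun n hn => ha ⟨n, hn⟩⟩), ?_⟩
      exact congrArg Subtype.val (C.black.apply_symm_apply _)

theorem isKernel_edge (C : Constellation T N) (x : N.Node) :
    (T.subdivide C.white).IsKernel {d | N.Le (C.edge d) (N.out x)} := C.kernel x

/-- The edges belonging to the white dots on the edge `a`. -/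
def whites (C : Constellation T N) (a : T.Edge) : List N.Edge :=
  List.ofFn fun i => C.edge (Sum.inr ⟨a, i⟩)

/-- Listing the white dots of an edge in order encodes both their number and their numbering, and
avoids indices in `Fin` types depending on equal but different numbers. -/
theorem compatible_iff (C : Constellation T N) (C' : Constellation T' N') (f : T.Iso T')
    (g : N.Iso N') : C.Compatible C' f g ↔
      (∀ n, g.edge (C.edge (Sum.inl n)) = C'.edge (Sum.inl (f.node n))) ∧
      ∀ a, C'.whites (f.edge a) = (C.whites a).map g.edge := by
  have hout : ∀ p q, g.node (C.null p).1 = (C'.null q).1 ↔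
      g.edge (C.edge (Sum.inr p)) = C'.edge (Sum.inr q) := by
    intro p q
    refine Iff.trans ⟨congrArg N'.out, fun h => N'.out_injective h⟩ ?_
    rw [g.out_node]
    rfl
  have hlist : ∀ a, C'.whites (f.edge a) = (C.whites a).map g.edge ↔
      C'.white (f.edge a) = C.white a ∧ ∀ (i : Fin (C.white a)) (i' : Fin (C'.white (f.edge a))),
        (i : ℕ) = i' → g.node (C.null ⟨a, i⟩).1 = (C'.null ⟨f.edge a, i'⟩).1 := by
    intro a
    simp only [hout]
    unfold whites
    rw [List.map_ofFn]
    constructor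
    · intro h
      have hl : C'.white (f.edge a) = C.white a := by simpa using congrArg List.length h
      refine ⟨hl, fun i i' hi => ?_⟩
      have h1 := List.getElem_of_eq h (i := (i : ℕ)) (by simp [hl])
      simp only [List.getElem_ofFn, Function.comp] at h1
      refine h1.symm.trans ?_
      exact congrArg (fun i => C'.edge (Sum.inr ⟨f.edge a, i⟩)) (Fin.ext hi)
    · rintro ⟨hl, h⟩
      refine List.ext_getElem (by simp [hl]) fun i h1 h2 => ?_
      simp only [List.getElem_ofFn, Function.comp]
      exact (h _ _ rfl).symm
  constructor
  · rintro ⟨h1, h2, h3⟩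
    exact ⟨h2, fun a => (hlist a).2 ⟨h1 a, h3 a⟩⟩
  · rintro ⟨h2, h3⟩
    exact ⟨fun a => ((hlist a).1 (h3 a)).1, h2, fun a => ((hlist a).1 (h3 a)).2⟩

/-- A constellation given by the edges belonging to the dots. -/
noncomputable def ofLists (β : T.Node → N.Edge) (L : T.Edge → List N.Edge)
    (hi : Function.Injective
      (Sum.elim β fun p : Σ a, Fin (L a).length => (L p.1).get p.2))
    (hr : ∀ a, N.IsTop a → ∃ p, Sum.elim β (fun p : Σ a, Fin (L a).length => (L p.1).get p.2) p = a)
    (hb : ∀ n m, N.out m ≠ β n) (hw : ∀ a, ∀ d ∈ L a, N.IsTop d ∧ ∃ m, N.out m = d)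
    (hk : ∀ x, (T.subdivide fun a => (L a).length).IsKernel
      {d | N.Le (Sum.elim β (fun p => (L p.1).get p.2) d) (N.out x)}) : Constellation T N :=
  have h := fun p : Σ a, Fin (L a).length => hw p.1 _ (List.get_mem _ p.2)
  have h' : ∀ p, N.out (h p).2.choose = (L p.1).get p.2 := fun p => (h p).2.choose_spec
  { white := fun a => (L a).length
    black := Equiv.ofBijective (fun n => ⟨β n, hb n⟩)
      ⟨fun n m e => Sum.inl_injective (hi (congrArg Subtype.val e)), by
        rintro ⟨a, ha⟩
        obtain ⟨n | p, rfl⟩ := hr a fun x n _ => ha n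
        · exact ⟨n, rfl⟩
        · exact absurd (h' p) (ha _)⟩
    null := Equiv.ofBijective (fun p => ⟨(h p).2.choose, fun x hx => (h p).1 x _ hx (h' p)⟩)
      ⟨fun p q e => Sum.inr_injective (hi ((h' p).symm.trans
        ((congrArg (fun z => N.out z.1) e).trans (h' q)))), by
        rintro ⟨n, hn⟩
        obtain ⟨m | p, e⟩ := hr (N.out n) fun x m hx hm => hn x (N.out_injective hm ▸ hx)
        · exact absurd e.symm (hb m n)
        · exact ⟨p, Subtype.ext (N.out_injective ((h' p).trans e))⟩⟩
    kernel := fun x => by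
      refine Eq.mp ?_ (hk x)
      congr 1
      ext d
      refine iff_of_eq (congrArg (fun b => N.Le b (N.out x)) ?_)
      rcases d with n | p
      · rfl
      · exact (h' p).symm }

theorem whites_ofLists (β : T.Node → N.Edge) (L : T.Edge → List N.Edge) (hi hr hb hw hk) (a) :
    (ofLists β L hi hr hb hw hk).whites a = L a := by
  refine Eq.trans ?_ (List.ofFn_get (L a))
  refine congrArg List.ofFn (funext fun i => ?_)
  exact (hw a _ (List.get_mem _ i)).2.choose_spec

end Constellation

/-! ### Extending zoom complexes by one constellation -/

namespace ZoomComplex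
open FTree Constellation

/-- The trees of the extended sequence equal the given ones only up to a provable equality, so the
constellations are transported and the extension is stated up to isomorphism. -/
theorem exists_extension {n : ℕ} (X : ZoomComplex n) (N : FTree) (C : Constellation X.composition N) :
    ∃ (Y : ZoomComplex (n + 1)) (f : ∀ i, (Y.truncate.tree i).Iso (X.tree i))
      (g : Y.composition.Iso N),
      (∀ i, (Y.truncate.const i).Compatible (X.const i) (f i.castSucc) (f i.succ)) ∧
      (Y.const (Fin.last _)).Compatible C (f (Fin.last _)) g := by
  let tree : Fin (n + 1 + 2) → FTree := Fin.lastCases (motive := fun _ => FTree) N X.tree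
  have h1 : ∀ i : Fin (n + 2), tree i.castSucc = X.tree i := fun i => Fin.lastCases_castSucc i
  have h2 : tree (Fin.last _) = N := Fin.lastCases_last
  let const : ∀ i : Fin (n + 1 + 1), Constellation (tree i.castSucc) (tree i.succ) :=
    Fin.lastCases (motive := fun i => Constellation (tree i.castSucc) (tree i.succ))
      (C.transport (Iso.ofEq (h1 (Fin.last _))) (Iso.ofEq h2.symm))
      (fun i => (X.const i).transport (Iso.ofEq (h1 i.castSucc)) (Iso.ofEq (h1 i.succ).symm))
  refine ⟨⟨tree, const⟩, fun i => Iso.ofEq (h1 i), Iso.ofEq h2, fun i => ?_, ?_⟩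
  · have e : const i.castSucc = (X.const i).transport (Iso.ofEq (h1 i.castSucc))
        (Iso.ofEq (h1 i.succ).symm) := Fin.lastCases_castSucc i
    have := compatible_transport (X.const i) (Iso.ofEq (h1 i.castSucc)) (Iso.ofEq (h1 i.succ).symm)
    rw [← e, Iso.ofEq_symm] at this
    exact this
  · have e : const (Fin.last _) = C.transport (Iso.ofEq (h1 (Fin.last _))) (Iso.ofEq h2.symm) :=
      Fin.lastCases_last
    have := compatible_transport C (Iso.ofEq (h1 (Fin.last _))) (Iso.ofEq h2.symm)
    rw [← e, Iso.ofEq_symm] at this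
    exact this

theorem isomorphic_of_truncate {n : ℕ} {X Y : ZoomComplex (n + 1)}
    (f : ∀ i, (X.truncate.tree i).Iso (Y.truncate.tree i)) (g : X.composition.Iso Y.composition)
    (h : ∀ i, (X.truncate.const i).Compatible (Y.truncate.const i) (f i.castSucc) (f i.succ))
    (h' : (X.const (Fin.last _)).Compatible (Y.const (Fin.last _)) (f (Fin.last _)) g) :
    ∃ F : ∀ i, (X.tree i).Iso (Y.tree i), (∀ i, (X.const i).Compatible (Y.const i)
      (F i.castSucc) (F i.succ)) ∧ F (Fin.last _) = g := by
  let F : ∀ i, (X.tree i).Iso (Y.tree i) :=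
    Fin.lastCases (motive := fun i => (X.tree i).Iso (Y.tree i)) g f
  have h1 : ∀ i : Fin (n + 2), F i.castSucc = f i := fun i => Fin.lastCases_castSucc i
  have h2 : F (Fin.last _) = g := Fin.lastCases_last
  refine ⟨F, fun i => ?_, h2⟩
  induction i using Fin.lastCases with
  | last =>
    refine Eq.mp ?_ h'
    exact congrArg₂ (fun a b => (X.const (Fin.last _)).Compatible (Y.const (Fin.last _)) a b)
      (h1 _).symm h2.symm
  | cast i =>
    refine Eq.mp ?_ (h i)
    exact congrArg₂ (fun a b => (X.const i.castSucc).Compatible (Y.const i.castSucc) a b)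
      (h1 _).symm (h1 _).symm

end ZoomComplex

/-! ### The order on the edges -/

namespace FTree
variable (T : FTree)

/-- The edge `b` is directly below the edge `a`. -/
def Step (a b : T.Edge) : Prop := ∃ n, T.into a = some n ∧ T.out n = b

variable {T}

theorem Step.unique {a b b' : T.Edge} (h : T.Step a b) (h' : T.Step a b') : b = b' := by
  obtain ⟨n, h1, rfl⟩ := h
  obtain ⟨m, h2, rfl⟩ := h'
  rw [Option.some.inj (h1.symm.trans h2)]

theorem not_step_root (b : T.Edge) : ¬T.Step T.root b := by
  rintro ⟨n, h, _⟩
  rw [(T.into_eq_none _).2 rfl] at h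
  cases h

theorem le_root_iff (a : T.Edge) : T.Le T.root a ↔ a = T.root := by
  refine ⟨fun h => ?_, fun h => h ▸ .refl⟩
  rcases Relation.ReflTransGen.cases_head h with h | ⟨b, h, _⟩
  · exact h.symm
  · exact absurd h (not_step_root b)

theorem not_cyclic (a b : T.Edge) (h : T.Step a b) (h' : T.Le b a) : False := by
  have key : ∀ a : T.Edge, ∀ b, T.Step a b → T.Le b a → False := by
    intro a
    induction T.reaches_root a using Relation.ReflTransGen.head_induction_on with
    | refl => exact fun b h _ => not_step_root b h
    | @head a c h1 _ ih =>
      intro b h h'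
      obtain rfl : b = c := h.unique h1
      rcases Relation.ReflTransGen.cases_head h' with rfl | ⟨d, h2, h3⟩
      · exact ih _ h .refl
      · exact ih d h2 (h3.tail h)
  exact key a b h h'

theorem le_total {x a b : T.Edge} (ha : T.Le x a) (hb : T.Le x b) : T.Le a b ∨ T.Le b a := by
  induction ha using Relation.ReflTransGen.head_induction_on with
  | refl => exact .inl hb
  | @head x c h1 h2 ih =>
    rcases Relation.ReflTransGen.cases_head hb with rfl | ⟨d, h3, h4⟩
    · exact .inr (.head h1 h2)
    · obtain rfl : d = c := Step.unique (T := T) h3 h1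
      exact ih h4

/-- There are no cycles, since every edge reaches the root, and there are finitely many edges.
Induction along this relation passes from the edges directly above an edge to the edge itself. -/
theorem step_wellFounded (T : FTree) : WellFounded (T.Step) := by
  have := T.finite_edge
  have h : IsTrans T.Edge (Relation.TransGen T.Step) := ⟨fun _ _ _ => Relation.TransGen.trans⟩
  have h' : Std.Irrefl (Relation.TransGen T.Step) := ⟨fun a ha => by
    obtain ⟨b, h1, h2⟩ := Relation.TransGen.head'_iff.1 ha
    exact not_cyclic a b h1 h2⟩
  exact Subrelation.wf (fun h => Relation.TransGen.single h)
    (Finite.wellFounded_of_trans_of_irrefl (Relation.TransGen T.Step))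

end FTree

/-! ### Branches and isomorphisms of underlying trees -/

namespace PTree
variable {I I' : Type} {P : PolyEndo I} {Q : PolyEndo I'} {X Y : Type}

/-- The tree isomorphism between two trees with at least one node, given by isomorphisms of the branches. -/
def isoNode {b : P.B} {c : P.E b → PTree P X} {b' : Q.B} {c' : Q.E b' → PTree Q Y}
    (σ : P.E b ≃ Q.E b') (h : ∀ e, (c e).underlying.Iso (c' (σ e)).underlying) :
    (node b c).underlying.Iso (node b' c').underlying where
  edge := Equiv.optionCongr (Equiv.sigmaCongr σ fun e => (h e).edge)
  node := Equiv.optionCongr (Equiv.sigmaCongr σ fun e => (h e).node)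
  out_node := by
    rintro (_ | ⟨e, n⟩)
    · rfl
    · exact congrArg (fun a => some (Sigma.mk (σ e) a)) ((h e).out_node n)
  into_edge := by
    rintro (_ | ⟨e, a⟩)
    · rfl
    · have h1 : (c' (σ e)).into ((h e).edge a) = ((c e).into a).map (h e).node := (h e).into_edge a
      change some (((c' (σ e)).into ((h e).edge a)).map (Sigma.mk (β := fun e => (c' e).Nodes) (σ e))) =
        (some (((c e).into a).map (Sigma.mk (β := fun e => (c e).Nodes) e))).map _
      rw [h1]
      cases (c e).into a <;> rfl

/-- The isomorphism between two unit trees. -/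
def isoLeaf (x : X) (y : Y) : (leaf x : PTree P X).underlying.Iso (leaf y : PTree Q Y).underlying where
  edge := Equiv.refl PUnit
  node := Equiv.refl PEmpty
  out_node n := PEmpty.elim n
  into_edge _ := rfl

section
variable {b : P.B} {c : P.E b → PTree P X}

theorem step_some (e : P.E b) (a : (c e).Edges) (y : (node b c).Edges) :
    (node b c).underlying.Step (some ⟨e, a⟩) y ↔
      (a = (c e).rootEdge ∧ y = none) ∨ ∃ a', (c e).underlying.Step a a' ∧ y = some ⟨e, a'⟩ := by
  have h0 : ∀ a, (c e).into a = none ↔ a = (c e).rootEdge := (c e).underlying.into_eq_none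
  constructor
  · rintro ⟨n, h, rfl⟩
    have h : some (((c e).into a).map (Sigma.mk (β := fun e => (c e).Nodes) e)) = some n := h
    have h := Option.some.inj h
    cases ha : (c e).into a with
    | none =>
      rw [ha] at h
      subst h
      exact .inl ⟨(h0 a).1 ha, rfl⟩
    | some m =>
      rw [ha] at h
      subst h
      exact .inr ⟨(c e).out m, ⟨m, ha, rfl⟩, rfl⟩
  · rintro (⟨rfl, rfl⟩ | ⟨a', ⟨n, h, rfl⟩, rfl⟩)
    · refine ⟨none, ?_, rfl⟩
      change some (((c e).into _).map (Sigma.mk (β := fun e => (c e).Nodes) e)) = some none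
      rw [(h0 _).2 rfl]
      rfl
    · refine ⟨some ⟨e, n⟩, ?_, rfl⟩
      have h : (c e).into a = some n := h
      change some (((c e).into _).map (Sigma.mk (β := fun e => (c e).Nodes) e)) = _
      rw [h]
      rfl

theorem le_some_iff (e : P.E b) (a a' : (c e).Edges) :
    (node b c).underlying.Le (some ⟨e, a⟩) (some ⟨e, a'⟩) ↔ (c e).underlying.Le a a' := by
  constructor
  · intro h
    have key : ∀ x y, (node b c).underlying.Le x y → ∀ a, x = some ⟨e, a⟩ → ∀ a', y = some ⟨e, a'⟩ →
        (c e).underlying.Le a a' := by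
      intro x y h
      induction h using Relation.ReflTransGen.head_induction_on with
      | refl =>
        rintro a h1 a' h2
        have := Option.some.inj (h1.symm.trans h2)
        obtain rfl : a = a' := eq_of_heq (Sigma.mk.inj this).2
        exact .refl
      | @head x z h1 h2 ih =>
        rintro a rfl a' rfl
        rcases (step_some e a z).1 h1 with ⟨_, rfl⟩ | ⟨a'', h3, rfl⟩
        · have := ((node b c).underlying.le_root_iff _).1 h2
          cases this
        · exact .head h3 (ih a'' rfl a' rfl)
    exact key _ _ h a rfl a' rfl
  · intro h
    refine h.lift (p := fun a b' => ∃ n, (node b c).into a = some n ∧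
          (node b c).out n = b') (fun a => some ⟨e, a⟩) ?_
    exact fun a a' h => (step_some e a _).2 (.inr ⟨a', h, rfl⟩)

theorem eq_of_le_some {e e' : P.E b} {a : (c e).Edges} {a' : (c e').Edges}
    (h : (node b c).underlying.Le (some ⟨e, a⟩) (some ⟨e', a'⟩)) : e = e' := by
  have key : ∀ x y, (node b c).underlying.Le x y → ∀ e a, x = some ⟨e, a⟩ → ∀ e' a', y = some ⟨e', a'⟩ →
      e = e' := by
    intro x y h
    induction h using Relation.ReflTransGen.head_induction_on with
    | refl =>
      rintro e a h1 e' a' h2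
      exact (Sigma.mk.inj (Option.some.inj (h1.symm.trans h2))).1
    | @head x z h1 h2 ih =>
      rintro e a rfl e' a' rfl
      rcases (step_some e a z).1 h1 with ⟨_, rfl⟩ | ⟨a'', h3, rfl⟩
      · have := ((node b c).underlying.le_root_iff _).1 h2
        cases this
      · exact ih e a'' rfl e' a' rfl
  exact key _ _ h e a rfl e' a' rfl

theorem isTop_some (e : P.E b) (a : (c e).Edges) :
    (node b c).underlying.IsTop (some ⟨e, a⟩) ↔ (c e).underlying.IsTop a := by
  constructor
  · intro h x n hx ha
    obtain ⟨m, h1, h2⟩ := (step_some (c := c) e x (some ⟨e, a⟩)).2 (.inr ⟨a, ⟨n, hx, ha⟩, rfl⟩)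
    exact h _ m h1 h2
  · rintro h (_ | ⟨e', x⟩) n hx ha
    · exact FTree.not_step_root (T := (node b c).underlying) _ ⟨n, hx, ha⟩
    · rcases (step_some (c := c) e' x (some ⟨e, a⟩)).1 ⟨n, hx, ha⟩ with ⟨_, h1⟩ | ⟨a', ⟨m, h1, h2⟩, h3⟩
      · cases h1
      · obtain ⟨h4, h5⟩ := Sigma.mk.inj (Option.some.inj h3)
        subst h4
        obtain rfl := eq_of_heq h5
        exact h _ m h1 h2

theorem isTop_none : (node b c).underlying.IsTop none ↔ IsEmpty (P.E b) := by
  constructor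
  · intro h
    refine ⟨fun e => ?_⟩
    obtain ⟨m, h1, h2⟩ := (step_some (c := c) e (c e).rootEdge none).2 (.inl ⟨rfl, rfl⟩)
    exact h _ m h1 h2
  · rintro h (_ | ⟨e', x⟩) n hx ha
    · exact FTree.not_step_root (T := (node b c).underlying) _ ⟨n, hx, ha⟩
    · exact h.false e'

/-- An isomorphism preserves the root edge and the relation of lying directly below, so it permutes
the root edges of the branches. Induction up from these edges shows that each branch is carried into
a single branch. -/
theorem exists_iso_children {b' : Q.B} {c' : Q.E b' → PTree Q Y}
    (g : (node b c).underlying.Iso (node b' c').underlying) :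
    ∃ (σ : P.E b ≃ Q.E b') (h : ∀ e, (c e).underlying.Iso (c' (σ e)).underlying),
      ∀ e a, g.edge (some ⟨e, a⟩) = some ⟨σ e, (h e).edge a⟩ := by
  have hroot : g.edge none = none := g.edge_root
  have hstep : ∀ x y, (node b c).underlying.Step x y →
      (node b' c').underlying.Step (g.edge x) (g.edge y) := by
    rintro x _ ⟨n, h, rfl⟩
    exact ⟨g.node n, (g.into_eq_some_iff x n).2 h, g.out_node n⟩
  have hsome : ∀ x, ∃ y, g.edge (some x) = some y := by
    intro x
    cases hx : g.edge (some x) with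
    | none =>
      have := g.edge.injective (hx.trans hroot.symm)
      cases this
    | some y => exact ⟨y, rfl⟩
  have h1 : ∀ e, ∃ e', g.edge (some ⟨e, (c e).rootEdge⟩) = some ⟨e', (c' e').rootEdge⟩ := by
    intro e
    obtain ⟨⟨e', a'⟩, h⟩ := hsome ⟨e, (c e).rootEdge⟩
    have h2 := hstep _ _ ((step_some (c := c) e (c e).rootEdge none).2 (.inl ⟨rfl, rfl⟩))
    rw [h, hroot] at h2
    rcases (step_some (c := c') e' a' none).1 h2 with ⟨rfl, _⟩ | ⟨_, _, h3⟩
    · exact ⟨e', h⟩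
    · cases h3
  choose σ hσ using h1
  have h2 : ∀ e a, ∃ a', g.edge (some ⟨e, a⟩) = some ⟨σ e, a'⟩ := by
    intro e a
    induction (c e).underlying.reaches_root a using Relation.ReflTransGen.head_induction_on with
    | refl => exact ⟨_, hσ e⟩
    | @head x y hxy _ ih =>
      obtain ⟨y', hy⟩ := ih
      obtain ⟨⟨e', x'⟩, h⟩ := hsome ⟨e, x⟩
      have h2 := hstep _ _ ((step_some (c := c) e x (some ⟨e, y⟩)).2 (.inr ⟨y, hxy, rfl⟩))
      rw [h, hy] at h2
      rcases (step_some (c := c') e' x' _).1 h2 with ⟨_, h3⟩ | ⟨a', _, h3⟩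
      · cases h3
      · obtain h4 := (Sigma.mk.inj (Option.some.inj h3)).1
        rw [h]
        change σ e = e' at h4
        subst h4
        exact ⟨x', rfl⟩
  choose ge hge using h2
  have hσinj : Function.Injective σ := by
    intro e e' h
    have : g.edge (some ⟨e, (c e).rootEdge⟩) = g.edge (some ⟨e', (c e').rootEdge⟩) := by
      rw [hσ, hσ, h]
    exact (Sigma.mk.inj (Option.some.inj (g.edge.injective this))).1
  have hsurj : ∀ e' a', ∃ e a, (⟨e', a'⟩ : Σ e, (c' e).Edges) = ⟨σ e, ge e a⟩ := by
    intro e' a'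
    obtain ⟨x, hx⟩ := g.edge.surjective (some ⟨e', a'⟩)
    rcases x with _ | ⟨e, a⟩
    · cases hroot.symm.trans hx
    · exact ⟨e, a, Option.some.inj (hx.symm.trans (hge e a))⟩
  have hgb : ∀ e, Function.Bijective (ge e) := by
    refine fun e => ⟨fun a a' h => ?_, fun a' => ?_⟩
    · have : g.edge (some ⟨e, a⟩) = g.edge (some ⟨e, a'⟩) := by rw [hge, hge, h]
      exact eq_of_heq (Sigma.mk.inj (Option.some.inj (g.edge.injective this))).2
    · obtain ⟨e2, a, h⟩ := hsurj (σ e) a'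
      obtain ⟨h3, h4⟩ := Sigma.mk.inj h
      obtain rfl := hσinj h3
      exact ⟨a, (eq_of_heq h4).symm⟩
  have hnd : ∀ e (n : (c e).Nodes), ∃ n', g.node (some ⟨e, n⟩) = some ⟨σ e, n'⟩ ∧
      (c' (σ e)).out n' = ge e ((c e).out n) := by
    intro e n
    have h3 : (node b' c').out (g.node (some ⟨e, n⟩)) = some ⟨σ e, ge e ((c e).out n)⟩ :=
      (g.out_node _).trans (hge e _)
    generalize g.node (some ⟨e, n⟩) = m at h3
    rcases m with _ | ⟨e', n'⟩
    · cases h3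
    · obtain ⟨h4, h5⟩ := Sigma.mk.inj (Option.some.inj h3)
      change e' = σ e at h4
      subst h4
      exact ⟨n', rfl, eq_of_heq h5⟩
  choose nd hnd hnd' using hnd
  have hnb : ∀ e, Function.Bijective (nd e) := by
    refine fun e => ⟨fun n n' h => ?_, fun n' => ?_⟩
    · have : g.node (some ⟨e, n⟩) = g.node (some ⟨e, n'⟩) := by rw [hnd, hnd, h]
      exact eq_of_heq (Sigma.mk.inj (Option.some.inj (g.node.injective this))).2
    · obtain ⟨x, hx⟩ := g.node.surjective (some ⟨σ e, n'⟩)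
      rcases x with _ | ⟨e2, n⟩
      · have h3 : (node b' c').out (g.node none) = none := (g.out_node none).trans hroot
        rw [hx] at h3
        cases h3
      · obtain ⟨h3, h4⟩ := Sigma.mk.inj (Option.some.inj (hx.symm.trans (hnd e2 n)))
        obtain rfl := hσinj h3
        exact ⟨n, (eq_of_heq h4).symm⟩
  refine ⟨Equiv.ofBijective σ ⟨hσinj, fun e' => ?_⟩, fun e =>
    ⟨Equiv.ofBijective _ (hgb e), Equiv.ofBijective _ (hnb e), hnd' e, fun a => ?_⟩, hge⟩
  · obtain ⟨e, a, h⟩ := hsurj e' (c' e').rootEdge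
    exact ⟨e, (Sigma.mk.inj h).1.symm⟩
  · have h3 := (congrArg (node b' c').into (hge e a)).symm.trans (g.into_edge (some ⟨e, a⟩))
    have h3 : some (((c' (σ e)).into (ge e a)).map (Sigma.mk (β := fun e => (c' e).Nodes) (σ e))) =
        (some (((c e).into a).map (Sigma.mk (β := fun e => (c e).Nodes) e))).map g.node := h3
    change (c' (σ e)).into (ge e a) = ((c e).into a).map (nd e)
    cases hx : (c e).into a with
    | none =>
      rw [hx] at h3
      cases hy : (c' (σ e)).into (ge e a) with
      | none => rfl
      | some m =>
        rw [hy] at h3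
        have h4 : (node b' c').out (g.node none) = none := (g.out_node none).trans hroot
        have h5 : some ⟨σ e, m⟩ = g.node none := Option.some.inj h3
        rw [← h5] at h4
        cases h4
    | some n =>
      rw [hx] at h3
      have h5 : ((c' (σ e)).into (ge e a)).map (Sigma.mk (β := fun e => (c' e).Nodes) (σ e)) = g.node (some ⟨e, n⟩) :=
        Option.some.inj h3
      rw [hnd] at h5
      obtain ⟨m, hm, h6⟩ := Option.map_eq_some_iff.1 h5
      rw [hm]
      exact congrArg some (eq_of_heq (Sigma.mk.inj h6).2)

end

theorem exists_isTop_le (T : PTree P X) (a : T.Edges) :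
    ∃ d, T.underlying.IsTop d ∧ T.underlying.Le d a := by
  induction T with
  | leaf x => exact ⟨a, fun y n => PEmpty.elim n, .refl⟩
  | node b c ih =>
    rcases a with _ | ⟨e, a⟩
    · by_cases h : IsEmpty (P.E b)
      · exact ⟨none, isTop_none.2 h, .refl⟩
      · obtain ⟨e⟩ := not_isEmpty_iff.1 h
        obtain ⟨d, hd, _⟩ := ih e (c e).rootEdge
        exact ⟨some ⟨e, d⟩, (isTop_some e d).2 hd, (node b c).underlying.mem_root _⟩
    · obtain ⟨d, hd, hd'⟩ := ih e a
      exact ⟨some ⟨e, d⟩, (isTop_some e d).2 hd, (le_some_iff e d a).2 hd'⟩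

end PTree

/-! ### Every finite tree underlies a decorated tree -/

namespace FTree
open PTree

/-- The polynomial whose operations are the nodes of `N`, with their input edges as inputs. -/
def poly (N : FTree) : PolyEndo PUnit.{1} where
  B := N.Node
  E n := {a : N.Edge // N.into a = some n}
  finite n := by
    have := N.finite_edge
    infer_instance
  s _ _ := ⟨⟩
  t _ := ⟨⟩

theorem exists_iso_underlying (N : FTree) : ∃ M : PTree N.poly PUnit.{1}, Nonempty (N.Iso M.underlying) := by
  -- `M` is the part of `N` above the edge `a`. Its root edge has no node below it in `M`, although
  -- `a` may have one in `N`; hence the exception in the clause about `into`, which becomes harmless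
  -- when `a` is the root.
  have key : ∀ a : N.Edge, ∃ (M : PTree N.poly PUnit.{1}) (ε : M.Edges → N.Edge) (ν : M.Nodes → N.Node),
      Function.Injective ε ∧ ε M.rootEdge = a ∧ (∀ n, N.out (ν n) = ε (M.out n)) ∧
      (∀ x, x = M.rootEdge ∨ N.into (ε x) = (M.into x).map ν) ∧ (∀ x, N.Le (ε x) a) ∧
      (∀ y, N.Le y a → ∃ x, ε x = y) ∧ ∀ n, N.Le (N.out n) a → ∃ m, ν m = n := by
    intro a
    induction a using N.step_wellFounded.induction with
    | _ a ih =>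
    by_cases ha : ∃ n, N.out n = a
    · obtain ⟨n, hn⟩ := ha
      have hst : ∀ e : {a : N.Edge // N.into a = some n}, N.Step e.1 a := fun e => ⟨n, e.2, hn⟩
      choose M ε ν h1 h2 h3 h4 h5 h6 h7 using fun e : {a : N.Edge // N.into a = some n} => ih e.1 (hst e)
      have hle : ∀ y, N.Le y a → y = a ∨ ∃ e : {a : N.Edge // N.into a = some n}, N.Le y e.1 := by
        intro y hy
        rcases Relation.ReflTransGen.cases_tail hy with h | ⟨z, hz, m, hm, hm'⟩
        · exact .inl h.symm
        · obtain rfl : m = n := N.out_injective (hm'.trans hn.symm)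
          exact .inr ⟨⟨z, hm⟩, hz⟩
      refine ⟨node (P := N.poly) n M, fun x => x.elim a fun p => ε p.1 p.2,
        fun x => x.elim n fun p => ν p.1 p.2, ?_, rfl, ?_, ?_, ?_, ?_, ?_⟩
      · have hne : ∀ e x, ε e x ≠ a := fun e x h => not_cyclic e.1 a (hst e) (h ▸ h5 e x)
        rintro (_ | ⟨e, x⟩) (_ | ⟨e', x'⟩) h
        · rfl
        · exact absurd h.symm (hne e' x')
        · exact absurd h (hne e x)
        · have h : ε e x = ε e' x' := h
          obtain rfl : e = e' := by
            have key : ∀ e e' : {a : N.Edge // N.into a = some n}, N.Le e.1 e'.1 → e = e' := by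
              intro e e' hh
              rcases Relation.ReflTransGen.cases_head hh with h | ⟨z, hz, hz'⟩
              · exact Subtype.ext h
              · obtain rfl : z = a := Step.unique hz (hst e)
                exact (not_cyclic _ _ (hst e') hz').elim
            rcases le_total (h5 e x) (h ▸ h5 e' x') with h | h
            · exact key _ _ h
            · exact (key _ _ h).symm
          rw [h1 e h]
      · rintro (_ | ⟨e, x⟩)
        · exact hn
        · exact h3 e x
      · rintro (_ | ⟨e, x⟩)
        · exact .inl rfl
        · refine .inr ?_
          change N.into (ε e x) = (some (((M e).into x).map (Sigma.mk (β := fun e => (M e).Nodes) e))).map _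
          by_cases hx : x = (M e).rootEdge
          · subst hx
            refine (congrArg N.into (h2 e)).trans (e.2.trans ?_)
            have h0 : (M e).into (M e).rootEdge = none := ((M e).underlying.into_eq_none _).2 rfl
            rw [h0]
            rfl
          · refine ((h4 e x).resolve_left hx).trans ?_
            cases hy : (M e).into x with
            | none => exact absurd (((M e).underlying.into_eq_none _).1 hy) hx
            | some m => rfl
      · rintro (_ | ⟨e, x⟩)
        · exact .refl
        · exact (h5 e x).tail (hst e)
      · intro y hy
        rcases hle y hy with rfl | ⟨e, he⟩
        · exact ⟨none, rfl⟩
        · obtain ⟨x, hx⟩ := h6 e y he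
          exact ⟨some ⟨e, x⟩, hx⟩
      · intro m hm
        rcases hle _ hm with h | ⟨e, he⟩
        · exact ⟨none, N.out_injective (hn.trans h.symm)⟩
        · obtain ⟨x, hx⟩ := h7 e m he
          exact ⟨some ⟨e, x⟩, hx⟩
    · have hle : ∀ y, N.Le y a → y = a := by
        intro y hy
        rcases Relation.ReflTransGen.cases_tail hy with h | ⟨z, hz, m, hm, hm'⟩
        · exact h.symm
        · exact absurd ⟨m, hm'⟩ ha
      refine ⟨leaf ⟨⟩, fun _ => a, fun n => PEmpty.elim n, fun _ _ _ => rfl, rfl, fun n => PEmpty.elim n,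
        fun _ => .inl rfl, fun _ => .refl, fun y hy => ⟨⟨⟩, (hle y hy).symm⟩,
        fun n hn => absurd ⟨n, hle _ hn⟩ ha⟩
  obtain ⟨M, ε, ν, h1, h2, h3, h4, _, h6, h7⟩ := key N.root
  have hν : Function.Injective ν := fun n m h =>
    M.underlying.out_injective (h1 ((h3 n).symm.trans ((congrArg N.out h).trans (h3 m))))
  refine ⟨M, ⟨Iso.symm ⟨Equiv.ofBijective ε ⟨h1, fun y => h6 y (N.mem_root y)⟩,
    Equiv.ofBijective ν ⟨hν, fun n => h7 n (N.mem_root _)⟩, h3, fun x => ?_⟩⟩⟩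
  rcases h4 x with rfl | h
  · refine ((N.into_eq_none _).2 h2).trans ?_
    exact (congrArg (Option.map ν) ((M.underlying.into_eq_none _).2 rfl)).symm
  · exact h

end FTree

/-! ### Trees with labelled nodes -/

namespace PTree
open PolyEndo
variable {I : Type u} {P : PolyEndo I} {X Y : Type u} {D D' J : Type u}

/-- Trees with nodes decorated by operations and by arbitrary labels. -/
abbrev Labelled (P : PolyEndo I) (D X : Type u) : Type u := PTree (P.pull (Prod.snd : D × P.B → P.B)) X

namespace Labelled

/-- Renaming of the labels. -/
def rename (g : D → D') (V : Labelled P D X) : Labelled P D' X :=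
  V.relabel (f := Prod.snd) (f' := Prod.snd) (Prod.map g id) fun _ => rfl

/-- The label of the root node. -/
def top : Labelled P D X → Option D
  | leaf _ => none
  | node a _ => some a.1

/-- The label `x` occurs. -/
def Mem : Labelled P D X → D → Prop
  | leaf _, _ => False
  | node a c, x => x = a.1 ∨ ∃ e, Mem (c e) x

/-- A node labelled `y` is directly below a node labelled `x`. -/
def Par : Labelled P D X → D → D → Prop
  | leaf _, _, _ => False
  | node a c, x, y => (y = a.1 ∧ ∃ e, top (c e) = some x) ∨ ∃ e, Par (c e) x y

/-- The labels are distinct. -/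
def Distinct : Labelled P D X → Prop
  | leaf _ => True
  | node a c => (∀ e, Distinct (c e)) ∧ (∀ e, ¬Mem (c e) a.1) ∧
      ∀ e e' x, Mem (c e) x → Mem (c e') x → e = e'

/-- The set of nodes with labels in `K` is nonempty and connected. -/
def Conn (V : Labelled P D X) (K : Set D) : Prop :=
  ∃ r ∈ K, ∀ x ∈ K, x = r ∨ ∃ y ∈ K, V.Par x y

theorem mem_iff (V : Labelled P D X) (x : D) : V.Mem x ↔ ∃ n, (V.nodeOp n).1 = x := by
  induction V with
  | leaf y => exact ⟨fun h => h.elim, fun ⟨n, _⟩ => PEmpty.elim n⟩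
  | node a c ih =>
    constructor
    · rintro (rfl | ⟨e, h⟩)
      · exact ⟨none, rfl⟩
      · obtain ⟨n, hn⟩ := (ih e).1 h
        exact ⟨some ⟨e, n⟩, hn⟩
    · rintro ⟨_ | ⟨e, n⟩, h⟩
      · exact .inl h.symm
      · exact .inr ⟨e, (ih e).2 ⟨n, h⟩⟩

theorem mem_of_top {V : Labelled P D X} {x : D} (h : V.top = some x) : V.Mem x := by
  cases V with
  | leaf y => cases h
  | node a c => exact .inl (Option.some.inj h).symm

theorem mem_of_par {V : Labelled P D X} {x y : D} (h : V.Par x y) : V.Mem x ∧ V.Mem y := by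
  induction V with
  | leaf z => exact h.elim
  | node a c ih =>
    rcases h with ⟨rfl, e, h⟩ | ⟨e, h⟩
    · exact ⟨.inr ⟨e, mem_of_top h⟩, .inl rfl⟩
    · exact ⟨.inr ⟨e, (ih e h).1⟩, .inr ⟨e, (ih e h).2⟩⟩

theorem exists_par {V : Labelled P D X} {x : D} (h : V.Mem x) : V.top = some x ∨ ∃ y, V.Par x y := by
  induction V with
  | leaf z => exact h.elim
  | node a c ih =>
    rcases h with rfl | ⟨e, h⟩
    · exact .inl rfl
    · rcases ih e h with h | ⟨y, h⟩
      · exact .inr ⟨a.1, .inl ⟨rfl, e, h⟩⟩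
      · exact .inr ⟨y, .inr ⟨e, h⟩⟩

theorem distinct_of_injective (V : Labelled P D X) (h : Function.Injective fun n => (V.nodeOp n).1) :
    V.Distinct := by
  induction V with
  | leaf z => trivial
  | node a c ih =>
    refine ⟨fun e => ih e fun n m hnm => ?_, fun e he => ?_, fun e e' x hx hx' => ?_⟩
    · have := @h (some ⟨e, n⟩) (some ⟨e, m⟩) hnm
      exact eq_of_heq (Sigma.mk.inj (Option.some.inj this)).2
    · obtain ⟨n, hn⟩ := (mem_iff _ _).1 he
      have := @h (some ⟨e, n⟩) none hn
      cases this
    · obtain ⟨n, hn⟩ := (mem_iff _ _).1 hx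
      obtain ⟨m, hm⟩ := (mem_iff _ _).1 hx'
      have := @h (some ⟨e, n⟩) (some ⟨e', m⟩) (hn.trans hm.symm)
      exact (Sigma.mk.inj (Option.some.inj this)).1

theorem Distinct.injective {V : Labelled P D X} (h : V.Distinct) :
    Function.Injective fun n => (V.nodeOp n).1 := by
  induction V with
  | leaf z => exact fun n => PEmpty.elim n
  | node a c ih =>
    rintro (_ | ⟨e, n⟩) (_ | ⟨e', m⟩) hnm
    · rfl
    · exact (h.2.1 e' ((mem_iff _ _).2 ⟨m, hnm.symm⟩)).elim
    · exact (h.2.1 e ((mem_iff _ _).2 ⟨n, hnm⟩)).elim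
    · obtain rfl := h.2.2 e e' _ ((mem_iff _ _).2 ⟨n, hnm⟩) ((mem_iff _ _).2 ⟨m, rfl⟩)
      exact congrArg (fun n => some (Sigma.mk e n)) (ih e (h.1 e) hnm)

theorem Distinct.top_ne {V : Labelled P D X} (hV : V.Distinct) {x y : D} (h : V.Par x y) :
    V.top ≠ some x := by
  cases V with
  | leaf z => exact h.elim
  | node a c =>
    intro hx
    obtain rfl : a.1 = x := Option.some.inj hx
    rcases h with ⟨_, e, h⟩ | ⟨e, h⟩
    · exact hV.2.1 e (mem_of_top h)
    · exact hV.2.1 e (mem_of_par h).1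

theorem Distinct.par_unique {V : Labelled P D X} (hV : V.Distinct) {x y y' : D} (h : V.Par x y)
    (h' : V.Par x y') : y = y' := by
  induction V with
  | leaf z => exact h.elim
  | node a c ih =>
    rcases h with ⟨rfl, e, h⟩ | ⟨e, h⟩ <;> rcases h' with ⟨rfl, e', h'⟩ | ⟨e', h'⟩
    · rfl
    · obtain rfl := hV.2.2 e e' x (mem_of_top h) (mem_of_par h').1
      exact ((hV.1 e).top_ne h' h).elim
    · obtain rfl := hV.2.2 e e' x (mem_of_par h).1 (mem_of_top h')
      exact ((hV.1 e).top_ne h h').elim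
    · obtain rfl := hV.2.2 e e' x (mem_of_par h).1 (mem_of_par h').1
      exact ih e (hV.1 e) h h'

theorem mem_map (V : Labelled P D X) (k : X → Y) (x : D) : Mem (V.map k) x ↔ V.Mem x := by
  induction V with
  | leaf z => exact Iff.rfl
  | node a c ih => exact or_congr Iff.rfl (exists_congr ih)

theorem top_map (V : Labelled P D X) (k : X → Y) : top (V.map k) = V.top := by
  cases V <;> rfl

theorem par_map (V : Labelled P D X) (k : X → Y) (x y : D) : Par (V.map k) x y ↔ V.Par x y := by
  induction V with
  | leaf z => exact Iff.rfl
  | node a c ih =>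
    refine or_congr (and_congr Iff.rfl (exists_congr fun e => ?_)) (exists_congr ih)
    exact iff_of_eq (congrArg (· = some x) (top_map (c e) k))

theorem mem_rename (g : D → D') (V : Labelled P D X) (x : D') :
    (V.rename g).Mem x ↔ ∃ y, V.Mem y ∧ g y = x := by
  induction V with
  | leaf z => exact ⟨fun h => h.elim, fun ⟨_, h, _⟩ => h.elim⟩
  | node a c ih =>
    refine (or_congr Iff.rfl (exists_congr ih)).trans ?_
    constructor
    · rintro (rfl | ⟨e, y, h, rfl⟩)
      · exact ⟨a.1, .inl rfl, rfl⟩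
      · exact ⟨y, .inr ⟨e, h⟩, rfl⟩
    · rintro ⟨y, rfl | ⟨e, h⟩, rfl⟩
      · exact .inl rfl
      · exact .inr ⟨e, y, h, rfl⟩

theorem top_rename (g : D → D') (V : Labelled P D X) : (V.rename g).top = V.top.map g := by
  cases V <;> rfl

theorem par_rename (g : D → D') {V : Labelled P D X} {x y : D} (h : V.Par x y) :
    (V.rename g).Par (g x) (g y) := by
  induction V with
  | leaf z => exact h.elim
  | node a c ih =>
    rcases h with ⟨rfl, e, h⟩ | ⟨e, h⟩
    · refine .inl ⟨rfl, e, ?_⟩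
      exact (top_rename g (c e)).trans (congrArg (Option.map g) h)
    · exact .inr ⟨e, ih e h⟩

theorem distinct_rename (g : D → D') {V : Labelled P D X} (hV : V.Distinct)
    (hg : ∀ x y, V.Mem x → V.Mem y → g x = g y → x = y) : (V.rename g).Distinct := by
  induction V with
  | leaf z => trivial
  | node a c ih =>
    refine ⟨fun e => ih e (hV.1 e) fun x y hx hy => hg x y (.inr ⟨e, hx⟩) (.inr ⟨e, hy⟩),
      fun e he => ?_, fun e e' x hx hx' => ?_⟩
    · obtain ⟨y, hy, hy'⟩ := (mem_rename g (c e) _).1 he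
      exact hV.2.1 e (hg y a.1 (.inr ⟨e, hy⟩) (.inl rfl) hy' ▸ hy)
    · obtain ⟨y, hy, rfl⟩ := (mem_rename g (c e) _).1 hx
      obtain ⟨y', hy', h⟩ := (mem_rename g (c e') _).1 hx'
      exact hV.2.2 e e' y hy (hg y' y (.inr ⟨e', hy'⟩) (.inr ⟨e, hy⟩) h ▸ hy')

theorem Conn.rename (g : D → D') {V : Labelled P D X} {K : Set D} (h : V.Conn K) :
    (V.rename g).Conn (g '' K) := by
  obtain ⟨r, hr, h⟩ := h
  refine ⟨g r, ⟨r, hr, rfl⟩, ?_⟩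
  rintro _ ⟨x, hx, rfl⟩
  rcases h x hx with rfl | ⟨y, hy, h⟩
  · exact .inl rfl
  · exact .inr ⟨g y, ⟨y, hy, rfl⟩, par_rename g h⟩

theorem conn_mem {V : Labelled P D X} {d : D} (h : V.top = some d) : V.Conn {x | V.Mem x} := by
  refine ⟨d, mem_of_top h, fun x hx => ?_⟩
  rcases exists_par hx with h' | ⟨y, hy⟩
  · exact .inl (Option.some.inj (h'.symm.trans h))
  · exact .inr ⟨y, (mem_of_par hy).2, hy⟩

theorem top_bind_of_top {V : Labelled P D X} {x : D} (h : V.top = some x) (k : X → Labelled P D Y) :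
    top (V.bind k) = some x := by
  cases V with
  | leaf z => cases h
  | node a c => exact h

theorem par_bind {V : Labelled P D X} {k : X → Labelled P D Y} {x y : D} (h : Par (V.bind k) x y) :
    V.Par x y ∨ (V.Mem y ∧ ∃ l, top (k (V.leafLabel l)) = some x) ∨
      ∃ l, Par (k (V.leafLabel l)) x y := by
  induction V with
  | leaf z => exact .inr (.inr ⟨⟨⟩, h⟩)
  | node a c ih =>
    rcases h with ⟨rfl, e, h⟩ | ⟨e, h⟩
    · cases hc : c e with
      | leaf l =>
        refine .inr (.inl ⟨.inl rfl, ⟨⟨e, hc ▸ PUnit.unit⟩, ?_⟩⟩)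
        have key : ∀ (t : Labelled P D X) (ht : t = leaf l) (i : t.Leaves), t.leafLabel i = l := by
          rintro _ rfl i
          rfl
        have h : top ((c e).bind k) = some x := h
        rw [hc] at h
        change top (k ((c e).leafLabel _)) = some x
        rw [key (c e) hc]
        exact h
      | node a' c' =>
        refine .inl (.inl ⟨rfl, e, ?_⟩)
        have h : top ((c e).bind k) = some x := h
        rw [hc] at h ⊢
        exact h
    · rcases ih e h with h | ⟨h, l, h'⟩ | ⟨l, h⟩
      · exact .inl (.inr ⟨e, h⟩)
      · exact .inr (.inl ⟨.inr ⟨e, h⟩, ⟨e, l⟩, h'⟩)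
      · exact .inr (.inr ⟨⟨e, l⟩, h⟩)

theorem par_bind_left {V : Labelled P D X} (k : X → Labelled P D Y) {x y : D} (h : V.Par x y) :
    Par (V.bind k) x y := by
  induction V with
  | leaf z => exact h.elim
  | node a c ih =>
    rcases h with ⟨rfl, e, h⟩ | ⟨e, h⟩
    · exact .inl ⟨rfl, e, top_bind_of_top h k⟩
    · exact .inr ⟨e, ih e h⟩

theorem par_bind_right {V : Labelled P D X} {k : X → Labelled P D Y} {x y : D} (l : V.Leaves)
    (h : Par (k (V.leafLabel l)) x y) : Par (V.bind k) x y := by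
  induction V with
  | leaf z => exact h
  | node a c ih => exact .inr ⟨l.1, ih l.1 l.2 h⟩

open Classical in
/-- The component of the root node in the set of nodes whose labels have colour `j`. -/
noncomputable def cut (π : D → J) (j : J) : Labelled P D X → Labelled P D (Labelled P D X)
  | leaf x => leaf (leaf x)
  | node a c => if π a.1 = j then node a fun e => cut π j (c e) else leaf (node a c)

/-- If `V` has the colour `j` throughout and nothing grafted onto it begins with this colour, then
`cut` stops exactly at the grafting places. It recovers `V` together with the grafted trees, which
is how `flatten` will be inverted. -/
theorem cut_bind (π : D → J) (j : J) (V : Labelled P D X) (k : X → Labelled P D Y)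
    (hV : ∀ x, V.Mem x → π x = j) (hk : ∀ l, cut π j (k l) = leaf (k l)) :
    cut π j (V.bind k) = V.map k := by
  induction V with
  | leaf x => exact hk x
  | node a c ih =>
    refine (if_pos (hV _ (.inl rfl))).trans ?_
    exact congrArg (node a) (funext fun e => ih e fun x hx => hV x (.inr ⟨e, hx⟩))

theorem cut_of_top {π : D → J} {j : J} {V : Labelled P D X} (h : ∀ x, V.top = some x → π x ≠ j) :
    cut π j V = leaf V := by
  cases V with
  | leaf x => rfl
  | node a c => exact if_neg (h a.1 rfl)

end Labelled
end PTree

/-! ### Decomposition of labelled trees into monochromatic chunks -/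

namespace PolyEndo
open PTree Labelled
variable {I : Type u} {P : Mon (PolyEndo I)} {X Y : Type u} {D D' J : Type u}

/-- Trees with labels in `D` and an arbitrary contraction. -/
abbrev Chunk (P : Mon (PolyEndo I)) (D : Type u) : Type u :=
  Σ b : P.X.B, Tr (P := P) (Prod.snd : D × P.X.B → P.X.B) b

/-- Trees with nodes decorated by labelled trees. -/
abbrev ChunkTree (P : Mon (PolyEndo I)) (D X : Type u) : Type u :=
  PTree (P.X.pull (Sigma.fst : Chunk P D → P.X.B)) X

namespace ChunkTree

/-- Substitution of the labelled trees into the nodes. -/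
def flatten (Z : ChunkTree P D X) : Labelled P.X D X :=
  Z.sub (Q := P.X.pull (Sigma.fst : Chunk P D → P.X.B)) fun a => a.2.1

/-- The colour of the root of the chunk at the root node. -/
def colour (π : D → J) : ChunkTree P D X → Option J
  | leaf _ => none
  | node a _ => (top a.2.1).map π

/-- The chunks are nonempty and monochromatic, and the colours of adjacent chunks are different. -/
def Reduced (π : D → J) : ChunkTree P D X → Prop
  | leaf _ => True
  | node a c => (∃ d, top a.2.1 = some d ∧ ∀ x, Mem a.2.1 x → π x = π d) ∧
      ∀ e, Reduced π (c e) ∧ colour π (c e) ≠ (top a.2.1).map π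

theorem root_flatten (τ : X → I) (Z : ChunkTree P D X) (hZ : Z.Valid τ) :
    Z.flatten.root τ = Z.root τ :=
  root_sub (Q := P.X.pull (Sigma.fst : Chunk P D → P.X.B)) _ (fun a => a.2.root_eq) Z hZ

theorem top_flatten {π : D → J} {Z : ChunkTree P D X} (hZ : Z.Reduced π) :
    (top Z.flatten).map π = Z.colour π := by
  cases Z with
  | leaf x => rfl
  | node a c =>
    obtain ⟨⟨d, hd, _⟩, _⟩ := hZ
    refine (congrArg (Option.map π) (top_bind_of_top hd _)).trans ?_
    exact congrArg (Option.map π) hd.symm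

theorem cut_flatten {π : D → J} {j : J} {Z : ChunkTree P D X} (hZ : Z.Reduced π)
    (h : Z.colour π ≠ some j) : cut π j Z.flatten = leaf Z.flatten :=
  cut_of_top fun x hx hj => h <| by
    rw [← top_flatten hZ, hx, ← hj]
    rfl

/-- In a reduced tree the chunk at the root is the component of the root node in its colour, so
`cut` finds it in the flattened tree. `Tr.map_injective` separates this chunk from the trees
attached to its leaves, and one continues with these. -/
theorem flatten_injective {π : D → J} (τ : X → I) {Z Z' : ChunkTree P D X} (hZ : Z.Reduced π)
    (hZ' : Z'.Reduced π) (hv : Z.Valid τ) (hv' : Z'.Valid τ) (h : Z.flatten = Z'.flatten) : Z = Z' := by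
  have hne : ∀ (x : X) (a : Chunk P D) (c : P.X.E a.1 → ChunkTree P D X),
      Reduced π (node (P := P.X.pull (Sigma.fst : Chunk P D → P.X.B)) a c) →
      flatten (leaf x) ≠ flatten (node (P := P.X.pull (Sigma.fst : Chunk P D → P.X.B)) a c) := by
    rintro x a c ⟨⟨d, hd, _⟩, _⟩ h
    have h1 : top (flatten (node (P := P.X.pull (Sigma.fst : Chunk P D → P.X.B)) a c)) = some d :=
      top_bind_of_top hd _
    rw [← h] at h1
    cases h1
  induction Z generalizing Z' with
  | leaf x =>
    cases Z' with
    | leaf x' => exact congrArg leaf (leaf.inj h)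
    | node a c => exact (hne x a c hZ' h).elim
  | node a c ih =>
    cases Z' with
    | leaf x' => exact (hne x' a c hZ h.symm).elim
    | node a' c' =>
      have e1 := (top_flatten hZ).symm.trans ((congrArg (fun V => (top V).map π) h).trans (top_flatten hZ'))
      obtain ⟨⟨d, hd, hm⟩, hr⟩ := hZ
      obtain ⟨⟨d', hd', hm'⟩, hr'⟩ := hZ'
      simp only [colour, hd, hd', Option.map_some, Option.some.injEq] at e1 hr hr'
      have e2 : (a.2.1.map fun e => flatten (c e)) = a'.2.1.map fun e => flatten (c' e) := by
        refine (cut_bind π (π d) a.2.1 (fun e => flatten (c e)) hm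
          fun e => cut_flatten (hr e).1 (hr e).2).symm.trans ?_
        refine (congrArg (cut π (π d)) h).trans ?_
        exact cut_bind π (π d) a'.2.1 (fun e => flatten (c' e)) (fun x hx => (hm' x hx).trans e1.symm)
          fun e => cut_flatten (hr' e).1 (e1 ▸ (hr' e).2)
      have e3 := Tr.map_injective (fun T : Labelled P.X D X => T.root τ)
        (fun e => (root_flatten τ (c e) (hv e).2).trans (hv e).1)
        (fun e => (root_flatten τ (c' e) (hv' e).2).trans (hv' e).1) e2
      obtain ⟨rfl, e4⟩ := Sigma.mk.inj e3
      have e4 := congrFun (eq_of_heq e4)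
      exact congrArg (node a) (funext fun e => ih e (hr e).1 (hr' e).1 (hv e).2 (hv' e).2 (e4 e))

/-- Across the border between two chunks the colour changes, so a node and its parent of the same
colour lie in one chunk. -/
theorem par_flatten {π : D → J} {Z : ChunkTree P D X} (hZ : Z.Reduced π) {x y : D}
    (h : Par Z.flatten x y) (hxy : π x = π y) : ∃ n, Par (Z.nodeOp n).2.1 x y := by
  induction Z with
  | leaf z => exact h.elim
  | node a c ih =>
    obtain ⟨⟨d, hd, hm⟩, hr⟩ := hZ
    rcases par_bind h with h | ⟨h, l, h'⟩ | ⟨l, h⟩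
    · exact ⟨none, h⟩
    · refine ((hr (a.2.1.leafLabel l)).2 ((top_flatten (hr _).1).symm.trans ?_)).elim
      refine (congrArg (Option.map π) h').trans ?_
      rw [hd]
      exact congrArg some (hxy.trans (hm y h))
    · obtain ⟨n, hn⟩ := ih (a.2.1.leafLabel l) (hr _).1 h
      exact ⟨some ⟨_, n⟩, hn⟩

theorem reduced_of_injective {π : D → J} (Z : ChunkTree P D X)
    (h : ∀ n, ∃ d, top (Z.nodeOp n).2.1 = some d ∧ ∀ x, Mem (Z.nodeOp n).2.1 x → π x = π d)
    (hi : Function.Injective fun n => (top (Z.nodeOp n).2.1).map π) : Z.Reduced π := by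
  induction Z with
  | leaf x => trivial
  | node a c ih =>
    refine ⟨h none, fun e => ⟨ih e (fun n => h (some ⟨e, n⟩)) fun n m hnm => ?_, fun he => ?_⟩⟩
    · have := @hi (some ⟨e, n⟩) (some ⟨e, m⟩) hnm
      exact eq_of_heq (Sigma.mk.inj (Option.some.inj this)).2
    · have key : ∀ t : ChunkTree P D X, t.colour π = (top a.2.1).map π →
          ∃ n : t.Nodes, (top (t.nodeOp n).2.1).map π = (top a.2.1).map π := by
        intro t ht
        cases t with
        | leaf x =>
          obtain ⟨d, hd, _⟩ := h none
          have hd : top a.2.1 = some d := hd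
          rw [hd] at ht
          cases ht
        | node a' c' => exact ⟨none, ht⟩
      obtain ⟨n, hn⟩ := key _ he
      have := @hi (some ⟨e, n⟩) none hn
      cases this

/-- Each node either starts a new chunk, or has the colour of the node below it. -/
def Good (π : D → J) (S : D → Prop) : J → Labelled P.X D X → Prop
  | _, leaf _ => True
  | j, node a c => (S a.1 ∨ π a.1 = j) ∧ ∀ e, Good π S (π a.1) (c e)

theorem good_of_par {π : D → J} {S : D → Prop} (V : Labelled P.X D X)
    (h : ∀ x y, V.Par x y → S x ∨ π x = π y) (j : J) (ht : ∀ d, V.top = some d → S d ∨ π d = j) :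
    Good π S j V := by
  induction V generalizing j with
  | leaf x => trivial
  | node a c ih =>
    exact ⟨ht _ rfl, fun e => ih e (fun x y hxy => h x y (.inr ⟨e, hxy⟩)) _
      fun d hd => h d a.1 (.inl ⟨rfl, e, hd⟩)⟩

/-- A monochromatic chunk in which exactly the root has the property `S`. -/
def IsComponent (π : D → J) (S : D → Prop) (V : Labelled P.X D X) : Prop :=
  ∃ d, V.top = some d ∧ S d ∧ ∀ x, V.Mem x → π x = π d ∧ (S x → x = d)

/-- The property `S` marks the nodes which are to be roots of chunks. Working towards the root, `W`
is the unfinished chunk of colour `j` at the bottom, with finished chunk trees attached to its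
leaves. A marked node completes the chunk above it; by `Good` an unmarked one has the colour of the
unfinished chunk and joins it. -/
theorem exists_flatten {π : D → J} {S : D → Prop} (τ : X → I) (V : Labelled P.X D X)
    (hV : V.Valid τ) (j : J) (hg : Good π S j V) :
    ∃ W : Labelled P.X D {Z : ChunkTree P D X // Z.Valid τ ∧
        ∀ n, IsComponent π S (Z.nodeOp n).2.1},
      W.Valid (fun Z => Z.1.root τ) ∧ W.bind (fun Z => Z.1.flatten) = V ∧
      ∀ x, W.Mem x → π x = j ∧ ¬S x := by
  induction V generalizing j with
  | leaf x =>
    exact ⟨leaf ⟨leaf x, trivial, fun n => PEmpty.elim n⟩, trivial, rfl, fun x hx => hx.elim⟩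
  | node a c ih =>
    choose W h1 h2 h3 using fun e => ih e (hV e).2 _ (hg.2 e)
    let N : Labelled P.X D {Z : ChunkTree P D X // Z.Valid τ ∧
        ∀ n, IsComponent π S (Z.nodeOp n).2.1} := node a W
    have hN : N.Valid fun Z => Z.1.root τ := fun e => by
      refine ⟨?_, h1 e⟩
      have := root_bind (τ := fun Z => Z.1.root τ) (τ' := τ) (W e) (fun Z => Z.1.flatten)
        fun Z => root_flatten τ Z.1 Z.2.1
      rw [h2] at this
      exact this.symm.trans (hV e).1
    have hN' : N.bind (fun Z => Z.1.flatten) = node a c :=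
      congrArg (node a) (funext h2)
    by_cases hS : S a.1
    -- Separating the leaf decorations turns the completed chunk into an operation of the chunk
    -- tree, the finished trees becoming its branches.
    · obtain ⟨x, k, hk, hx⟩ := Tr.exists_map (P := P) _ N hN
      have hc : IsComponent π S x.2.1 := by
        refine ⟨a.1, ?_, hS, fun y hy => ?_⟩
        · rw [← top_map x.2.1 k, hx]
          rfl
        · rw [← mem_map x.2.1 k, hx] at hy
          rcases hy with rfl | ⟨e, hy⟩
          · exact ⟨rfl, fun _ => rfl⟩
          · exact ⟨(h3 e y hy).1, fun h => ((h3 e y hy).2 h).elim⟩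
      refine ⟨leaf ⟨node (P := P.X.pull (Sigma.fst : Chunk P D → P.X.B)) x fun e => (k e).1,
        fun e => ⟨hk e, (k e).2.1⟩, ?_⟩, trivial, ?_, fun x hx => hx.elim⟩
      · rintro (_ | ⟨e, n⟩)
        · exact hc
        · exact (k e).2.2 n
      · refine Eq.trans ?_ hN'
        rw [← hx]
        exact (bind_bind x.2.1 (fun e => leaf (k e)) fun Z => flatten Z.1).symm
    · refine ⟨N, hN, hN', ?_⟩
      have hj : π a.1 = j := hg.1.resolve_left hS
      rintro x (rfl | ⟨e, hx⟩)
      · exact ⟨hj, hS⟩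
      · exact ⟨(h3 e x hx).1.trans hj, (h3 e x hx).2⟩

end ChunkTree

/-! ### Partition of a labelled tree along connected colour classes -/

namespace Tr

/-- Renaming of the labels. -/
def rename {b : P.X.B} (g : D → D') (x : Tr (P := P) (Prod.snd : D × P.X.B → P.X.B) b) :
    Tr (P := P) (Prod.snd : D' × P.X.B → P.X.B) b :=
  x.relabel (f := Prod.snd) (f' := Prod.snd) (Prod.map g id) fun _ => rfl

theorem exists_ofLift {C : Type u} {f : C → P.X.B} {b : P.X.B} (x : Tr f b) :
    ∃ (z : (plusPoly P).B) (h : (plusPoly P).t z = b) (l : z.1.Nodes → C)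
      (hl : ∀ n, f (l n) = z.1.nodeOp n), x = (ofLift z b h).relabel l hl := by
  refine ⟨⟨(tree ⟨b, x⟩).erase, valid_erase _ _ (tree_valid _)⟩, t_tree ⟨b, x⟩ _,
    PTree.label (tree ⟨b, x⟩), nodeOp_erase (tree ⟨b, x⟩), ?_⟩
  exact (ofTree_tree ⟨b, x⟩ (tree_valid _) (t_tree _ _)).symm

variable {b : P.X.B} (z : (plusPoly P).B) (h : (plusPoly P).t z = b)
  (G : ∀ n : z.1.Nodes, Tr (P := P) (Prod.snd : D × P.X.B → P.X.B) (z.1.nodeOp n))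

/-- The tree `z` with its nodes decorated by the labelled trees `G n`. -/
noncomputable def chunks : Tr (P := P) (Sigma.fst : Chunk P D → P.X.B) b :=
  (ofLift z b h).relabel (fun n => ⟨z.1.nodeOp n, G n⟩) fun _ => rfl

theorem flatten_chunks : ChunkTree.flatten (chunks z h G).1 = ((ofLift z b h).sub G).1 := by
  refine (sub_relabel _ (fun _ => rfl) _ _).trans ?_
  refine congrArg (fun F => PTree.sub (Q := P.X.pull z.1.nodeOp) F (lift z b h)) (funext fun n => ?_)
  exact PTree.map_id _

theorem nodes_chunks : Same (chunks z h G).1.nodeOp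
    (fun n : z.1.Nodes => (⟨z.1.nodeOp n, G n⟩ : Chunk P D)) := by
  obtain ⟨φ, hφ⟩ := nodes_relabel (P := P.X) (f := (Sigma.fst : Chunk P D → P.X.B))
    (fun n => (⟨z.1.nodeOp n, G n⟩ : Chunk P D)) (fun _ => rfl) (lift z b h)
  exact ⟨φ.trans (Equiv.ofBijective _ (lift_nodeOp_bij z b h)), hφ⟩

theorem nodes_sub_ofLift : Same ((ofLift z b h).sub G).1.nodeOp
    (fun p : Σ n : z.1.Nodes, (G n).1.Nodes => (G p.1).1.nodeOp p.2) := by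
  obtain ⟨φ, hφ⟩ := nodes_sub (Q := P.X.pull z.1.nodeOp) (fun n => (G n).1)
    (fun n => (G n).leafLabel_bijective) (lift z b h)
  refine ⟨φ.trans (Equiv.sigmaCongrLeft (β := fun n => (G n).1.Nodes)
    (Equiv.ofBijective _ (lift_nodeOp_bij z b h))), hφ⟩

theorem mem_sub_ofLift (x : D) : Mem ((ofLift z b h).sub G).1 x ↔ ∃ n, Mem (G n).1 x := by
  obtain ⟨φ, hφ⟩ := nodes_sub_ofLift z h G
  rw [mem_iff]
  constructor
  · rintro ⟨m, rfl⟩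
    exact ⟨(φ m).1, (mem_iff _ _).2 ⟨(φ m).2, congrArg Prod.fst (hφ m).symm⟩⟩
  · rintro ⟨n, hn⟩
    obtain ⟨m, rfl⟩ := (mem_iff _ _).1 hn
    refine ⟨φ.symm ⟨n, m⟩, ?_⟩
    rw [hφ, Equiv.apply_symm_apply]

theorem reduced_chunks {π : D → J} {κ : z.1.Nodes → J} (hκ : Function.Injective κ)
    (hG : ∀ n, ∃ d, top (G n).1 = some d) (hπ : ∀ n x, Mem (G n).1 x → π x = κ n) :
    ChunkTree.Reduced π (chunks z h G).1 := by
  obtain ⟨φ, hφ⟩ := nodes_chunks z h G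
  choose d hd using hG
  have hd' : ∀ n, π (d n) = κ n := fun n => hπ n _ (mem_of_top (hd n))
  refine ChunkTree.reduced_of_injective _ (fun n => ?_) fun n m hnm => ?_
  · rw [hφ]
    exact ⟨d _, hd _, fun x hx => (hπ _ x hx).trans (hd' _).symm⟩
  · have key : ∀ n, (top ((chunks z h G).1.nodeOp n).2.1).map π = some (κ (φ n)) := fun n => by
      rw [hφ]
      exact (congrArg (Option.map π) (hd (φ n))).trans (congrArg some (hd' _))
    exact φ.injective (hκ (Option.some.inj ((key n).symm.trans (hnm.trans (key m)))))

/-- Distinct nodes of `z` carry pieces of distinct colours, so the chunk trees are reduced and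
`flatten_injective` identifies them. Erasing the chunks then gives `z`, and the decorations of its
nodes give `G`. -/
theorem sub_ofLift_injective {z' : (plusPoly P).B} {h' : (plusPoly P).t z' = b}
    {G' : ∀ n : z'.1.Nodes, Tr (P := P) (Prod.snd : D × P.X.B → P.X.B) (z'.1.nodeOp n)}
    {π : D → J} {κ : z.1.Nodes → J} {κ' : z'.1.Nodes → J} (hκ : Function.Injective κ)
    (hκ' : Function.Injective κ') (hG : ∀ n, ∃ d, top (G n).1 = some d)
    (hG' : ∀ n, ∃ d, top (G' n).1 = some d) (hπ : ∀ n x, Mem (G n).1 x → π x = κ n)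
    (hπ' : ∀ n x, Mem (G' n).1 x → π x = κ' n)
    (e : (ofLift z b h).sub G = (ofLift z' b h').sub G') :
    (⟨z, G⟩ : Σ z : (plusPoly P).B, ∀ n : z.1.Nodes,
      Tr (P := P) (Prod.snd : D × P.X.B → P.X.B) (z.1.nodeOp n)) = ⟨z', G'⟩ := by
  have e1 : chunks z h G = chunks z' h' G' := by
    refine Subtype.ext (ChunkTree.flatten_injective (P.X.s b) (reduced_chunks z h G hκ hG hπ)
      (reduced_chunks z' h' G' hκ' hG' hπ') (valid _) (valid _) ?_)
    rw [flatten_chunks, flatten_chunks, e]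
  have e2 : z = z' := by
    have h1 : ∀ (z : (plusPoly P).B) (h : (plusPoly P).t z = b) (G : ∀ n : z.1.Nodes,
        Tr (P := P) (Prod.snd : D × P.X.B → P.X.B) (z.1.nodeOp n)),
        ((chunks z h G).1.map (P.X.s b)).erase = z.1 := by
      intro z h G
      refine (congrArg PTree.erase (relabel_map _ (fun _ => rfl) _ _).symm).trans ?_
      refine (erase_relabel _ (fun _ => rfl) _).trans ?_
      exact (congrArg PTree.erase (lift_map z b h)).trans (erase_nodeSelf _)
    refine Subtype.ext ((h1 z h G).symm.trans (Eq.trans ?_ (h1 z' h' G')))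
    rw [e1]
  subst e2
  have e3 : (fun n => (⟨z.1.nodeOp n, G n⟩ : Chunk P D)) = fun n => ⟨z.1.nodeOp n, G' n⟩ := by
    refine nodeSelf_relabel_inj (f := (Sigma.fst : Chunk P D → P.X.B)) z.1 _ _ (fun _ => rfl)
      (fun _ => rfl) ?_
    have h1 : ∀ (G : ∀ n : z.1.Nodes, Tr (P := P) (Prod.snd : D × P.X.B → P.X.B) (z.1.nodeOp n)),
        (chunks z h G).1.map (P.X.s b) =
        z.1.nodeSelf.relabel (f := (Sigma.fst : Chunk P D → P.X.B)) (fun n => ⟨z.1.nodeOp n, G n⟩) (fun _ => rfl) := by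
      intro G
      refine (relabel_map _ (fun _ => rfl) _ _).symm.trans ?_
      exact congrArg (PTree.relabel (f := (Sigma.fst : Chunk P D → P.X.B)) _ _) (lift_map z b h)
    refine (h1 G).symm.trans (Eq.trans ?_ (h1 G'))
    exact congrArg (fun x : Tr (P := P) (Sigma.fst : Chunk P D → P.X.B) b => x.1.map (P.X.s b)) e1
  exact congrArg (Sigma.mk z) (funext fun n => eq_of_heq (Sigma.mk.inj (congrFun e3 n)).2)

/-- Each colour class is connected, hence has a lowest node. Cutting the tree directly below the
lowest nodes leaves exactly the colour classes as chunks, and contracting the chunks gives a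
`P`-tree `z` with one node for each colour. -/
theorem exists_partition (x : Tr (P := P) (Prod.snd : D × P.X.B → P.X.B) b) (hx : Distinct x.1)
    {d : D} (hd : top x.1 = some d) (π : D → J)
    (hc : ∀ j, Conn x.1 {y | Mem x.1 y ∧ π y = j}) :
    ∃ (z : (plusPoly P).B) (h : (plusPoly P).t z = b)
      (G : ∀ n : z.1.Nodes, Tr (P := P) (Prod.snd : D × P.X.B → P.X.B) (z.1.nodeOp n))
      (σ : J ≃ z.1.Nodes), x = (ofLift z b h).sub G ∧ (∀ n, Distinct (G n).1) ∧
      (∀ j y, Mem (G (σ j)).1 y ↔ Mem x.1 y ∧ π y = j) ∧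
      ∀ j K, (∀ y ∈ K, π y = j) → Conn x.1 K → Conn (G (σ j)).1 K := by
  choose r hr hr' using hc
  -- `r j` is the lowest label of colour `j`. By connectedness a label is the lowest of its class or
  -- has a parent of the same colour, which is what `Good` requires.
  let S : D → Prop := fun y => y = r (π y)
  have hpar : ∀ y y', Par x.1 y y' → S y ∨ π y = π y' := by
    intro y y' h
    rcases hr' (π y) y ⟨(mem_of_par h).1, rfl⟩ with h1 | ⟨y'', ⟨_, h1⟩, h2⟩
    · exact .inl h1
    · exact .inr (hx.par_unique h2 h ▸ h1.symm)
  have htop : S d := by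
    rcases hr' (π d) d ⟨mem_of_top hd, rfl⟩ with h1 | ⟨y'', _, h2⟩
    · exact h1
    · exact (hx.top_ne h2 hd).elim
  obtain ⟨W, _, hW, hW'⟩ := ChunkTree.exists_flatten (P := P) (π := π) (S := S) (P.X.s b) x.1 x.valid (π d)
    (ChunkTree.good_of_par x.1 hpar _ fun d' hd' => .inl (Option.some.inj (hd.symm.trans hd') ▸ htop))
  -- The root node is the lowest of its class and completes a chunk, so no unfinished chunk remains
  -- at the bottom.
  cases W with
  | node a c =>
    rw [← hW] at hd
    obtain rfl : a.1 = d := Option.some.inj hd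
    exact ((hW' _ (.inl rfl)).2 htop).elim
  | leaf Z =>
  obtain ⟨Z, hZ, hZ'⟩ := Z
  have hW : ChunkTree.flatten Z = x.1 := hW
  have hev : ev P (P.X.s b) Z.erase (valid_erase _ _ hZ) = idExt P b := by
    have h1 := valid_sub_tree (fun a : Chunk P D => a.2) Z hZ
    refine (ev_sub_tree (fun a : Chunk P D => a.2) Z hZ (valid_erase _ _ h1) _).symm.trans ?_
    exact (ev_congr P _ (congrArg PTree.erase hW) _ _).trans (x.ev_erase (valid_erase _ _ x.valid))
  obtain ⟨z, h, l, hl, hzl⟩ := exists_ofLift (P := P) (⟨Z, hZ, hev⟩ : Tr (P := P) Sigma.fst b)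
  have hzl : Z = (lift z b h).relabel l hl := congrArg Subtype.val hzl
  let G : ∀ n : z.1.Nodes, Tr (P := P) (Prod.snd : D × P.X.B → P.X.B) (z.1.nodeOp n) :=
    fun n => (l n).2.cast (hl n)
  have hxG : x = (ofLift z b h).sub G := by
    refine Subtype.ext (hW.symm.trans ?_)
    rw [hzl]
    refine (sub_relabel _ hl _ _).trans ?_
    refine congrArg (fun F => PTree.sub (Q := P.X.pull z.1.nodeOp) F (lift z b h)) (funext fun n => ?_)
    exact (cast_val (hl n) (l n).2).symm
  have hcast : ∀ (b' b'' : P.X.B) (hb : b' = b'') (y : Tr (P := P) (Prod.snd : D × P.X.B → P.X.B) b'),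
      ChunkTree.IsComponent π S y.1 → ChunkTree.IsComponent π S (y.cast hb).1 := by
    rintro b' _ rfl y hy
    exact hy
  have hcomp : ∀ n, ChunkTree.IsComponent π S (G n).1 := by
    intro n
    subst hzl
    obtain ⟨φ, hφ⟩ := nodes_relabel (P := P.X) (f := (Sigma.fst : Chunk P D → P.X.B)) l hl (lift z b h)
    obtain ⟨m, rfl⟩ := (lift_nodeOp_bij z b h).2 n
    obtain ⟨m, rfl⟩ := φ.surjective m
    have h1 := hZ' m
    rw [hφ] at h1
    exact hcast _ _ (hl _) _ h1
  choose t ht hS hmono using hcomp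
  obtain ⟨φ, hφ⟩ := nodes_sub_ofLift z h G
  have hxi : Function.Injective fun p : Σ n : z.1.Nodes, (G n).1.Nodes => ((G p.1).1.nodeOp p.2).1 := by
    intro p q hpq
    have hi := hx.injective
    rw [hxG] at hi
    refine φ.symm.injective (hi ?_)
    change (((ofLift z b h).sub G).1.nodeOp _).1 = (((ofLift z b h).sub G).1.nodeOp _).1
    rw [hφ, hφ, Equiv.apply_symm_apply, Equiv.apply_symm_apply]
    exact hpq
  have hdisj : ∀ n m y, Mem (G n).1 y → Mem (G m).1 y → n = m := by
    intro n m y hn hm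
    obtain ⟨i, hi⟩ := (mem_iff _ _).1 hn
    obtain ⟨j, hj⟩ := (mem_iff _ _).1 hm
    exact congrArg Sigma.fst (@hxi ⟨n, i⟩ ⟨m, j⟩ (hi.trans hj.symm))
  have hmem : ∀ y, Mem x.1 y ↔ ∃ n, Mem (G n).1 y := fun y => by
    rw [hxG]
    exact mem_sub_ofLift z h G y
  have hκ : Function.Injective fun n => π (t n) := by
    intro n m hnm
    have h1 : t n = t m := (hS n).trans ((congrArg r hnm).trans (hS m).symm)
    exact hdisj n m (t n) (mem_of_top (ht n)) (h1 ▸ mem_of_top (ht m))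
  have hκ' : Function.Surjective fun n => π (t n) := by
    intro j
    obtain ⟨n, hn⟩ := (hmem _).1 (hr j).1
    have h1 : r j = t n := (hmono n _ hn).2 (congrArg r (hr j).2.symm)
    exact ⟨n, (congrArg π h1).symm.trans (hr j).2⟩
  let κ := Equiv.ofBijective (fun n => π (t n)) ⟨hκ, hκ'⟩
  have hκs : ∀ j, π (t (κ.symm j)) = j := κ.apply_symm_apply
  refine ⟨z, h, G, κ.symm, hxG, fun n => distinct_of_injective _ fun i j hij => ?_, fun j y => ?_, fun j K hK hcK => ?_⟩
  · exact eq_of_heq (Sigma.mk.inj (@hxi ⟨n, i⟩ ⟨n, j⟩ hij)).2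
  · constructor
    · intro hy
      exact ⟨(hmem y).2 ⟨_, hy⟩, (hmono _ y hy).1.trans (hκs j)⟩
    · rintro ⟨hy, rfl⟩
      obtain ⟨n, hn⟩ := (hmem y).1 hy
      obtain rfl : n = κ.symm (π y) := hκ ((hmono n y hn).1.symm.trans (hκs _).symm)
      exact hn
  · obtain ⟨q, hq, hcK⟩ := hcK
    refine ⟨q, hq, fun y hy => (hcK y hy).imp_right ?_⟩
    rintro ⟨y', hy', hp⟩
    refine ⟨y', hy', ?_⟩
    obtain ⟨ψ, hψ⟩ := nodes_chunks z h G
    rw [hxG, ← flatten_chunks] at hp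
    -- A parent relation within one colour does not cross the border of a chunk, so connected sets
    -- of one colour stay connected in their piece.
    obtain ⟨m, hm⟩ := ChunkTree.par_flatten (reduced_chunks z h G hκ (fun n => ⟨_, ht n⟩)
      fun n y hy => (hmono n y hy).1) hp ((hK y hy).trans (hK y' hy').symm)
    rw [hψ] at hm
    obtain e : ψ m = κ.symm j := hκ ((hmono _ y (mem_of_par hm).1).1.symm.trans ((hK y hy).trans (hκs _).symm))
    rw [← e]
    exact hm

end Tr
end PolyEndo

/-! ### Substitution, naming and pruning of labelled trees -/

namespace PTree.Labelled
variable {I : Type u} {P : PolyEndo I} {X Y : Type u} {D D' J : Type u}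

theorem exists_top {V : Labelled P D X} {x : D} (h : V.Mem x) : ∃ d, V.top = some d := by
  cases V with
  | leaf y => exact h.elim
  | node a c => exact ⟨a.1, rfl⟩

theorem par_sub {Q : PolyEndo I} (F : (a : Q.B) → Labelled P D (Q.E a))
    (hF : ∀ a, Function.Bijective (F a).leafLabel) (T : PTree Q X) (n : T.Nodes) {x y : D}
    (h : (F (T.nodeOp n)).Par x y) : Par (T.sub F) x y := by
  induction T with
  | leaf z => exact PEmpty.elim n
  | node a c ih =>
    rcases n with _ | ⟨e, n⟩
    · exact par_bind_left _ h
    · obtain ⟨l, rfl⟩ := (hF a).2 e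
      exact par_bind_right (V := F a) (k := fun e => (c e).sub F) l (ih _ n h)

end PTree.Labelled

namespace PolyEndo
open PTree Labelled SetOperad
variable {I : Type u} {P : Mon (PolyEndo I)} {X Y : Type u} {D D' J : Type u}

namespace Tr
variable {b : P.X.B}

theorem par_sub_ofLift (z : (plusPoly P).B) (h : (plusPoly P).t z = b)
    (G : ∀ n : z.1.Nodes, Tr (P := P) (Prod.snd : D × P.X.B → P.X.B) (z.1.nodeOp n)) (n : z.1.Nodes)
    {x y : D} (hxy : Par (G n).1 x y) : Par ((ofLift z b h).sub G).1 x y := by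
  obtain ⟨m, rfl⟩ := (lift_nodeOp_bij z b h).2 n
  exact Labelled.par_sub (Q := P.X.pull z.1.nodeOp) (fun n => (G n).1)
    (fun n => (G n).leafLabel_bijective) (lift z b h) m hxy

theorem distinct_sub_ofLift (z : (plusPoly P).B) (h : (plusPoly P).t z = b)
    (G : ∀ n : z.1.Nodes, Tr (P := P) (Prod.snd : D × P.X.B → P.X.B) (z.1.nodeOp n))
    (hG : ∀ n, Distinct (G n).1) (hG' : ∀ n m y, Mem (G n).1 y → Mem (G m).1 y → n = m) :
    Distinct ((ofLift z b h).sub G).1 := by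
  obtain ⟨φ, hφ⟩ := nodes_sub_ofLift z h G
  refine distinct_of_injective _ fun i j hij => φ.injective ?_
  replace hij := (congrArg Prod.fst (hφ i)).symm.trans (hij.trans (congrArg Prod.fst (hφ j)))
  generalize φ i = p at hij
  generalize φ j = q at hij
  obtain ⟨n, i⟩ := p
  obtain ⟨m, j⟩ := q
  obtain rfl := hG' n m _ ((mem_iff _ _).2 ⟨i, rfl⟩) ((mem_iff _ _).2 ⟨j, hij.symm⟩)
  exact congrArg (Sigma.mk n) ((hG n).injective hij)

theorem val_cast_mem {b' : P.X.B} (h : b = b')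
    (x : Tr (P := P) (Prod.snd : D × P.X.B → P.X.B) b) (y : D) :
    Mem (x.cast h).1 y ↔ Mem x.1 y := by
  subst h
  rfl

theorem distinct_cast {b' : P.X.B} (h : b = b')
    (x : Tr (P := P) (Prod.snd : D × P.X.B → P.X.B) b) :
    Distinct (x.cast h).1 ↔ Distinct x.1 := by
  subst h
  rfl

theorem conn_cast {b' : P.X.B} (h : b = b')
    (x : Tr (P := P) (Prod.snd : D × P.X.B → P.X.B) b) (K : Set D) :
    Conn (x.cast h).1 K ↔ Conn x.1 K := by
  subst h
  rfl

theorem unitTr_fst {f : X → P.X.B} (i : I) : (unitTr (P := P) f i).1 = (MonObj.one (X := P.X)).onB i := by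
  have h := tree_ev (unitTr f i) (valid_erase _ _ (tree_valid _))
  have h1 := ev_congr P (fun i => i) (congrArg PTree.erase (tree_unitTr f i))
    (valid_erase _ _ (tree_valid _)) trivial
  exact congrArg Ext.op (h.symm.trans h1)

open Classical in
/-- A one node tree, or a unit tree if the label has the property `w`. -/
noncomputable def pruneAt (w : D → Prop) (a : D × P.X.B) :
    Tr (P := P) (Prod.snd : D × P.X.B → P.X.B) a.2 :=
  -- The type `i` is the output type of the unit operation, so its choice does not matter.
  if h : w a.1 ∧ ∃ i, (MonObj.one (X := P.X)).onB i = a.2 then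
    (unitTr Prod.snd h.2.choose).2.cast ((unitTr_fst _).trans h.2.choose_spec)
  else corolla Prod.snd a

/-- Contraction of the nodes whose labels have the property `w`. -/
noncomputable def prune (w : D → Prop) (x : Tr (P := P) (Prod.snd : D × P.X.B → P.X.B) b) :
    Tr (P := P) (Prod.snd : D × P.X.B → P.X.B) b :=
  x.sub (pruneAt w)

theorem rename_unitTr (g : D → D') {i i' : I} (hi : i = i') {b : P.X.B}
    (h : (unitTr (P := P) (Prod.snd : D × P.X.B → P.X.B) i).1 = b)
    (h' : (unitTr (P := P) (Prod.snd : D' × P.X.B → P.X.B) i').1 = b) :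
    ((unitTr (P := P) (Prod.snd : D × P.X.B → P.X.B) i).2.cast h).rename g =
      (unitTr (P := P) (Prod.snd : D' × P.X.B → P.X.B) i').2.cast h' := by
  subst hi
  refine ext_map ?_
  refine (relabel_map (P := P.X) (f := Prod.snd) (f' := Prod.snd) (Prod.map g id) (fun _ => rfl)
    ((unitTr (P := P) (Prod.snd : D × P.X.B → P.X.B) i).2.cast h).1 (P.X.s b)).symm.trans ?_
  have key : ∀ (x : Σ b, Tr (P := P) (Prod.snd : D × P.X.B → P.X.B) b) (hb : x.1 = b),
      (x.2.cast hb).1.map (P.X.s b) = tree x := by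
    rintro x rfl
    rfl
  have key' : ∀ (x : Σ b, Tr (P := P) (Prod.snd : D' × P.X.B → P.X.B) b) (hb : x.1 = b),
      (x.2.cast hb).1.map (P.X.s b) = tree x := by
    rintro x rfl
    rfl
  refine (congrArg (PTree.relabel (P := P.X) (f := Prod.snd) (f' := Prod.snd) (Prod.map g id) (fun _ => rfl)) ((key _ h).trans (tree_unitTr _ _))).trans ?_
  exact ((key' _ h').trans (tree_unitTr _ _)).symm

theorem pruneAt_rename (g : D → D') (w : D' → Prop) (a : D × P.X.B) :
    pruneAt (P := P) w (g a.1, a.2) = (pruneAt (fun x => w (g x)) a).rename g := by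
  unfold pruneAt
  by_cases h : w (g a.1) ∧ ∃ i, (MonObj.one (X := P.X)).onB i = a.2
  · rw [dif_pos h, dif_pos h]
    exact (rename_unitTr g rfl _ _).symm
  · rw [dif_neg h, dif_neg h]
    rfl

theorem prune_rename (g : D → D') (w : D' → Prop)
    (x : Tr (P := P) (Prod.snd : D × P.X.B → P.X.B) b) :
    (x.rename g).prune w = (x.prune fun y => w (g y)).rename g := by
  refine Subtype.ext ?_
  refine (sub_relabel (f := Prod.snd) _ (fun _ => rfl) _ _).trans ?_
  refine Eq.trans ?_ (relabel_sub (f := Prod.snd) (Q := P.X.pull (Prod.snd : D × P.X.B → P.X.B)) _ (fun _ => rfl) _ _).symm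
  refine congrArg (fun F => PTree.sub (Q := P.X.pull (Prod.snd : D × P.X.B → P.X.B)) F x.1) (funext fun a => ?_)
  refine (PTree.map_id _).trans ?_
  exact congrArg Subtype.val (pruneAt_rename g w a)

theorem prune_sub_ofLift (w : D → Prop) (z : (plusPoly P).B) (h : (plusPoly P).t z = b)
    (G : ∀ n : z.1.Nodes, Tr (P := P) (Prod.snd : D × P.X.B → P.X.B) (z.1.nodeOp n)) :
    ((ofLift z b h).sub G).prune w = (ofLift z b h).sub fun n => (G n).prune w :=
  Subtype.ext (sub_sub _ _ _)

theorem prune_cast {b' : P.X.B} (h : b = b') (w : D → Prop)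
    (x : Tr (P := P) (Prod.snd : D × P.X.B → P.X.B) b) :
    (x.cast h).prune w = (x.prune w).cast h := by
  subst h
  rfl

theorem relabel_congr {f : D → P.X.B} {f' : D' → P.X.B} {g g' : D' → D} (hg : g = g') (h : ∀ a, f (g a) = f' a)
    (h' : ∀ a, f (g' a) = f' a) (x : Tr f' b) : x.relabel g h = x.relabel g' h' := by
  subst hg
  rfl

/-- The tree `z` with its nodes labelled by `l`. -/
noncomputable def named (z : (plusPoly P).B) (h : (plusPoly P).t z = b) (l : z.1.Nodes → D) :
    Tr (P := P) (Prod.snd : D × P.X.B → P.X.B) b :=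
  (ofLift z b h).relabel (f := Prod.snd) (fun n => (l n, z.1.nodeOp n)) fun _ => rfl

theorem named_cast {b' : P.X.B} (z : (plusPoly P).B) (h : (plusPoly P).t z = b) (h' : b = b')
    (l : z.1.Nodes → D) : (named z h l).cast h' = named z (h.trans h') l := by
  subst h'
  rfl

theorem rename_named (g : D → D') (z : (plusPoly P).B) (h : (plusPoly P).t z = b)
    (l : z.1.Nodes → D) : (named z h l).rename g = named z h fun n => g (l n) :=
  Subtype.ext (relabel_relabel (P := P.X) (f := (Prod.snd : D' × P.X.B → P.X.B)) (f' := Prod.snd)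
    (f'' := z.1.nodeOp) (Prod.map g id) (fun _ => rfl) (fun n => (l n, z.1.nodeOp n)) (fun _ => rfl)
    (lift z b h))

/-- This is `lift_subst` with the pairs of an outer and an inner node replaced by labels. It is the
link between substitution of labelled trees and the multiplication of `plus P`. -/
theorem named_mul (w : CompOp (plusPoly P) (plusPoly P)) (h : (plusPoly P).t ((plusMul P).onB w) = b)
    (h' : (plusPoly P).t w.op = b) (l : ∀ n : w.op.1.Nodes, (w.args n).1.Nodes → D) :
    (ofLift w.op b h').sub (fun n => named (w.args n) (w.compat n) (l n)) =
      named ((plusMul P).onB w) h fun m => l ((plusMul P).onE w m).1 ((plusMul P).onE w m).2 := by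
  refine Subtype.ext ?_
  have h1 := congrArg (PTree.relabel (P := P.X) (f := (Prod.snd : D × P.X.B → P.X.B))
    (f' := (comp (plusPoly P) (plusPoly P)).s w)
    (fun p => (l p.1 p.2, (w.args p.1).1.nodeOp p.2)) fun _ => rfl) (lift_subst w b h)
  refine Eq.trans ?_ (h1.symm.trans ?_)
  · refine Eq.trans ?_ (relabel_sub (f := Prod.snd) (Q := P.X.pull w.op.1.nodeOp) _ (fun _ => rfl) _ _).symm
    refine congrArg (fun F => PTree.sub (Q := P.X.pull w.op.1.nodeOp) F (lift w.op b h')) (funext fun n => ?_)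
    exact (relabel_relabel (P := P.X) (f := (Prod.snd : D × P.X.B → P.X.B))
      (f' := (comp (plusPoly P) (plusPoly P)).s w) (f'' := (w.args n).1.nodeOp)
      (fun p => (l p.1 p.2, (w.args p.1).1.nodeOp p.2)) (fun _ => rfl) (fun m => ⟨n, m⟩) (fun _ => rfl)
      (lift (w.args n) (w.op.1.nodeOp n) (w.compat n))).symm
  · refine (relabel_relabel (P := P.X) (f := (Prod.snd : D × P.X.B → P.X.B))
      (f' := (comp (plusPoly P) (plusPoly P)).s w) (f'' := ((plusMul P).onB w).1.nodeOp)
      (fun p => (l p.1 p.2, (w.args p.1).1.nodeOp p.2)) (fun _ => rfl) ((plusMul P).onE w)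
      ((plusMul P).s_onE w) (lift ((plusMul P).onB w) b h)).trans ?_
    refine congrArg Subtype.val (relabel_congr (P := P) (f := (Prod.snd : D × P.X.B → P.X.B))
      (f' := ((plusMul P).onB w).1.nodeOp)
      (g := fun m => (l ((plusMul P).onE w m).1 ((plusMul P).onE w m).2,
        (w.args ((plusMul P).onE w m).1).1.nodeOp ((plusMul P).onE w m).2))
      (g' := fun m => (l ((plusMul P).onE w m).1 ((plusMul P).onE w m).2, ((plusMul P).onB w).1.nodeOp m))
      (funext fun m => ?_) ((plusMul P).s_onE w) (fun _ => rfl)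
      (ofLift ((plusMul P).onB w) b h))
    exact Prod.ext rfl ((plusMul P).s_onE w m)

theorem prune_corolla (w : D → Prop) (a : D × P.X.B) :
    (corolla (P := P) Prod.snd a).prune w = pruneAt w a :=
  Subtype.ext (bind_leaf _)

theorem pruneAt_eq_unitTr {w : D → Prop} {a : D × P.X.B} (hw : w a.1) {i : I}
    (hi : (unitTr (P := P) Prod.snd i).1 = a.2) :
    pruneAt (P := P) w a = (unitTr (P := P) Prod.snd i).2.cast hi := by
  have h : w a.1 ∧ ∃ i, (MonObj.one (X := P.X)).onB i = a.2 := ⟨hw, i, (unitTr_fst i).symm.trans hi⟩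
  have e : h.2.choose = i := by
    have h1 := h.2.choose_spec.trans (hi.symm.trans (unitTr_fst i))
    exact ((MonObj.one (X := P.X)).t_onB _).symm.trans
      ((congrArg P.X.t h1).trans ((MonObj.one (X := P.X)).t_onB i))
  unfold pruneAt
  rw [dif_pos h]
  have key : ∀ (j : I) (hj : j = i) (h1 : (unitTr (P := P) (Prod.snd : D × P.X.B → P.X.B) j).1 = a.2),
      (unitTr (P := P) (Prod.snd : D × P.X.B → P.X.B) j).2.cast h1 =
        (unitTr (P := P) (Prod.snd : D × P.X.B → P.X.B) i).2.cast hi := by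
    rintro j rfl h1
    rfl
  exact key _ e _

end Tr
end PolyEndo

/-! ### The total substitution of a tree of trees -/

namespace PolyEndo
open PTree Labelled SetOperad
variable {I : Type} {P : Mon (PolyEndo I)}

open Classical in
/-- The tree obtained by substituting recursively all the trees decorating the nodes of `S`. A node decorated
by a unit tree is kept as a node decorated by a unit operation. The nodes are labelled by the
edges of `S` with no edge above them. -/
noncomputable def full : (S : PTree (plusPoly P) P.X.B) → S.Valid (fun b => b) →
    Tr (P := P) (Prod.snd : S.Edges × P.X.B → P.X.B) (S.root fun b => b)
  | leaf b, _ => Tr.corolla (P := P) Prod.snd ((PUnit.unit, b) : PUnit × P.X.B)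
  | node z c, h =>
    -- A `P`-tree without nodes is a unit tree, and substituting it would delete the node without
    -- trace. A unit operation is kept instead, labelled by the output edge `none` of this null-dot;
    -- it will be a white dot.
    if IsEmpty z.1.Nodes then
      Tr.corolla (P := P) Prod.snd ((none, (plusPoly P).t z) : (node z c).Edges × P.X.B)
    else (Tr.ofLift z _ rfl).sub fun n =>
      ((full (c n) (h n).2).cast (h n).1).rename fun a => (some ⟨n, a⟩ : (node z c).Edges)

/-- The tree `z` with its nodes replaced by the trees obtained from the branches. -/
noncomputable def fullNode (z : (plusPoly P).B) (c : z.1.Nodes → PTree (plusPoly P) P.X.B)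
    (h : (node (P := plusPoly P) z c).Valid fun b => b) (n : z.1.Nodes) :
    Tr (P := P) (Prod.snd : (node (P := plusPoly P) z c).Edges × P.X.B → P.X.B) (z.1.nodeOp n) :=
  ((full (c n) (h n).2).cast (h n).1).rename fun a => (some ⟨n, a⟩ : (node (P := plusPoly P) z c).Edges)

section
variable (z : (plusPoly P).B) (c : z.1.Nodes → PTree (plusPoly P) P.X.B)
  (h : (node (P := plusPoly P) z c).Valid fun b => b)

theorem full_of_isEmpty (hz : IsEmpty z.1.Nodes) : full (node (P := plusPoly P) z c) h =
    Tr.corolla (P := P) Prod.snd ((none, (plusPoly P).t z) : (node (P := plusPoly P) z c).Edges × P.X.B) :=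
  if_pos hz

theorem full_of_nonempty (hz : ¬IsEmpty z.1.Nodes) : full (node (P := plusPoly P) z c) h =
    (Tr.ofLift z _ rfl).sub (fullNode z c h) :=
  if_neg hz

theorem mem_fullNode (n : z.1.Nodes) (y) : Mem (fullNode z c h n).1 y ↔
    ∃ a, Mem (full (c n) (h n).2).1 a ∧ some ⟨n, a⟩ = y := by
  refine (mem_rename _ _ _).trans (exists_congr fun a => and_congr ?_ Iff.rfl)
  exact Tr.val_cast_mem _ _ _

end

theorem mem_full (S : PTree (plusPoly P) P.X.B) (h : S.Valid fun b => b) (a : S.Edges) :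
    Mem (full S h).1 a ↔ S.underlying.IsTop a := by
  induction S with
  | leaf b => exact ⟨fun _ y n => PEmpty.elim n, fun _ => .inl rfl⟩
  | node z c ih =>
    by_cases hz : IsEmpty z.1.Nodes
    · rw [full_of_isEmpty z c h hz]
      rcases a with _ | ⟨n, a⟩
      · exact ⟨fun _ => isTop_none.2 hz, fun _ => .inl rfl⟩
      · exact (hz.false n).elim
    · rw [full_of_nonempty z c h hz]
      refine (Tr.mem_sub_ofLift z rfl (fullNode z c h) a).trans ?_
      refine (exists_congr fun n => (mem_fullNode z c h n a).trans
        (exists_congr fun a' => and_congr (ih n (h n).2 a') Iff.rfl)).trans ?_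
      rcases a with _ | ⟨n, a⟩
      · refine ⟨fun ⟨n, a, _, h⟩ => (by cases h), fun h => (hz (isTop_none.1 h)).elim⟩
      · refine Iff.trans ⟨?_, fun h => ⟨n, a, h, rfl⟩⟩ (isTop_some (P := plusPoly P) (c := c) n a).symm
        rintro ⟨m, a', h, e⟩
        obtain ⟨h1, h2⟩ := Sigma.mk.inj (Option.some.inj e)
        subst h1
        obtain rfl := eq_of_heq h2
        exact h

theorem distinct_full (S : PTree (plusPoly P) P.X.B) (h : S.Valid fun b => b) :
    Distinct (full S h).1 := by
  induction S with
  | leaf b => exact ⟨fun _ => trivial, fun _ h => h.elim, fun _ _ _ h => h.elim⟩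
  | node z c ih =>
    by_cases hz : IsEmpty z.1.Nodes
    · rw [full_of_isEmpty z c h hz]
      exact ⟨fun _ => trivial, fun _ h => h.elim, fun _ _ _ h => h.elim⟩
    · rw [full_of_nonempty z c h hz]
      refine Tr.distinct_sub_ofLift z rfl _ (fun n => ?_) fun n m y hn hm => ?_
      · refine distinct_rename _ ((Tr.distinct_cast _ _).2 (ih n (h n).2)) fun x y _ _ e => ?_
        exact eq_of_heq (Sigma.mk.inj (Option.some.inj e)).2
      · obtain ⟨a, _, rfl⟩ := (mem_fullNode z c h n y).1 hn
        obtain ⟨a', _, e⟩ := (mem_fullNode z c h m _).1 hm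
        exact (Sigma.mk.inj (Option.some.inj e)).1.symm

theorem exists_top_full (S : PTree (plusPoly P) P.X.B) (h : S.Valid fun b => b) :
    ∃ d, top (full S h).1 = some d := by
  obtain ⟨d, hd, _⟩ := exists_isTop_le S S.rootEdge
  exact exists_top ((mem_full S h d).2 hd)

/-- The labels are edges with nothing above them, so a label which is the output edge of a node
belongs to a null-dot. There the operation is the contraction of a unit tree. -/
theorem full_white (S : PTree (plusPoly P) P.X.B) (h : S.Valid fun b => b) (n : (full S h).1.Nodes)
    (hn : ∃ m, S.out m = ((full S h).1.nodeOp n).1) :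
    ∃ i, ((full S h).1.nodeOp n).2 = (MonObj.one (X := P.X)).onB i := by
  induction S with
  | leaf b => exact PEmpty.elim hn.choose
  | node z c ih =>
    by_cases hz : IsEmpty z.1.Nodes
    · revert n
      rw [full_of_isEmpty z c h hz]
      rintro (_ | ⟨_, n⟩) _
      · obtain ⟨z, hz'⟩ := z
        cases z with
        | leaf i => exact ⟨i, rfl⟩
        | node b c => exact hz.elim none
      · exact PEmpty.elim n
    · revert n
      rw [full_of_nonempty z c h hz]
      obtain ⟨φ, hφ⟩ := Tr.nodes_sub_ofLift z rfl (fullNode z c h)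
      intro n
      refine Eq.mp (congrArg (fun a : (node (P := plusPoly P) z c).Edges × P.X.B =>
        (∃ m, (node (P := plusPoly P) z c).out m = a.1) → ∃ i, a.2 = (MonObj.one (X := P.X)).onB i)
        (hφ n).symm) ?_
      obtain ⟨n, i⟩ := φ n
      have key : ∀ (b : P.X.B) (hb : (c n).root (fun b => b) = b)
          (i : (((full (c n) (h n).2).cast hb).rename fun a =>
            (some ⟨n, a⟩ : (node (P := plusPoly P) z c).Edges)).1.Nodes),
          (∃ m, (node (P := plusPoly P) z c).out m = ((((full (c n) (h n).2).cast hb).rename fun a =>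
            (some ⟨n, a⟩ : (node (P := plusPoly P) z c).Edges)).1.nodeOp i).1) →
          ∃ j, ((((full (c n) (h n).2).cast hb).rename fun a =>
            (some ⟨n, a⟩ : (node (P := plusPoly P) z c).Edges)).1.nodeOp i).2 =
              (MonObj.one (X := P.X)).onB j := by
        rintro _ rfl i
        obtain ⟨ψ, hψ⟩ := nodes_relabel (P := P.X) (f := Prod.snd) (f' := Prod.snd)
          (Prod.map (fun a => (some ⟨n, a⟩ : (node (P := plusPoly P) z c).Edges)) id)
          (fun _ => rfl) (full (c n) (h n).2).1
        intro hm
        obtain ⟨m, hm⟩ := hm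
        have h1 := hm.trans (congrArg Prod.fst (hψ i))
        obtain ⟨j, hj⟩ := ih n (h n).2 (ψ i) (by
          rcases m with _ | ⟨n', m⟩
          · cases h1
          · obtain ⟨h2, h3⟩ := Sigma.mk.inj (Option.some.inj h1)
            change n' = n at h2
            subst h2
            exact ⟨m, eq_of_heq h3⟩)
        exact ⟨j, (congrArg Prod.snd (hψ i)).trans hj⟩
      exact key _ (h n).1 i

/-- The kernel rule. For the root node the set consists of all labels of a nonempty tree. For a node
in a branch, the set is connected in the total substitution of the branch, and parent relations
survive when this is inserted into a larger tree. -/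
theorem conn_full (S : PTree (plusPoly P) P.X.B) (h : S.Valid fun b => b) (x : S.Nodes) :
    Conn (full S h).1 {y | S.underlying.IsTop y ∧ S.underlying.Le y (S.out x)} := by
  induction S with
  | leaf b => exact PEmpty.elim x
  | node z c ih =>
    rcases x with _ | ⟨n, x⟩
    · obtain ⟨d, hd⟩ := exists_top_full (node (P := plusPoly P) z c) h
      refine Eq.mp ?_ (conn_mem hd)
      congr 1
      ext y
      refine (mem_full _ h y).trans ⟨fun hy => ⟨hy, ?_⟩, fun hy => hy.1⟩
      exact (node (P := plusPoly P) z c).underlying.mem_root y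
    · have hz : ¬IsEmpty z.1.Nodes := fun hz => hz.false n
      rw [full_of_nonempty z c h hz]
      have h1 := (ih n (h n).2 x)
      have h2 := Conn.rename (fun a => (some ⟨n, a⟩ : (node (P := plusPoly P) z c).Edges))
        ((Tr.conn_cast (h n).1 (full (c n) (h n).2) _).2 h1)
      obtain ⟨r, hr, h3⟩ := h2
      have hset : (fun a => (some ⟨n, a⟩ : (node (P := plusPoly P) z c).Edges)) ''
          {y | (c n).underlying.IsTop y ∧ (c n).underlying.Le y ((c n).out x)} =
          {y | (node (P := plusPoly P) z c).underlying.IsTop y ∧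
            (node (P := plusPoly P) z c).underlying.Le y ((node (P := plusPoly P) z c).out (some ⟨n, x⟩))} := by
        ext y
        constructor
        · rintro ⟨y, ⟨hy, hy'⟩, rfl⟩
          exact ⟨(isTop_some (P := plusPoly P) (c := c) n y).2 hy,
            (le_some_iff (P := plusPoly P) (c := c) n y _).2 hy'⟩
        · rintro ⟨hy, hy'⟩
          rcases y with _ | ⟨m, y⟩
          · have := ((node (P := plusPoly P) z c).underlying.le_root_iff _).1 hy'
            cases this
          · obtain rfl : m = n := eq_of_le_some (P := plusPoly P) (c := c) hy'
            exact ⟨y, ⟨(isTop_some (P := plusPoly P) (c := c) m y).1 hy,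
              (le_some_iff (P := plusPoly P) (c := c) m y _).1 hy'⟩, rfl⟩
      refine Eq.mp (congrArg (Conn _) hset) ?_
      refine ⟨r, hr, fun y hy => (h3 y hy).imp_right ?_⟩
      rintro ⟨y', hy', hp⟩
      exact ⟨y', hy', Tr.par_sub_ofLift z rfl (fullNode z c h) n hp⟩

/-- Pruning commutes with substitution, so the recursion defining `full` turns into the recursion
defining contraction for `plus P`, by `named_mul`. At a null-dot the unit operation that was kept is
pruned to the unit tree decorating it. -/
theorem prune_full (S : PTree (plusPoly P) P.X.B) (h : S.Valid fun b => b) :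
    (full S h).prune (fun a => ∃ m, S.out m = a) =
      Tr.named (contract (plus P) (fun b => b) S h).op (contract (plus P) (fun b => b) S h).t_op
        fun n => S.leafEdge ((contract (plus P) (fun b => b) S h).leafOf n) := by
  induction S with
  | leaf b =>
    refine (Tr.prune_corolla _ _).trans ?_
    have hw : ¬((∃ m : PEmpty, (leaf b : PTree (plusPoly P) P.X.B).out m = PUnit.unit) ∧
      ∃ i, (MonObj.one (X := P.X)).onB i = b) := fun hw => PEmpty.elim hw.1.choose
    refine (dif_neg hw).trans ?_
    refine Subtype.ext ?_
    have h1 := congrArg (PTree.relabel (P := P.X) (f := (Prod.snd : PUnit × P.X.B → P.X.B))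
      (f' := ((plusOne P).onB b).1.nodeOp) (fun n => (PUnit.unit, ((plusOne P).onB b).1.nodeOp n)) fun _ => rfl)
      (lift_one (P := P) b b (contract (plus P) (fun b => b) (leaf b) h).t_op rfl)
    exact h1.symm
  | node z c ih =>
    let k := fun n => contract (plus P) (fun b => b) (c n) (h n).2
    let w : CompOp (plusPoly P) (plusPoly P) := ⟨z, fun n => (k n).op, fun n => (k n).t_op.trans (h n).1⟩
    refine Eq.trans ?_ (Tr.named_mul w (contract (plus P) (fun b => b) (node z c) h).t_op rfl
      fun n m => (some ⟨n, (c n).leafEdge ((k n).leafOf m)⟩ : (node (P := plusPoly P) z c).Edges))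
    by_cases hz : IsEmpty z.1.Nodes
    · rw [full_of_isEmpty z c h hz]
      refine (Tr.prune_corolla _ _).trans ?_
      obtain ⟨z, hz'⟩ := z
      cases z with
      | node b c => exact (hz.false none).elim
      | leaf i =>
      refine (Tr.pruneAt_eq_unitTr ⟨none, rfl⟩ (Tr.unitTr_fst i)).trans (Tr.ext_map ?_)
      have key : ∀ (D : Type) (x : Σ b, Tr (P := P) (Prod.snd : D × P.X.B → P.X.B) b) (b : P.X.B) (hb : x.1 = b),
          (x.2.cast hb).1.map (P.X.s b) = Tr.tree x := by
        rintro D x _ rfl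
        rfl
      refine (key _ _ _ _).trans ((tree_unitTr _ i).trans ?_)
      refine Eq.trans ?_ (sub_map (Q := P.X.pull (leaf i : PTree P.X I).nodeOp) _ _ _)
      exact (congrArg (PTree.sub (Q := P.X.pull (leaf i : PTree P.X I).nodeOp) _)
        (lift_map (P := P) ⟨leaf i, hz'⟩ _ rfl)).symm
    · rw [full_of_nonempty z c h hz]
      refine (Tr.prune_sub_ofLift _ z rfl (fullNode z c h)).trans ?_
      refine congrArg (Tr.sub (Tr.ofLift z _ rfl)) (funext fun n => ?_)
      refine (Tr.prune_rename _ _ _).trans ?_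
      have hw : (fun a => ∃ m, (node (P := plusPoly P) z c).out m = some ⟨n, a⟩) =
          fun a => ∃ m, (c n).out m = a := by
        funext a
        refine propext ⟨?_, fun ⟨m, hm⟩ => ⟨some ⟨n, m⟩, congrArg (fun a => some (Sigma.mk n a)) hm⟩⟩
        rintro ⟨_ | ⟨n', m⟩, e⟩
        · cases e
        · obtain ⟨h2, h3⟩ := Sigma.mk.inj (Option.some.inj e)
          change n' = n at h2
          subst h2
          exact ⟨m, eq_of_heq h3⟩
      have e1 := (Tr.prune_cast (h n).1 (fun a => ∃ m, (node (P := plusPoly P) z c).out m = some ⟨n, a⟩)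
        (full (c n) (h n).2)).trans (congrArg (fun x => Tr.cast (h n).1 x)
          ((congrArg (fun w => (full (c n) (h n).2).prune w) hw).trans (ih n (h n).2)))
      refine (congrArg (Tr.rename _) (e1.trans (Tr.named_cast _ _ _ _))).trans ?_
      exact Tr.rename_named _ _ _ _

end PolyEndo

/-! ### Inserting unit operations in the edges of a tree -/

namespace PTree
open PolyEndo Labelled
variable {I : Type} {P : Mon (PolyEndo I)} {D D' : Type}

/-- The unit operation of type `i` has exactly one input. -/
theorem one_unique (P : Mon (PolyEndo I)) (i : I) :
    ∃ e : P.X.E ((MonObj.one (X := P.X)).onB i), ∀ e', e' = e := by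
  obtain ⟨e, he⟩ := ((MonObj.one (X := P.X)).bij i).2 PUnit.unit
  exact ⟨e, fun e' => ((MonObj.one (X := P.X)).bij i).1 rfl⟩

/-- The tree `V` of type `i` with unit operations labelled by the elements of a list attached to its
root edge, the first element directly below `V`. -/
def chain (i : I) (ls : List D) (V : Labelled P.X D I) : Labelled P.X D I :=
  ls.foldl (fun V d => node (P := P.X.pull Prod.snd) (d, (MonObj.one (X := P.X)).onB i) fun _ => V) V

theorem chain_concat (i : I) (d : D) (ls : List D) (V : Labelled P.X D I) : chain i (ls ++ [d]) V =
    node (P := P.X.pull Prod.snd) (d, (MonObj.one (X := P.X)).onB i) fun _ => chain i ls V :=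
  List.foldl_append ..

theorem chain_valid (i : I) (ls : List D) (V : Labelled P.X D I) (hV : V.Valid fun i => i)
    (hr : V.root (fun i => i) = i) :
    (chain i ls V).Valid (fun i => i) ∧ (chain i ls V).root (fun i => i) = i := by
  induction ls generalizing V with
  | nil => exact ⟨hV, hr⟩
  | cons d ls ih =>
    refine ih _ (fun e => ⟨hr.trans ?_, hV⟩) ((MonObj.one (X := P.X)).t_onB i)
    exact (MonObj.one (X := P.X)).s_onE i e

/-- The list runs downwards, so the new root node carries its last element; `ls[j + 1]? = none` says
that the position `j` is the last one. -/
theorem top_chain (i : I) (ls : List D) (V : Labelled P.X D I) (x : D) :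
    top (chain i ls V) = some x ↔
      (top V = some x ∧ ls[0]? = none) ∨ ∃ j, ls[j]? = some x ∧ ls[j + 1]? = none := by
  induction ls generalizing V with
  | nil => simp [chain]
  | cons d ls ih =>
    refine (ih _).trans ?_
    constructor
    · rintro (⟨h, h'⟩ | ⟨j, h⟩)
      · exact .inr ⟨0, h, h'⟩
      · exact .inr ⟨j + 1, h⟩
    · rintro (⟨_, h⟩ | ⟨_ | j, h, h'⟩)
      · cases h
      · exact .inl ⟨h, h'⟩
      · exact .inr ⟨j, h, h'⟩

theorem par_chain (i : I) (ls : List D) (V : Labelled P.X D I) (x y : D) :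
    Par (chain i ls V) x y ↔ Par V x y ∨
      (top V = some x ∧ ls[0]? = some y) ∨ ∃ j, ls[j]? = some x ∧ ls[j + 1]? = some y := by
  induction ls generalizing V with
  | nil => simp [chain]
  | cons d ls ih =>
    obtain ⟨e, he⟩ := one_unique P i
    refine (ih _).trans ?_
    constructor
    · rintro ((⟨rfl, _, h⟩ | ⟨_, h⟩) | ⟨h, h'⟩ | ⟨j, h⟩)
      · exact .inr (.inl ⟨h, rfl⟩)
      · exact .inl h
      · exact .inr (.inr ⟨0, h, h'⟩)
      · exact .inr (.inr ⟨j + 1, h⟩)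
    · rintro (h | ⟨h, h'⟩ | ⟨_ | j, h, h'⟩)
      · exact .inl (.inr ⟨e, h⟩)
      · exact .inl (.inl ⟨(Option.some.inj h').symm, e, h⟩)
      · exact .inr (.inl ⟨h, h'⟩)
      · exact .inr (.inr ⟨j, h, h'⟩)

theorem mem_chain (i : I) (ls : List D) (V : Labelled P.X D I) (x : D) :
    Mem (chain i ls V) x ↔ Mem V x ∨ x ∈ ls := by
  induction ls generalizing V with
  | nil => simp [chain]
  | cons d ls ih =>
    obtain ⟨e, he⟩ := one_unique P i
    refine (ih _).trans ?_
    constructor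
    · rintro ((rfl | ⟨_, h⟩) | h)
      · exact .inr (List.mem_cons_self ..)
      · exact .inl h
      · exact .inr (List.mem_cons_of_mem _ h)
    · rintro (h | h)
      · exact .inl (.inr ⟨e, h⟩)
      · rcases List.mem_cons.1 h with rfl | h
        · exact .inl (.inl rfl)
        · exact .inr h

theorem rename_chain (g : D → D') (i : I) (ls : List D) (V : Labelled P.X D I) :
    (chain i ls V).rename g = chain i (ls.map g) (V.rename g) := by
  induction ls generalizing V with
  | nil => rfl
  | cons d ls ih => exact ih _

/-- The tree `T` with its nodes labelled by `β`, and with unit operations labelled by the lists `L`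
inserted in its edges. -/
def insertUnits : (T : PTree P.X I) → (T.Nodes → D) → (T.Edges → List D) → Labelled P.X D I
  | leaf i, _, L => chain i (L PUnit.unit) (leaf i)
  | node b c, β, L => chain (P.X.t b) (L none) (node (P := P.X.pull Prod.snd) (β none, b) fun e =>
      insertUnits (c e) (fun n => β (some ⟨e, n⟩)) fun a => L (some ⟨e, a⟩))

theorem insertUnits_valid (T : PTree P.X I) (hT : T.Valid fun i => i) (β : T.Nodes → D)
    (L : T.Edges → List D) : (insertUnits T β L).Valid (fun i => i) ∧
      (insertUnits T β L).root (fun i => i) = T.root fun i => i := by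
  induction T with
  | leaf i => exact chain_valid i _ _ trivial rfl
  | node b c ih =>
    refine chain_valid _ _ _ (fun e => ?_) rfl
    have := ih e (hT e).2 (fun n => β (some ⟨e, n⟩)) fun a => L (some ⟨e, a⟩)
    exact ⟨this.2.trans (hT e).1, this.1⟩

theorem rename_insertUnits (g : D → D') (T : PTree P.X I) (β : T.Nodes → D)
    (L : T.Edges → List D) : (insertUnits T β L).rename g =
      insertUnits T (fun n => g (β n)) fun a => (L a).map g := by
  induction T with
  | leaf i => exact rename_chain g i _ _
  | node b c ih =>
    refine (rename_chain g _ _ _).trans ?_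
    refine congrArg (chain _ _) ?_
    exact congrArg (node (P := P.X.pull Prod.snd) (g (β none), b)) (funext fun e => ih e _ _)

theorem mem_insertUnits (T : PTree P.X I) (β : T.Nodes → D) (L : T.Edges → List D) (x : D) :
    Mem (insertUnits T β L) x ↔ (∃ n, β n = x) ∨ ∃ a, x ∈ L a := by
  induction T with
  | leaf i =>
    refine (mem_chain i _ _ x).trans ⟨?_, ?_⟩
    · rintro (h | h)
      · exact h.elim
      · exact .inr ⟨_, h⟩
    · rintro (⟨n, _⟩ | ⟨a, h⟩)
      · exact PEmpty.elim n
      · exact .inr h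
  | node b c ih =>
    refine (mem_chain _ _ _ x).trans ((or_congr (or_congr Iff.rfl (exists_congr fun e =>
      ih e _ _)) Iff.rfl).trans ⟨?_, ?_⟩)
    · rintro ((rfl | ⟨e, ⟨n, h⟩ | ⟨a, h⟩⟩) | h)
      · exact .inl ⟨none, rfl⟩
      · exact .inl ⟨_, h⟩
      · exact .inr ⟨_, h⟩
      · exact .inr ⟨_, h⟩
    · rintro (⟨_ | ⟨e, n⟩, h⟩ | ⟨_ | ⟨e, a⟩, h⟩)
      · exact .inl (.inl h.symm)
      · exact .inl (.inr ⟨e, .inl ⟨n, h⟩⟩)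
      · exact .inr h
      · exact .inl (.inr ⟨e, .inr ⟨a, h⟩⟩)

/-- The label below the position `j` in the list attached to the edge `a`. -/
def nextLabel (T : PTree P.X I) (β : T.Nodes → D) (L : T.Edges → List D) (a : T.Edges) (j : ℕ) : Option D :=
  (L a)[j]?.or ((T.into a).map β)

theorem nextLabel_root (T : PTree P.X I) (β : T.Nodes → D) (L : T.Edges → List D) (j : ℕ) :
    nextLabel T β L T.rootEdge j = (L T.rootEdge)[j]? := by
  have h : T.into T.rootEdge = none := (T.underlying.into_eq_none _).2 rfl
  simp [nextLabel, h]

theorem nextLabel_some {b : P.X.B} {c : P.X.E b → PTree P.X I} (β : (node b c).Nodes → D)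
    (L : (node b c).Edges → List D) (e : P.X.E b) (a : (c e).Edges) (j : ℕ) :
    nextLabel (node b c) β L (some ⟨e, a⟩) j =
      (nextLabel (c e) (fun n => β (some ⟨e, n⟩)) (fun a => L (some ⟨e, a⟩)) a j).or (some (β none)) := by
  have h : (node b c).into (some ⟨e, a⟩) =
      some (((c e).into a).map (Sigma.mk (β := fun e => (c e).Nodes) e)) := rfl
  unfold nextLabel
  rw [h]
  cases (L (some ⟨e, a⟩))[j]? with
  | some x => rfl
  | none => cases (c e).into a <;> rfl

/-- The label `o`, or nothing, is directly below the label `x`. -/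
def IsNext (T : PTree P.X I) (β : T.Nodes → D) (L : T.Edges → List D) (x : D) (o : Option D) : Prop :=
  (∃ n, β n = x ∧ nextLabel T β L (T.out n) 0 = o) ∨ ∃ a j, (L a)[j]? = some x ∧ nextLabel T β L a (j + 1) = o

theorem nextLabel_node {b : P.X.B} {c : P.X.E b → PTree P.X I} (β : (node b c).Nodes → D)
    (L : (node b c).Edges → List D) (x : D) (o : Option D) : IsNext (node b c) β L x o ↔
      ((β none = x ∧ (L none)[0]? = o) ∨ ∃ j, (L none)[j]? = some x ∧ (L none)[j + 1]? = o) ∨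
      ∃ e o', IsNext (c e) (fun n => β (some ⟨e, n⟩)) (fun a => L (some ⟨e, a⟩)) x o' ∧
        o'.or (some (β none)) = o := by
  have hr : ∀ j, nextLabel (node b c) β L none j = (L none)[j]? := nextLabel_root (node b c) β L
  constructor
  · rintro (⟨_ | ⟨e, n⟩, h, h'⟩ | ⟨_ | ⟨e, a⟩, j, h, h'⟩)
    · exact .inl (.inl ⟨h, (hr 0).symm.trans h'⟩)
    · exact .inr ⟨e, _, .inl ⟨n, h, rfl⟩, (nextLabel_some β L e _ 0).symm.trans h'⟩
    · exact .inl (.inr ⟨j, h, (hr _).symm.trans h'⟩)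
    · exact .inr ⟨e, _, .inr ⟨a, j, h, rfl⟩, (nextLabel_some β L e _ _).symm.trans h'⟩
  · rintro ((⟨h, h'⟩ | ⟨j, h, h'⟩) | ⟨e, _, ⟨n, h, rfl⟩ | ⟨a, j, h, rfl⟩, h'⟩)
    · exact .inl ⟨none, h, (hr 0).trans h'⟩
    · exact .inr ⟨none, j, h, (hr _).trans h'⟩
    · exact .inl ⟨some ⟨e, n⟩, h, (nextLabel_some β L e _ 0).trans h'⟩
    · exact .inr ⟨some ⟨e, a⟩, j, h, (nextLabel_some β L e _ _).trans h'⟩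

/-- Root label and parent relation are treated together: what has nothing below it in a branch
acquires the node carrying the branch as its parent. -/
theorem top_par_insertUnits (T : PTree P.X I) (β : T.Nodes → D) (L : T.Edges → List D) (x : D) :
    (top (insertUnits T β L) = some x ↔ IsNext T β L x none) ∧
      ∀ y, Par (insertUnits T β L) x y ↔ IsNext T β L x (some y) := by
  induction T with
  | leaf i =>
    have h : ∀ o, IsNext (leaf i) β L x o ↔ ∃ j, (L PUnit.unit)[j]? = some x ∧ (L PUnit.unit)[j + 1]? = o := by
      intro o
      constructor
      · rintro (⟨n, _⟩ | ⟨a, j, h, h'⟩)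
        · exact PEmpty.elim n
        · exact ⟨j, h, (nextLabel_root (leaf i) β L _).symm.trans h'⟩
      · rintro ⟨j, h, h'⟩
        exact .inr ⟨PUnit.unit, j, h, (nextLabel_root (leaf i) β L _).trans h'⟩
    refine ⟨(top_chain _ _ _ _).trans (Iff.trans ?_ (h none).symm), fun y =>
      (par_chain _ _ _ _ _).trans (Iff.trans ?_ (h (some y)).symm)⟩
    · exact ⟨fun h => h.elim (fun h => by cases h.1) id, .inr⟩
    · exact ⟨fun h => h.elim False.elim fun h => h.elim (fun h => by cases h.1) id, fun h => .inr (.inr h)⟩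
  | node b c ih =>
    refine ⟨(top_chain _ _ _ _).trans (Iff.trans ?_ (nextLabel_node β L x none).symm), fun y =>
      (par_chain _ _ _ _ _).trans (Iff.trans ?_ (nextLabel_node β L x (some y)).symm)⟩
    · constructor
      · rintro (⟨h, h'⟩ | h)
        · exact .inl (.inl ⟨Option.some.inj h, h'⟩)
        · exact .inl (.inr h)
      · rintro ((⟨h, h'⟩ | h) | ⟨e, o, _, h⟩)
        · exact .inl ⟨congrArg some h, h'⟩
        · exact .inr h
        · cases o <;> cases h
    · constructor
      · rintro ((⟨rfl, e, h⟩ | ⟨e, h⟩) | ⟨h, h'⟩ | h)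
        · exact .inr ⟨e, none, (ih e _ _).1.1 h, rfl⟩
        · exact .inr ⟨e, some y, ((ih e _ _).2 y).1 h, rfl⟩
        · exact .inl (.inl ⟨Option.some.inj h, h'⟩)
        · exact .inl (.inr h)
      · rintro ((⟨h, h'⟩ | h) | ⟨e, _ | y', h, h'⟩)
        · exact .inr (.inl ⟨congrArg some h, h'⟩)
        · exact .inr (.inr h)
        · exact .inl (.inl ⟨(Option.some.inj h').symm, e, (ih e _ _).1.2 h⟩)
        · obtain rfl := Option.some.inj h'
          exact .inl (.inr ⟨e, ((ih e _ _).2 _).2 h⟩)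

/-- The tree with inserted unit operations, its nodes labelled according to a labelling of the nodes of
a subdivision of `T`. -/
def insertDots (T : PTree P.X I) (w : T.Edges → ℕ) (l : (T.Nodes ⊕ Σ a, Fin (w a)) → D) :
    Labelled P.X D I :=
  insertUnits T (fun n => l (Sum.inl n)) fun a => List.ofFn fun i => l (Sum.inr ⟨a, i⟩)

theorem nextLabel_ofFn (T : PTree P.X I) (w : T.Edges → ℕ) (l : (T.Nodes ⊕ Σ a, Fin (w a)) → D)
    (a : T.Edges) (j : Fin (w a + 1)) :
    nextLabel T (fun n => l (Sum.inl n)) (fun a => List.ofFn fun i => l (Sum.inr ⟨a, i⟩)) a j =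
      (T.underlying.subdivInto w ⟨a, j⟩).map l := by
  have h1 := FTree.subdivInto_eq T.underlying w a j
  refine Eq.trans ?_ (congrArg (Option.map l) h1).symm
  unfold nextLabel
  rw [List.getElem?_ofFn]
  by_cases h : (j : ℕ) < w a
  · rw [dif_pos h]
    refine Eq.trans ?_ (congrArg (Option.map l) (dif_pos h)).symm
    rfl
  · rw [dif_neg h]
    refine Eq.trans ?_ (congrArg (Option.map l) (dif_neg h)).symm
    change (T.into a).map _ = ((T.into a).map Sum.inl).map l
    rw [Option.map_map]
    rfl

/-- The tree with inserted unit operations models the subdivision of the underlying tree. Through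
this lemma `Conn` becomes the kernel condition in `conn_insertDots`. -/
theorem par_insertDots (T : PTree P.X I) (w : T.Edges → ℕ) (l : (T.Nodes ⊕ Σ a, Fin (w a)) → D)
    (x y : D) : Par (insertDots T w l) x y ↔
      ∃ p q, (T.underlying.subdivide w).parent p = some q ∧ l p = x ∧ l q = y := by
  have hs : ∀ p, ((T.underlying.subdivide w).parent p).map l = some y ↔
      ∃ q, (T.underlying.subdivide w).parent p = some q ∧ l q = y := fun p => Option.map_eq_some_iff
  refine ((top_par_insertUnits T _ _ x).2 y).trans ?_
  constructor
  · rintro (⟨n, h, h'⟩ | ⟨a, j, h, h'⟩)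
    · obtain ⟨q, hq, hq'⟩ := (hs (Sum.inl n)).1 ((nextLabel_ofFn T w l _ 0).symm.trans h')
      exact ⟨_, q, hq, h, hq'⟩
    · rw [List.getElem?_ofFn] at h
      by_cases hj : j < w a
      · rw [dif_pos hj] at h
        obtain ⟨q, hq, hq'⟩ := (hs (Sum.inr ⟨a, ⟨j, hj⟩⟩)).1
          ((nextLabel_ofFn T w l a (Fin.succ ⟨j, hj⟩)).symm.trans h')
        exact ⟨_, q, hq, Option.some.inj h, hq'⟩
      · rw [dif_neg hj] at h
        cases h
  · rintro ⟨n | ⟨a, j⟩, q, hq, h, h'⟩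
    · exact .inl ⟨n, h, (nextLabel_ofFn T w l _ 0).trans ((hs (Sum.inl n)).2 ⟨q, hq, h'⟩)⟩
    · refine .inr ⟨a, j, ?_, (nextLabel_ofFn T w l a j.succ).trans ((hs (Sum.inr ⟨a, j⟩)).2 ⟨q, hq, h'⟩)⟩
      rw [List.getElem?_ofFn, dif_pos j.2]
      exact congrArg some h

theorem mem_insertDots (T : PTree P.X I) (w : T.Edges → ℕ) (l : (T.Nodes ⊕ Σ a, Fin (w a)) → D)
    (x : D) : Mem (insertDots T w l) x ↔ ∃ p, l p = x := by
  refine (mem_insertUnits T _ _ x).trans ?_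
  constructor
  · rintro (⟨n, h⟩ | ⟨a, h⟩)
    · exact ⟨_, h⟩
    · obtain ⟨i, h⟩ := List.mem_ofFn.1 h
      exact ⟨_, h⟩
  · rintro ⟨n | ⟨a, i⟩, h⟩
    · exact .inl ⟨n, h⟩
    · exact .inr ⟨a, List.mem_ofFn.2 ⟨i, h⟩⟩

theorem conn_insertDots (T : PTree P.X I) (w : T.Edges → ℕ) (l : (T.Nodes ⊕ Σ a, Fin (w a)) → D)
    (hl : Function.Injective l) (K : Set D) (hK : ∀ x ∈ K, ∃ p, l p = x) :
    Conn (insertDots T w l) K ↔ (T.underlying.subdivide w).IsKernel {d | l d ∈ K} := by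
  rw [FTree.isKernel_iff]
  constructor
  · rintro ⟨r, hr, h⟩
    obtain ⟨r, rfl⟩ := hK r hr
    refine ⟨r, hr, fun p hp => (h _ hp).imp (fun h => hl h) ?_⟩
    rintro ⟨y, hy, h⟩
    obtain ⟨p', q, hpq, h1, rfl⟩ := (par_insertDots T w l _ _).1 h
    obtain rfl := hl h1
    exact ⟨q, hy, hpq⟩
  · rintro ⟨r, hr, h⟩
    refine ⟨l r, hr, fun x hx => ?_⟩
    obtain ⟨p, rfl⟩ := hK x hx
    refine (h p hx).imp (congrArg l) ?_
    rintro ⟨q, hq, h⟩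
    exact ⟨l q, hq, (par_insertDots T w l _ _).2 ⟨p, q, h, rfl, rfl⟩⟩

theorem distinct_chain (i : I) (ls : List D) (V : Labelled P.X D I) :
    Distinct (chain i ls V) ↔ Distinct V ∧ ls.Nodup ∧ ∀ d ∈ ls, ¬Mem V d := by
  induction ls generalizing V with
  | nil => simp [chain]
  | cons d ls ih =>
    obtain ⟨e, he⟩ := one_unique P i
    refine (ih _).trans ?_
    constructor
    · rintro ⟨⟨h1, h2, _⟩, h3, h4⟩
      refine ⟨h1 e, List.nodup_cons.2 ⟨fun h => h4 d h (.inl rfl), h3⟩, fun d' hd' h => ?_⟩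
      rcases List.mem_cons.1 hd' with rfl | hd'
      · exact h2 e h
      · exact h4 d' hd' (.inr ⟨e, h⟩)
    · rintro ⟨h1, h2, h3⟩
      obtain ⟨h4, h5⟩ := List.nodup_cons.1 h2
      refine ⟨⟨fun _ => h1, fun _ => h3 d (List.mem_cons_self ..), fun e' e'' _ _ _ =>
        (he e').trans (he e'').symm⟩, h5, ?_⟩
      rintro d' hd' (rfl | ⟨_, h⟩)
      · exact h4 hd'
      · exact h3 d' (List.mem_cons_of_mem _ hd') h

theorem distinct_insertDots (T : PTree P.X I) (w : T.Edges → ℕ) (l : (T.Nodes ⊕ Σ a, Fin (w a)) → D) :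
    Distinct (insertDots T w l) ↔ Function.Injective l := by
  induction T with
  | leaf i =>
    refine (distinct_chain _ _ _).trans ?_
    constructor
    · rintro ⟨_, h, _⟩
      have h := List.nodup_ofFn.1 h
      rintro (n | ⟨a, i⟩) (m | ⟨a', j⟩) e
      · exact PEmpty.elim n
      · exact PEmpty.elim n
      · exact PEmpty.elim m
      · obtain rfl : i = j := h e
        rfl
    · refine fun h => ⟨trivial, List.nodup_ofFn.2 fun i j e => ?_, fun _ _ h => h⟩
      exact eq_of_heq (Sigma.mk.inj (Sum.inr_injective (h e))).2
  | node b c ih =>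
    -- The dots of the branch `e` as dots of the whole tree. The remaining dots are the root node
    -- and the dots on the root edge.
    let ι : ∀ e, ((c e).Nodes ⊕ Σ a : (c e).Edges, Fin (w (some ⟨e, a⟩))) → (node b c).Nodes ⊕ Σ a, Fin (w a) :=
      fun e => Sum.map (fun n => (some ⟨e, n⟩ : Option (Σ e, (c e).Nodes))) fun p =>
        (Sigma.mk (β := fun a : (node b c).Edges => Fin (w a)) (some ⟨e, p.1⟩) p.2)
    have hι : ∀ e p e' p', ι e p = ι e' p' → (Sigma.mk e p :
        Σ e, (c e).Nodes ⊕ (Σ a : (c e).Edges, Fin (w (some ⟨e, a⟩)))) = Sigma.mk e' p' := by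
      rintro e (n | ⟨a, i⟩) e' (n' | ⟨a', i'⟩) h
      · cases Sum.inl_injective h
        rfl
      · cases h
      · cases h
      · cases Sum.inr_injective h
        rfl
    have hmem : ∀ e x, Mem (insertDots (c e) (fun a => w (some ⟨e, a⟩)) fun p => l (ι e p)) x ↔
        ∃ p, l (ι e p) = x := fun e x => mem_insertDots _ _ _ x
    have ih' : ∀ e, Distinct (insertDots (c e) (fun a => w (some ⟨e, a⟩)) fun p => l (ι e p)) ↔
        Function.Injective fun p => l (ι e p) := fun e => ih e _ _
    have hcases : ∀ q, q = Sum.inl none ∨ (∃ i, q = Sum.inr ⟨none, i⟩) ∨ ∃ e p, q = ι e p := by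
      rintro ((_ | ⟨e, n⟩) | ⟨_ | ⟨e, a⟩, i⟩)
      · exact .inl rfl
      · exact .inr (.inr ⟨e, Sum.inl n, rfl⟩)
      · exact .inr (.inl ⟨i, rfl⟩)
      · exact .inr (.inr ⟨e, Sum.inr ⟨a, i⟩, rfl⟩)
    refine (distinct_chain _ _ _).trans ?_
    constructor
    · rintro ⟨⟨h1, h2, h3⟩, h4, h5⟩
      have h4 := List.nodup_ofFn.1 h4
      have h5 := fun i => h5 _ (List.mem_ofFn.2 ⟨i, rfl⟩)
      have h1 := fun e => (ih' e).1 (h1 e)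
      have k1 : ∀ e p, l (ι e p) ≠ l (Sum.inl none) := fun e p h => h2 e ((hmem e _).2 ⟨p, h⟩)
      have k2 : ∀ e p i, l (ι e p) ≠ l (Sum.inr ⟨none, i⟩) := fun e p i h =>
        h5 i (.inr ⟨e, (hmem e _).2 ⟨p, h⟩⟩)
      have k3 : ∀ i, l (Sum.inr ⟨none, i⟩) ≠ l (Sum.inl none) := fun i h => h5 i (.inl h)
      have k4 : ∀ e p e' p', l (ι e p) = l (ι e' p') → ι e p = ι e' p' := by
        intro e p e' p' h
        obtain rfl := h3 e e' _ ((hmem e _).2 ⟨p, rfl⟩) ((hmem e' _).2 ⟨p', h.symm⟩)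
        exact congrArg (ι e) (h1 e h)
      intro q q' h
      rcases hcases q with rfl | ⟨i, rfl⟩ | ⟨e, p, rfl⟩ <;>
        rcases hcases q' with rfl | ⟨i', rfl⟩ | ⟨e', p', rfl⟩
      · rfl
      · exact (k3 _ h.symm).elim
      · exact (k1 _ _ h.symm).elim
      · exact (k3 _ h).elim
      · rw [h4 h]
      · exact (k2 _ _ _ h.symm).elim
      · exact (k1 _ _ h).elim
      · exact (k2 _ _ _ h).elim
      · exact k4 _ _ _ _ h
    · intro h
      refine ⟨⟨fun e => (ih' e).2 fun p p' hp => ?_, fun e he => ?_, fun e e' x hx hx' => ?_⟩,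
        List.nodup_ofFn.2 fun i j e => ?_, ?_⟩
      · exact eq_of_heq (Sigma.mk.inj (hι e p e p' (h hp))).2
      · obtain ⟨p, hp⟩ := (hmem e _).1 he
        have := h hp
        rcases p with n | p <;> cases this
      · obtain ⟨p, rfl⟩ := (hmem e _).1 hx
        obtain ⟨p', hp'⟩ := (hmem e' _).1 hx'
        exact (Sigma.mk.inj (hι _ _ _ _ (h hp'))).1.symm
      · exact eq_of_heq (Sigma.mk.inj (Sum.inr_injective (h e))).2
      · rintro d hd hd'
        obtain ⟨i, rfl⟩ := List.mem_ofFn.1 hd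
        rcases hd' with hd' | ⟨e, hd'⟩
        · cases h hd'
        · obtain ⟨p, hp⟩ := (hmem e _).1 hd'
          have := h hp
          rcases p with n | p <;> cases this

end PTree

/-! ### Recovering a tree from its subdivision -/

namespace PTree
open PolyEndo Labelled SetOperad
variable {I : Type} {P : Mon (PolyEndo I)} {D D' : Type} {w : D → Prop}

theorem pruneAt_of_unit {d : D} (hd : w d) (i : I) :
    ∃ e, (Tr.pruneAt (P := P) w (d, (MonObj.one (X := P.X)).onB i)).1 = leaf e := by
  have h1 := Tr.pruneAt_eq_unitTr (P := P) (w := w) (a := (d, (MonObj.one (X := P.X)).onB i)) hd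
    (Tr.unitTr_fst i)
  have key : ∀ (x : Σ b, Tr (P := P) (Prod.snd : D × P.X.B → P.X.B) b) (b : P.X.B) (hb : x.1 = b),
      (x.2.cast hb).1.map (P.X.s b) = Tr.tree x := by
    rintro x _ rfl
    rfl
  have h2 := (congrArg (fun x : Tr (P := P) (Prod.snd : D × P.X.B → P.X.B) _ => x.1.map (P.X.s _)) h1).trans
    ((key _ _ _).trans (tree_unitTr _ i))
  revert h2
  generalize (Tr.pruneAt (P := P) w (d, (MonObj.one (X := P.X)).onB i)).1 = V
  intro h2
  cases V with
  | leaf e => exact ⟨e, rfl⟩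
  | node a c => cases h2

theorem pruneAt_of_not {d : D} (hd : ¬w d) (b : P.X.B) :
    (Tr.pruneAt (P := P) w (d, b)).1 = node (P := P.X.pull Prod.snd) (d, b) leaf :=
  congrArg Subtype.val (dif_neg fun h => hd h.1)

/-- Contraction of the unit operations whose labels have the property `w`. -/
noncomputable def pruneTree (w : D → Prop) (V : Labelled P.X D I) : Labelled P.X D I :=
  V.sub (Q := P.X.pull (Prod.snd : D × P.X.B → P.X.B)) fun a => (Tr.pruneAt (P := P) w a).1

theorem pruneTree_chain (i : I) (ls : List D) (hls : ∀ d ∈ ls, w d) (V : Labelled P.X D I) :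
    pruneTree w (chain i ls V) = pruneTree w V := by
  induction ls generalizing V with
  | nil => rfl
  | cons d ls ih =>
    obtain ⟨e, he⟩ := pruneAt_of_unit (P := P) (hls d (List.mem_cons_self ..)) i
    refine (ih (fun d' hd' => hls d' (List.mem_cons_of_mem _ hd')) _).trans ?_
    exact congrArg (fun S : Labelled P.X D _ => S.bind fun _ => pruneTree w V) he

/-- The property `w` distinguishes the inserted labels from the original ones, so pruning removes
precisely the insertions. -/
theorem pruneTree_insertUnits (T : PTree P.X I) (β : T.Nodes → D) (L : T.Edges → List D)
    (hβ : ∀ n, ¬w (β n)) (hL : ∀ a, ∀ d ∈ L a, w d) :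
    pruneTree w (insertUnits T β L) = insertUnits T β fun _ => [] := by
  induction T with
  | leaf i => exact pruneTree_chain i _ (hL _) _
  | node b c ih =>
    refine (pruneTree_chain _ _ (hL none) _).trans ?_
    refine (congrArg (fun S : Labelled P.X D _ => S.bind fun e => pruneTree w
      (insertUnits (c e) (fun n => β (some ⟨e, n⟩)) fun a => L (some ⟨e, a⟩)))
      (pruneAt_of_not (P := P) (hβ none) b)).trans ?_
    exact congrArg (node (P := P.X.pull Prod.snd) (β none, b)) (funext fun e =>
      ih e _ _ (fun n => hβ _) fun a => hL _)

theorem nodeSelf_relabel_eq (T : PTree P.X I) (β : T.Nodes → D) :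
    T.nodeSelf.relabel (f := (Prod.snd : D × P.X.B → P.X.B)) (fun n => (β n, T.nodeOp n)) (fun _ => rfl) =
      insertUnits T β fun _ => [] := by
  induction T with
  | leaf i => rfl
  | node b c ih =>
    let l : (node b c).Nodes → D × P.X.B := fun n => (β n, (node b c).nodeOp n)
    have key : ∀ (e : P.X.E b),
        (c e).nodeSelf.relabel (f := (Prod.snd : D × P.X.B → P.X.B)) (fun n => l (some ⟨e, n⟩)) (fun n => rfl) =
          PTree.relabel (f := (Prod.snd : D × P.X.B → P.X.B)) l (fun _ => rfl)
            (((c e).self.relabel (f := (node b c).nodeOp)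
            (fun n => some ⟨e, n⟩) (fun _ => rfl)).map (Sigma.mk (β := fun e => (c e).Leaves) e) |>.map
              (node b c).leafLabel) := by
      intro e
      refine (relabel_map _ _ _ _).trans ?_
      refine Eq.trans ?_ (congrArg (PTree.relabel (f := (Prod.snd : D × P.X.B → P.X.B)) l _) (map_map _ _ _)).symm
      refine Eq.trans ?_ (relabel_map _ _ _ _).symm
      exact congrArg (fun S : PTree (P.X.pull (Prod.snd : D × P.X.B → P.X.B)) _ => S.map _) (relabel_relabel _ _ _ _ _).symm
    refine Eq.trans ?_ (congrArg (node (P := P.X.pull Prod.snd) (l none)) (funext fun e => ih e _))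
    exact congrArg (node (P := P.X.pull Prod.snd) (l none)) (funext fun e => (key e).symm)

theorem insertUnits_nil_injective {T T' : PTree P.X I} {β : T.Nodes → D} {β' : T'.Nodes → D}
    (h : insertUnits T β (fun _ => []) = insertUnits T' β' fun _ => []) :
    (⟨T, β⟩ : Σ T : PTree P.X I, T.Nodes → D) = ⟨T', β'⟩ := by
  rw [← nodeSelf_relabel_eq, ← nodeSelf_relabel_eq] at h
  have h1 : ∀ (T : PTree P.X I) (β : T.Nodes → D),
      (T.nodeSelf.relabel (f := (Prod.snd : D × P.X.B → P.X.B)) (fun n => (β n, T.nodeOp n))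
        (fun _ => rfl)).erase = T := fun T β =>
    (erase_relabel _ (fun _ => rfl) _).trans (erase_nodeSelf T)
  obtain rfl : T = T' := (h1 T β).symm.trans ((congrArg PTree.erase h).trans (h1 T' β'))
  have h2 := nodeSelf_relabel_inj (f := (Prod.snd : D × P.X.B → P.X.B)) T _ _ _ _ h
  exact congrArg (Sigma.mk T) (funext fun n => (Prod.mk.inj (congrFun h2 n)).1)

/-- Read from the root upwards, the inserted list ends at the first label without the property `w`,
or at a leaf. The induction therefore removes elements at the end of the list. -/
theorem chain_injective {i : I} {ls ls' : List D} (h : ∀ d ∈ ls, w d) (h' : ∀ d ∈ ls', w d)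
    {V V' : Labelled P.X D I} (hV : ∀ d, top V = some d → ¬w d) (hV' : ∀ d, top V' = some d → ¬w d)
    (e : chain i ls V = chain i ls' V') : ls = ls' ∧ V = V' := by
  have hn : ∀ (ls : List D) (d : D) (V V' : Labelled P.X D I), w d → (∀ d, top V' = some d → ¬w d) →
      chain i (ls ++ [d]) V ≠ V' := by
    intro ls d V V' hd hV' e
    rw [chain_concat] at e
    exact hV' d (congrArg top e).symm hd
  induction ls using List.reverseRecOn generalizing ls' with
  | nil =>
    rcases List.eq_nil_or_concat ls' with rfl | ⟨ls', d, rfl⟩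
    · exact ⟨rfl, e⟩
    · rw [List.concat_eq_append] at h' e
      exact (hn ls' d V' V (h' d (by simp)) hV e.symm).elim
  | append_singleton ls d ih =>
    rcases List.eq_nil_or_concat ls' with rfl | ⟨ls', d', rfl⟩
    · exact (hn ls d V V' (h d (by simp)) hV' e).elim
    · rw [List.concat_eq_append] at h' e ⊢
      rw [chain_concat, chain_concat] at e
      injection e with h1 h2
      obtain ⟨rfl, _⟩ := Prod.mk.inj h1
      obtain ⟨x, _⟩ := one_unique P i
      obtain ⟨rfl, rfl⟩ := ih (fun d hd => h d (List.mem_append_left _ hd))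
        (fun d hd => h' d (List.mem_append_left _ hd)) (congrFun h2 x)
      exact ⟨rfl, rfl⟩

theorem insertUnits_injective (T : PTree P.X I) {β β' : T.Nodes → D} {L L' : T.Edges → List D}
    (hβ : ∀ n, ¬w (β n)) (hL : ∀ a, ∀ d ∈ L a, w d) (hβ' : ∀ n, ¬w (β' n))
    (hL' : ∀ a, ∀ d ∈ L' a, w d) (e : insertUnits T β L = insertUnits T β' L') : β = β' ∧ L = L' := by
  induction T with
  | leaf i =>
    obtain ⟨h, _⟩ := chain_injective (hL _) (hL' _) (fun _ h => by cases h) (fun _ h => by cases h) e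
    exact ⟨funext fun n => PEmpty.elim n, funext fun _ => h⟩
  | node b c ih =>
    have ht : ∀ (β : (node b c).Nodes → D) (V : P.X.E b → Labelled P.X D I), (∀ n, ¬w (β n)) →
        ∀ d, top (node (P := P.X.pull Prod.snd) (β none, b) V) = some d → ¬w d :=
      fun β V hβ d h => Option.some.inj h ▸ hβ none
    obtain ⟨h, h'⟩ := chain_injective (hL _) (hL' _) (ht β _ hβ) (ht β' _ hβ') e
    injection h' with h1 h2
    have h3 := fun e => ih e (fun n => hβ (some ⟨e, n⟩)) (fun a => hL (some ⟨e, a⟩))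
      (fun n => hβ' _) (fun a => hL' _) (congrFun h2 e)
    refine ⟨funext fun n => ?_, funext fun a => ?_⟩
    · rcases n with _ | ⟨e, n⟩
      · exact (Prod.mk.inj h1).1
      · exact congrFun (h3 e).1 n
    · rcases a with _ | ⟨e, a⟩
      · exact h
      · exact congrFun (h3 e).2 a

theorem exists_insertUnits_concat (T : PTree P.X I) (hT : T.Valid fun i => i) (β : T.Nodes → D)
    (L : T.Edges → List D) (d : D) (i : I) (hi : T.root (fun i => i) = i) : ∃ L' : T.Edges → List D, insertUnits T β L' =
      node (P := P.X.pull Prod.snd) (d, (MonObj.one (X := P.X)).onB i)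
        (fun _ => insertUnits T β L) ∧ ∀ a, ∀ x ∈ L' a, x = d ∨ x ∈ L a := by
  subst hi
  cases T with
  | leaf i =>
    refine ⟨fun a => L a ++ [d], chain_concat i d _ _, fun a x hx => ?_⟩
    rcases List.mem_append.1 hx with h | h
    · exact .inr h
    · exact .inl (List.mem_singleton.1 h)
  | node b c =>
    refine ⟨fun a => Option.elim a (L none ++ [d]) fun p => L (some p), chain_concat _ d _ _, ?_⟩
    rintro (_ | p) x hx
    · rcases List.mem_append.1 hx with h | h
      · exact .inr h
      · exact .inl (List.mem_singleton.1 h)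
    · exact .inr hx

/-- Any tree whose `w`-labels sit on unit operations is a subdivision. If the root node is such a
unit, it is appended to the list of the root edge of the tree above it; otherwise it becomes a node
of `T`. -/
theorem exists_insertUnits (V : Labelled P.X D I) (hV : V.Valid fun i => i)
    (hw : ∀ n, w (V.nodeOp n).1 → ∃ i, (V.nodeOp n).2 = (MonObj.one (X := P.X)).onB i) :
    ∃ (T : PTree P.X I) (β : T.Nodes → D) (L : T.Edges → List D), T.Valid (fun i => i) ∧
      V = insertUnits T β L ∧ (∀ n, ¬w (β n)) ∧ ∀ a, ∀ d ∈ L a, w d := by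
  induction V with
  | leaf i => exact ⟨leaf i, fun n => PEmpty.elim n, fun _ => [], trivial, rfl, fun n => PEmpty.elim n, by simp⟩
  | node a c ih =>
    obtain ⟨d, b⟩ := a
    choose T β L hT hV' hβ hL using fun e => ih e (hV e).2 fun n => hw (some ⟨e, n⟩)
    by_cases hd : w d
    · obtain ⟨i, rfl⟩ : ∃ i, b = _ := hw none hd
      obtain ⟨e, he⟩ := one_unique P i
      have hr : (T e).root (fun i => i) = i := by
        refine ((insertUnits_valid (T e) (hT e) (β e) (L e)).2.symm.trans ?_).trans
          ((hV e).1.trans ((MonObj.one (X := P.X)).s_onE i e).symm)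
        exact congrArg (PTree.root fun i => i) (hV' e).symm
      obtain ⟨L', h1, h2⟩ := exists_insertUnits_concat (T e) (hT e) (β e) (L e) d i hr
      refine ⟨T e, β e, L', hT e, ?_, hβ e, fun a x hx => ?_⟩
      · refine Eq.trans ?_ h1.symm
        refine congrArg (node (P := P.X.pull Prod.snd) _) (funext fun e' => ?_)
        rw [he e']
        exact hV' e
      · rcases h2 a x hx with rfl | h
        · exact hd
        · exact hL e a x h
    · refine ⟨node b T, fun n => Option.elim n d fun p => β p.1 p.2,
        fun a => Option.elim a [] fun p => L p.1 p.2, fun e => ⟨?_, hT e⟩, ?_, ?_, ?_⟩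
      · refine ((insertUnits_valid (T e) (hT e) (β e) (L e)).2.symm.trans ?_).trans (hV e).1
        exact congrArg (PTree.root fun i => i) (hV' e).symm
      · exact congrArg (node (P := P.X.pull Prod.snd) (d, b)) (funext hV')
      · rintro (_ | ⟨e, n⟩)
        · exact hd
        · exact hβ e n
      · rintro (_ | ⟨e, a⟩) x hx
        · cases hx
        · exact hL e a x hx

end PTree

/-! ### Constellations and subdivided decorated trees -/

namespace FTree
open PTree PolyEndo Labelled Constellation
variable {I : Type} {P : Mon (PolyEndo I)}

/-- A dictionary: distinct labels mean injectivity of the labelling of dots, `hm` says that exactly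
the edges with nothing above them are hit, and `hc` is the kernel rule. The converse translation is
`insertDots_constellation`. -/
theorem exists_constellation (T : PTree P.X I) (N : FTree) (β : T.Nodes → N.Edge)
    (L : T.Edges → List N.Edge) (hd : Distinct (insertUnits T β L))
    (hm : ∀ a, Mem (insertUnits T β L) a ↔ N.IsTop a)
    (hc : ∀ m, Conn (insertUnits T β L) {y | N.IsTop y ∧ N.Le y (N.out m)})
    (hβ : ∀ n m, N.out m ≠ β n) (hL : ∀ a, ∀ d ∈ L a, ∃ m, N.out m = d) :
    ∃ C : Constellation T.underlying N, (∀ n, C.edge (Sum.inl n) = β n) ∧ ∀ a, C.whites a = L a := by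
  let l : (T.Nodes ⊕ Σ a, Fin (L a).length) → N.Edge := Sum.elim β fun p => (L p.1).get p.2
  have hl : insertDots T (fun a => (L a).length) l = insertUnits T β L :=
    congrArg (insertUnits T β) (funext fun a => List.ofFn_get (L a))
  have hm' : ∀ a, (∃ p, l p = a) ↔ N.IsTop a := fun a =>
    (mem_insertDots T _ l a).symm.trans ((iff_of_eq (congrArg (fun V => Mem V a) hl)).trans (hm a))
  have hi : Function.Injective l := (distinct_insertDots T _ l).1 (hl ▸ hd)
  refine ⟨ofLists β L hi (fun a => (hm' a).2) hβ (fun a d hd' => ⟨?_, hL a d hd'⟩) (fun x => ?_),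
    fun _ => rfl, fun a => whites_ofLists β L _ _ _ _ _ a⟩
  · exact (hm d).1 ((mem_insertUnits T β L d).2 (.inr ⟨a, hd'⟩))
  · have h1 := (conn_insertDots T _ l hi {y | N.IsTop y ∧ N.Le y (N.out x)}
      fun y hy => (hm' y).2 hy.1).1 (hl ▸ hc x)
    refine Eq.mp (congrArg _ (Set.ext fun d => ?_)) h1
    exact ⟨fun h => h.2, fun h => ⟨(hm' _).1 ⟨d, rfl⟩, h⟩⟩

theorem insertDots_constellation {T : PTree P.X I} {N : FTree} (C : Constellation T.underlying N) :
    Distinct (insertDots T C.white C.edge) ∧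
      (∀ a, Mem (insertDots T C.white C.edge) a ↔ N.IsTop a) ∧
      ∀ m, Conn (insertDots T C.white C.edge) {y | N.IsTop y ∧ N.Le y (N.out m)} := by
  have hm : ∀ a, Mem (insertDots T C.white C.edge) a ↔ N.IsTop a := fun a =>
    (mem_insertDots T _ _ a).trans (C.exists_edge a)
  refine ⟨(distinct_insertDots T _ _).2 C.edge_injective, hm, fun m => ?_⟩
  refine (conn_insertDots T _ _ C.edge_injective _ fun y hy => (C.exists_edge y).2 hy.1).2 ?_
  refine Eq.mp (congrArg _ (Set.ext fun d => ?_)) (C.isKernel_edge m)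
  exact ⟨fun h => ⟨(C.exists_edge _).1 ⟨d, rfl⟩, h⟩, fun h => h.2⟩

end FTree

/-! ### Renaming of labels -/

namespace PTree.Labelled
variable {I : Type u} {P : PolyEndo I} {X Y : Type u} {D D' D'' : Type u}

theorem conn_map (V : Labelled P D X) (k : X → Y) (K : Set D) : Conn (V.map k) K ↔ V.Conn K :=
  exists_congr fun _ => and_congr Iff.rfl (forall₂_congr fun x _ => or_congr Iff.rfl
    (exists_congr fun y => and_congr Iff.rfl (par_map V k x y)))

theorem distinct_map (V : Labelled P D X) (k : X → Y) : Distinct (V.map k) ↔ V.Distinct := by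
  induction V with
  | leaf z => exact Iff.rfl
  | node a c ih =>
    refine and_congr (forall_congr' ih) (and_congr (forall_congr' fun e => not_congr (mem_map _ _ _)) ?_)
    exact forall₃_congr fun e e' x => imp_congr (mem_map _ _ _) (imp_congr (mem_map _ _ _) Iff.rfl)

theorem rename_congr {g g' : D → D'} {V : Labelled P D X} (h : ∀ y, V.Mem y → g y = g' y) :
    V.rename g = V.rename g' := by
  induction V with
  | leaf z => rfl
  | node a c ih =>
    refine Eq.trans (b := node (P := P.pull (Prod.snd : D' × P.B → P.B)) (g a.1, a.2)
      fun e => Labelled.rename g' (c e)) ?_ ?_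
    · exact congrArg (node (P := P.pull (Prod.snd : D' × P.B → P.B)) (g a.1, a.2))
        (funext fun e => ih e fun y hy => h y (.inr ⟨e, hy⟩))
    · exact congrArg (fun d => node (P := P.pull (Prod.snd : D' × P.B → P.B)) (d, a.2)
        fun e => Labelled.rename g' (c e)) (h a.1 (.inl rfl))

end PTree.Labelled

namespace PolyEndo
open PTree Labelled SetOperad
variable {I : Type u} {P : Mon (PolyEndo I)} {D D' D'' : Type u} {b : P.X.B}

namespace Tr

theorem rename_rename (g : D → D') (g' : D' → D'') (x : Tr (P := P) (Prod.snd : D × P.X.B → P.X.B) b) :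
    (x.rename g).rename g' = x.rename fun y => g' (g y) :=
  Subtype.ext (relabel_relabel (P := P.X) (f := (Prod.snd : D'' × P.X.B → P.X.B)) (f' := Prod.snd)
    (f'' := Prod.snd) (Prod.map g' id) (fun _ => rfl) (Prod.map g id) (fun _ => rfl) x.1)

theorem rename_congr {g g' : D → D'} {x : Tr (P := P) (Prod.snd : D × P.X.B → P.X.B) b}
    (h : ∀ y, Mem x.1 y → g y = g' y) : x.rename g = x.rename g' :=
  Subtype.ext (Labelled.rename_congr h)

theorem rename_id' {g : D → D} {x : Tr (P := P) (Prod.snd : D × P.X.B → P.X.B) b}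
    (h : ∀ y, Mem x.1 y → g y = y) : x.rename g = x := by
  refine (rename_congr h).trans (Subtype.ext ?_)
  refine (sub_node (P := P.X.pull (Prod.snd : D × P.X.B → P.X.B)) x.1)

theorem rename_cast {b' : P.X.B} (h : b = b') (g : D → D')
    (x : Tr (P := P) (Prod.snd : D × P.X.B → P.X.B) b) : (x.cast h).rename g = (x.rename g).cast h := by
  subst h
  rfl

theorem rename_sub_ofLift (g : D → D') (z : (plusPoly P).B) (h : (plusPoly P).t z = b)
    (G : ∀ n : z.1.Nodes, Tr (P := P) (Prod.snd : D × P.X.B → P.X.B) (z.1.nodeOp n)) :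
    ((ofLift z b h).sub G).rename g = (ofLift z b h).sub fun n => (G n).rename g :=
  Subtype.ext (relabel_sub (P := P.X) (f := (Prod.snd : D' × P.X.B → P.X.B))
    (f' := (Prod.snd : D × P.X.B → P.X.B)) (Q := P.X.pull z.1.nodeOp) (Prod.map g id) (fun _ => rfl)
    (fun n => (G n).1) (ofLift z b h).1)

theorem tree_rename (g : D → D') (x : Tr (P := P) (Prod.snd : D × P.X.B → P.X.B) b) :
    tree ⟨b, x.rename g⟩ = Labelled.rename g (tree ⟨b, x⟩) :=
  (relabel_map (P := P.X) (f := Prod.snd) (f' := Prod.snd) (Prod.map g id) (fun _ => rfl) x.1 _).symm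

/-- Only one label, occurring once, leaves room for a single node. Its operation is then the
contraction, and the names of the leaves are forced by `tree_injective`. -/
theorem eq_corolla {x : Tr (P := P) (Prod.snd : D × P.X.B → P.X.B) b} {d : D} (hx : Distinct x.1)
    (hm : ∀ y, Mem x.1 y ↔ y = d) : x = corolla Prod.snd (d, b) := by
  obtain ⟨V, hV⟩ := x
  cases V with
  | leaf e => exact ((hm d).2 rfl).elim
  | node a c =>
    obtain ⟨d', b'⟩ := a
    obtain rfl : d' = d := (hm d').1 (.inl rfl)
    have hc : ∀ e, ∃ y, c e = leaf y := by
      intro e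
      cases hce : c e with
      | leaf y => exact ⟨y, rfl⟩
      | node a' c' =>
        have h1 : Mem (c e) a'.1 := hce ▸ .inl rfl
        exact (hx.2.1 e ((hm _).1 (.inr ⟨e, h1⟩) ▸ h1)).elim
    choose k hk using hc
    obtain rfl : c = fun e => leaf (k e) := funext hk
    have h1 : tree (P := P) ⟨b, ⟨_, hV⟩⟩ = tree (P := P) ⟨b', corolla Prod.snd (d', b')⟩ := by
      refine congrArg (node (P := P.X.pull Prod.snd) (d', b')) (funext fun e => ?_)
      exact congrArg leaf (hV.1 e).1
    have h2 := tree_injective h1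
    obtain rfl : b = b' := congrArg Sigma.fst h2
    exact eq_of_heq (Sigma.mk.inj h2).2

end Tr
end PolyEndo

/-! ### Reconstruction of a tree of trees from its total substitution -/

namespace PolyEndo
open PTree Labelled SetOperad Constellation
variable {I : Type} {P : Mon (PolyEndo I)}

theorem Tr.sigma_eq_of_cast {D : Type} {b₁ b₂ b : P.X.B} (h₁ : b₁ = b) (h₂ : b₂ = b)
    {x : Tr (P := P) (Prod.snd : D × P.X.B → P.X.B) b₁}
    {y : Tr (P := P) (Prod.snd : D × P.X.B → P.X.B) b₂} (h : x.cast h₁ = y.cast h₂) :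
    (⟨b₁, x⟩ : Σ b, Tr (P := P) (Prod.snd : D × P.X.B → P.X.B) b) = ⟨b₂, y⟩ := by
  subst h₁
  subst h₂
  exact congrArg (Sigma.mk _) h

theorem Tr.cast_eq_of_sigma {D : Type} {b₁ b : P.X.B} (h₁ : b₁ = b)
    {x : Tr (P := P) (Prod.snd : D × P.X.B → P.X.B) b₁}
    {y : Tr (P := P) (Prod.snd : D × P.X.B → P.X.B) b}
    (h : (⟨b₁, x⟩ : Σ b, Tr (P := P) (Prod.snd : D × P.X.B → P.X.B) b) = ⟨b, y⟩) : x.cast h₁ = y := by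
  subst h₁
  exact eq_of_heq (Sigma.mk.inj h).2

theorem le_some_iff' {J : Type} {R : PolyEndo J} {X : Type} {r : R.B} {c : R.E r → PTree R X} (e : R.E r)
    (a : (c e).Edges) (y : (node r c).Edges) : (node r c).underlying.Le y (some ⟨e, a⟩) ↔
      ∃ a', y = some ⟨e, a'⟩ ∧ (c e).underlying.Le a' a := by
  constructor
  · intro h
    rcases y with _ | ⟨m, y⟩
    · cases ((node r c).underlying.le_root_iff _).1 h
    · obtain rfl : m = e := eq_of_le_some h
      exact ⟨y, rfl, (le_some_iff m y a).1 h⟩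
  · rintro ⟨a', rfl, h⟩
    exact (le_some_iff e a' a).2 h

open Classical in
/-- The edge of the branch `c e` corresponding to an edge of the whole tree. -/
noncomputable def branchEdge {J : Type} {R : PolyEndo J} {X : Type} {r : R.B} (c : R.E r → PTree R X) (e : R.E r)
    (a : (node r c).Edges) : (c e).Edges :=
  if h : ∃ x, a = some ⟨e, x⟩ then h.choose else (c e).rootEdge

theorem branchEdge_some {J : Type} {R : PolyEndo J} {X : Type} {r : R.B} (c : R.E r → PTree R X) (e : R.E r)
    (a : (c e).Edges) : branchEdge c e (some ⟨e, a⟩) = a := by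
  have h : ∃ x : (c e).Edges, (some ⟨e, a⟩ : Option (Σ e, (c e).Edges)) = some ⟨e, x⟩ := ⟨a, rfl⟩
  exact (dif_pos h).trans (eq_of_heq (Sigma.mk.inj (Option.some.inj h.choose_spec)).2).symm

/-- The labels are coloured by the branches of `S'`, to which the branches of `S` correspond under
`g`. Both total substitutions are then the same tree cut into pieces of distinct colours, so
`Tr.sub_ofLift_injective` identifies the decorations of the root nodes and the pieces, and induction
applies to the branches. A null-dot is decorated by a unit tree, which is known from its
contraction. -/
theorem full_injective (S S' : PTree (plusPoly P) P.X.B) (h : S.Valid fun b => b)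
    (h' : S'.Valid fun b => b) (g : S.underlying.Iso S'.underlying)
    (e : (⟨_, full S' h'⟩ : Σ b, Tr (P := P) (Prod.snd : S'.Edges × P.X.B → P.X.B) b) =
      ⟨_, (full S h).rename g.edge⟩) :
    ∃ h : S = S', ∀ a, g.edge a = cast (congrArg Edges h) a := by
  induction S generalizing S' with
  | leaf b =>
    cases S' with
    | leaf b' =>
      obtain rfl : b' = b := congrArg Sigma.fst e
      exact ⟨rfl, fun _ => rfl⟩
    | node z' c' => exact PEmpty.elim (g.node.symm none)
  | node z c ih =>
    cases S' with
    | leaf b' => exact PEmpty.elim (g.node none)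
    | node z' c' =>
    obtain ⟨σ, gc, hg⟩ := exists_iso_children (c := c) (c' := c') g
    have hroot : g.edge none = none := g.edge_root
    by_cases hz : IsEmpty z.1.Nodes
    · have hz' : IsEmpty z'.1.Nodes := ⟨fun n => hz.false (σ.symm n)⟩
      have e1 : (plusPoly P).t z' = (plusPoly P).t z := congrArg Sigma.fst e
      obtain rfl : z = z' := by
        obtain ⟨z, hv⟩ := z
        obtain ⟨z', hv'⟩ := z'
        cases z with
        | node b c => exact hz.elim none
        | leaf i =>
        cases z' with
        | node b c => exact hz'.elim none
        | leaf i' =>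
        obtain rfl : i' = i := ((MonObj.one (X := P.X)).t_onB _).symm.trans
          ((congrArg P.X.t e1).trans ((MonObj.one (X := P.X)).t_onB i))
        rfl
      obtain rfl : c = c' := funext fun n => (hz.false n).elim
      refine ⟨rfl, ?_⟩
      rintro (_ | ⟨n, a⟩)
      · exact hroot
      · exact (hz.false n).elim
    · have hz' : ¬IsEmpty z'.1.Nodes := fun hz' => hz ⟨fun n => hz'.false (σ n)⟩
      rw [full_of_nonempty z c h hz, full_of_nonempty z' c' h' hz'] at e
      obtain ⟨e1, e2⟩ := Sigma.mk.inj e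
      have e3 : (Tr.ofLift z _ rfl).sub (fun n => (fullNode z c h n).rename g.edge) =
          (Tr.ofLift z' _ e1).sub (fullNode z' c' h') := by
        refine (Tr.rename_sub_ofLift g.edge z rfl (fullNode z c h)).symm.trans ?_
        refine eq_of_heq (e2.symm.trans ?_)
        have key : ∀ (b b' : P.X.B) (hb : (plusPoly P).t z' = b) (hb' : (plusPoly P).t z' = b'), HEq
            ((Tr.ofLift z' b hb).sub (fullNode z' c' h')) ((Tr.ofLift z' b' hb').sub (fullNode z' c' h')) := by
          rintro b _ hb rfl
          subst hb
          rfl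
        exact key _ _ _ _
      have hmem : ∀ n y, Mem ((fullNode z c h n).rename g.edge).1 y → ∃ a, y = some ⟨σ n, a⟩ := by
        intro n y hy
        obtain ⟨y', hy', rfl⟩ := (mem_rename _ _ _).1 hy
        obtain ⟨a, _, rfl⟩ := (mem_fullNode z c h n _).1 hy'
        exact ⟨_, hg n a⟩
      have hmem' : ∀ n y, Mem (fullNode z' c' h' n).1 y → ∃ a, y = some ⟨n, a⟩ := by
        intro n y hy
        obtain ⟨a, _, rfl⟩ := (mem_fullNode z' c' h' n _).1 hy
        exact ⟨_, rfl⟩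
      have htop' : ∀ n, ∃ d, top (fullNode z' c' h' n).1 = some d := by
        intro n
        obtain ⟨d, hd⟩ := exists_top_full (c' n) (h' n).2
        exact exists_top ((mem_fullNode z' c' h' n _).2 ⟨d, mem_of_top hd, rfl⟩)
      have htop : ∀ n, ∃ d, top ((fullNode z c h n).rename g.edge).1 = some d := by
        intro n
        obtain ⟨d, hd⟩ := exists_top_full (c n) (h n).2
        exact exists_top ((mem_rename _ _ _).2 ⟨_, (mem_fullNode z c h n _).2 ⟨d, mem_of_top hd, rfl⟩, rfl⟩)
      have e4 := Tr.sub_ofLift_injective z rfl _ (z' := z') (h' := e1) (G' := fullNode z' c' h')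
        (π := fun y : (node (P := plusPoly P) z' c').Edges => Option.map Sigma.fst y)
        (κ := fun n => some (σ n)) (κ' := some)
        (fun n m h => σ.injective (Option.some.inj h)) (Option.some_injective _) htop htop'
        (fun n y hy => by obtain ⟨a, rfl⟩ := hmem n y hy; rfl)
        (fun n y hy => by obtain ⟨a, rfl⟩ := hmem' n y hy; rfl) e3
      obtain ⟨e5, e6⟩ := Sigma.mk.inj e4
      subst e5
      have e7 := fun n => congrFun (eq_of_heq e6) n
      -- Any label occurring in the piece at `n` shows in which branch the piece lies, and the
      -- pieces agree.
      have hσ : ∀ n, σ n = n := by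
        intro n
        obtain ⟨d, hd⟩ := htop' n
        have hd := mem_of_top hd
        obtain ⟨a, rfl⟩ := hmem' n _ hd
        rw [← e7 n] at hd
        obtain ⟨a', h1⟩ := hmem n _ hd
        exact (Sigma.mk.inj (Option.some.inj h1)).1.symm
      have hgc : ∀ n, ∃ γ : (c n).underlying.Iso (c' n).underlying, ∀ a, g.edge (some ⟨n, a⟩) = some ⟨n, γ.edge a⟩ := by
        intro n
        have h1 : ∀ m, σ n = m → ∃ γ : (c n).underlying.Iso (c' m).underlying,
            ∀ a, g.edge (some ⟨n, a⟩) = some ⟨m, γ.edge a⟩ := by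
          rintro _ rfl
          exact ⟨gc n, hg n⟩
        exact h1 n (hσ n)
      choose γ hγ using hgc
      have hc : ∀ n, ∃ h : c n = c' n, ∀ a, (γ n).edge a = cast (congrArg Edges h) a := by
        intro n
        refine ih n (c' n) (h n).2 (h' n).2 (γ n) ?_
        have hρ : ∀ a : (c' n).Edges, branchEdge c' n (some ⟨n, a⟩) = a := branchEdge_some c' n
        refine Tr.sigma_eq_of_cast (h' n).1 (h n).1 ?_
        have h1 := congrArg (Tr.rename (branchEdge c' n)) (e7 n)
        unfold fullNode at h1
        have h2 := (congrArg (Tr.rename (branchEdge c' n)) (Tr.rename_rename _ g.edge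
          ((full (c n) (h n).2).cast (h n).1))).symm.trans h1
        have h3 := (Tr.rename_rename _ _ _).symm.trans (h2.trans (Tr.rename_rename _ (branchEdge c' n)
          ((full (c' n) (h' n).2).cast (h' n).1)))
        refine (Tr.rename_id' fun a _ => hρ a).symm.trans (h3.symm.trans ?_)
        refine (Tr.rename_congr fun a _ => ?_).trans (Tr.rename_cast (h n).1 (γ n).edge _)
        exact (congrArg (branchEdge c' n) (hγ n a)).trans (hρ _)
      obtain rfl : c = c' := funext fun n => (hc n).choose
      refine ⟨rfl, ?_⟩
      rintro (_ | ⟨n, a⟩)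
      · exact hroot
      · exact (hγ n a).trans (congrArg (fun a => some (Sigma.mk n a)) ((hc n).choose_spec a))


/-- The colour of a label is the branch of `M` containing it. The kernel rule for the lowest node of
a branch says that its colour class is connected, so `Tr.exists_partition` provides the decoration
`z` of the root node and one piece for each branch. The pieces inherit the hypotheses, the kernel
rule for higher nodes being a statement about sets of one colour. -/
theorem exists_full {J : Type} {R : PolyEndo J} {X : Type} (M : PTree R X) {b : P.X.B}
    (x : Tr (P := P) (Prod.snd : M.Edges × P.X.B → P.X.B) b) (hx : Distinct x.1)
    (hm : ∀ a, Mem x.1 a ↔ M.underlying.IsTop a)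
    (hw : ∀ n, (∃ m, M.out m = (x.1.nodeOp n).1) → ∃ i, (x.1.nodeOp n).2 = (MonObj.one (X := P.X)).onB i)
    (hc : ∀ m, Conn x.1 {y | M.underlying.IsTop y ∧ M.underlying.Le y (M.out m)}) :
    ∃ (S : PTree (plusPoly P) P.X.B) (h : S.Valid fun b => b) (g : M.underlying.Iso S.underlying),
      (⟨_, full S h⟩ : Σ b, Tr (P := P) (Prod.snd : S.Edges × P.X.B → P.X.B) b) =
        ⟨b, x.rename g.edge⟩ := by
  induction M generalizing b with
  | leaf y =>
    refine ⟨leaf b, trivial, isoLeaf _ _, ?_⟩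
    have h1 := Tr.eq_corolla (d := PUnit.unit) hx fun y => ⟨fun _ => rfl, fun _ => (hm y).2 fun _ n => PEmpty.elim n⟩
    rw [h1]
    rfl
  | node r c ih =>
    by_cases hr : IsEmpty (R.E r)
    · have h1 := Tr.eq_corolla (d := none) hx fun y => by
        refine (hm y).trans ?_
        rcases y with _ | ⟨e, _⟩
        · exact ⟨fun _ => rfl, fun _ => isTop_none.2 hr⟩
        · exact (hr.false e).elim
      -- Over a null-dot the tree has a single, white, node. By `hw` it is a unit operation, hence
      -- the contraction of a unit tree.
      obtain ⟨i, rfl⟩ : ∃ i, b = (MonObj.one (X := P.X)).onB i := by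
        subst h1
        exact hw none ⟨none, rfl⟩
      let z : (plusPoly P).B := ⟨leaf i, trivial⟩
      have hz : IsEmpty z.1.Nodes := inferInstanceAs (IsEmpty PEmpty)
      have hz' : IsEmpty ((plusPoly P).E z) := hz
      refine ⟨node z fun n => (hz.false n).elim, fun n => (hz.false n).elim,
        isoNode (Equiv.equivOfIsEmpty _ _) fun e => (hr.false e).elim, ?_⟩
      subst h1
      exact congrArg (Sigma.mk ((plusPoly P).t z)) (full_of_isEmpty z _ _ hz)
    · obtain ⟨e₀⟩ := not_isEmpty_iff.1 hr
      -- The root edge `none` has edges above it and is not a label, so the value `e₀` there is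
      -- arbitrary.
      let π : (node r c).Edges → R.E r := fun y => y.elim e₀ Sigma.fst
      have hmem : ∀ y, Mem x.1 y → ∃ a, y = some ⟨π y, a⟩ := by
        rintro (_ | ⟨e, a⟩) hy
        · exact (hr (isTop_none.1 ((hm _).1 hy))).elim
        · exact ⟨a, rfl⟩
      have hmem' : ∀ e a, Mem x.1 (some ⟨e, a⟩) ↔ (c e).underlying.IsTop a := fun e a =>
        (hm _).trans (isTop_some e a)
      obtain ⟨d, hd⟩ : ∃ d, top x.1 = some d := by
        obtain ⟨d, hd, _⟩ := exists_isTop_le (node r c) none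
        exact exists_top ((hm d).2 hd)
      have hconn : ∀ e, Conn x.1 {y | Mem x.1 y ∧ π y = e} := by
        intro e
        -- A branch without nodes has no kernel condition of its own, but it contains only one edge
        -- and thus only one label.
        cases hce : c e with
        | leaf y =>
          have hu : ∀ a a' : (c e).Edges, a = a' := by
            rw [hce]
            exact fun _ _ => rfl
          obtain ⟨a, ha, _⟩ := exists_isTop_le (c e) (c e).rootEdge
          refine ⟨some ⟨e, a⟩, ⟨(hmem' e a).2 ha, rfl⟩, ?_⟩
          rintro y ⟨hy, rfl⟩
          obtain ⟨a', ha'⟩ := hmem y hy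
          exact .inl (ha'.trans (congrArg (fun a => some (Sigma.mk (π y) a)) (hu _ _)))
        | node r' c' =>
          obtain ⟨m, hm'⟩ : ∃ m, (c e).out m = (c e).rootEdge := by
            rw [hce]
            exact ⟨none, rfl⟩
          refine Eq.mp (congrArg (Conn x.1) (Set.ext fun y => ?_)) (hc (some ⟨e, m⟩))
          have ho : (node r c).out (some ⟨e, m⟩) = some ⟨e, (c e).rootEdge⟩ :=
            congrArg (fun a => some (Sigma.mk e a)) hm'
          change _ ∧ (node r c).underlying.Le y ((node r c).out (some ⟨e, m⟩)) ↔ _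
          rw [ho]
          refine (and_congr_left' (hm y).symm).trans (and_congr_right fun hy => ?_)
          refine (le_some_iff' e _ y).trans ⟨?_, fun h => ?_⟩
          · rintro ⟨a, rfl, _⟩
            rfl
          · obtain ⟨a, ha⟩ := hmem y hy
            subst h
            exact ⟨a, ha, (c (π y)).underlying.mem_root a⟩
      obtain ⟨z, h, G, σ, hxG, hG, hGm, hGc⟩ := Tr.exists_partition x hx hd π hconn
      subst h
      have key : ∀ n : z.1.Nodes, ∃ (S : PTree (plusPoly P) P.X.B) (h : S.Valid fun b => b)
          (g : (c (σ.symm n)).underlying.Iso S.underlying),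
          (⟨_, full S h⟩ : Σ b, Tr (P := P) (Prod.snd : S.Edges × P.X.B → P.X.B) b) =
            ⟨_, ((G n).rename (branchEdge c (σ.symm n))).rename g.edge⟩ := by
        intro n
        obtain ⟨e, rfl⟩ := σ.surjective n
        rw [σ.symm_apply_apply]
        have hl : ∀ y, Mem (G (σ e)).1 y ↔ ∃ a, y = some ⟨e, a⟩ ∧ (c e).underlying.IsTop a := by
          intro y
          refine (hGm e y).trans ⟨?_, ?_⟩
          · rintro ⟨hy, rfl⟩
            obtain ⟨a, ha⟩ := hmem y hy
            exact ⟨a, ha, (hmem' _ a).1 (ha ▸ hy)⟩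
          · rintro ⟨a, rfl, ha⟩
            exact ⟨(hmem' e a).2 ha, rfl⟩
        refine ih e _ ?_ ?_ ?_ ?_
        · refine distinct_rename _ (hG _) fun y y' hy hy' h => ?_
          obtain ⟨a, rfl, _⟩ := (hl y).1 hy
          obtain ⟨a', rfl, _⟩ := (hl y').1 hy'
          rw [branchEdge_some, branchEdge_some] at h
          rw [h]
        · intro a
          refine (mem_rename _ _ _).trans ⟨?_, fun ha => ?_⟩
          · rintro ⟨y, hy, rfl⟩
            obtain ⟨a, rfl, ha⟩ := (hl y).1 hy
            rw [branchEdge_some]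
            exact ha
          · exact ⟨some ⟨e, a⟩, (hl _).2 ⟨a, rfl, ha⟩, branchEdge_some c e a⟩
        · intro i
          obtain ⟨ψ, hψ⟩ := nodes_relabel (P := P.X) (f := Prod.snd) (f' := Prod.snd)
            (Prod.map (branchEdge c e) id) (fun _ => rfl) (G (σ e)).1
          rintro ⟨m, hm'⟩
          obtain ⟨φ, hφ⟩ := Tr.nodes_sub_ofLift z rfl G
          have h1 := hφ (φ.symm ⟨σ e, ψ i⟩)
          rw [Equiv.apply_symm_apply] at h1
          obtain ⟨a, ha, _⟩ := (hl _).1 ((mem_iff _ _).2 ⟨ψ i, rfl⟩)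
          have h2 := hm'.trans (congrArg Prod.fst (hψ i))
          have h3 : (c e).out m = a := h2.trans ((congrArg (branchEdge c e) ha).trans (branchEdge_some c e a))
          subst hxG
          obtain ⟨j, hj⟩ := hw (φ.symm ⟨σ e, ψ i⟩) ⟨some ⟨e, m⟩,
            (congrArg (fun a => some (Sigma.mk e a)) h3).trans (ha.symm.trans (congrArg Prod.fst h1).symm)⟩
          exact ⟨j, (congrArg Prod.snd (hψ i)).trans ((congrArg Prod.snd h1).symm.trans hj)⟩
        · intro m
          have h1 := Conn.rename (branchEdge c e) (hGc e _ (fun y hy => by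
            obtain ⟨a, rfl, _⟩ := (le_some_iff' e _ y).1 hy.2
            rfl) (hc (some ⟨e, m⟩)))
          refine Eq.mp (congrArg (Conn _) (Set.ext fun a => ?_)) h1
          constructor
          · rintro ⟨y, ⟨hy, hy'⟩, rfl⟩
            obtain ⟨a, rfl, ha⟩ := (le_some_iff' e _ y).1 hy'
            rw [branchEdge_some]
            exact ⟨(isTop_some e a).1 hy, ha⟩
          · rintro ⟨ha, ha'⟩
            exact ⟨some ⟨e, a⟩, ⟨(isTop_some e a).2 ha, (le_some_iff' e _ _).2 ⟨a, rfl, ha'⟩⟩, branchEdge_some c e a⟩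
      choose S hS g hg using key
      have hroot : ∀ n, (S n).root (fun b => b) = z.1.nodeOp n := fun n => congrArg Sigma.fst (hg n)
      let γ : (node (P := plusPoly P) z S).underlying.Iso (node r c).underlying :=
        isoNode σ.symm fun n => (g n).symm
      have hγ : ∀ n a, γ.symm.edge (some ⟨σ.symm n, a⟩) = some ⟨n, (g n).edge a⟩ := by
        intro n a
        refine γ.edge.injective ((γ.edge.apply_symm_apply _).trans ?_)
        refine congrArg (fun a => some (Sigma.mk (σ.symm n) a)) ?_
        exact ((g n).edge.symm_apply_apply a).symm
      have hz : ¬IsEmpty z.1.Nodes := fun hz => hz.false (σ e₀)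
      refine ⟨node z S, fun n => ⟨hroot n, hS n⟩, γ.symm, ?_⟩
      have hGn : ∀ n y, Mem (G n).1 y → ∃ a, y = some ⟨σ.symm n, a⟩ := by
        intro n
        obtain ⟨e, rfl⟩ := σ.surjective n
        rw [σ.symm_apply_apply]
        intro y hy
        obtain ⟨hy', rfl⟩ := (hGm _ y).1 hy
        exact hmem y hy'
      subst hxG
      refine congrArg (Sigma.mk ((plusPoly P).t z)) ((full_of_nonempty z S (fun n => ⟨hroot n, hS n⟩) hz).trans ?_)
      refine Eq.trans ?_ (Tr.rename_sub_ofLift _ z rfl G).symm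
      refine congrArg (Tr.sub (Tr.ofLift z _ rfl)) (funext fun n => ?_)
      refine (congrArg (Tr.rename _) (Tr.cast_eq_of_sigma (hroot n) (hg n))).trans ?_
      refine (congrArg (Tr.rename _) (Tr.rename_rename _ _ _)).trans ((Tr.rename_rename _ _ _).trans ?_)
      refine Tr.rename_congr fun y hy => ?_
      obtain ⟨a, rfl⟩ := hGn n y hy
      rw [branchEdge_some]
      exact (hγ n a).symm

end PolyEndo

/-! ### Compatibility of constellations in terms of subdivided trees -/

namespace PTree
open PolyEndo Labelled Constellation FTree
variable {I : Type} {P : Mon (PolyEndo I)} {N N' : FTree} {D : Type}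

theorem nodeOp_chain (i : I) (ls : List D) (V : Labelled P.X D I) (n : (chain i ls V).Nodes) :
    (∃ m, (chain i ls V).nodeOp n = V.nodeOp m) ∨
      ((chain i ls V).nodeOp n).1 ∈ ls ∧ ∃ j, ((chain i ls V).nodeOp n).2 = (MonObj.one (X := P.X)).onB j := by
  induction ls generalizing V with
  | nil => exact .inl ⟨n, rfl⟩
  | cons d ls ih =>
    rcases ih _ n with ⟨m, hm⟩ | ⟨h, h'⟩
    · rcases m with _ | ⟨e, m⟩
      · refine .inr ⟨?_, i, congrArg Prod.snd hm⟩
        exact List.mem_cons.2 (.inl (congrArg Prod.fst hm))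
      · exact .inl ⟨m, hm⟩
    · exact .inr ⟨List.mem_cons_of_mem _ h, h'⟩

theorem nodeOp_insertUnits (T : PTree P.X I) (β : T.Nodes → D) (L : T.Edges → List D)
    (n : (insertUnits T β L).Nodes) : (∃ m, ((insertUnits T β L).nodeOp n).1 = β m) ∨
      ∃ j, ((insertUnits T β L).nodeOp n).2 = (MonObj.one (X := P.X)).onB j := by
  induction T with
  | leaf i =>
    rcases nodeOp_chain i (L PUnit.unit) (leaf i) n with ⟨m, _⟩ | ⟨_, h⟩
    · exact PEmpty.elim m
    · exact .inr h
  | node b c ih =>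
    rcases nodeOp_chain _ (L none) _ n with ⟨m, hm⟩ | ⟨_, h⟩
    · rcases m with _ | ⟨e, m⟩
      · exact .inl ⟨none, congrArg Prod.fst hm⟩
      · refine (ih e _ _ m).imp (fun ⟨m', h⟩ => ⟨some ⟨e, m'⟩, ?_⟩) fun ⟨j, h⟩ => ⟨j, ?_⟩
        · exact (congrArg Prod.fst hm).trans h
        · exact (congrArg Prod.snd hm).trans h
    · exact .inr h

theorem rename_insertDots_of_compatible {T : PTree P.X I} {C : Constellation T.underlying N}
    {C' : Constellation T.underlying N'} {g : N.Iso N'} (h : C.Compatible C' (Iso.refl _) g) :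
    (insertDots T C.white C.edge).rename g.edge = insertDots T C'.white C'.edge := by
  obtain ⟨h1, h2⟩ := (compatible_iff _ _ _ _).1 h
  refine (rename_insertUnits _ _ _ _).trans ?_
  exact congrArg₂ (insertUnits T) (funext h1) (funext fun a => (h2 a).symm)

/-- White dots are recognised by their labels, which are output edges of nodes. Pruning them on both
sides identifies the two trees, after which `insertUnits_injective` compares the labels dot by dot.
-/
theorem compatible_of_rename_insertDots {T T' : PTree P.X I} (C : Constellation T.underlying N)
    (C' : Constellation T'.underlying N') (g : N.Iso N')
    (h : insertDots T' C'.white C'.edge = (insertDots T C.white C.edge).rename g.edge) :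
    ∃ e : T = T', C.Compatible C' (Iso.ofEq (congrArg underlying e)) g := by
  let w : N'.Edge → Prop := fun a => ∃ m, N'.out m = a
  have hβ' : ∀ n, ¬w (C'.edge (Sum.inl n)) := fun n ⟨m, hm⟩ => (C'.black n).2 m hm
  have hL' : ∀ a, ∀ d ∈ C'.whites a, w d := by
    intro a d hd
    obtain ⟨i, rfl⟩ := List.mem_ofFn.1 hd
    exact ⟨_, rfl⟩
  have hβ : ∀ n, ¬w (g.edge (C.edge (Sum.inl n))) := by
    rintro n ⟨m, hm⟩
    obtain ⟨m, rfl⟩ := g.node.surjective m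
    exact (C.black n).2 m (g.edge.injective ((g.out_node m).symm.trans hm))
  have hL : ∀ a, ∀ d ∈ (C.whites a).map g.edge, w d := by
    intro a d hd
    obtain ⟨d, hd', rfl⟩ := List.mem_map.1 hd
    obtain ⟨i, rfl⟩ := List.mem_ofFn.1 hd'
    exact ⟨g.node _, g.out_node _⟩
  have h1 := h.trans (rename_insertUnits _ _ _ _)
  have h2 := insertUnits_nil_injective ((pruneTree_insertUnits T' _ _ hβ' hL').symm.trans
    ((congrArg (pruneTree w) h1).trans (pruneTree_insertUnits T _ _ hβ hL)))
  obtain rfl : T' = T := congrArg Sigma.fst h2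
  obtain ⟨h3, h4⟩ := insertUnits_injective T' hβ' hL' hβ hL h1
  refine ⟨rfl, (compatible_iff _ _ _ _).2 ⟨fun n => (congrFun h3 n).symm, fun a => congrFun h4 a⟩⟩

end PTree

/-! ### The canonical constellation of a tree of trees -/

namespace PolyEndo
open PTree Labelled SetOperad Constellation FTree
variable {I : Type} {P : Mon (PolyEndo I)}

/-- By `full_white` the total substitution is some tree with unit operations inserted. Pruning these
and comparing with `prune_full` shows that this tree is the contraction of `S`, with each node
labelled by the leaf matched with it. -/
theorem exists_canonical (S : PTree (plusPoly P) P.X.B) (h : S.Valid fun b => b) :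
    ∃ C : Constellation (contract (plus P) (fun b => b) S h).op.1.underlying S.underlying,
      insertDots _ C.white C.edge = Tr.tree ⟨_, full S h⟩ ∧
      ∀ n, C.edge (Sum.inl n) = S.leafEdge ((contract (plus P) (fun b => b) S h).leafOf n) := by
  let k := contract (plus P) (fun b => b) S h
  let w : S.Edges → Prop := fun a => ∃ m, S.out m = a
  let V : Labelled P.X S.Edges I := Tr.tree ⟨_, full S h⟩
  obtain ⟨T, β, L, hT, hV, hβ, hL⟩ := exists_insertUnits (w := w) V (Tr.tree_valid _) (by
    obtain ⟨φ, hφ⟩ := nodes_map (full S h).1 (P.X.s (S.root fun b => b))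
    intro n hn
    have hn : w (V.nodeOp n).1 := hn
    have e : V.nodeOp n = (full S h).1.nodeOp (φ n) := hφ n
    rw [e] at hn ⊢
    exact full_white S h (φ n) hn)
  have h1 : pruneTree w V = insertUnits k.op.1 (fun n => S.leafEdge (k.leafOf n)) fun _ => [] := by
    refine (sub_map (Q := P.X.pull (Prod.snd : S.Edges × P.X.B → P.X.B)) _ _ _).trans ?_
    refine (congrArg (fun x : Tr (P := P) (Prod.snd : S.Edges × P.X.B → P.X.B) _ => x.1.map (P.X.s _))
      (prune_full S h)).trans ?_
    refine Eq.trans ?_ (nodeSelf_relabel_eq _ _)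
    refine (relabel_map (P := P.X) (f := Prod.snd) (f' := k.op.1.nodeOp) _ (fun _ => rfl) _ _).symm.trans ?_
    exact congrArg (PTree.relabel (P := P.X) (f := Prod.snd) (f' := k.op.1.nodeOp) _ _) (lift_map k.op _ k.t_op)
  have h2 := (h1.symm.trans (congrArg (pruneTree w) hV)).trans (pruneTree_insertUnits T β L hβ hL)
  have key : ∀ (T' : PTree P.X I) (β' : T'.Nodes → S.Edges),
      (insertUnits T' β' fun _ => []) = insertUnits T β (fun _ => []) →
      ∃ L', V = insertUnits T' β' L' ∧ (∀ n, ¬w (β' n)) ∧ ∀ a, ∀ d ∈ L' a, w d := by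
    intro T' β' e
    obtain ⟨h3, h4⟩ := Sigma.mk.inj (insertUnits_nil_injective e)
    subst h3
    obtain rfl := eq_of_heq h4
    exact ⟨L, hV, hβ, hL⟩
  obtain ⟨L', hV', hβ', hL''⟩ := key _ _ h2
  have hd : Distinct V := (distinct_map _ _).2 (distinct_full S h)
  have hm : ∀ a, Mem V a ↔ S.underlying.IsTop a := fun a => (mem_map _ _ _).trans (mem_full S h a)
  have hc : ∀ m, Conn V {y | S.underlying.IsTop y ∧ S.underlying.Le y (S.out m)} := fun m =>
    (conn_map _ _ _).2 (conn_full S h m)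
  obtain ⟨C, hC, hC'⟩ := exists_constellation k.op.1 S.underlying (fun n => S.leafEdge (k.leafOf n)) L'
    (hV' ▸ hd) (fun a => hV' ▸ hm a) (fun m => hV' ▸ hc m) (fun n m hm => hβ' n ⟨m, hm⟩) hL''
  refine ⟨C, Eq.trans ?_ hV'.symm, hC⟩
  exact congrArg₂ (insertUnits k.op.1) (funext hC) (funext hC')

/-- The constellation between the contraction of a tree of trees and its underlying tree. -/
noncomputable def canonical (S : PTree (plusPoly P) P.X.B) (h : S.Valid fun b => b) :
    Constellation (contract (plus P) (fun b => b) S h).op.1.underlying S.underlying :=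
  (exists_canonical S h).choose

theorem canonical_black (S : PTree (plusPoly P) P.X.B) (h : S.Valid fun b => b) (n) :
    ((canonical S h).black n).1 = S.leafEdge ((contract (plus P) (fun b => b) S h).leafOf n) :=
  (exists_canonical S h).choose_spec.2 n

theorem insertDots_canonical (S : PTree (plusPoly P) P.X.B) (h : S.Valid fun b => b) :
    insertDots _ (canonical S h).white (canonical S h).edge = Tr.tree ⟨_, full S h⟩ :=
  (exists_canonical S h).choose_spec.1

/-- A canonical constellation contains the total substitution, from which `full_injective` recovers
both the tree of trees and the isomorphism `g`. In particular there are no automorphisms fixing the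
contraction. -/
theorem canonical_injective {S S' : PTree (plusPoly P) P.X.B} {h : S.Valid fun b => b}
    {h' : S'.Valid fun b => b} (e : (contract (plus P) (fun b => b) S h).op =
      (contract (plus P) (fun b => b) S' h').op) (g : S.underlying.Iso S'.underlying)
    (hg : (canonical S h).Compatible (canonical S' h')
      (Iso.ofEq (congrArg (fun z : (plusPoly P).B => z.1.underlying) e)) g) :
    ∃ e : S = S', g = Iso.ofEq (congrArg underlying e) := by
  have key : ∀ (z z' : (plusPoly P).B) (e : z = z') (C : Constellation z.1.underlying S.underlying)
      (C' : Constellation z'.1.underlying S'.underlying), C.Compatible C'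
        (Iso.ofEq (congrArg (fun z : (plusPoly P).B => z.1.underlying) e)) g →
      (insertDots z.1 C.white C.edge).rename g.edge = insertDots z'.1 C'.white C'.edge := by
    rintro z _ rfl C C' h
    exact rename_insertDots_of_compatible h
  have h1 := key _ _ e _ _ hg
  rw [insertDots_canonical, insertDots_canonical] at h1
  have h2 := Tr.tree_injective ((Tr.tree_rename g.edge (full S h)).trans h1)
  obtain ⟨e', he⟩ := full_injective S S' h h' g h2.symm
  refine ⟨e', Iso.ext_edge fun a => (he a).trans ?_⟩
  subst e'
  rfl

/-- Up to isomorphism `N` underlies a decorated tree, as `exists_full` requires. The `P`-tree `z`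
with its white dots inserted satisfies the hypotheses of that lemma; equality of the subdivided
trees then forces the contraction to be `z`. -/
theorem exists_compatible_canonical (z : (plusPoly P).B) (N : FTree)
    (C : Constellation z.1.underlying N) : ∃ (S : PTree (plusPoly P) P.X.B) (h : S.Valid fun b => b)
      (e : z = (contract (plus P) (fun b => b) S h).op) (g : N.Iso S.underlying),
      C.Compatible (canonical S h) (Iso.ofEq (congrArg (fun z : (plusPoly P).B => z.1.underlying) e)) g := by
  obtain ⟨M, ⟨φ⟩⟩ := exists_iso_underlying N
  let C' : Constellation z.1.underlying M.underlying := C.transport (Iso.refl _) φ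
  have hC : C.Compatible C' (Iso.refl _) φ := (compatible_transport C (Iso.refl _) φ).symm
  obtain ⟨h1, h2, h3⟩ := insertDots_constellation C'
  let V : Labelled P.X M.Edges I := insertDots z.1 C'.white C'.edge
  have hV := (insertUnits_valid z.1 z.2 (fun n => C'.edge (Sum.inl n)) C'.whites).1
  let x : Tr (P := P) (Prod.snd : M.Edges × P.X.B → P.X.B) _ := Tr.ofTree V hV _ rfl
  have hx : x.1.map (P.X.s _) = V := Tr.ofTree_map V hV _ rfl
  obtain ⟨S, h, g, e⟩ := exists_full M x ((distinct_map _ _).1 (Eq.mpr (congrArg Distinct hx) h1))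
    (fun a => (mem_map _ _ _).symm.trans ((iff_of_eq (congrArg (fun V => Mem V a) hx)).trans (h2 a)))
    (fun n => by
      rintro ⟨m, hm⟩
      obtain ⟨φ, hφ⟩ := nodes_map x.1 (P.X.s _)
      have h4 : ∀ n' : (x.1.map (P.X.s _)).Nodes, (∃ m, ((x.1.map (P.X.s _)).nodeOp n').1 = C'.edge (Sum.inl m)) ∨
          ∃ j, ((x.1.map (P.X.s _)).nodeOp n').2 = (MonObj.one (X := P.X)).onB j := by
        rw [hx]
        exact nodeOp_insertUnits _ _ _
      have h5 := hφ (φ.symm n)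
      rw [Equiv.apply_symm_apply] at h5
      rcases h4 (φ.symm n) with ⟨m', h6⟩ | ⟨j, h6⟩
      · exact ((C'.black m').2 m (hm.trans ((congrArg Prod.fst h5).symm.trans h6))).elim
      · exact ⟨j, (congrArg Prod.snd h5).symm.trans h6⟩)
    (fun m => (conn_map _ _ _).1 (Eq.mpr (congrArg (fun V => Conn V _) hx) (h3 m)))
  have h4 := (congrArg Tr.tree e).trans ((Tr.tree_rename g.edge x).trans (congrArg (Labelled.rename g.edge) hx))
  obtain ⟨e', h5⟩ := compatible_of_rename_insertDots C' (canonical S h) g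
    ((insertDots_canonical S h).trans h4)
  exact ⟨S, h, Subtype.ext e', φ.trans g, hC.trans h5⟩

end PolyEndo

/-! ### Linear trees -/

namespace FTree
open PTree

theorem Iso.isLinear {S T : FTree} (f : S.Iso T) (h : S.IsLinear) : T.IsLinear := by
  intro n
  obtain ⟨n, rfl⟩ := f.node.surjective n
  obtain ⟨a, ha, h'⟩ := h n
  refine ⟨f.edge a, (f.into_eq_some_iff a n).2 ha, fun b hb => ?_⟩
  obtain ⟨b, rfl⟩ := f.edge.surjective b
  rw [h' b ((f.into_eq_some_iff b n).1 hb)]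

theorem exists_isTop_le (N : FTree) (a : N.Edge) : ∃ d, N.IsTop d ∧ N.Le d a := by
  obtain ⟨M, ⟨φ⟩⟩ := exists_iso_underlying N
  obtain ⟨d, hd, h⟩ := PTree.exists_isTop_le M (φ.edge a)
  obtain ⟨d, rfl⟩ := φ.edge.surjective d
  exact ⟨d, (φ.isTop_iff d).1 hd, φ.le_edge_iff.1 h⟩

/-- A tree over the identity polynomial is determined up to unique isomorphism by its underlying tree. -/
theorem linear_rigid (S S' : PTree (opetopicMonad.{0} 0).2.X (opetopicMonad.{0} 0).1)
    (g : S.underlying.Iso S'.underlying) : ∃ e : S = S', g = Iso.ofEq (congrArg underlying e) := by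
  induction S generalizing S' with
  | leaf x =>
    cases S' with
    | leaf x' => exact ⟨rfl, Iso.ext_edge fun _ => rfl⟩
    | node b c => exact PEmpty.elim (g.node.symm none)
  | node b c ih =>
    cases S' with
    | leaf x' => exact PEmpty.elim (g.node none)
    | node b' c' =>
      obtain ⟨σ, h, hg⟩ := exists_iso_children (c := c) (c' := c') g
      have hc : ∀ e, ∃ he : c e = c' e, h e = Iso.ofEq (congrArg underlying he) := fun e => ih e _ (h e)
      obtain rfl : c = c' := funext fun e => (hc e).choose
      refine ⟨rfl, Iso.ext_edge ?_⟩
      rintro (_ | ⟨e, a⟩)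
      · exact g.edge_root
      · refine (hg e a).trans (congrArg (fun a => some (Sigma.mk e a)) ?_)
        exact congrArg (fun f : (c e).underlying.Iso (c e).underlying => f.edge a) (hc e).choose_spec

/-- The identity monad has a single operation, which is unary, so the trees over it are the linear
trees. -/
theorem IsLinear.exists_iso {N : FTree} (hN : N.IsLinear) :
    ∃ S : PTree (opetopicMonad.{0} 0).2.X (opetopicMonad.{0} 0).1, Nonempty (N.Iso S.underlying) := by
  obtain ⟨M, ⟨φ⟩⟩ := exists_iso_underlying N
  have key : ∀ M : PTree N.poly PUnit.{1},
      ∃ S : PTree (opetopicMonad.{0} 0).2.X (opetopicMonad.{0} 0).1, Nonempty (M.underlying.Iso S.underlying) := by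
    intro M
    induction M with
    | leaf x => exact ⟨leaf PUnit.unit, ⟨isoLeaf _ _⟩⟩
    | node n c ih =>
      obtain ⟨a, ha, h'⟩ := hN n
      obtain ⟨S, ⟨f⟩⟩ := ih ⟨a, ha⟩
      let σ : N.poly.E n ≃ (opetopicMonad.{0} 0).2.X.E PUnit.unit :=
        ⟨fun _ => PUnit.unit, fun _ => ⟨a, ha⟩, fun e => Subtype.ext (h' e.1 e.2).symm, fun _ => rfl⟩
      have hf : ∀ e : N.poly.E n, Nonempty ((c e).underlying.Iso S.underlying) := by
        intro e
        obtain rfl : e = ⟨a, ha⟩ := Subtype.ext (h' e.1 e.2)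
        exact ⟨f⟩
      exact ⟨node (P := (opetopicMonad.{0} 0).2.X) PUnit.unit fun _ => S, ⟨isoNode σ fun e => (hf e).some⟩⟩
  obtain ⟨S, ⟨f⟩⟩ := key M
  exact ⟨S, ⟨φ.trans f⟩⟩

theorem isLinear_underlying (S : PTree (opetopicMonad.{0} 0).2.X (opetopicMonad.{0} 0).1) :
    S.underlying.IsLinear := by
  intro n
  induction S with
  | leaf x => exact PEmpty.elim n
  | node b c ih =>
    have hi : ∀ e a, (node b c).into (some ⟨e, a⟩) =
      some (((c e).into a).map (Sigma.mk (β := fun e => (c e).Nodes) e)) := fun _ _ => rfl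
    rcases n with _ | ⟨e, n⟩
    · have h0 : ∀ e a, (c e).into a = none ↔ a = (c e).rootEdge := fun e => (c e).underlying.into_eq_none
      refine ⟨some ⟨PUnit.unit, (c PUnit.unit).rootEdge⟩, ?_, ?_⟩
      · exact (hi _ _).trans (congrArg (fun x => some (Option.map
          (Sigma.mk (β := fun e => (c e).Nodes) PUnit.unit) x)) ((h0 PUnit.unit _).2 rfl))
      · rintro (_ | ⟨e, a⟩) h
        · cases h
        · have h1 := Option.some.inj ((hi e a).symm.trans h)
          rw [Option.map_eq_none_iff] at h1
          rw [(h0 e a).1 h1]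
          rfl
    · obtain ⟨a, ha, h'⟩ := ih e n
      have ha : (c e).into a = some n := ha
      refine ⟨some ⟨e, a⟩, (hi e a).trans (by rw [ha]; rfl), ?_⟩
      rintro (_ | ⟨e', a'⟩) h
      · cases h
      · obtain rfl : e' = e := rfl
        have h1 := Option.some.inj ((hi e' a').symm.trans h)
        obtain ⟨m, hm, h2⟩ := Option.map_eq_some_iff.1 h1
        obtain rfl : m = n := eq_of_heq (Sigma.mk.inj h2).2
        rw [h' a' hm]

theorem IsLinear.isEmpty_nullDot {N : FTree} (h : N.IsLinear) : IsEmpty N.NullDot :=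
  ⟨fun n => n.2 _ (h n.1).choose_spec.1⟩

theorem IsLinear.isTop_iff {N : FTree} (h : N.IsLinear) (a : N.Edge) : N.IsTop a ↔ ∀ n, N.out n ≠ a :=
  ⟨fun ha n => ha _ n (h n).choose_spec.1, fun ha _ n _ => ha n⟩

theorem IsLinear.leaf_unique {N : FTree} (h : N.IsLinear) (a b : N.Leaf) : a = b := by
  have key : ∀ S : PTree (opetopicMonad.{0} 0).2.X (opetopicMonad.{0} 0).1, ∀ a b : S.Edges,
      (∀ n, S.out n ≠ a) → (∀ n, S.out n ≠ b) → a = b := by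
    intro S
    induction S with
    | leaf x => exact fun _ _ _ _ => rfl
    | node r c ih =>
      rintro (_ | ⟨e, a⟩) (_ | ⟨e', b⟩) ha hb
      · rfl
      · exact (ha none rfl).elim
      · exact (hb none rfl).elim
      · obtain rfl : e = e' := rfl
        refine congrArg (fun a => some (Sigma.mk e a)) (ih e a b (fun n hn => ha (some ⟨e, n⟩) ?_)
          fun n hn => hb (some ⟨e, n⟩) ?_)
        · exact congrArg (fun a => some (Sigma.mk e a)) hn
        · exact congrArg (fun a => some (Sigma.mk e a)) hn
  obtain ⟨S, ⟨φ⟩⟩ := h.exists_iso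
  refine Subtype.ext (φ.edge.injective (key S _ _ (φ.leaf a).2 (φ.leaf b).2))

/-- A linear tree has no null-dots and only one leaf. There are thus no white dots, and the values
on black dots are forced. -/
theorem IsLinear.compatible {T T' N N' : FTree} (hN : N.IsLinear) (hN' : N'.IsLinear) (C : Constellation T N)
    (C' : Constellation T' N') (f : T.Iso T') (g : N.Iso N') : C.Compatible C' f g := by
  have h := hN.isEmpty_nullDot
  have h' := hN'.isEmpty_nullDot
  refine ⟨fun a => ?_, fun n => ?_, fun a i => (h.false (C.null ⟨a, i⟩)).elim⟩
  · have h1 : C.white a = 0 := Nat.eq_zero_of_not_pos fun hp => h.false (C.null ⟨a, ⟨0, hp⟩⟩)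
    have h2 : C'.white (f.edge a) = 0 :=
      Nat.eq_zero_of_not_pos fun hp => h'.false (C'.null ⟨_, ⟨0, hp⟩⟩)
    rw [h1, h2]
  · exact congrArg Subtype.val (hN'.leaf_unique (g.leaf (C.black n)) (C'.black (f.node n)))

theorem IsLinear.exists_constellation {T N : FTree} (hT : Nat.card T.Node = 1) (hN : N.IsLinear) :
    Nonempty (Constellation T N) := by
  obtain ⟨hs, ⟨t⟩⟩ := Nat.card_eq_one_iff_unique.1 hT
  have h := hN.isEmpty_nullDot
  obtain ⟨d, hd, _⟩ := N.exists_isTop_le N.root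
  have hle : ∀ (a : N.Leaf) x, N.Le a.1 (N.out x) := by
    intro a x
    obtain ⟨d, hd, hle⟩ := N.exists_isTop_le (N.out x)
    rw [hN.leaf_unique a ⟨d, (hN.isTop_iff d).1 hd⟩]
    exact hle
  refine ⟨⟨fun _ => 0, ⟨fun _ => ⟨d, (hN.isTop_iff d).1 hd⟩, fun _ => t, fun _ => Subsingleton.elim _ _,
    fun _ => hN.leaf_unique _ _⟩, ⟨fun p => p.2.elim0, fun n => (h.false n).elim, fun p => p.2.elim0,
    fun n => (h.false n).elim⟩, fun x => ?_⟩⟩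
  rw [isKernel_iff]
  refine ⟨Sum.inl t, hle _ x, ?_⟩
  rintro (n | ⟨a, i⟩) _
  · exact .inl (congrArg Sum.inl (Subsingleton.elim _ _))
  · exact i.elim0

theorem IsLinear.iso_of_card {N N' : FTree} (hN : N.IsLinear) (hN' : N'.IsLinear)
    (h : Nat.card N.Node = 1) (h' : Nat.card N'.Node = 1) : Nonempty (N.Iso N') := by
  have key : ∀ S : PTree (opetopicMonad.{0} 0).2.X (opetopicMonad.{0} 0).1,
      Nat.card S.Nodes = 1 → S = node (P := (opetopicMonad.{0} 0).2.X) PUnit.unit fun _ => leaf PUnit.unit := by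
    intro S hS
    obtain ⟨hs, ⟨t⟩⟩ := Nat.card_eq_one_iff_unique.1 hS
    cases S with
    | leaf x => exact PEmpty.elim t
    | node b c =>
      refine congrArg (node (P := (opetopicMonad.{0} 0).2.X) PUnit.unit) (funext fun e => ?_)
      cases hc : c e with
      | leaf x => rfl
      | node b' c' =>
        have h1 : Nonempty (c e).Nodes := by
          rw [hc]
          exact ⟨none⟩
        obtain ⟨n⟩ := h1
        cases hs.elim (none : (node b c).Nodes) (some ⟨e, n⟩)
  obtain ⟨S, ⟨φ⟩⟩ := hN.exists_iso
  obtain ⟨S', ⟨φ'⟩⟩ := hN'.exists_iso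
  have e : S = S' := (key S ((Nat.card_congr φ.node).symm.trans h)).trans
    (key S' ((Nat.card_congr φ'.node).symm.trans h')).symm
  subst e
  exact ⟨φ.trans φ'.symm⟩

end FTree

/-! ### Zoom complexes as iterated trees of trees -/

namespace FTree

theorem Iso.symm_trans_eq_iff {S A B : FTree} (τ : S.Iso A) (f : S.Iso B) (g : A.Iso B) :
    τ.symm.trans f = g ↔ f = τ.trans g := by
  constructor
  · rintro rfl
    exact ext_edge fun a => congrArg f.edge (τ.edge.symm_apply_apply a).symm
  · rintro rfl
    exact ext_edge fun a => congrArg g.edge (τ.edge.apply_symm_apply a)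

theorem valid_linear (S : PTree (opetopicMonad.{0} 0).2.X (opetopicMonad.{0} 0).1) :
    S.Valid fun i => i := by
  induction S with
  | leaf x => trivial
  | node b c ih => exact fun e => ⟨rfl, ih e⟩

end FTree

namespace ZoomComplex
open FTree PTree PolyEndo Constellation

/-- The isomorphism between the underlying trees of equal operations. -/
abbrev isoOfEq {I : Type} {P : Mon (PolyEndo I)} {z z' : (plusPoly P).B} (e : z = z') :
    z.1.underlying.Iso z'.1.underlying :=
  Iso.ofEq (congrArg (fun z : (plusPoly P).B => z.1.underlying) e)

/-- The constellations of the complex `X` of degree `k + 2`, from degree 3 on, are isomorphic to the canonical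
constellations obtained from the tree `z`, by means of isomorphisms ending with `τ`. -/
def IsDecoration : (k : ℕ) → (X : ZoomComplex (k + 2)) → (z : (plusPoly (opetopicMonad.{0} k).2).B) →
    X.composition.Iso z.1.underlying → Prop
  -- In degree 2 the isomorphism `τ` alone determines `z`, a tree over the identity monad; the lower
  -- constellations go between linear trees and carry no information.
  | 0, _, _, _ => True
  | k + 1, X, z, τ => ∃ τ' : X.truncate.composition.Iso
        ((plusPoly (plus (opetopicMonad.{0} k).2)).t z).1.underlying,
      IsDecoration k X.truncate ((plusPoly (plus (opetopicMonad.{0} k).2)).t z) τ' ∧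
      (X.const (Fin.last _)).Compatible (canonical z.1 z.2) τ' τ

theorem isOpetopic_truncate {n : ℕ} {X : ZoomComplex (n + 1)} (h : X.IsOpetopic) : X.truncate.IsOpetopic :=
  ⟨fun i => h.1 i.castSucc, fun i => h.2 i.castSucc⟩

/-- The truncated complex is decorated first. Transported along its decoration, the top
constellation starts at a tree of the form treated by `exists_compatible_canonical`, which provides
the next tree of trees. -/
theorem exists_isDecoration (k : ℕ) (X : ZoomComplex (k + 2)) (hX : X.IsOpetopic) :
    ∃ (z : (plusPoly (opetopicMonad.{0} k).2).B) (τ : X.composition.Iso z.1.underlying), IsDecoration k X z τ := by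
  induction k with
  | zero =>
    obtain ⟨S, ⟨τ⟩⟩ := IsLinear.exists_iso (hX.2 (Fin.last _) rfl)
    exact ⟨⟨S, valid_linear S⟩, τ, trivial⟩
  | succ k ih =>
    obtain ⟨z, τ', h⟩ := ih X.truncate (isOpetopic_truncate hX)
    obtain ⟨S, hS, e, g, hg⟩ := exists_compatible_canonical z X.composition
      (Constellation.transport (X.const (Fin.last _)) τ'.symm (Iso.refl _))
    subst e
    refine ⟨⟨S, hS⟩, g, τ', h, ?_⟩
    have h1 := (compatible_transport (X.const (Fin.last _)) τ'.symm (Iso.refl _)).symm.trans hg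
    exact h1

/-- The isomorphisms must be carried through the induction along with the equality `z = z'`:
`canonical_injective` only compares constellations over an isomorphism of contractions which comes
from an equality. -/
theorem isDecoration_unique (k : ℕ) {X Y : ZoomComplex (k + 2)} (f : ∀ i, (X.tree i).Iso (Y.tree i))
    (hf : ∀ i, (X.const i).Compatible (Y.const i) (f i.castSucc) (f i.succ))
    {z z' : (plusPoly (opetopicMonad.{0} k).2).B} {τ : X.composition.Iso z.1.underlying}
    {τ' : Y.composition.Iso z'.1.underlying} (h : IsDecoration k X z τ) (h' : IsDecoration k Y z' τ') :
    ∃ e : z = z', (f (Fin.last _)).trans τ' = τ.trans (isoOfEq e) := by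
  induction k with
  | zero =>
    obtain ⟨e, he⟩ := linear_rigid z.1 z'.1 (τ.symm.trans ((f (Fin.last _)).trans τ'))
    exact ⟨Subtype.ext e, (Iso.symm_trans_eq_iff _ _ _).1 he⟩
  | succ k ih =>
    obtain ⟨σ, h1, h2⟩ := h
    obtain ⟨σ', h1', h2'⟩ := h'
    obtain ⟨e, he⟩ := ih (fun i => f i.castSucc) (fun i => hf i.castSucc) h1 h1'
    have h3 := h2.symm.trans ((hf (Fin.last _)).trans h2')
    have h4 : σ.symm.trans ((f (Fin.last (k + 3)).castSucc).trans σ') = isoOfEq e :=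
      (Iso.symm_trans_eq_iff _ _ _).2 he
    obtain ⟨e', he'⟩ := canonical_injective (S := z.1) (S' := z'.1) (h := z.2) (h' := z'.2) e
      (τ.symm.trans ((f (Fin.last _)).trans τ')) (Eq.mp
      (congrArg (fun i => (canonical z.1 z.2).Compatible (canonical z'.1 z'.2) i _) h4) h3)
    exact ⟨Subtype.ext e', (Iso.symm_trans_eq_iff _ _ _).1 he'⟩

theorem exists_iso_linear (X Y : ZoomComplex 2) (hX : X.IsOpetopic) (hY : Y.IsOpetopic)
    (g : X.composition.Iso Y.composition) : ∃ f : ∀ i, (X.tree i).Iso (Y.tree i),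
      (∀ i, (X.const i).Compatible (Y.const i) (f i.castSucc) (f i.succ)) ∧ f (Fin.last _) = g := by
  have hl : ∀ {X : ZoomComplex 2}, X.IsOpetopic → ∀ i, (X.tree i).IsLinear := by
    intro X hX i
    by_cases h : (i : ℕ) ≤ 2
    · exact (hX.1 i h).1
    · exact hX.2 i (by omega)
  have h1 : ∀ i : Fin 3, Nonempty ((X.tree i.castSucc).Iso (Y.tree i.castSucc)) := fun i =>
    IsLinear.iso_of_card (hl hX _) (hl hY _) (hX.1 i.castSucc (Nat.lt_succ_iff.1 i.2)).2
      (hY.1 i.castSucc (Nat.lt_succ_iff.1 i.2)).2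
  exact isomorphic_of_truncate (X := X) (Y := Y) (fun i => (h1 i).some) g
    (fun i => IsLinear.compatible (hl hX _) (hl hY _) _ _ _ _)
    (IsLinear.compatible (hl hX _) (hl hY _) _ _ _ _)

theorem isomorphic_of_isDecoration (k : ℕ) {X Y : ZoomComplex (k + 2)} (hX : X.IsOpetopic) (hY : Y.IsOpetopic)
    {z : (plusPoly (opetopicMonad.{0} k).2).B} {τ : X.composition.Iso z.1.underlying}
    {τ' : Y.composition.Iso z.1.underlying} (h : IsDecoration k X z τ) (h' : IsDecoration k Y z τ') :
    ∃ f : ∀ i, (X.tree i).Iso (Y.tree i), (∀ i, (X.const i).Compatible (Y.const i)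
      (f i.castSucc) (f i.succ)) ∧ f (Fin.last _) = τ.trans τ'.symm := by
  induction k with
  | zero => exact exists_iso_linear X Y hX hY _
  | succ k ih =>
    obtain ⟨σ, h1, h2⟩ := h
    obtain ⟨σ', h1', h2'⟩ := h'
    obtain ⟨f, hf, hf'⟩ := ih (isOpetopic_truncate hX) (isOpetopic_truncate hY) h1 h1'
    refine isomorphic_of_truncate f _ hf ?_
    rw [hf']
    exact h2.trans h2'.symm

theorem isDecoration_of_iso (k : ℕ) {X Y : ZoomComplex (k + 2)} (f : ∀ i, (X.tree i).Iso (Y.tree i))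
    (hf : ∀ i, (X.const i).Compatible (Y.const i) (f i.castSucc) (f i.succ))
    {z : (plusPoly (opetopicMonad.{0} k).2).B} {τ : Y.composition.Iso z.1.underlying}
    (h : IsDecoration k Y z τ) : IsDecoration k X z ((f (Fin.last _)).trans τ) := by
  induction k with
  | zero => trivial
  | succ k ih =>
    obtain ⟨σ, h1, h2⟩ := h
    exact ⟨_, ih (fun i => f i.castSucc) (fun i => hf i.castSucc) h1, (hf (Fin.last _)).trans h2⟩

theorem exists_isDecoration' (k : ℕ) (z : (plusPoly (opetopicMonad.{0} k).2).B) :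
    ∃ (X : ZoomComplex (k + 2)) (_ : X.IsOpetopic) (τ : X.composition.Iso z.1.underlying), IsDecoration k X z τ := by
  induction k with
  | zero =>
    let T₁ : FTree := (node (P := (opetopicMonad.{0} 0).2.X) PUnit.unit fun _ => leaf PUnit.unit :
      PTree (opetopicMonad.{0} 0).2.X (opetopicMonad.{0} 0).1).underlying
    have hT₁ : T₁.IsLinear := isLinear_underlying _
    have hc : Nat.card T₁.Node = 1 := by
      refine Nat.card_eq_one_iff_unique.2 ⟨⟨?_⟩, ⟨none⟩⟩
      rintro (_ | ⟨_, n⟩) (_ | ⟨_, m⟩)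
      · rfl
      · exact PEmpty.elim m
      · exact PEmpty.elim n
      · exact PEmpty.elim n
    have hz : z.1.underlying.IsLinear := isLinear_underlying _
    let tree : Fin 4 → FTree := ![T₁, T₁, T₁, z.1.underlying]
    have hl : ∀ i, (tree i).IsLinear := by
      intro i
      fin_cases i
      exacts [hT₁, hT₁, hT₁, hz]
    have hc' : ∀ i : Fin 3, Nat.card (tree i.castSucc).Node = 1 := by
      intro i
      fin_cases i <;> exact hc
    refine ⟨⟨tree, fun i => (IsLinear.exists_constellation (hc' i) (hl i.succ)).some⟩,
      ⟨fun i hi => ⟨hl i, hc' ⟨i, by omega⟩⟩, fun i _ => hl i⟩, Iso.refl _, trivial⟩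
  | succ k ih =>
    obtain ⟨X, hX, σ, hσ⟩ := ih ((plusPoly (plus (opetopicMonad.{0} k).2)).t z)
    -- By induction a complex realises the contraction of `z`; the canonical constellation of `z` is
    -- placed on top of it.
    obtain ⟨Y, f, g, hf, hg⟩ := exists_extension X z.1.underlying
      (Constellation.transport (canonical z.1 z.2) σ (Iso.refl _))
    have h1 : ∀ i : Fin (k + 3 + 2), (i : ℕ) ≤ 3 → ∃ j : Fin (k + 2 + 2), i = j.castSucc := fun i hi =>
      ⟨⟨i, by omega⟩, rfl⟩
    refine ⟨Y, ⟨fun i hi => ?_, fun i hi => ?_⟩, g, _, isDecoration_of_iso k f hf hσ, ?_⟩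
    · obtain ⟨j, rfl⟩ := h1 i (by omega)
      obtain ⟨h2, h3⟩ := hX.1 j hi
      exact ⟨(f j).symm.isLinear h2, (Nat.card_congr (f j).node).trans h3⟩
    · obtain ⟨j, rfl⟩ := h1 i (by omega)
      exact (f j).symm.isLinear (hX.2 j hi)
    · have h2 := hg.trans (compatible_transport (canonical z.1 z.2) σ (Iso.refl _))
      exact h2

end ZoomComplex

/-! ### The bijections between the notions of opetope -/

namespace Opetope
open FTree PTree PolyEndo ZoomComplex

theorem subsingleton_of_card (n : ℕ) (hn : n ≤ 1) (X Y : OpetopicComplex n) : X.1.Isomorphic Y.1 := by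
  have h : ∀ i : Fin (n + 2), (i : ℕ) ≤ 2 := fun i => by omega
  exact ⟨fun i => (IsLinear.iso_of_card (X.2.1 i (h i)).1 (Y.2.1 i (h i)).1 (X.2.1 i (h i)).2
    (Y.2.1 i (h i)).2).some, fun i => IsLinear.compatible (X.2.1 _ (h _)).1 (Y.2.1 _ (h _)).1 _ _ _ _⟩

theorem nonempty_zero_one : Nonempty (OpetopicComplex 1) ∧ Nonempty (OpetopicComplex 0) := by
  obtain ⟨X, hX, _⟩ := exists_isDecoration' 0 ⟨leaf PUnit.unit, trivial⟩
  exact ⟨⟨⟨_, isOpetopic_truncate hX⟩⟩, ⟨⟨_, isOpetopic_truncate (isOpetopic_truncate hX)⟩⟩⟩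

/-- The set of opetopes of dimension at most one has one element. -/
noncomputable def equivUnit (n : ℕ) (hn : n ≤ 1) (h : Nonempty (OpetopicComplex n)) : Opetope n ≃ PUnit.{1} where
  toFun _ := PUnit.unit
  invFun _ := mk h.some
  left_inv X := by
    induction X using Quot.ind with
    | mk X => exact Quot.sound (subsingleton_of_card n hn _ _)
  right_inv _ := rfl

/-- The tree of trees represented by a zoom complex. -/
noncomputable def toTree (k : ℕ) (X : OpetopicComplex (k + 2)) : (plusPoly (opetopicMonad.{0} k).2).B :=
  (exists_isDecoration k X.1 X.2).choose

theorem toTree_spec (k : ℕ) (X : OpetopicComplex (k + 2)) :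
    ∃ τ : X.1.composition.Iso (toTree k X).1.underlying, IsDecoration k X.1 (toTree k X) τ :=
  (exists_isDecoration k X.1 X.2).choose_spec

theorem toTree_eq (k : ℕ) {X Y : OpetopicComplex (k + 2)} (h : X.1.Isomorphic Y.1) : toTree k X = toTree k Y := by
  obtain ⟨f, hf⟩ := h
  obtain ⟨τ, hτ⟩ := toTree_spec k X
  obtain ⟨τ', hτ'⟩ := toTree_spec k Y
  exact (isDecoration_unique k f hf hτ hτ').choose

theorem unique_of_isDecoration (k : ℕ) {X : ZoomComplex (k + 2)} {z z' : (plusPoly (opetopicMonad.{0} k).2).B}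
    {τ : X.composition.Iso z.1.underlying} {τ' : X.composition.Iso z'.1.underlying}
    (h : IsDecoration k X z τ) (h' : IsDecoration k X z' τ') : ∃ e : z = z', τ' = τ.trans (isoOfEq e) :=
  isDecoration_unique k (fun _ => Iso.refl _) (fun _ => Constellation.compatible_refl _) h h'

/-- The bijection between the opetopes of dimension at least two and trees of trees. -/
noncomputable def equivTree (k : ℕ) : Opetope (k + 2) ≃ (plusPoly (opetopicMonad.{0} k).2).B :=
  Equiv.ofBijective (Quot.lift (toTree k) fun _ _ => toTree_eq k) <| by
    constructor
    · intro X Y h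
      induction X using Quot.ind with
      | mk X =>
      induction Y using Quot.ind with
      | mk Y =>
      have h : toTree k X = toTree k Y := h
      obtain ⟨τ, hτ⟩ := toTree_spec k X
      obtain ⟨τ', hτ'⟩ := toTree_spec k Y
      revert τ
      rw [h]
      intro τ hτ
      obtain ⟨f, hf, _⟩ := isomorphic_of_isDecoration k X.2 Y.2 hτ hτ'
      exact Quot.sound ⟨f, hf⟩
    · intro z
      obtain ⟨X, hX, τ, hτ⟩ := exists_isDecoration' k z
      obtain ⟨τ', hτ'⟩ := toTree_spec k ⟨X, hX⟩
      exact ⟨mk ⟨X, hX⟩, (unique_of_isDecoration k hτ' hτ).choose⟩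

/-- The bijection between the opetopes defined by zoom complexes and by the iterated Baez-Dolan construction. -/
noncomputable def equiv : ∀ k, Opetope k ≃ (opetopicMonad.{0} k).1
  | 0 => equivUnit 0 (by omega) nonempty_zero_one.2
  | 1 => equivUnit 1 (by omega) nonempty_zero_one.1
  | k + 2 => equivTree k

/-- A decoration of `X` by `z` contains a decoration of the truncated complex by the contraction of
`z`, and decorations are unique. In the two lowest degrees the sets have one element. -/
theorem equiv_target (k : ℕ) (X : Opetope (k + 1)) :
    equiv k X.target = (opetopicMonad.{0} k).2.X.t (equiv (k + 1) X) := by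
  match k with
  | 0 => rfl
  | 1 => rfl
  | k + 2 =>
    induction X using Quot.ind with
    | mk X =>
    obtain ⟨τ, σ, h, _⟩ := toTree_spec (k + 1) X
    obtain ⟨τ', h'⟩ := toTree_spec k X.truncate
    exact (unique_of_isDecoration k h' h).choose

/-- The node of the target corresponding to `d` is given as an input `e` with an equality in a sigma
type, since the two descriptions of the target agree only up to `equiv_target`. By rigidity the
isomorphism chosen for the truncated complex is the one inside the decoration of `X`; the claim is
then the description of black dots in `canonical_black`. -/
theorem exists_tau : ∃ τ : ∀ k (X : OpetopicComplex (k + 2)), X.1.composition.Iso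
      (PTree.underlying (P := (opetopicMonad.{0} k).2.X) (equiv (k + 2) (Opetope.mk X)).1),
    ∀ k (X : OpetopicComplex (k + 3)) (d : X.1.truncate.composition.Node)
      (e : (opetopicMonad.{0} (k + 1)).2.X.E
        ((opetopicMonad.{0} (k + 2)).2.X.t (equiv (k + 3) (Opetope.mk X)))),
      (⟨_, e⟩ : Σ T, (opetopicMonad.{0} (k + 1)).2.X.E T) =
        ⟨equiv (k + 2) (Opetope.mk X.truncate), (τ k X.truncate).node d⟩ →
      PTree.leafEdge (P := (opetopicMonad.{0} (k + 1)).2.X) _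
          ((PTree.contract _ _ _ (equiv (k + 3) (Opetope.mk X)).2).leafOf e) =
        (τ (k + 1) X).edge (X.1.spheres d).1 := by
  choose τ hτ using toTree_spec
  refine ⟨τ, fun k X d e he => ?_⟩
  obtain ⟨σ, h1, h2⟩ := hτ (k + 1) X
  obtain ⟨e1, e2⟩ := unique_of_isDecoration k h1 (hτ k X.truncate)
  have key : ∀ (z z' : (plusPoly (opetopicMonad.{0} k).2).B) (e1 : z = z')
      (σ : X.1.truncate.composition.Iso z.1.underlying) (τ : X.1.truncate.composition.Iso z'.1.underlying),
      τ = σ.trans (isoOfEq e1) → (⟨z', τ.node d⟩ : Σ T, (opetopicMonad.{0} (k + 1)).2.X.E T) = ⟨z, σ.node d⟩ := by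
    rintro z _ rfl σ _ rfl
    rfl
  obtain rfl : e = σ.node d := eq_of_heq (Sigma.mk.inj (he.trans (key _ _ e1 σ _ e2))).2
  refine (canonical_black _ _ _).symm.trans (h2.2.1 d).symm

end Opetope

theorem mainTheorem3 :
    (∀ {I : Type u} (P : Mon (PolyEndo I)),
      (PolyEndo.base P).IsEquivalence ∧
      (PolyEndo.forgetOver P).IsRightAdjoint ∧
      (∀ (e : Over P.X ≌ Over P.X.B), e.functor = PolyEndo.base P →
        ∀ (F : Over P.X ⥤ Over P) (adj : F ⊣ PolyEndo.forgetOver P),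
          Nonempty (transportMonad e adj.toMonad ≅ PolyEndo.monad (PolyEndo.plus P))) ∧
      (leinsterBase P).IsEquivalence ∧
      (TOperad.forget (PolyEndo.monad P)).IsRightAdjoint ∧
      (∀ (e : Over ((PolyEndo.monad P).obj (⊤_ (Over I))) ≌ Over P.X.B),
        e.functor = leinsterBase P →
        ∀ (F : Over ((PolyEndo.monad P).obj (⊤_ (Over I))) ⥤ TOperad (PolyEndo.monad P))
          (adj : F ⊣ TOperad.forget (PolyEndo.monad P)),
          Nonempty (transportMonad e adj.toMonad ≅ PolyEndo.monad (PolyEndo.plus P)))) ∧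
    (∀ k, (TOperad.forget (leinsterMonad.{u} k).2).IsRightAdjoint) ∧
    (∃ (φ : ∀ k, (opetopicMonad.{u} k).1 ≃ (leinsterMonad.{u} k).1)
      (ψ : ∀ k, transportMonad (Over.mapIso (φ k).toIso)
        (PolyEndo.monad (opetopicMonad.{u} k).2) ≅ (leinsterMonad.{u} k).2),
      ∀ k (z : PolyEndo.Ext (opetopicMonad.{u} k).2.X
          ((Over.map (φ k).symm.toIso.hom).obj (⊤_ (Over (leinsterMonad.{u} k).1)))),
        ((ψ k).hom.app (⊤_ (Over (leinsterMonad.{u} k).1))).left z = φ (k + 1) z.op) ∧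
    (∃ Ω : ∀ k, Opetope k ≃ (opetopicMonad.{0} k).1,
      (∀ k (X : Opetope (k + 1)),
        Ω k X.target = (opetopicMonad.{0} k).2.X.t (Ω (k + 1) X)) ∧
      ∃ τ : ∀ k (X : OpetopicComplex (k + 2)), X.1.composition.Iso
          (PTree.underlying (P := (opetopicMonad.{0} k).2.X) (Ω (k + 2) (Opetope.mk X)).1),
        ∀ k (X : OpetopicComplex (k + 3)) (d : X.1.truncate.composition.Node)
          (e : (opetopicMonad.{0} (k + 1)).2.X.E
            ((opetopicMonad.{0} (k + 2)).2.X.t (Ω (k + 3) (Opetope.mk X)))),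
          (⟨_, e⟩ : Σ T, (opetopicMonad.{0} (k + 1)).2.X.E T) =
            ⟨Ω (k + 2) (Opetope.mk X.truncate), (τ k X.truncate).node d⟩ →
          PTree.leafEdge (P := (opetopicMonad.{0} (k + 1)).2.X) _
              ((PTree.contract _ _ _ (Ω (k + 3) (Opetope.mk X)).2).leafOf e) =
            (τ (k + 1) X).edge (X.1.spheres d).1) := by
  exact ⟨fun P => PolyEndo.baez_dolan P, PolyEndo.leinster_comparison.1,
    PolyEndo.leinster_comparison.2, Opetope.equiv, Opetope.equiv_target, Opetope.exists_tau⟩
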